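/- Let $\varepsilon_1,\varepsilon_2,c_1,c_2\in C([0,1])$ with $\varepsilon_1,\varepsilon_2>0$, let $q>0$ and $\tau>0$. Consider the closed loop $$\partial_t u_1=-\varepsilon_1(x)\,\partial_x u_1+c_1(x)u_2,\qquad \partial_t u_2=\varepsilon_2(x)\,\partial_x u_2+c_2(x)u_1,\qquad \tau\,\partial_t v=\partial_x v\qquad (0\le x\le 1,\ t\ge 0),$$ $$u_1(0,t)=q\,u_2(0,t),\qquad u_2(1,t)=v(0,t),\qquad v(1,t)=U(t),$$ with the control law $$U(t)=\int_0^1 p(1-y)v(y,t)\,dy+\int_0^1\alpha_1(1,y)u_1(y,t)\,dy+\int_0^1\alpha_2(1,y)u_2(y,t)\,dy,\qquad p(x)=\tau\,\varepsilon_2(1)\,\alpha_2(x,1).$$ Here $\alpha_1,\alpha_2$ are bounded measurable functions on $[0,1]^2$ and $K^{21},K^{22}$ are continuous functions on $\{0\le y\le x\le 1\}$ with $$\tfrac1\tau\partial_x\alpha_1-\partial_y\big(\varepsilon_1(y)\alpha_1\big)=c_2(y)\alpha_2,\qquad \tfrac1\tau\partial_x\alpha_2+\partial_y\big(\varepsilon_2(y)\alpha_2\big)=c_1(y)\alpha_1,$$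 $$\alpha_1(x,1)=0\ (0<x\le 1),\quad \varepsilon_2(0)\alpha_2(x,0)=q\,\varepsilon_1(0)\alpha_1(x,0),\quad \alpha_1(0,y)=K^{21}(1,y),\quad \alpha_2(0,y)=K^{22}(1,y),$$ $$\varepsilon_2(x)\partial_xK^{21}-\partial_y\big(\varepsilon_1(y)K^{21}\big)=c_2(y)K^{22},\qquad \varepsilon_2(x)\partial_xK^{22}+\partial_y\big(\varepsilon_2(y)K^{22}\big)=c_1(y)K^{21},$$ $$K^{21}(x,x)=-\frac{c_2(x)}{\varepsilon_1(x)+\varepsilon_2(x)},\qquad \varepsilon_2(0)K^{22}(x,0)=q\,\varepsilon_1(0)K^{21}(x,0),$$ where the kernel equations are understood along characteristics: after multiplication by $\varepsilon_i(y)$, the increment of $\varepsilon_i(y)$ times the kernel along every characteristic curve in the domain is the integral of $\varepsilon_i(y)$ times the right-hand side. Then such kernels exist. Moreover, for all such kernels and all initial data $u_1(\cdot,0)=u_{10}$, $u_2(\cdot,0)=u_{20}$, $v(\cdot,0)=v_0$ in $L^2([0,1])$, the closed loop has a weak solution $(u_1,u_2,v)\in C([0,\infty);L^2([0,1])^3)$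 (in the sense of $C^1$ test functions, with boundary values in $L^2_{\mathrm{loc}}([0,\infty))$), and it is finite-time stable, that is, every such solution reaches the zero equilibrium at time $$t_F=\tau+\int_0^1\Big(\frac1{\varepsilon_1(y)}+\frac1{\varepsilon_2(y)}\Big)dy:\qquad u_1(\cdot,t)=u_2(\cdot,t)=v(\cdot,t)=0\ \text{ in } L^2([0,1])\text{ for all } t\ge t_F .$$ -/

import Mathlib

open MeasureTheory Set

namespace DelayedHyperbolic

/-- Data of the `2 × 2` linear hyperbolic system with input delay
`∂ₜu₁ = -ε₁ ∂ₓu₁ + c₁ u₂`, `∂ₜu₂ = ε₂ ∂ₓu₂ + c₂ u₁`, `u₁(0,t) = q u₂(0,t)`,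
`u₂(1,t) = U(t - τ)`, on `0 ≤ x ≤ 1`. Only the values of the coefficients on `[0,1]` matter. -/
structure Plant where
  ε₁ : ℝ → ℝ
  ε₂ : ℝ → ℝ
  c₁ : ℝ → ℝ
  c₂ : ℝ → ℝ
  q : ℝ
  τ : ℝ
  ε₁_cont : ContinuousOn ε₁ (Icc 0 1)
  ε₂_cont : ContinuousOn ε₂ (Icc 0 1)
  c₁_cont : ContinuousOn c₁ (Icc 0 1)
  c₂_cont : ContinuousOn c₂ (Icc 0 1)
  ε₁_pos : ∀ x ∈ Icc (0 : ℝ) 1, 0 < ε₁ x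
  ε₂_pos : ∀ x ∈ Icc (0 : ℝ) 1, 0 < ε₂ x
  q_pos : 0 < q
  τ_pos : 0 < τ

/-! ### Kernels -/

/-- The first-order equation `a(x) ∂ₓF + b(y) ∂ᵧF = G` on `Ω`, in the sense of characteristics:
along every curve `X' = a(X)`, `Y' = b(Y)` that stays in `Ω`, the increment of `F` is the
integral of `G`. -/
def SolvesAlongCharacteristics (Ω : Set (ℝ × ℝ)) (a b : ℝ → ℝ) (F G : ℝ → ℝ → ℝ) : Prop :=
  ∀ (X Y : ℝ → ℝ) (r s : ℝ), r ≤ s →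
    (∀ θ ∈ Icc r s, (X θ, Y θ) ∈ Ω ∧
      HasDerivWithinAt X (a (X θ)) (Icc r s) θ ∧
      HasDerivWithinAt Y (b (Y θ)) (Icc r s) θ) →
    F (X s) (Y s) - F (X r) (Y r) = ∫ θ in r..s, G (X θ) (Y θ)

/-- The pair of coupled kernel equations
`a(x) ∂ₓk₁ - ε₁(y) ∂ᵧk₁ = ε₁'(y) k₁ + c₂(y) k₂`,
`a(x) ∂ₓk₂ + ε₂(y) ∂ᵧk₂ = -ε₂'(y) k₂ + c₁(y) k₁` on `Ω`.
As `ε₁`, `ε₂` need not be differentiable, each equation is multiplied by `εᵢ(y)` and the term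
with `εᵢ'` is absorbed by the product rule: they read
`(a ∂ₓ - ε₁ ∂ᵧ)(ε₁(y) k₁) = ε₁(y) c₂(y) k₂` and `(a ∂ₓ + ε₂ ∂ᵧ)(ε₂(y) k₂) = ε₂(y) c₁(y) k₁`. -/
structure KernelEquations (P : Plant) (Ω : Set (ℝ × ℝ)) (a : ℝ → ℝ) (k₁ k₂ : ℝ → ℝ → ℝ) :
    Prop where
  eq₁ : SolvesAlongCharacteristics Ω a (fun y => -P.ε₁ y)
    (fun x y => P.ε₁ y * k₁ x y) (fun x y => P.ε₁ y * (P.c₂ y * k₂ x y))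
  eq₂ : SolvesAlongCharacteristics Ω a P.ε₂
    (fun x y => P.ε₂ y * k₂ x y) (fun x y => P.ε₂ y * (P.c₁ y * k₁ x y))

/-- The triangle `0 ≤ y ≤ x ≤ 1`. -/
def triangle : Set (ℝ × ℝ) := {z | 0 ≤ z.2 ∧ z.2 ≤ z.1 ∧ z.1 ≤ 1}

/-- The square `0 ≤ x, y ≤ 1`. -/
def square : Set (ℝ × ℝ) := Icc (0 : ℝ) 1 ×ˢ Icc (0 : ℝ) 1

/-- The second row `(K²¹, K²²)` of the delay-free backstepping kernel. -/
structure IsBacksteppingKernel (P : Plant) (K21 K22 : ℝ → ℝ → ℝ) : Prop where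
  cont₁ : ContinuousOn (fun z : ℝ × ℝ => K21 z.1 z.2) triangle
  cont₂ : ContinuousOn (fun z : ℝ × ℝ => K22 z.1 z.2) triangle
  eqs : KernelEquations P triangle P.ε₂ K21 K22
  diag : ∀ x ∈ Icc (0 : ℝ) 1, K21 x x = -P.c₂ x / (P.ε₁ x + P.ε₂ x)
  bottom : ∀ x ∈ Icc (0 : ℝ) 1, P.ε₂ 0 * K22 x 0 = P.q * P.ε₁ 0 * K21 x 0

/-- The kernels `(α₁, α₂)` of the affine Volterra transformation, bounded and measurable. At the
corner `(0,1)`, where the conditions `α₁(x,1) = 0` and `α₁(0,y) = K²¹(1,y)` are in general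
incompatible (so that `α₁` jumps along the characteristic from that corner), the second one is
kept. -/
structure IsPredictorKernel (P : Plant) (K21 K22 α₁ α₂ : ℝ → ℝ → ℝ) : Prop where
  meas₁ : Measurable fun z : ℝ × ℝ => α₁ z.1 z.2
  meas₂ : Measurable fun z : ℝ × ℝ => α₂ z.1 z.2
  bdd : ∃ M : ℝ, ∀ z ∈ square, |α₁ z.1 z.2| ≤ M ∧ |α₂ z.1 z.2| ≤ M
  eqs : KernelEquations P square (fun _ => 1 / P.τ) α₁ α₂
  right : ∀ x ∈ Ioc (0 : ℝ) 1, α₁ x 1 = 0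
  bottom : ∀ x ∈ Icc (0 : ℝ) 1, P.ε₂ 0 * α₂ x 0 = P.q * P.ε₁ 0 * α₁ x 0
  left₁ : ∀ y ∈ Icc (0 : ℝ) 1, α₁ 0 y = K21 1 y
  left₂ : ∀ y ∈ Icc (0 : ℝ) 1, α₂ 0 y = K22 1 y

/-! ### Weak solutions -/

/-- The Hilbert space `L²([0,1])`. -/
abbrev L2 : Type := Lp ℝ 2 (volume.restrict (Icc (0 : ℝ) 1))

/-- `y ∈ C([0,∞); L²(0,1))` is the weak solution of `∂ₜy + λ(x) ∂ₓy = f` on `[0,1] × [0,∞)`, with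
`y(·,0) = y₀` and with boundary values `y(0,t) = a(t)`, `y(1,t) = b(t)` (in `L²_loc`). The velocity
`λ` does not vanish on `[0,1]` but need not be differentiable, so the equation is divided by `λ`
before it is tested. -/
structure IsWeakTransportSolution (lam : ℝ → ℝ) (f : ℝ → ℝ → ℝ) (y₀ : L2) (a b : ℝ → ℝ)
    (y : ℝ → L2) : Prop where
  cont : ContinuousOn y (Ici 0)
  init : y 0 = y₀
  left_memLp : ∀ T : ℝ, MemLp a 2 (volume.restrict (Icc 0 T))
  right_memLp : ∀ T : ℝ, MemLp b 2 (volume.restrict (Icc 0 T))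
  weak : ∀ ψ : ℝ → ℝ → ℝ, ContDiff ℝ 1 (fun z : ℝ × ℝ => ψ z.1 z.2) → ∀ T : ℝ, 0 ≤ T →
    (∫ x in Icc (0 : ℝ) 1, ψ x T / lam x * y T x) - (∫ x in Icc (0 : ℝ) 1, ψ x 0 / lam x * y₀ x) =
      (∫ t in (0 : ℝ)..T, ∫ x in Icc (0 : ℝ) 1,
        (deriv (fun s => ψ x s) t / lam x + deriv (fun ξ => ψ ξ t) x) * y t x) +
      (∫ t in (0 : ℝ)..T, ∫ x in Icc (0 : ℝ) 1, ψ x t / lam x * f x t) +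
      ∫ t in (0 : ℝ)..T, (ψ 0 t * a t - ψ 1 t * b t)

/-- The delay-compensating feedback
`U = ∫₀¹ p(1-y) v(y) dy + ∫₀¹ α₁(1,y) u₁(y) dy + ∫₀¹ α₂(1,y) u₂(y) dy`, where
`p(x) = τ ε₂(1) α₂(x,1)`. -/
noncomputable def feedback (P : Plant) (α₁ α₂ : ℝ → ℝ → ℝ) (u₁ u₂ v : L2) : ℝ :=
  (∫ y in Icc (0 : ℝ) 1, (P.τ * P.ε₂ 1 * α₂ (1 - y) 1) * v y) +
  (∫ y in Icc (0 : ℝ) 1, α₁ 1 y * u₁ y) +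
  ∫ y in Icc (0 : ℝ) 1, α₂ 1 y * u₂ y

/-- `(u₁, u₂, v)` is a weak solution, with initial state `(u₁₀, u₂₀, v₀)`, of the closed loop
`∂ₜu₁ = -ε₁ ∂ₓu₁ + c₁ u₂`, `∂ₜu₂ = ε₂ ∂ₓu₂ + c₂ u₁`, `τ ∂ₜv = ∂ₓv`,
`u₁(0,t) = q u₂(0,t)`, `u₂(1,t) = v(0,t)`, `v(1,t) = U(t)`. Here `g₁`, `g₂`, `g₃` stand for the
boundary values `u₁(1,·)`, `u₂(0,·)`, `v(0,·)`. -/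
def IsClosedLoopSolution (P : Plant) (α₁ α₂ : ℝ → ℝ → ℝ) (u₁₀ u₂₀ v₀ : L2)
    (u₁ u₂ v : ℝ → L2) : Prop :=
  ∃ g₁ g₂ g₃ : ℝ → ℝ,
    IsWeakTransportSolution P.ε₁ (fun x t => P.c₁ x * u₂ t x) u₁₀
      (fun t => P.q * g₂ t) g₁ u₁ ∧
    IsWeakTransportSolution (fun x => -P.ε₂ x) (fun x t => P.c₂ x * u₁ t x) u₂₀ g₂ g₃ u₂ ∧
    IsWeakTransportSolution (fun _ => -(1 / P.τ)) (fun _ _ => 0) v₀ g₃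
      (fun t => feedback P α₁ α₂ (u₁ t) (u₂ t) (v t)) v

/-- `t_F = τ + ∫₀¹ (1/ε₁ + 1/ε₂) dy`. -/
noncomputable def finalTime (P : Plant) : ℝ :=
  P.τ + ∫ y in (0 : ℝ)..1, (1 / P.ε₁ y + 1 / P.ε₂ y)

end DelayedHyperbolic

/-!
# Delay-compensating boundary control of a `2 × 2` hyperbolic system

Everything takes place along characteristics. The coefficients are only continuous, so positions are
replaced by travel times: `Speed.phase` is `x ↦ ∫₀ˣ 1/e`, the characteristics are the curves
`Speed.flow`, and an equation `∂ₜF ± e ∂ₓF = G` means that the increments of `F` along them are the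
integrals of `G` (`Transported`). A product rule (`Transported.mul`) and Fubini's theorem on domains
bounded by characteristics (`integral_exit_sub_entry`) replace integration by parts.

*Kernels.* The integrated equations for `(K²¹, K²²)` are a fixed point problem for continuous
functions on the triangle, contractive in a weighted sup norm (`exists_isBacksteppingKernel`). The
equations for `(α₁, α₂)` are a transport problem in the time `τ x`: `ε₁ α₁` runs from `y = 1` to
`y = 0`, where it is reflected into `ε₂ α₂`. Straightened, the two parts form one `Pipe` run through
at unit speed, whose solvability is again a weighted contraction (`exists_isPredictorKernel`).

*Stability.* For a locally bounded solution along characteristics (`IsMildSolution`) the proof has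
three steps. The predictor kernels are adjoint to the plant, so that the pairing of the kernels at
`x = 1 - (t - t₁)/τ` with the state at the time `t`, followed from `t₁` to `t₁ + τ`, changes only by
what leaves the delay line; hence `u₂(1, t₁ + τ) = ∫ (K²¹(1,·) u₁ + K²²(1,·) u₂)(t₁ + τ)`
(`IsMildSolution.right_eq`): the delay is compensated. Likewise the combination
`u₂ - ∫₀ˣ (K²¹ u₁ + K²² u₂)` is transported without source (`IsMildSolution.backstepping`). It
vanishes at `x = 1` from the time `τ` on, so `u₂(0,·)` vanishes once this value has crossed the
interval, `u₁(0,·) = q u₂(0,·)` vanishes as well, and the Volterra equations in `x` that remain have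
only the zero solution (`IsMildSolution.eq_zero`). A weak solution is reduced to this case by
averaging twice in time: the weak form, tested with functions of `x` alone, shows that the averages
solve the same equations along characteristics, with traces that are the averages of the boundary
values, and a continuous function whose averages vanish is zero (`IsClosedLoopSolution.eq_zero`).

*Existence.* The closed loop itself is a pipe (the delay line, then `u₂`, then `u₁`), so a bounded
initial state is the start of a mild solution (`exists_isMildSolution`). The energy with weights
`1`, `q² + 1`, `q² + 2` for `u₁`, `u₂`, `v` and a factor `e^{-2κt}` controls the state and the
outgoing traces by the initial state (`exists_energy_estimate`); applied to the difference of a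
solution and its time shift it gives continuity in time, and applied to differences of solutions it
lets one pass from continuous to square integrable initial states
(`exists_isClosedLoopSolution`).
-/

namespace DelayedHyperbolic

/-! ### Travel times and flows -/

/-- A continuous velocity field on the whole line, positive and bounded above. -/
structure Speed where
  e : ℝ → ℝ
  cont : Continuous e
  pos : ∀ x, 0 < e x
  bdd : ∃ M, ∀ x, e x ≤ M

namespace Speed

variable (S : Speed)

lemma continuous_inv : Continuous fun x => 1 / S.e x :=
  continuous_const.div S.cont fun x => (S.pos x).ne'

lemma hasDerivAt_integral_inv (x : ℝ) :
    HasDerivAt (fun x => ∫ y in (0 : ℝ)..x, 1 / S.e y) (1 / S.e x) x :=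
  intervalIntegral.integral_hasDerivAt_right (S.continuous_inv.intervalIntegrable _ _)
    S.continuous_inv.aestronglyMeasurable.stronglyMeasurableAtFilter S.continuous_inv.continuousAt

lemma strictMono_integral_inv : StrictMono fun x => ∫ y in (0 : ℝ)..x, 1 / S.e y :=
  strictMono_of_deriv_pos fun x => by
    rw [(S.hasDerivAt_integral_inv x).deriv]
    exact one_div_pos.2 (S.pos x)

lemma surjective_integral_inv : Function.Surjective fun x => ∫ y in (0 : ℝ)..x, 1 / S.e y := by
  obtain ⟨M, hM⟩ := S.bdd
  have hM0 : 0 < M := (S.pos 0).trans_le (hM 0)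
  have hinv : ∀ x, 1 / M ≤ 1 / S.e x := fun x => one_div_le_one_div_of_le (S.pos x) (hM x)
  have hcont : Continuous fun x => ∫ y in (0 : ℝ)..x, 1 / S.e y :=
    continuous_iff_continuousAt.2 fun x => (S.hasDerivAt_integral_inv x).continuousAt
  refine hcont.surjective ?_ ?_
  · refine Filter.tendsto_atTop_mono' _ ?_
      (Filter.tendsto_id.atTop_mul_const (one_div_pos.2 hM0))
    filter_upwards [Filter.eventually_ge_atTop 0] with x hx
    calc x * (1 / M) = ∫ y in (0 : ℝ)..x, 1 / M := by simp
      _ ≤ _ := intervalIntegral.integral_mono_on hx (by simp)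
        (S.continuous_inv.intervalIntegrable _ _) fun y _ => hinv y
  · refine Filter.tendsto_atBot_mono' _ ?_
      (Filter.tendsto_id.atBot_mul_const (one_div_pos.2 hM0))
    filter_upwards [Filter.eventually_le_atBot 0] with x hx
    have h : ∫ y in x..(0 : ℝ), 1 / M ≤ ∫ y in x..(0 : ℝ), 1 / S.e y :=
      intervalIntegral.integral_mono_on hx (by simp)
        (S.continuous_inv.intervalIntegrable _ _) fun y _ => hinv y
    rw [intervalIntegral.integral_symm]
    simp only [intervalIntegral.integral_const, zero_sub, smul_eq_mul] at h
    simp only [id]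
    linarith

/-- The time `∫₀ˣ 1/e` needed to travel from `0` to `x`, as an order isomorphism of the line. -/
noncomputable def phase : ℝ ≃o ℝ :=
  S.strictMono_integral_inv.orderIsoOfSurjective _ S.surjective_integral_inv

lemma phase_apply (x : ℝ) : S.phase x = ∫ y in (0 : ℝ)..x, 1 / S.e y := rfl

@[simp] lemma phase_zero : S.phase 0 = 0 := by simp [phase_apply]

@[simp] lemma phase_symm_zero : S.phase.symm 0 = 0 := by
  rw [OrderIso.symm_apply_eq, phase_zero]

lemma hasDerivAt_phase (x : ℝ) : HasDerivAt S.phase (1 / S.e x) x := S.hasDerivAt_integral_inv x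

@[fun_prop] lemma continuous_phase : Continuous S.phase := S.phase.continuous

@[fun_prop] lemma continuous_phase_symm : Continuous S.phase.symm := S.phase.symm.continuous

lemma hasDerivAt_phase_symm (ξ : ℝ) :
    HasDerivAt S.phase.symm (S.e (S.phase.symm ξ)) ξ := by
  have h := HasDerivAt.of_local_left_inverse (f := S.phase) (g := S.phase.symm) (a := ξ)
    S.continuous_phase_symm.continuousAt (S.hasDerivAt_phase (S.phase.symm ξ))
    (one_div_pos.2 (S.pos _)).ne' (Filter.Eventually.of_forall fun y => by simp)
  simpa using h

lemma phase_nonneg {x : ℝ} (hx : 0 ≤ x) : 0 ≤ S.phase x := by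
  rw [← S.phase_zero]; exact S.phase.monotone hx

lemma phase_pos {x : ℝ} (hx : 0 < x) : 0 < S.phase x := by
  rw [← S.phase_zero]; exact S.phase.strictMono hx

/-- Change of variables between position and travel time; no regularity of `g` is needed. -/
lemma integral_phase {a b : ℝ} (hab : a ≤ b) (g : ℝ → ℝ) :
    ∫ ξ in S.phase a..S.phase b, g ξ = ∫ x in a..b, g (S.phase x) / S.e x := by
  rw [intervalIntegral.integral_of_le (S.phase.monotone hab), intervalIntegral.integral_of_le hab,
    ← integral_Icc_eq_integral_Ioc, ← integral_Icc_eq_integral_Ioc, ← OrderIso.image_Icc,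
    integral_image_eq_integral_abs_deriv_smul measurableSet_Icc
      (fun x _ => (S.hasDerivAt_phase x).hasDerivWithinAt) S.phase.injective.injOn]
  refine integral_congr_ae (Filter.Eventually.of_forall fun x => ?_)
  simp only [abs_of_pos (one_div_pos.2 (S.pos x)), smul_eq_mul]
  ring

/-- The flow of the velocity field. -/
noncomputable def flow (σ x : ℝ) : ℝ := S.phase.symm (S.phase x + σ)

@[simp] lemma flow_zero (x : ℝ) : S.flow 0 x = x := by simp [flow]

@[simp] lemma phase_flow (σ x : ℝ) : S.phase (S.flow σ x) = S.phase x + σ := by simp [flow]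

lemma flow_flow (σ ρ x : ℝ) : S.flow σ (S.flow ρ x) = S.flow (σ + ρ) x := by
  simp only [flow, OrderIso.apply_symm_apply]
  congr 1
  ring

lemma flow_eq_iff {σ x y : ℝ} : S.flow σ x = y ↔ S.phase x + σ = S.phase y := by
  rw [flow, OrderIso.symm_apply_eq]

lemma le_flow_iff {σ x y : ℝ} : y ≤ S.flow σ x ↔ S.phase y ≤ S.phase x + σ := by
  rw [flow, OrderIso.le_symm_apply]

lemma flow_le_iff {σ x y : ℝ} : S.flow σ x ≤ y ↔ S.phase x + σ ≤ S.phase y := by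
  rw [flow, OrderIso.symm_apply_le]

lemma continuous_flow_left (x : ℝ) : Continuous fun σ => S.flow σ x := by
  unfold flow; fun_prop

lemma hasDerivAt_flow (σ x : ℝ) : HasDerivAt (fun σ => S.flow σ x) (S.e (S.flow σ x)) σ := by
  have h := (S.hasDerivAt_phase_symm (S.phase x + σ)).comp σ
    ((hasDerivAt_id σ).const_add (S.phase x))
  simpa [flow, Function.comp_def] using h

/-- A solution of `X' = κ e(X)` on an interval is a piece of the flow. -/
lemma eq_flow_of_hasDerivWithinAt {X : ℝ → ℝ} {κ r s : ℝ}
    (hX : ∀ θ ∈ Icc r s, HasDerivWithinAt X (κ * S.e (X θ)) (Icc r s) θ) :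
    ∀ θ ∈ Icc r s, X θ = S.flow (κ * (θ - r)) (X r) := by
  intro θ hθ
  have hd : ∀ θ ∈ Icc r s, HasDerivWithinAt (fun θ => S.phase (X θ) - κ * θ) 0 (Icc r s) θ := by
    intro θ hθ
    have h := ((S.hasDerivAt_phase (X θ)).comp_hasDerivWithinAt θ (hX θ hθ)).sub
      ((hasDerivWithinAt_id θ (Icc r s)).const_mul κ)
    refine h.congr_deriv ?_
    have := (S.pos (X θ)).ne'
    field_simp
    ring
  have hc := constant_of_has_deriv_right_zero (f := fun θ => S.phase (X θ) - κ * θ)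
    (fun θ hθ => (hd θ hθ).continuousWithinAt)
    (fun θ hθ => ((hd θ ⟨hθ.1, hθ.2.le⟩).mono_of_mem_nhdsWithin
      (Icc_mem_nhdsGE_of_mem hθ))) θ hθ
  rw [eq_comm, flow_eq_iff]
  linarith

end Speed

/-- The retraction of the line onto `[0,1]`. -/
def clamp (x : ℝ) : ℝ := max 0 (min 1 x)

lemma clamp_mem (x : ℝ) : clamp x ∈ Icc (0 : ℝ) 1 :=
  ⟨le_max_left _ _, max_le zero_le_one (min_le_left _ _)⟩

lemma clamp_of_mem {x : ℝ} (hx : x ∈ Icc (0 : ℝ) 1) : clamp x = x := by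
  rw [clamp, min_eq_right hx.2, max_eq_right hx.1]

@[fun_prop] lemma continuous_clamp : Continuous clamp := by unfold clamp; fun_prop

lemma continuous_comp_clamp {f : ℝ → ℝ} (hf : ContinuousOn f (Icc 0 1)) :
    Continuous fun x => f (clamp x) :=
  hf.comp_continuous continuous_clamp clamp_mem

lemma exists_bound_comp_clamp {f : ℝ → ℝ} (hf : ContinuousOn f (Icc 0 1)) :
    ∃ M, 0 ≤ M ∧ ∀ x, |f (clamp x)| ≤ M := by
  obtain ⟨M, hM⟩ := isCompact_Icc.exists_bound_of_continuousOn hf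
  exact ⟨M, (abs_nonneg _).trans (hM 0 (by simp)), fun x => hM _ (clamp_mem x)⟩

/-- A velocity given on `[0,1]`, extended to the line by constants. -/
def Speed.ofIcc (f : ℝ → ℝ) (hf : ContinuousOn f (Icc 0 1)) (hpos : ∀ x ∈ Icc (0 : ℝ) 1, 0 < f x) :
    Speed where
  e x := f (clamp x)
  cont := continuous_comp_clamp hf
  pos x := hpos _ (clamp_mem x)
  bdd := (exists_bound_comp_clamp hf).imp fun _ hM x => (le_abs_self _).trans (hM.2 x)

namespace Plant

variable (P : Plant)

/-- The velocity `ε₁` of `u₁`. -/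
def s₁ : Speed := Speed.ofIcc P.ε₁ P.ε₁_cont P.ε₁_pos

/-- The velocity `ε₂` of `u₂`. -/
def s₂ : Speed := Speed.ofIcc P.ε₂ P.ε₂_cont P.ε₂_pos

/-- The velocity `1/τ` of the delay line. -/
noncomputable def s₃ : Speed where
  e _ := 1 / P.τ
  cont := continuous_const
  pos _ := one_div_pos.2 P.τ_pos
  bdd := ⟨1 / P.τ, fun _ => le_rfl⟩

/-- The coefficient `c₁`, extended to the line by constants. -/
def k₁ (x : ℝ) : ℝ := P.c₁ (clamp x)

/-- The coefficient `c₂`, extended to the line by constants. -/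
def k₂ (x : ℝ) : ℝ := P.c₂ (clamp x)

@[fun_prop] lemma continuous_k₁ : Continuous P.k₁ := continuous_comp_clamp P.c₁_cont
@[fun_prop] lemma continuous_k₂ : Continuous P.k₂ := continuous_comp_clamp P.c₂_cont
@[fun_prop] lemma continuous_s₁ : Continuous P.s₁.e := P.s₁.cont
@[fun_prop] lemma continuous_s₂ : Continuous P.s₂.e := P.s₂.cont

lemma s₁_e {x : ℝ} (hx : x ∈ Icc (0 : ℝ) 1) : P.s₁.e x = P.ε₁ x := by
  simp [s₁, Speed.ofIcc, clamp_of_mem hx]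
lemma s₂_e {x : ℝ} (hx : x ∈ Icc (0 : ℝ) 1) : P.s₂.e x = P.ε₂ x := by
  simp [s₂, Speed.ofIcc, clamp_of_mem hx]
lemma k₁_eq {x : ℝ} (hx : x ∈ Icc (0 : ℝ) 1) : P.k₁ x = P.c₁ x := by simp [k₁, clamp_of_mem hx]
lemma k₂_eq {x : ℝ} (hx : x ∈ Icc (0 : ℝ) 1) : P.k₂ x = P.c₂ x := by simp [k₂, clamp_of_mem hx]
@[simp] lemma s₃_e (x : ℝ) : P.s₃.e x = 1 / P.τ := rfl

@[simp] lemma s₃_phase (x : ℝ) : P.s₃.phase x = P.τ * x := by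
  simp [Speed.phase_apply, mul_comm]

lemma s₃_flow (σ x : ℝ) : P.s₃.flow σ x = x + σ / P.τ := by
  have := P.τ_pos.ne'
  rw [Speed.flow_eq_iff]
  simp only [s₃_phase]
  field_simp

lemma exists_bound_k₁ : ∃ M, 0 ≤ M ∧ ∀ x, |P.k₁ x| ≤ M := exists_bound_comp_clamp P.c₁_cont
lemma exists_bound_k₂ : ∃ M, 0 ≤ M ∧ ∀ x, |P.k₂ x| ≤ M := exists_bound_comp_clamp P.c₂_cont
lemma exists_bound_s₁ : ∃ M, 0 ≤ M ∧ ∀ x, |P.s₁.e x| ≤ M := exists_bound_comp_clamp P.ε₁_cont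
lemma exists_bound_s₂ : ∃ M, 0 ≤ M ∧ ∀ x, |P.s₂.e x| ≤ M := exists_bound_comp_clamp P.ε₂_cont

lemma finalTime_eq : finalTime P = P.τ + P.s₂.phase 1 + P.s₁.phase 1 := by
  have h : ∀ (S : Speed), IntervalIntegrable (fun y => 1 / S.e y) volume 0 1 := fun S =>
    S.continuous_inv.intervalIntegrable _ _
  rw [finalTime, Speed.phase_apply, Speed.phase_apply, add_assoc,
    add_comm (∫ y in (0 : ℝ)..1, 1 / P.s₂.e y), ← intervalIntegral.integral_add (h _) (h _)]
  congr 1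
  refine intervalIntegral.integral_congr fun y hy => ?_
  rw [uIcc_of_le zero_le_one] at hy
  simp only [P.s₁_e hy, P.s₂_e hy]

end Plant

/-- Along curves that stay in `Ω`, the equation in the sense of characteristics is the increment
formula along the flows. `κ` is the sign of the second velocity. -/
lemma solvesAlongCharacteristics_iff {Ω : Set (ℝ × ℝ)} {a b : ℝ → ℝ} {F G : ℝ → ℝ → ℝ}
    (A B : Speed) (κ : ℝ) (ha : ∀ z ∈ Ω, a z.1 = A.e z.1) (hb : ∀ z ∈ Ω, b z.2 = κ * B.e z.2) :
    SolvesAlongCharacteristics Ω a b F G ↔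
      ∀ x y δ : ℝ, 0 ≤ δ → (∀ σ ∈ Icc 0 δ, (A.flow σ x, B.flow (κ * σ) y) ∈ Ω) →
        F (A.flow δ x) (B.flow (κ * δ) y) - F x y =
          ∫ σ in (0 : ℝ)..δ, G (A.flow σ x) (B.flow (κ * σ) y) := by
  constructor
  · intro h x y δ hδ hΩ
    have := h (fun σ => A.flow σ x) (fun σ => B.flow (κ * σ) y) 0 δ hδ fun σ hσ => by
      refine ⟨hΩ σ hσ, ?_, ?_⟩
      · rw [ha _ (hΩ σ hσ)]
        exact (A.hasDerivAt_flow σ x).hasDerivWithinAt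
      · rw [hb _ (hΩ σ hσ)]
        have h1 := (B.hasDerivAt_flow (κ * σ) y).comp σ ((hasDerivAt_id σ).const_mul κ)
        simp only [mul_one] at h1
        rw [mul_comm κ (B.e _)]
        exact h1.hasDerivWithinAt
    simpa using this
  · intro h X Y r s hrs hXY
    have hX := A.eq_flow_of_hasDerivWithinAt (X := X) (κ := 1) (r := r) (s := s) fun θ hθ => by
      have := (hXY θ hθ).2.1
      rwa [ha _ (hXY θ hθ).1, ← one_mul (A.e _)] at this
    have hY := B.eq_flow_of_hasDerivWithinAt (X := Y) (κ := κ) (r := r) (s := s) fun θ hθ => by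
      have := (hXY θ hθ).2.2
      rwa [hb _ (hXY θ hθ).1] at this
    simp only [one_mul] at hX
    have key := h (X r) (Y r) (s - r) (sub_nonneg.2 hrs) fun σ hσ => by
      have hmem : σ + r ∈ Icc r s := ⟨by linarith [hσ.1], by linarith [hσ.2]⟩
      have h1 := (hXY _ hmem).1
      rw [hX _ hmem, hY _ hmem] at h1
      simpa using h1
    rw [hX s ⟨hrs, le_rfl⟩, hY s ⟨hrs, le_rfl⟩, key]
    have h2 := intervalIntegral.integral_comp_sub_right (a := r) (b := s)
      (fun σ => G (A.flow σ (X r)) (B.flow (κ * σ) (Y r))) r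
    rw [sub_self] at h2
    rw [← h2]
    refine intervalIntegral.integral_congr fun θ hθ => ?_
    rw [uIcc_of_le hrs] at hθ
    simp only [← hX θ hθ, ← hY θ hθ]

end DelayedHyperbolic

namespace DelayedHyperbolic

/-! ### Integration along straight lines -/

lemma intervalIntegrable_of_bounded {f : ℝ → ℝ} {a b M : ℝ} (hab : a ≤ b) (hf : Measurable f)
    (hM : ∀ x ∈ Icc a b, |f x| ≤ M) : IntervalIntegrable f volume a b := by
  rw [intervalIntegrable_iff_integrableOn_Icc_of_le hab]
  exact Measure.integrableOn_of_bounded (by simp) hf.aestronglyMeasurable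
    ((ae_restrict_iff' measurableSet_Icc).2 (Filter.Eventually.of_forall hM))

/-- Product rule for functions given as integrals of integrable functions. -/
lemma mul_sub_mul_eq_integral {A B A' B' : ℝ → ℝ} {a b : ℝ} (hab : a ≤ b)
    (hA' : IntervalIntegrable A' volume a b) (hB' : IntervalIntegrable B' volume a b)
    (hA : ∀ x ∈ Icc a b, A x - A a = ∫ t in a..x, A' t)
    (hB : ∀ x ∈ Icc a b, B x - B a = ∫ t in a..x, B' t) :
    A b * B b - A a * B a = ∫ t in a..b, (A' t * B t + A t * B' t) := by
  set f : ℝ → ℝ := fun x => A a + ∫ t in a..x, A' t with hf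
  set g : ℝ → ℝ := fun x => B a + ∫ t in a..x, B' t with hg
  have hAC : ∀ c : ℝ, AbsolutelyContinuousOnInterval (fun _ : ℝ => c) a b := fun c =>
    contDiffOn_const.absolutelyContinuousOnInterval
  have hfAC : AbsolutelyContinuousOnInterval f a b :=
    (hAC _).fun_add (hA'.absolutelyContinuousOnInterval_intervalIntegral left_mem_uIcc)
  have hgAC : AbsolutelyContinuousOnInterval g a b :=
    (hAC _).fun_add (hB'.absolutelyContinuousOnInterval_intervalIntegral left_mem_uIcc)
  have hfA : ∀ x ∈ Icc a b, f x = A x := fun x hx => by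
    simp only [hf, ← hA x hx]; ring
  have hgB : ∀ x ∈ Icc a b, g x = B x := fun x hx => by
    simp only [hg, ← hB x hx]; ring
  rw [← hfA b ⟨hab, le_rfl⟩, ← hgB b ⟨hab, le_rfl⟩, ← hfA a ⟨le_rfl, hab⟩,
    ← hgB a ⟨le_rfl, hab⟩, ← hfAC.integral_deriv_mul_eq_sub hgAC]
  refine intervalIntegral.integral_congr_ae ?_
  filter_upwards [hA'.ae_hasDerivAt_integral, hB'.ae_hasDerivAt_integral] with x h1 h2 hx
  have hx' : x ∈ uIcc a b := uIoc_subset_uIcc hx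
  have hx'' : x ∈ Icc a b := by rwa [uIcc_of_le hab] at hx'
  rw [((h1 hx' a left_mem_uIcc).const_add (A a)).deriv,
    ((h2 hx' a left_mem_uIcc).const_add (B a)).deriv, hfA x hx'', hgB x hx'']

/-- Fubini's theorem on the region `{(η,t) | s η ≤ t ≤ e η} = {(η,t) | α t ≤ η ≤ β t}`: the exit
values minus the entry values of a function integrate to the double integral of its
derivative. -/
lemma integral_exit_sub_entry {A B a b M : ℝ} {s e hin hout α β : ℝ → ℝ} {g : ℝ → ℝ → ℝ}
    (hAB : A ≤ B) (hab : a ≤ b) (hs : Measurable s) (he : Measurable e)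
    (hg : Measurable (Function.uncurry g))
    (hse : ∀ η ∈ Icc A B, a ≤ s η ∧ s η ≤ e η ∧ e η ≤ b)
    (hM : ∀ η ∈ Icc A B, ∀ t ∈ Icc (s η) (e η), |g η t| ≤ M)
    (hhin : IntervalIntegrable hin volume A B) (hhout : IntervalIntegrable hout volume A B)
    (h : ∀ η ∈ Icc A B, hout η - hin η = ∫ t in s η..e η, g η t)
    (hαβ : ∀ t ∈ Icc a b, A ≤ α t ∧ α t ≤ β t ∧ β t ≤ B)
    (hreg : ∀ t ∈ Icc a b, ∀ η ∈ Icc A B, (s η ≤ t ∧ t ≤ e η) ↔ (α t ≤ η ∧ η ≤ β t)) :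
    (∫ η in A..B, hout η) - ∫ η in A..B, hin η = ∫ t in a..b, ∫ η in α t..β t, g η t := by
  set R : Set (ℝ × ℝ) := {z | s z.1 ≤ z.2 ∧ z.2 ≤ e z.1} with hR
  have hRm : MeasurableSet R :=
    (measurableSet_le (hs.comp measurable_fst) measurable_snd).inter
      (measurableSet_le measurable_snd (he.comp measurable_fst))
  set g' : ℝ → ℝ → ℝ := fun η t => R.indicator (Function.uncurry g) (η, t) with hg'
  have hg'm : Measurable (Function.uncurry g') := hg.indicator hRm
  have hint : IntegrableOn (Function.uncurry g') (uIoc A B ×ˢ uIoc a b) := by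
    refine Measure.integrableOn_of_bounded (M := max M 0) ?_ hg'm.aestronglyMeasurable ?_
    · rw [Measure.volume_eq_prod, Measure.prod_prod]
      exact ENNReal.mul_ne_top (by simp [uIoc]) (by simp [uIoc])
    · refine (ae_restrict_iff' (measurableSet_uIoc.prod measurableSet_uIoc)).2
        (Filter.Eventually.of_forall fun z hz => ?_)
      rw [uIoc_of_le hAB] at hz
      simp only [Function.uncurry, hg', indicator]
      split_ifs with hzR
      · exact (hM z.1 ⟨hz.1.1.le, hz.1.2⟩ z.2 hzR).trans (le_max_left _ _)
      · simp
  rw [← intervalIntegral.integral_sub hhout hhin]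
  have h1 : ∫ η in A..B, (hout η - hin η) = ∫ η in A..B, ∫ t in a..b, g' η t := by
    refine intervalIntegral.integral_congr fun η hη => ?_
    rw [uIcc_of_le hAB] at hη
    obtain ⟨h2, h3, h4⟩ := hse η hη
    simp only [h η hη]
    rw [intervalIntegral.integral_of_le h3, intervalIntegral.integral_of_le (h2.trans (h3.trans h4)),
      ← integral_Icc_eq_integral_Ioc, ← integral_Icc_eq_integral_Ioc]
    have : (fun t => g' η t) = (Icc (s η) (e η)).indicator (g η) := by
      ext t
      simp only [hg', indicator, hR, Function.uncurry, mem_Icc, mem_ofPred_eq]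
    rw [this, setIntegral_indicator measurableSet_Icc,
      inter_eq_self_of_subset_right (Icc_subset_Icc h2 h4)]
  rw [h1, intervalIntegral_intervalIntegral_swap hint]
  refine intervalIntegral.integral_congr fun t ht => ?_
  rw [uIcc_of_le hab] at ht
  obtain ⟨h2, h3, h4⟩ := hαβ t ht
  rw [intervalIntegral.integral_of_le h3, intervalIntegral.integral_of_le (h2.trans (h3.trans h4)),
    ← integral_Icc_eq_integral_Ioc, ← integral_Icc_eq_integral_Ioc]
  have : EqOn (fun η => g' η t) ((Icc (α t) (β t)).indicator (fun η => g η t)) (Icc A B) := by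
    intro η hη
    simp only [hg', indicator, hR, Function.uncurry, mem_Icc, mem_ofPred_eq, hreg t ht η hη]
  rw [setIntegral_congr_fun measurableSet_Icc this, setIntegral_indicator measurableSet_Icc,
      inter_eq_self_of_subset_right (Icc_subset_Icc h2 h4)]

/-- Balance law on the rectangle `[p₀,p₁] × [a,b]` for a function whose increments along the lines
of slope one are integrals of `G`. -/
lemma integral_rectangle {F G : ℝ → ℝ → ℝ} {p₀ p₁ a b M : ℝ} (hp : p₀ ≤ p₁) (hab : a ≤ b)
    (hF : Measurable (Function.uncurry F)) (hG : Measurable (Function.uncurry G))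
    (hFM : ∀ p ∈ Icc p₀ p₁, ∀ t ∈ Icc a b, |F p t| ≤ M)
    (hGM : ∀ p ∈ Icc p₀ p₁, ∀ t ∈ Icc a b, |G p t| ≤ M)
    (h : ∀ p t δ, 0 ≤ δ → p₀ ≤ p → p + δ ≤ p₁ → a ≤ t → t + δ ≤ b →
      F (p + δ) (t + δ) - F p t = ∫ σ in (0 : ℝ)..δ, G (p + σ) (t + σ)) :
    (∫ p in p₀..p₁, F p b) - ∫ p in p₀..p₁, F p a =
      (∫ t in a..b, ∫ p in p₀..p₁, G p t) + ∫ t in a..b, (F p₀ t - F p₁ t) := by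
  set s : ℝ → ℝ := fun η => max a (p₀ - η) with hs
  set e : ℝ → ℝ := fun η => min b (p₁ - η) with he
  have hsm : Measurable s := by fun_prop
  have hem : Measurable e := by fun_prop
  have hse : ∀ η ∈ Icc (p₀ - b) (p₁ - a), a ≤ s η ∧ s η ≤ e η ∧ e η ≤ b := by
    intro η hη
    refine ⟨le_max_left _ _, max_le (le_min hab (by linarith [hη.2]))
      (le_min (by linarith [hη.1]) (by linarith)), min_le_left _ _⟩
  have hline : Measurable fun z : ℝ × ℝ => (z.1 + z.2, z.2) := by fun_prop
  have hpt : ∀ η ∈ Icc (p₀ - b) (p₁ - a), ∀ t ∈ Icc (s η) (e η),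
      η + t ∈ Icc p₀ p₁ ∧ t ∈ Icc a b := by
    intro η hη t ht
    have h1 := (max_le_iff.1 ht.1)
    have h2 := (le_min_iff.1 ht.2)
    exact ⟨⟨by linarith [h1.2], by linarith [h2.2]⟩, h1.1, h2.1⟩
  have hin : ∀ f : ℝ → ℝ, Measurable f →
      (∀ η ∈ Icc (p₀ - b) (p₁ - a), f η ∈ Icc (s η) (e η)) →
      IntervalIntegrable (fun η => F (η + f η) (f η)) volume (p₀ - b) (p₁ - a) := by
    intro f hf hfi
    refine intervalIntegrable_of_bounded (M := M) (by linarith)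
      (hF.comp ((measurable_id.add hf).prodMk hf)) fun η hη => ?_
    obtain ⟨h1, h2⟩ := hpt η hη _ (hfi η hη)
    exact hFM _ h1 _ h2
  have hent := hin s hsm fun η hη => ⟨le_rfl, (hse η hη).2.1⟩
  have hext := hin e hem fun η hη => ⟨(hse η hη).2.1, le_rfl⟩
  have key := integral_exit_sub_entry (A := p₀ - b) (B := p₁ - a) (a := a) (b := b) (M := M)
    (s := s) (e := e) (hin := fun η => F (η + s η) (s η)) (hout := fun η => F (η + e η) (e η))
    (α := fun t => p₀ - t) (β := fun t => p₁ - t) (g := fun η t => G (η + t) t)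
    (by linarith) hab hsm hem (hG.comp hline) hse
    (fun η hη t ht => hGM _ (hpt η hη t ht).1 _ (hpt η hη t ht).2) hent hext ?_ ?_ ?_
  · have hL1 : ∫ η in (p₀ - b)..(p₁ - a), F (η + e η) (e η) =
        (∫ p in p₀..p₁, F p b) + ∫ t in a..b, F p₁ t := by
      rw [← intervalIntegral.integral_add_adjacent_intervals (b := p₁ - b)
        (hext.mono_set (uIcc_subset_uIcc left_mem_uIcc
          (by rw [uIcc_of_le (by linarith)]; constructor <;> linarith)))
        (hext.mono_set (uIcc_subset_uIcc (by rw [uIcc_of_le (by linarith)]; constructor <;> linarith)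
          right_mem_uIcc))]
      congr 1
      · have h1 := intervalIntegral.integral_comp_add_right (a := p₀ - b) (b := p₁ - b)
          (fun p => F p b) b
        simp only [sub_add_cancel] at h1
        rw [← h1]
        refine intervalIntegral.integral_congr fun η hη => ?_
        rw [uIcc_of_le (by linarith)] at hη
        simp only [he, min_eq_left (by linarith [hη.2] : b ≤ p₁ - η)]
      · have h1 := intervalIntegral.integral_comp_sub_left (a := p₁ - b) (b := p₁ - a)
          (fun t => F p₁ t) p₁
        simp only [sub_sub_cancel] at h1
        rw [← h1]
        refine intervalIntegral.integral_congr fun η hη => ?_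
        rw [uIcc_of_le (by linarith)] at hη
        simp only [he, min_eq_right (by linarith [hη.1] : p₁ - η ≤ b), add_sub_cancel]
    have hL2 : ∫ η in (p₀ - b)..(p₁ - a), F (η + s η) (s η) =
        (∫ t in a..b, F p₀ t) + ∫ p in p₀..p₁, F p a := by
      rw [← intervalIntegral.integral_add_adjacent_intervals (b := p₀ - a)
        (hent.mono_set (uIcc_subset_uIcc left_mem_uIcc
          (by rw [uIcc_of_le (by linarith)]; constructor <;> linarith)))
        (hent.mono_set (uIcc_subset_uIcc (by rw [uIcc_of_le (by linarith)]; constructor <;> linarith)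
          right_mem_uIcc))]
      congr 1
      · have h1 := intervalIntegral.integral_comp_sub_left (a := p₀ - b) (b := p₀ - a)
          (fun t => F p₀ t) p₀
        simp only [sub_sub_cancel] at h1
        rw [← h1]
        refine intervalIntegral.integral_congr fun η hη => ?_
        rw [uIcc_of_le (by linarith)] at hη
        simp only [hs, max_eq_right (by linarith [hη.2] : a ≤ p₀ - η), add_sub_cancel]
      · have h1 := intervalIntegral.integral_comp_add_right (a := p₀ - a) (b := p₁ - a)
          (fun p => F p a) a
        simp only [sub_add_cancel] at h1
        rw [← h1]
        refine intervalIntegral.integral_congr fun η hη => ?_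
        rw [uIcc_of_le (by linarith)] at hη
        simp only [hs, max_eq_left (by linarith [hη.1] : p₀ - η ≤ a)]
    have hR : ∫ t in a..b, ∫ η in (p₀ - t)..(p₁ - t), G (η + t) t =
        ∫ t in a..b, ∫ p in p₀..p₁, G p t := by
      refine intervalIntegral.integral_congr fun t _ => ?_
      have h1 := intervalIntegral.integral_comp_add_right (a := p₀ - t) (b := p₁ - t)
          (fun p => G p t) t
      simpa only [sub_add_cancel] using h1
    have hI : ∀ p ∈ Icc p₀ p₁, IntervalIntegrable (F p) volume a b := fun p hp =>
      intervalIntegrable_of_bounded hab (hF.comp measurable_prodMk_left) (hFM p hp)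
    rw [hL1, hL2, hR] at key
    rw [intervalIntegral.integral_sub (hI _ ⟨le_rfl, hp⟩) (hI _ ⟨hp, le_rfl⟩)]
    linarith
  · intro η hη
    obtain ⟨h1, h2, h3⟩ := hse η hη
    obtain ⟨h4, h5⟩ := hpt η hη (s η) ⟨le_rfl, h2⟩
    obtain ⟨h6, h7⟩ := hpt η hη (e η) ⟨h2, le_rfl⟩
    have h8 := h (η + s η) (s η) (e η - s η) (by linarith) h4.1 (by linarith [h6.2]) h1
      (by linarith)
    have h9 := intervalIntegral.integral_comp_sub_right (a := s η) (b := e η)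
      (fun σ => G (η + s η + σ) (s η + σ)) (s η)
    rw [sub_self] at h9
    rw [← h9] at h8
    have h10 : ∀ t, η + s η + (t - s η) = η + t ∧ s η + (t - s η) = t := fun t => by
      constructor <;> ring
    simpa only [(h10 _).1, (h10 _).2] using h8
  · intro t ht
    exact ⟨by linarith [ht.2], by linarith, by linarith [ht.1]⟩
  · intro t ht η hη
    simp only [hs, he, max_le_iff, le_min_iff, ht.1, ht.2, true_and]
    constructor <;> rintro ⟨h1, h2⟩ <;> constructor <;> linarith

/-! ### Functions transported by a flow on `[0,1]` -/

/-- `F` satisfies `∂ₜF + κ e ∂ₓF = G` on `[0,1] × I` along the characteristics. -/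
def Transported (S : Speed) (κ : ℝ) (I : Set ℝ) (F G : ℝ → ℝ → ℝ) : Prop :=
  ∀ x t δ : ℝ, 0 ≤ δ → t ∈ I → t + δ ∈ I → (∀ σ ∈ Icc 0 δ, S.flow (κ * σ) x ∈ Icc (0 : ℝ) 1) →
    F (S.flow (κ * δ) x) (t + δ) - F x t =
      ∫ σ in (0 : ℝ)..δ, G (S.flow (κ * σ) x) (t + σ)

lemma Transported.mono {S : Speed} {κ : ℝ} {I J : Set ℝ} {F G : ℝ → ℝ → ℝ}
    (h : Transported S κ J F G) (hIJ : I ⊆ J) : Transported S κ I F G :=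
  fun x t δ hδ ht htδ hx => h x t δ hδ (hIJ ht) (hIJ htδ) hx

lemma Transported.congr {S : Speed} {κ a b : ℝ} {F G F' G' : ℝ → ℝ → ℝ}
    (h : Transported S κ (Icc a b) F G)
    (hF : ∀ x ∈ Icc (0 : ℝ) 1, ∀ t ∈ Icc a b, F' x t = F x t)
    (hG : ∀ x ∈ Icc (0 : ℝ) 1, ∀ t ∈ Icc a b, G' x t = G x t) :
    Transported S κ (Icc a b) F' G' := by
  intro x t δ hδ ht htδ hx
  have h0 : x ∈ Icc (0 : ℝ) 1 := by simpa using hx 0 ⟨le_rfl, hδ⟩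
  rw [hF _ (hx δ ⟨hδ, le_rfl⟩) _ htδ, hF _ h0 _ ht, h x t δ hδ ht htδ hx]
  refine intervalIntegral.integral_congr fun σ hσ => ?_
  rw [uIcc_of_le hδ] at hσ
  exact (hG _ (hx σ hσ) _ ⟨by linarith [ht.1, hσ.1], by linarith [htδ.2, hσ.2]⟩).symm

/-- Product rule along characteristics. -/
lemma Transported.mul {S : Speed} {κ a b M : ℝ} {F G F' G' : ℝ → ℝ → ℝ}
    (h : Transported S κ (Icc a b) F G) (h' : Transported S κ (Icc a b) F' G')
    (hG : Measurable (Function.uncurry G)) (hG' : Measurable (Function.uncurry G'))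
    (hGM : ∀ x ∈ Icc (0 : ℝ) 1, ∀ t ∈ Icc a b, |G x t| ≤ M)
    (hGM' : ∀ x ∈ Icc (0 : ℝ) 1, ∀ t ∈ Icc a b, |G' x t| ≤ M) :
    Transported S κ (Icc a b) (fun x t => F x t * F' x t)
      (fun x t => G x t * F' x t + F x t * G' x t) := by
  intro x t δ hδ ht htδ hx
  have hm : Measurable fun σ => (S.flow (κ * σ) x, t + σ) :=
    ((S.continuous_flow_left x).comp (continuous_const.mul continuous_id)).measurable.prodMk
      (by fun_prop)
  have hmem : ∀ σ ∈ Icc 0 δ, t + σ ∈ Icc a b := fun σ hσ =>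
    ⟨by linarith [ht.1, hσ.1], by linarith [htδ.2, hσ.2]⟩
  have key := mul_sub_mul_eq_integral (a := 0) (b := δ) hδ
    (A := fun σ => F (S.flow (κ * σ) x) (t + σ)) (B := fun σ => F' (S.flow (κ * σ) x) (t + σ))
    (intervalIntegrable_of_bounded hδ (hG.comp hm) fun σ hσ => hGM _ (hx σ hσ) _ (hmem σ hσ))
    (intervalIntegrable_of_bounded hδ (hG'.comp hm) fun σ hσ => hGM' _ (hx σ hσ) _ (hmem σ hσ))
    (fun σ hσ => by
      simpa using h x t σ hσ.1 ht (hmem σ hσ) fun ρ hρ => hx ρ ⟨hρ.1, hρ.2.trans hσ.2⟩)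
    (fun σ hσ => by
      simpa using h' x t σ hσ.1 ht (hmem σ hσ) fun ρ hρ => hx ρ ⟨hρ.1, hρ.2.trans hσ.2⟩)
  simpa using key

/-- Balance law on `[0,1] × [a,b]` for transport to the right. -/
lemma Transported.integral_right {S : Speed} {a b M : ℝ} {F G : ℝ → ℝ → ℝ} (hab : a ≤ b)
    (h : Transported S 1 (Icc a b) F G)
    (hF : Measurable (Function.uncurry F)) (hG : Measurable (Function.uncurry G))
    (hFM : ∀ x ∈ Icc (0 : ℝ) 1, ∀ t ∈ Icc a b, |F x t| ≤ M)
    (hGM : ∀ x ∈ Icc (0 : ℝ) 1, ∀ t ∈ Icc a b, |G x t| ≤ M) :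
    (∫ x in (0 : ℝ)..1, F x b / S.e x) - ∫ x in (0 : ℝ)..1, F x a / S.e x =
      (∫ t in a..b, ∫ x in (0 : ℝ)..1, G x t / S.e x) + ∫ t in a..b, (F 0 t - F 1 t) := by
  have hm : Measurable fun z : ℝ × ℝ => (S.phase.symm z.1, z.2) := by fun_prop
  have hmem : ∀ p ∈ Icc 0 (S.phase 1), S.phase.symm p ∈ Icc (0 : ℝ) 1 := fun p hp => by
    rw [mem_Icc, OrderIso.le_symm_apply, OrderIso.symm_apply_le, S.phase_zero]; exact hp
  have key := integral_rectangle (F := fun p t => F (S.phase.symm p) t)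
    (G := fun p t => G (S.phase.symm p) t) (p₀ := 0) (p₁ := S.phase 1) (M := M)
    (S.phase_nonneg zero_le_one) hab (hF.comp hm) (hG.comp hm)
    (fun p hp t ht => hFM _ (hmem p hp) t ht) (fun p hp t ht => hGM _ (hmem p hp) t ht) ?_
  · have hsub : ∀ f : ℝ → ℝ, ∫ p in (0 : ℝ)..S.phase 1, f (S.phase.symm p) =
        ∫ x in (0 : ℝ)..1, f x / S.e x := fun f => by
      have := S.integral_phase zero_le_one fun p => f (S.phase.symm p)
      simpa using this
    rw [hsub (fun x => F x b), hsub (fun x => F x a)] at key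
    simp only [fun t => hsub (fun x => G x t)] at key
    simpa using key
  · intro p t δ hδ hp hpδ ht htδ
    have := h (S.phase.symm p) t δ hδ ⟨ht, by linarith⟩ ⟨by linarith, htδ⟩ fun σ hσ => by
      rw [Speed.flow, OrderIso.apply_symm_apply, one_mul]
      exact hmem _ ⟨by linarith [hσ.1], by linarith [hσ.2]⟩
    simpa [Speed.flow] using this

/-- Balance law on `[0,1] × [a,b]` for transport to the left. -/
lemma Transported.integral_left {S : Speed} {a b M : ℝ} {F G : ℝ → ℝ → ℝ} (hab : a ≤ b)
    (h : Transported S (-1) (Icc a b) F G)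
    (hF : Measurable (Function.uncurry F)) (hG : Measurable (Function.uncurry G))
    (hFM : ∀ x ∈ Icc (0 : ℝ) 1, ∀ t ∈ Icc a b, |F x t| ≤ M)
    (hGM : ∀ x ∈ Icc (0 : ℝ) 1, ∀ t ∈ Icc a b, |G x t| ≤ M) :
    (∫ x in (0 : ℝ)..1, F x b / S.e x) - ∫ x in (0 : ℝ)..1, F x a / S.e x =
      (∫ t in a..b, ∫ x in (0 : ℝ)..1, G x t / S.e x) + ∫ t in a..b, (F 1 t - F 0 t) := by
  have hm : Measurable fun z : ℝ × ℝ => (S.phase.symm (S.phase 1 - z.1), z.2) := by fun_prop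
  have hmem : ∀ p ∈ Icc 0 (S.phase 1), S.phase.symm (S.phase 1 - p) ∈ Icc (0 : ℝ) 1 :=
    fun p hp => by
      rw [mem_Icc, OrderIso.le_symm_apply, OrderIso.symm_apply_le, S.phase_zero]
      constructor <;> linarith [hp.1, hp.2]
  have key := integral_rectangle (F := fun p t => F (S.phase.symm (S.phase 1 - p)) t)
    (G := fun p t => G (S.phase.symm (S.phase 1 - p)) t) (p₀ := 0) (p₁ := S.phase 1) (M := M)
    (S.phase_nonneg zero_le_one) hab (hF.comp hm) (hG.comp hm)
    (fun p hp t ht => hFM _ (hmem p hp) t ht) (fun p hp t ht => hGM _ (hmem p hp) t ht) ?_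
  · have hsub : ∀ f : ℝ → ℝ, ∫ p in (0 : ℝ)..S.phase 1, f (S.phase.symm (S.phase 1 - p)) =
        ∫ x in (0 : ℝ)..1, f x / S.e x := fun f => by
      rw [intervalIntegral.integral_comp_sub_left (fun p => f (S.phase.symm p)) (S.phase 1)]
      have := S.integral_phase zero_le_one fun p => f (S.phase.symm p)
      simpa using this
    rw [hsub (fun x => F x b), hsub (fun x => F x a)] at key
    simp only [fun t => hsub (fun x => G x t)] at key
    simpa using key
  · intro p t δ hδ hp hpδ ht htδ
    have := h (S.phase.symm (S.phase 1 - p)) t δ hδ ⟨ht, by linarith⟩ ⟨by linarith, htδ⟩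
      fun σ hσ => by
        rw [Speed.flow, OrderIso.apply_symm_apply, neg_one_mul]
        have := hmem (p + σ) ⟨by linarith [hσ.1], by linarith [hσ.2]⟩
        rwa [← sub_sub, sub_eq_add_neg _ σ] at this
    simpa [Speed.flow, sub_eq_add_neg, add_assoc, add_comm, add_left_comm] using this

end DelayedHyperbolic

namespace DelayedHyperbolic

/-! ### Fixed points in weighted sup norms -/

/-- Contraction principle for real functions in the sup norm with weight `1/ρ`, on a set `A` of
functions that is closed under geometric convergence. -/
lemma exists_fixedPoint {X : Type*} {ρ : X → ℝ} {A : Set (X → ℝ)} {Φ : (X → ℝ) → X → ℝ}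
    {f₀ : X → ℝ} {C₀ : ℝ} (hC₀ : 0 ≤ C₀) (hΦ : ∀ f ∈ A, Φ f ∈ A) (hf₀ : f₀ ∈ A)
    (h₀ : ∀ x, |Φ f₀ x - f₀ x| ≤ C₀ * ρ x)
    (hcontr : ∀ f ∈ A, ∀ g ∈ A, ∀ C, 0 ≤ C → (∀ x, |f x - g x| ≤ C * ρ x) →
      ∀ x, |Φ f x - Φ g x| ≤ C / 2 * ρ x)
    (hA : ∀ (u : ℕ → X → ℝ) (f : X → ℝ) (K : ℝ), (∀ n, u n ∈ A) →
      (∀ n x, |f x - u n x| ≤ K * (1 / 2) ^ n * ρ x) → f ∈ A) :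
    ∃ f ∈ A, Φ f = f := by
  set u : ℕ → X → ℝ := fun n => Φ^[n] f₀ with hu
  have hus : ∀ n, u (n + 1) = Φ (u n) := fun n => Function.iterate_succ_apply' Φ n f₀
  have huA : ∀ n, u n ∈ A := by
    intro n
    induction n with
    | zero => exact hf₀
    | succ n ih => rw [hus]; exact hΦ _ ih
  have hstep : ∀ n x, |u (n + 1) x - u n x| ≤ C₀ * (1 / 2) ^ n * ρ x := by
    intro n
    induction n with
    | zero => intro x; simpa [hu] using h₀ x
    | succ n ih =>
      intro x
      rw [hus (n + 1), hus n]
      have := hcontr _ (huA (n + 1)) _ (huA n) (C₀ * (1 / 2) ^ n) (by positivity) ih x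
      rw [hus n] at this
      refine this.trans (le_of_eq ?_)
      ring
  have hd : ∀ x n, dist (u n x) (u (n + 1) x) ≤ C₀ * ρ x * (1 / 2) ^ n := fun x n => by
    rw [dist_comm, Real.dist_eq]
    exact (hstep n x).trans (le_of_eq (by ring))
  have hlim : ∀ x, ∃ a, Filter.Tendsto (fun n => u n x) Filter.atTop (nhds a) := fun x =>
    cauchySeq_tendsto_of_complete
      (cauchySeq_of_le_geometric (1 / 2) (C₀ * ρ x) (by norm_num) (hd x))
  choose f hf using hlim
  have hdist : ∀ n x, |f x - u n x| ≤ 2 * C₀ * (1 / 2) ^ n * ρ x := fun n x => by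
    have := dist_le_of_le_geometric_of_tendsto (1 / 2) (C₀ * ρ x) (by norm_num) (hd x) (hf x) n
    rw [dist_comm, Real.dist_eq] at this
    refine this.trans (le_of_eq ?_)
    ring
  have hfA : f ∈ A := hA u f (2 * C₀) huA hdist
  refine ⟨f, hfA, funext fun x => ?_⟩
  refine tendsto_nhds_unique (f := fun n => u (n + 1) x) ?_
    ((hf x).comp (Filter.tendsto_add_atTop_nat 1))
  rw [tendsto_iff_dist_tendsto_zero]
  refine squeeze_zero (g := fun n : ℕ => C₀ * ρ x * (1 / 2) ^ n) (fun _ => dist_nonneg)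
    (fun n => ?_) ?_
  · rw [dist_comm, Real.dist_eq, hus]
    exact (hcontr _ hfA _ (huA n) (2 * C₀ * (1 / 2) ^ n) (by positivity) (hdist n) x).trans
      (le_of_eq (by ring))
  · simpa using (tendsto_pow_atTop_nhds_zero_of_lt_one (by norm_num : (0 : ℝ) ≤ 1 / 2)
      (by norm_num)).const_mul (C₀ * ρ x)

lemma measurable_intervalIntegral {α : Type*} [MeasurableSpace α] {f : α → ℝ → ℝ} {a b : α → ℝ}
    (hf : Measurable (Function.uncurry f)) (ha : Measurable a) (hb : Measurable b) :
    Measurable fun x => ∫ σ in a x..b x, f x σ := by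
  have key : ∀ a b : α → ℝ, Measurable a → Measurable b →
      Measurable fun x => ∫ σ in Ioc (a x) (b x), f x σ := by
    intro a b ha hb
    have hR : MeasurableSet {z : α × ℝ | a z.1 < z.2 ∧ z.2 ≤ b z.1} :=
      (measurableSet_lt (ha.comp measurable_fst) measurable_snd).inter
        (measurableSet_le measurable_snd (hb.comp measurable_fst))
    have h1 := ((hf.indicator hR).stronglyMeasurable.integral_prod_right'
      (ν := (volume : Measure ℝ))).measurable
    have h2 : (fun x => ∫ σ in Ioc (a x) (b x), f x σ) = fun x => ∫ σ,
        {z : α × ℝ | a z.1 < z.2 ∧ z.2 ≤ b z.1}.indicator (Function.uncurry f) (x, σ) := by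
      ext x
      rw [← integral_indicator measurableSet_Ioc]
      rfl
    rw [h2]
    exact h1
  simp only [intervalIntegral]
  exact (key a b ha hb).sub (key b a hb ha)

lemma integral_exp_mul_le {c a b : ℝ} (hc : 0 < c) :
    ∫ σ in a..b, Real.exp (c * σ) ≤ Real.exp (c * b) / c := by
  rw [intervalIntegral.integral_comp_mul_left (fun x => Real.exp x) hc.ne', integral_exp,
    smul_eq_mul, inv_mul_eq_div]
  gcongr
  linarith [Real.exp_pos (c * a)]

/-! ### Transport in a pipe -/

/-- A pipe `[0,Λ]` run through at unit speed, with source `m(p) w(r(p))` at the position `p` and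
inflow `∫ k w`. -/
structure Pipe where
  Λ : ℝ
  m : ℝ → ℝ
  r : ℝ → ℝ
  k : ℝ → ℝ
  M : ℝ
  N : ℝ
  Λ_nonneg : 0 ≤ Λ
  m_meas : Measurable m
  r_meas : Measurable r
  k_meas : Measurable k
  m_le : ∀ p, |m p| ≤ M
  k_le : ∀ p, |k p| ≤ N
  r_mem : ∀ p, r p ∈ Icc 0 Λ

/-- A measurable, locally bounded solution `W p t` along the characteristics of the pipe. The inflow
condition is imposed for `t > 0` only, so that it need not be compatible with the initial
state. -/
structure Pipe.IsSolution (Q : Pipe) (W : ℝ → ℝ → ℝ) : Prop where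
  meas : Measurable (Function.uncurry W)
  bdd : ∀ T, ∃ B, ∀ p ∈ Icc 0 Q.Λ, ∀ t ∈ Icc 0 T, |W p t| ≤ B
  transport : ∀ p t δ, 0 ≤ δ → 0 ≤ p → p + δ ≤ Q.Λ → 0 ≤ t →
    W (p + δ) (t + δ) - W p t = ∫ σ in (0 : ℝ)..δ, Q.m (p + σ) * W (Q.r (p + σ)) (t + σ)
  inflow : ∀ t, 0 < t → W 0 t = ∫ p in (0 : ℝ)..Q.Λ, Q.k p * W p t

namespace Pipe

variable (Q : Pipe)

lemma M_nonneg : 0 ≤ Q.M := (abs_nonneg _).trans (Q.m_le 0)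

lemma N_nonneg : 0 ≤ Q.N := (abs_nonneg _).trans (Q.k_le 0)

/-- The right-hand side of the fixed point equation of the pipe: the value carried along the
characteristic from the initial time or from the inflow, plus the source picked up. -/
noncomputable def rhs (w : ℝ → ℝ) (f : ℝ × ℝ → ℝ) (z : ℝ × ℝ) : ℝ :=
  (if z.2 ≤ z.1 then w (z.1 - z.2) else ∫ p in (0 : ℝ)..Q.Λ, Q.k p * f (p, z.2 - z.1)) +
    ∫ σ in max 0 (z.2 - z.1)..z.2, Q.m (z.1 - z.2 + σ) * f (Q.r (z.1 - z.2 + σ), σ)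

lemma measurable_rhs {w : ℝ → ℝ} {f : ℝ × ℝ → ℝ} (hw : Measurable w) (hf : Measurable f) :
    Measurable (Q.rhs w f) := by
  have h1 : Measurable fun z : ℝ × ℝ => ∫ p in (0 : ℝ)..Q.Λ, Q.k p * f (p, z.2 - z.1) := by
    refine measurable_intervalIntegral ?_ measurable_const measurable_const
    have := Q.k_meas
    simp only [Function.uncurry_def]
    fun_prop
  have h2 : Measurable fun z : ℝ × ℝ => ∫ σ in max 0 (z.2 - z.1)..z.2,
      Q.m (z.1 - z.2 + σ) * f (Q.r (z.1 - z.2 + σ), σ) := by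
    refine measurable_intervalIntegral ?_ (by fun_prop) measurable_snd
    have := Q.m_meas
    have := Q.r_meas
    simp only [Function.uncurry_def]
    fun_prop
  exact (Measurable.ite (measurableSet_le measurable_snd measurable_fst) (by fun_prop) h1).add h2

/-- Every bounded measurable initial state of the pipe is the start of a solution. -/
theorem exists_isSolution {w : ℝ → ℝ} {B : ℝ} (hw : Measurable w) (hB : ∀ p, |w p| ≤ B) :
    ∃ W, Q.IsSolution W ∧ ∀ p ∈ Icc 0 Q.Λ, W p 0 = w p := by
  have hM := Q.M_nonneg
  have hN := Q.N_nonneg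
  have hΛ := Q.Λ_nonneg
  have hB0 : 0 ≤ B := (abs_nonneg _).trans (hB 0)
  -- The weight decays in `p` fast enough to make the inflow operator small, and then grows in `t`
  -- fast enough to make the source operator small.
  set μ : ℝ := 4 * Q.N + 1 with hμ
  have hμ0 : 0 < μ := by positivity
  set κ : ℝ := μ + 4 * Q.M * Real.exp (μ * Q.Λ) with hκ
  have hκμ : μ ≤ κ := by
    have : 0 ≤ 4 * Q.M * Real.exp (μ * Q.Λ) := by positivity
    linarith
  have hκ0 : 0 < κ := hμ0.trans_le hκμ
  set ρ : ℝ × ℝ → ℝ := fun z => Real.exp (κ * z.2 - μ * z.1) with hρ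
  have hρ0 : ∀ z, 0 < ρ z := fun z => Real.exp_pos _
  set D : Set (ℝ × ℝ) := {z | z.1 ∈ Icc 0 Q.Λ ∧ 0 ≤ z.2} with hD
  have hDm : MeasurableSet D :=
    (measurable_fst measurableSet_Icc).inter (measurableSet_le measurable_const measurable_snd)
  set A : Set (ℝ × ℝ → ℝ) := {f | Measurable f ∧ ∃ C, ∀ z, |f z| ≤ C * ρ z} with hA
  set Φ : (ℝ × ℝ → ℝ) → ℝ × ℝ → ℝ := fun f => D.indicator (Q.rhs w f) with hΦ
  have hint1 : ∀ f ∈ A, ∀ s, IntervalIntegrable (fun p => Q.k p * f (p, s)) volume 0 Q.Λ := by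
    rintro f ⟨hfm, C, hC⟩ s
    have hC0 : 0 ≤ C := nonneg_of_mul_nonneg_left ((abs_nonneg _).trans (hC (0, 0))) (hρ0 _)
    refine intervalIntegrable_of_bounded (M := Q.N * (C * Real.exp (κ * s))) hΛ
      (Q.k_meas.mul (hfm.comp (by fun_prop))) fun p hp => ?_
    rw [abs_mul]
    refine mul_le_mul (Q.k_le p) ((hC _).trans ?_) (abs_nonneg _) hN
    simp only [hρ]
    gcongr
    nlinarith [hp.1]
  have hint2 : ∀ f ∈ A, ∀ c s t, s ≤ t → IntervalIntegrable
      (fun σ => Q.m (c + σ) * f (Q.r (c + σ), σ)) volume s t := by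
    rintro f ⟨hfm, C, hC⟩ c s t hst
    have hC0 : 0 ≤ C := nonneg_of_mul_nonneg_left ((abs_nonneg _).trans (hC (0, 0))) (hρ0 _)
    have := Q.m_meas
    have := Q.r_meas
    refine intervalIntegrable_of_bounded (M := Q.M * (C * Real.exp (κ * t))) hst
      (by fun_prop) fun σ hσ => ?_
    rw [abs_mul]
    refine mul_le_mul (Q.m_le _) ((hC _).trans ?_) (abs_nonneg _) hM
    simp only [hρ]
    gcongr
    nlinarith [(Q.r_mem (c + σ)).1, hσ.2]
  have h0A : (0 : ℝ × ℝ → ℝ) ∈ A := ⟨measurable_zero, 0, fun z => by simp⟩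
  have hcontr : ∀ f ∈ A, ∀ g ∈ A, ∀ C, 0 ≤ C → (∀ z, |f z - g z| ≤ C * ρ z) →
      ∀ z, |Φ f z - Φ g z| ≤ C / 2 * ρ z := by
    intro f hf g hg C hC0 hC z
    by_cases hz : z ∈ D
    swap
    · simp only [hΦ, indicator_of_notMem hz, sub_self, abs_zero]
      have := hρ0 z
      positivity
    obtain ⟨p, t⟩ := z
    obtain ⟨⟨hp0, hpΛ⟩, ht0⟩ := hz
    simp only at hp0 hpΛ ht0
    simp only [hΦ, indicator_of_mem (show (p, t) ∈ D from ⟨⟨hp0, hpΛ⟩, ht0⟩), rhs]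
    have hI : |(if t ≤ p then w (p - t) else ∫ p' in (0 : ℝ)..Q.Λ, Q.k p' * f (p', t - p)) -
        (if t ≤ p then w (p - t) else ∫ p' in (0 : ℝ)..Q.Λ, Q.k p' * g (p', t - p))| ≤
        C / 4 * ρ (p, t) := by
      split_ifs with h
      · rw [sub_self, abs_zero]
        have := hρ0 (p, t)
        positivity
      rw [← intervalIntegral.integral_sub (hint1 f hf _) (hint1 g hg _)]
      have hb : ∀ p' ∈ Ioc 0 Q.Λ, ‖Q.k p' * f (p', t - p) - Q.k p' * g (p', t - p)‖ ≤
          Q.N * C * Real.exp (κ * (t - p)) * Real.exp (-μ * p') := by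
        intro p' _
        rw [← mul_sub, Real.norm_eq_abs, abs_mul, mul_assoc, mul_assoc]
        refine mul_le_mul (Q.k_le _) ((hC _).trans (le_of_eq ?_)) (abs_nonneg _) hN
        simp only [hρ]
        rw [← Real.exp_add]
        ring_nf
      have h1 := intervalIntegral.norm_integral_le_of_norm_le (μ := volume) hΛ
        (Filter.Eventually.of_forall hb)
        (Continuous.intervalIntegrable (by fun_prop) _ _)
      rw [intervalIntegral.integral_const_mul] at h1
      have h2 : ∫ p' in (0 : ℝ)..Q.Λ, Real.exp (-μ * p') ≤ 1 / μ := by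
        rw [intervalIntegral.integral_comp_mul_left (fun x => Real.exp x) (by linarith),
          integral_exp, smul_eq_mul, inv_neg, mul_zero, Real.exp_zero, neg_mul, ← mul_neg,
          neg_sub, one_div]
        refine mul_le_of_le_one_right (by positivity) ?_
        linarith [Real.exp_pos (-μ * Q.Λ)]
      have h3 : Q.N * (1 / μ) ≤ 1 / 4 := by
        rw [mul_one_div, div_le_iff₀ hμ0]
        linarith
      have h4 : Real.exp (κ * (t - p)) ≤ ρ (p, t) := by
        simp only [hρ]
        gcongr
        nlinarith
      calc _ ≤ Q.N * C * Real.exp (κ * (t - p)) * ∫ p' in (0 : ℝ)..Q.Λ, Real.exp (-μ * p') := h1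
        _ ≤ Q.N * C * Real.exp (κ * (t - p)) * (1 / μ) := by gcongr
        _ = C * (Q.N * (1 / μ)) * Real.exp (κ * (t - p)) := by ring
        _ ≤ C * (1 / 4) * ρ (p, t) := by gcongr
        _ = C / 4 * ρ (p, t) := by ring
    have hst : max 0 (t - p) ≤ t := max_le ht0 (by linarith)
    have hJ : |(∫ σ in max 0 (t - p)..t, Q.m (p - t + σ) * f (Q.r (p - t + σ), σ)) -
        ∫ σ in max 0 (t - p)..t, Q.m (p - t + σ) * g (Q.r (p - t + σ), σ)| ≤
        C / 4 * ρ (p, t) := by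
      rw [← intervalIntegral.integral_sub (hint2 f hf _ _ _ hst) (hint2 g hg _ _ _ hst)]
      have hb : ∀ σ ∈ Ioc (max 0 (t - p)) t, ‖Q.m (p - t + σ) * f (Q.r (p - t + σ), σ) -
          Q.m (p - t + σ) * g (Q.r (p - t + σ), σ)‖ ≤ Q.M * C * Real.exp (κ * σ) := by
        intro σ _
        rw [← mul_sub, Real.norm_eq_abs, abs_mul, mul_assoc]
        refine mul_le_mul (Q.m_le _) ((hC _).trans ?_) (abs_nonneg _) hM
        simp only [hρ]
        gcongr
        nlinarith [(Q.r_mem (p - t + σ)).1]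
      have h1 := intervalIntegral.norm_integral_le_of_norm_le (μ := volume) hst
        (Filter.Eventually.of_forall hb)
        (Continuous.intervalIntegrable (by fun_prop) _ _)
      rw [intervalIntegral.integral_const_mul] at h1
      have h3 : Q.M * Real.exp (μ * Q.Λ) / κ ≤ 1 / 4 := by
        rw [div_le_iff₀ hκ0]
        linarith
      have h4 : Real.exp (κ * t) ≤ Real.exp (μ * Q.Λ) * ρ (p, t) := by
        simp only [hρ]
        rw [← Real.exp_add]
        gcongr
        nlinarith
      calc _ ≤ Q.M * C * ∫ σ in max 0 (t - p)..t, Real.exp (κ * σ) := h1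
        _ ≤ Q.M * C * (Real.exp (κ * t) / κ) := by
          gcongr
          exact integral_exp_mul_le hκ0
        _ ≤ Q.M * C * (Real.exp (μ * Q.Λ) * ρ (p, t) / κ) := by gcongr
        _ = C * (Q.M * Real.exp (μ * Q.Λ) / κ) * ρ (p, t) := by ring
        _ ≤ C * (1 / 4) * ρ (p, t) := by
          have := (hρ0 (p, t)).le
          gcongr
        _ = C / 4 * ρ (p, t) := by ring
    refine (le_of_eq (congrArg _ (add_sub_add_comm _ _ _ _))).trans
      ((abs_add_le _ _).trans ((add_le_add hI hJ).trans (le_of_eq ?_)))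
    ring
  have hΦ0 : ∀ z, |Φ 0 z - (0 : ℝ × ℝ → ℝ) z| ≤ B * Real.exp (μ * Q.Λ) * ρ z := by
    intro z
    simp only [Pi.zero_apply, sub_zero, hΦ]
    by_cases hz : z ∈ D
    swap
    · simp only [indicator_of_notMem hz, abs_zero]
      have := hρ0 z
      positivity
    have h1 : 1 ≤ Real.exp (μ * Q.Λ) * ρ z := by
      simp only [hρ]
      rw [← Real.exp_add]
      refine Real.one_le_exp ?_
      nlinarith [hz.1.2, hz.2]
    have h2 : |Q.rhs w 0 z| ≤ B := by
      simp only [rhs, Pi.zero_apply, mul_zero, intervalIntegral.integral_zero, add_zero]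
      split_ifs
      · exact hB _
      · simpa using hB0
    rw [indicator_of_mem hz, mul_assoc]
    nlinarith
  obtain ⟨f, ⟨hfm, C, hC⟩, hfix⟩ : ∃ f ∈ A, Φ f = f := by
    refine exists_fixedPoint (A := A) (Φ := Φ) (f₀ := 0) (ρ := ρ)
      (C₀ := B * Real.exp (μ * Q.Λ)) (by positivity) ?_ h0A hΦ0 hcontr ?_
    · rintro f ⟨hfm, C, hC⟩
      refine ⟨(Q.measurable_rhs hw hfm).indicator hDm, C / 2 + B * Real.exp (μ * Q.Λ), fun z => ?_⟩
      have hC0 : 0 ≤ C := nonneg_of_mul_nonneg_left ((abs_nonneg _).trans (hC (0, 0))) (hρ0 _)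
      have h1 := hcontr f ⟨hfm, C, hC⟩ 0 h0A C hC0 (fun z => by simpa using hC z) z
      have h2 := hΦ0 z
      simp only [Pi.zero_apply, sub_zero] at h2
      rw [add_mul]
      calc |Φ f z| = |(Φ f z - Φ 0 z) + Φ 0 z| := by rw [sub_add_cancel]
        _ ≤ _ := (abs_add_le _ _).trans (add_le_add h1 h2)
    · intro u f K hu hf
      refine ⟨measurable_of_tendsto_metrizable (f := u) (fun n => (hu n).1)
        (tendsto_pi_nhds.2 fun z => ?_), ?_⟩
      · rw [tendsto_iff_dist_tendsto_zero]
        refine squeeze_zero (g := fun n : ℕ => K * ρ z * (1 / 2) ^ n) (fun _ => dist_nonneg)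
          (fun n => ?_) ?_
        · rw [dist_comm, Real.dist_eq]
          exact (hf n z).trans (le_of_eq (by ring))
        · simpa using (tendsto_pow_atTop_nhds_zero_of_lt_one (by norm_num : (0 : ℝ) ≤ 1 / 2)
            (by norm_num)).const_mul (K * ρ z)
      · obtain ⟨C, hC⟩ := (hu 0).2
        refine ⟨K + C, fun z => ?_⟩
        have h1 := hf 0 z
        simp only [pow_zero, mul_one] at h1
        rw [add_mul]
        calc |f z| = |(f z - u 0 z) + u 0 z| := by rw [sub_add_cancel]
          _ ≤ _ := (abs_add_le _ _).trans (add_le_add h1 (hC z))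
  have hfix' : ∀ p t, p ∈ Icc 0 Q.Λ → 0 ≤ t → f (p, t) = Q.rhs w f (p, t) := by
    intro p t hp ht
    have := congrFun hfix (p, t)
    rw [← this]
    exact indicator_of_mem (show (p, t) ∈ D from ⟨hp, ht⟩) _
  refine ⟨fun p t => f (p, t), ⟨hfm, fun T => ⟨C * Real.exp (κ * T), fun p hp t ht => ?_⟩,
    ?_, ?_⟩, ?_⟩
  · have hC0 : 0 ≤ C := nonneg_of_mul_nonneg_left ((abs_nonneg _).trans (hC (0, 0))) (hρ0 _)
    refine (hC _).trans ?_
    simp only [hρ]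
    gcongr
    nlinarith [hp.1, ht.2]
  · intro p t δ hδ hp hpδ ht
    rw [hfix' p t ⟨hp, by linarith⟩ ht, hfix' (p + δ) (t + δ) ⟨by linarith, hpδ⟩ (by linarith)]
    simp only [rhs, add_sub_add_right_eq_sub, add_le_add_iff_right, add_sub_add_left_eq_sub]
    have hst : max 0 (t - p) ≤ t := max_le ht (by linarith)
    rw [← intervalIntegral.integral_add_adjacent_intervals (b := t) (c := t + δ)
      (hint2 f ⟨hfm, C, hC⟩ _ _ _ hst) (hint2 f ⟨hfm, C, hC⟩ _ _ _ (by linarith))]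
    have h9 := intervalIntegral.integral_comp_add_left (a := 0) (b := δ)
      (fun σ => Q.m (p - t + σ) * f (Q.r (p - t + σ), σ)) t
    rw [add_zero] at h9
    rw [← h9]
    have : ∀ σ, p - t + (t + σ) = p + σ := fun σ => by ring
    simp only [this]
    ring
  · intro t ht
    have h1 := hfix' 0 t ⟨le_rfl, hΛ⟩ ht.le
    rw [h1]
    simp only [rhs, sub_zero, max_eq_right ht.le, intervalIntegral.integral_same, add_zero,
      if_neg (not_le.2 ht)]
  · intro p hp
    refine (hfix' p 0 hp le_rfl).trans ?_
    simp only [rhs, if_pos hp.1, sub_zero, zero_sub]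
    rw [max_eq_left (by linarith [hp.1]), intervalIntegral.integral_same, add_zero]

end Pipe

end DelayedHyperbolic

namespace DelayedHyperbolic

/-! ### Existence of the kernels -/

/-- The retraction of the plane onto the triangle. -/
def toTriangle (z : ℝ × ℝ) : ℝ × ℝ := (clamp z.1, min (clamp z.2) (clamp z.1))

@[fun_prop] lemma continuous_toTriangle : Continuous toTriangle := by unfold toTriangle; fun_prop

lemma toTriangle_mem (z : ℝ × ℝ) : toTriangle z ∈ triangle :=
  ⟨le_min (clamp_mem _).1 (clamp_mem _).1, min_le_right _ _, (clamp_mem _).2⟩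

lemma toTriangle_of_mem {z : ℝ × ℝ} (hz : z ∈ triangle) : toTriangle z = z := by
  obtain ⟨h1, h2, h3⟩ := hz
  ext
  · exact clamp_of_mem ⟨h1.trans h2, h3⟩
  · simp only [toTriangle, clamp_of_mem (show z.1 ∈ Icc (0 : ℝ) 1 from ⟨h1.trans h2, h3⟩),
      clamp_of_mem (show z.2 ∈ Icc (0 : ℝ) 1 from ⟨h1, h2.trans h3⟩), min_eq_left h2]

lemma continuous_comp_toTriangle {f : ℝ × ℝ → ℝ} (hf : ContinuousOn f triangle) :
    Continuous fun z => f (toTriangle z) :=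
  hf.comp_continuous continuous_toTriangle toTriangle_mem

namespace Plant

variable (P : Plant)

/-- The velocity whose travel time is the sum of the travel times of `u₁` and `u₂`. -/
noncomputable def s₀ : Speed where
  e x := P.s₁.e x * P.s₂.e x / (P.s₁.e x + P.s₂.e x)
  cont := (P.s₁.cont.mul P.s₂.cont).div (P.s₁.cont.add P.s₂.cont)
    fun x => (add_pos (P.s₁.pos x) (P.s₂.pos x)).ne'
  pos x := div_pos (mul_pos (P.s₁.pos x) (P.s₂.pos x)) (add_pos (P.s₁.pos x) (P.s₂.pos x))
  bdd := by
    obtain ⟨M, hM⟩ := P.s₁.bdd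
    refine ⟨M, fun x => ?_⟩
    have h1 := P.s₁.pos x
    have h2 := P.s₂.pos x
    rw [div_le_iff₀ (by linarith)]
    nlinarith [hM x]

lemma one_div_s₀ (x : ℝ) : 1 / P.s₀.e x = 1 / P.s₁.e x + 1 / P.s₂.e x := by
  have h1 := (P.s₁.pos x).ne'
  have h2 := (P.s₂.pos x).ne'
  simp only [s₀]
  field_simp
  ring

lemma s₀_phase (x : ℝ) : P.s₀.phase x = P.s₁.phase x + P.s₂.phase x := by
  simp only [Speed.phase_apply, one_div_s₀]
  exact intervalIntegral.integral_add (P.s₁.continuous_inv.intervalIntegrable _ _)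
    (P.s₂.continuous_inv.intervalIntegrable _ _)

/-- The coupling coefficient `ε₁ c₂ / ε₂` of the kernel equations for `εᵢ kᵢ`. -/
noncomputable def h₁ (y : ℝ) : ℝ := P.s₁.e y * P.k₂ y / P.s₂.e y

/-- The coupling coefficient `ε₂ c₁ / ε₁` of the kernel equations for `εᵢ kᵢ`. -/
noncomputable def h₂ (y : ℝ) : ℝ := P.s₂.e y * P.k₁ y / P.s₁.e y

@[fun_prop] lemma continuous_h₁ : Continuous P.h₁ :=
  (P.continuous_s₁.mul P.continuous_k₂).div P.continuous_s₂ fun x => (P.s₂.pos x).ne'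

@[fun_prop] lemma continuous_h₂ : Continuous P.h₂ :=
  (P.continuous_s₂.mul P.continuous_k₁).div P.continuous_s₁ fun x => (P.s₁.pos x).ne'

lemma clamp_clamp (x : ℝ) : clamp (clamp x) = clamp x := clamp_of_mem (clamp_mem x)

lemma exists_bound_h : ∃ M, 0 ≤ M ∧ ∀ x, |P.h₁ x| ≤ M ∧ |P.h₂ x| ≤ M := by
  obtain ⟨M₁, hM₁, h1⟩ := exists_bound_comp_clamp P.continuous_h₁.continuousOn
  obtain ⟨M₂, hM₂, h2⟩ := exists_bound_comp_clamp P.continuous_h₂.continuousOn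
  have e1 : ∀ x, P.h₁ (clamp x) = P.h₁ x := fun x => by
    simp [h₁, s₁, s₂, k₂, Speed.ofIcc, clamp_clamp]
  have e2 : ∀ x, P.h₂ (clamp x) = P.h₂ x := fun x => by
    simp [h₂, s₁, s₂, k₁, Speed.ofIcc, clamp_clamp]
  simp only [e1] at h1
  simp only [e2] at h2
  exact ⟨max M₁ M₂, le_max_of_le_left hM₁, fun x =>
    ⟨(h1 x).trans (le_max_left _ _), (h2 x).trans (le_max_right _ _)⟩⟩

/-- The value `-ε₁ c₂ / (ε₁ + ε₂)` of `ε₁ K²¹` on the diagonal. -/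
noncomputable def diagonal (x : ℝ) : ℝ := P.s₁.e x * (-P.k₂ x / (P.s₁.e x + P.s₂.e x))

@[fun_prop] lemma continuous_diagonal : Continuous P.diagonal :=
  P.continuous_s₁.mul (P.continuous_k₂.neg.div (P.continuous_s₁.add P.continuous_s₂)
    fun x => (add_pos (P.s₁.pos x) (P.s₂.pos x)).ne')

/-- The integrated equation for `ε₁ K²¹`, along the characteristic that enters the triangle at the
diagonal. The functions `ε₁ K²¹`, `ε₂ K²²` are `f (false, ·)`, `f (true, ·)`. -/
noncomputable def rhs₁ (f : Bool × ℝ × ℝ → ℝ) (z : ℝ × ℝ) : ℝ :=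
  P.diagonal (P.s₀.phase.symm (P.s₂.phase z.1 + P.s₁.phase z.2)) +
    ∫ s in P.s₂.phase (P.s₀.phase.symm (P.s₂.phase z.1 + P.s₁.phase z.2))..P.s₂.phase z.1,
      P.h₁ (P.s₁.phase.symm (P.s₂.phase z.1 + P.s₁.phase z.2 - s)) *
        f (true, P.s₂.phase.symm s, P.s₁.phase.symm (P.s₂.phase z.1 + P.s₁.phase z.2 - s))

/-- The integrated equation for `ε₂ K²²`, along the characteristic that enters the triangle at
`y = 0`. -/
noncomputable def rhs₂ (f : Bool × ℝ × ℝ → ℝ) (z : ℝ × ℝ) : ℝ :=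
  P.q * f (false, P.s₂.phase.symm (P.s₂.phase z.1 - P.s₂.phase z.2), 0) +
    ∫ s in (P.s₂.phase z.1 - P.s₂.phase z.2)..P.s₂.phase z.1,
      P.h₂ (P.s₂.phase.symm (s - (P.s₂.phase z.1 - P.s₂.phase z.2))) *
        f (false, P.s₂.phase.symm s, P.s₂.phase.symm (s - (P.s₂.phase z.1 - P.s₂.phase z.2)))

lemma continuous_variable_intervalIntegral {α : Type*} [TopologicalSpace α] {f : α → ℝ → ℝ}
    {a b : α → ℝ} (hf : Continuous (Function.uncurry f)) (ha : Continuous a)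
    (hb : Continuous b) : Continuous fun x => ∫ σ in a x..b x, f x σ := by
  have hi : ∀ x s t, IntervalIntegrable (f x) volume s t := fun x s t =>
    (hf.comp (Continuous.prodMk_right x)).intervalIntegrable _ _
  have : (fun x => ∫ σ in a x..b x, f x σ) =
      fun x => (∫ σ in (0 : ℝ)..b x, f x σ) - ∫ σ in (0 : ℝ)..a x, f x σ := by
    ext x
    rw [intervalIntegral.integral_interval_sub_left (hi _ _ _) (hi _ _ _)]
  rw [this]
  exact (intervalIntegral.continuous_parametric_intervalIntegral_of_continuous hf hb).sub
    (intervalIntegral.continuous_parametric_intervalIntegral_of_continuous hf ha)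

lemma continuous_rhs₁ {f : Bool × ℝ × ℝ → ℝ} (hf : Continuous f) : Continuous (P.rhs₁ f) := by
  unfold rhs₁
  refine Continuous.add (by fun_prop) (continuous_variable_intervalIntegral ?_ (by fun_prop)
    (by fun_prop))
  simp only [Function.uncurry_def]
  fun_prop

lemma continuous_rhs₂ {f : Bool × ℝ × ℝ → ℝ} (hf : Continuous f) : Continuous (P.rhs₂ f) := by
  unfold rhs₂
  refine Continuous.add (by fun_prop) (continuous_variable_intervalIntegral ?_ (by fun_prop)
    (by fun_prop))
  simp only [Function.uncurry_def]
  fun_prop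

/-- The characteristic of `K²¹` through a point of the triangle lies in the triangle, back to the
diagonal. -/
lemma characteristic₁_mem {z : ℝ × ℝ} (hz : z ∈ triangle) :
    P.s₂.phase (P.s₀.phase.symm (P.s₂.phase z.1 + P.s₁.phase z.2)) ≤ P.s₂.phase z.1 ∧
    ∀ s ∈ Icc (P.s₂.phase (P.s₀.phase.symm (P.s₂.phase z.1 + P.s₁.phase z.2))) (P.s₂.phase z.1),
      (P.s₂.phase.symm s, P.s₁.phase.symm (P.s₂.phase z.1 + P.s₁.phase z.2 - s)) ∈ triangle := by
  obtain ⟨h1, h2, h3⟩ := hz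
  set x₀ := P.s₀.phase.symm (P.s₂.phase z.1 + P.s₁.phase z.2) with hx₀
  have hsum : P.s₁.phase x₀ + P.s₂.phase x₀ = P.s₂.phase z.1 + P.s₁.phase z.2 := by
    rw [← P.s₀_phase, hx₀, OrderIso.apply_symm_apply]
  have hx₀z : x₀ ≤ z.1 := by
    by_contra! h
    have := P.s₂.phase.strictMono h
    have := P.s₁.phase.strictMono (h2.trans_lt h)
    linarith
  refine ⟨P.s₂.phase.monotone hx₀z, fun s hs => ⟨?_, ?_, ?_⟩⟩
  · rw [OrderIso.le_symm_apply, P.s₁.phase_zero]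
    linarith [hs.2, P.s₁.phase_nonneg h1]
  · calc P.s₁.phase.symm (P.s₂.phase z.1 + P.s₁.phase z.2 - s) ≤ x₀ := by
          rw [OrderIso.symm_apply_le]; linarith [hs.1]
      _ ≤ P.s₂.phase.symm s := by rw [OrderIso.le_symm_apply]; exact hs.1
  · rw [OrderIso.symm_apply_le]
    exact hs.2.trans (P.s₂.phase.monotone h3)

/-- The characteristic of `K²²` through a point of the triangle lies in the triangle, back to
`y = 0`. -/
lemma characteristic₂_mem {z : ℝ × ℝ} (hz : z ∈ triangle) :
    P.s₂.phase z.1 - P.s₂.phase z.2 ≤ P.s₂.phase z.1 ∧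
    ∀ s ∈ Icc (P.s₂.phase z.1 - P.s₂.phase z.2) (P.s₂.phase z.1),
      (P.s₂.phase.symm s, P.s₂.phase.symm (s - (P.s₂.phase z.1 - P.s₂.phase z.2))) ∈
        triangle := by
  obtain ⟨h1, h2, h3⟩ := hz
  have h4 := P.s₂.phase_nonneg h1
  have h5 := P.s₂.phase.monotone h2
  refine ⟨by linarith, fun s hs => ⟨?_, ?_, ?_⟩⟩
  · rw [OrderIso.le_symm_apply, P.s₂.phase_zero]
    linarith [hs.1]
  · exact P.s₂.phase.symm.monotone (by linarith)
  · rw [OrderIso.symm_apply_le]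
    exact hs.2.trans (P.s₂.phase.monotone h3)

/-- The integrated kernel equations on the triangle have a continuous solution. -/
lemma exists_kernel_fixedPoint : ∃ f : Bool × ℝ × ℝ → ℝ, Continuous f ∧
    ∀ z ∈ triangle, f (false, z) = P.rhs₁ f z ∧ f (true, z) = P.rhs₂ f z := by
  obtain ⟨M, hM0, hM⟩ := P.exists_bound_h
  obtain ⟨B, hB0, hB⟩ := exists_bound_comp_clamp P.continuous_diagonal.continuousOn
  have hdiag : ∀ x, |P.diagonal x| ≤ B := fun x => by
    have e : P.diagonal (clamp x) = P.diagonal x := by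
      simp [diagonal, s₁, s₂, k₂, Speed.ofIcc, clamp_clamp]
    rw [← e]; exact hB x
  have hq := P.q_pos
  -- The weight of the second component absorbs the reflection at `y = 0`; its growth in `x` makes
  -- the integrals small.
  set β : ℝ := 4 * P.q + 1 with hβ
  have hβ1 : 1 ≤ β := by linarith
  set κ : ℝ := 4 * M * β + 1 with hκ
  have hκ0 : 0 < κ := by positivity
  set bw : Bool → ℝ := fun b => bif b then β else 1 with hbw
  have hbw1 : ∀ b, 1 ≤ bw b := fun b => by cases b <;> simp [hbw, hβ1]
  set ρ : Bool × ℝ × ℝ → ℝ := fun w => bw w.1 * Real.exp (κ * P.s₂.phase (toTriangle w.2).1)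
    with hρ
  have hph : ∀ z, 0 ≤ P.s₂.phase (toTriangle z).1 ∧
      P.s₂.phase (toTriangle z).1 ≤ P.s₂.phase 1 := fun z =>
    ⟨P.s₂.phase_nonneg (clamp_mem _).1, P.s₂.phase.monotone (clamp_mem _).2⟩
  have hρ1 : ∀ w, 1 ≤ ρ w := fun w =>
    one_le_mul_of_one_le_of_one_le (hbw1 _)
      (Real.one_le_exp (mul_nonneg hκ0.le (hph w.2).1))
  have hρ2 : ∀ w, ρ w ≤ β * Real.exp (κ * P.s₂.phase 1) := fun w => by
    simp only [hρ]
    have h1 : bw w.1 ≤ β := by cases w.1 <;> simp [hbw, hβ1]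
    have := (hph w.2).2
    gcongr
  have hρt : ∀ b z, z ∈ triangle → ρ (b, z) = bw b * Real.exp (κ * P.s₂.phase z.1) :=
    fun b z hz => by simp only [hρ, toTriangle_of_mem hz]
  set A : Set (Bool × ℝ × ℝ → ℝ) := {f | Continuous f} with hA
  set Φ : (Bool × ℝ × ℝ → ℝ) → Bool × ℝ × ℝ → ℝ := fun f w =>
    bif w.1 then P.rhs₂ f (toTriangle w.2) else P.rhs₁ f (toTriangle w.2) with hΦ
  obtain ⟨f, hf, hfix⟩ : ∃ f ∈ A, Φ f = f := by
    refine exists_fixedPoint (A := A) (Φ := Φ) (f₀ := 0) (ρ := ρ) (C₀ := B) hB0 ?_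
      continuous_zero ?_ ?_ ?_
    · intro f hf
      refine continuous_prod_of_discrete_left.2 fun b => ?_
      cases b
      · exact (P.continuous_rhs₁ hf).comp continuous_toTriangle
      · exact (P.continuous_rhs₂ hf).comp continuous_toTriangle
    · rintro ⟨b, z⟩
      have h1 := hρ1 (b, z)
      cases b
      · simp only [hΦ, cond_false, rhs₁, Pi.zero_apply, mul_zero, intervalIntegral.integral_zero,
          add_zero, sub_zero]
        nlinarith [hdiag (P.s₀.phase.symm
          (P.s₂.phase (toTriangle z).1 + P.s₁.phase (toTriangle z).2))]
      · simp only [hΦ, cond_true, rhs₂, Pi.zero_apply, mul_zero, intervalIntegral.integral_zero,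
          add_zero, sub_zero, abs_zero]
        positivity
    · rintro f hf g hg C hC0 hC ⟨b, z⟩
      have hf' : Continuous f := hf
      have hg' : Continuous g := hg
      have hzt := toTriangle_mem z
      rw [show ρ (b, z) = bw b * Real.exp (κ * P.s₂.phase (toTriangle z).1) from rfl]
      simp only [hΦ]
      generalize toTriangle z = z at hzt
      -- The gain `1/κ` comes from integrating the exponential weight.
      have hint : ∀ (h f₁ g₁ : ℝ → ℝ) (γ s t : ℝ), Continuous h → Continuous f₁ → Continuous g₁ →
          0 ≤ γ → s ≤ t → (∀ x, |h x| ≤ M) →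
          (∀ σ ∈ Icc s t, |f₁ σ - g₁ σ| ≤ C * (γ * Real.exp (κ * σ))) →
          |(∫ σ in s..t, h σ * f₁ σ) - ∫ σ in s..t, h σ * g₁ σ| ≤
            M * γ / κ * C * Real.exp (κ * t) := by
        intro h f₁ g₁ γ s t hh hf₁ hg₁ hγ hst hhM hfg
        rw [← intervalIntegral.integral_sub
          (show IntervalIntegrable (fun σ => h σ * f₁ σ) volume s t from
            (hh.mul hf₁).intervalIntegrable _ _)
          (show IntervalIntegrable (fun σ => h σ * g₁ σ) volume s t from
            (hh.mul hg₁).intervalIntegrable _ _)]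
        have h1 := intervalIntegral.norm_integral_le_of_norm_le (μ := volume)
          (f := fun σ => h σ * f₁ σ - h σ * g₁ σ)
          (g := fun σ => M * C * γ * Real.exp (κ * σ)) hst
          (Filter.Eventually.of_forall fun σ hσ => by
            rw [← mul_sub, Real.norm_eq_abs, abs_mul]
            calc _ ≤ M * (C * (γ * Real.exp (κ * σ))) :=
                  mul_le_mul (hhM σ) (hfg σ ⟨hσ.1.le, hσ.2⟩) (abs_nonneg _) hM0
              _ = _ := by ring)
          (Continuous.intervalIntegrable (by fun_prop) _ _)
        rw [intervalIntegral.integral_const_mul] at h1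
        calc _ ≤ M * C * γ * ∫ σ in s..t, Real.exp (κ * σ) := h1
          _ ≤ M * C * γ * (Real.exp (κ * t) / κ) := by
            gcongr
            exact integral_exp_mul_le hκ0
          _ = _ := by ring
      cases b
      · obtain ⟨h1, h2⟩ := P.characteristic₁_mem hzt
        have h3 := hint
          (fun s => P.h₁ (P.s₁.phase.symm (P.s₂.phase z.1 + P.s₁.phase z.2 - s)))
          (fun s => f (true, P.s₂.phase.symm s,
            P.s₁.phase.symm (P.s₂.phase z.1 + P.s₁.phase z.2 - s)))
          (fun s => g (true, P.s₂.phase.symm s,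
            P.s₁.phase.symm (P.s₂.phase z.1 + P.s₁.phase z.2 - s)))
          β _ _ (by fun_prop) (by fun_prop) (by fun_prop) (by positivity) h1
          (fun x => (hM _).1) fun σ hσ => by
            have := hC (true, P.s₂.phase.symm σ,
              P.s₁.phase.symm (P.s₂.phase z.1 + P.s₁.phase z.2 - σ))
            rw [hρt _ _ (h2 σ hσ)] at this
            simpa [hbw] using this
        have h4 : M * β / κ ≤ 1 / 2 := by
          rw [div_le_iff₀ hκ0]
          nlinarith
        simp only [cond_false, rhs₁, add_sub_add_left_eq_sub, hbw, one_mul]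
        refine h3.trans ?_
        calc _ ≤ 1 / 2 * C * Real.exp (κ * P.s₂.phase z.1) := by gcongr
          _ = _ := by ring
      · obtain ⟨h1, h2⟩ := P.characteristic₂_mem hzt
        have h3 := hint
          (fun s => P.h₂ (P.s₂.phase.symm (s - (P.s₂.phase z.1 - P.s₂.phase z.2))))
          (fun s => f (false, P.s₂.phase.symm s,
            P.s₂.phase.symm (s - (P.s₂.phase z.1 - P.s₂.phase z.2))))
          (fun s => g (false, P.s₂.phase.symm s,
            P.s₂.phase.symm (s - (P.s₂.phase z.1 - P.s₂.phase z.2))))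
          1 _ _ (by fun_prop) (by fun_prop) (by fun_prop) (by positivity) h1
          (fun x => (hM _).2) fun σ hσ => by
            have := hC (false, P.s₂.phase.symm σ,
              P.s₂.phase.symm (σ - (P.s₂.phase z.1 - P.s₂.phase z.2)))
            rw [hρt _ _ (h2 σ hσ)] at this
            simpa [hbw] using this
        have h4 : M * 1 / κ ≤ 1 / 4 := by
          rw [div_le_iff₀ hκ0]
          nlinarith
        have h5 : |P.q * f (false, P.s₂.phase.symm (P.s₂.phase z.1 - P.s₂.phase z.2), 0) -
            P.q * g (false, P.s₂.phase.symm (P.s₂.phase z.1 - P.s₂.phase z.2), 0)| ≤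
            P.q * (C * Real.exp (κ * P.s₂.phase z.1)) := by
          have h6 := h2 _ ⟨le_rfl, h1⟩
          rw [sub_self, P.s₂.phase_symm_zero] at h6
          have := hC (false, P.s₂.phase.symm (P.s₂.phase z.1 - P.s₂.phase z.2), 0)
          rw [hρt _ _ h6] at this
          rw [← mul_sub, abs_mul, abs_of_pos hq]
          gcongr
          refine this.trans ?_
          simp only [hbw, cond_false, one_mul, OrderIso.apply_symm_apply]
          gcongr
        simp only [cond_true, rhs₂, hbw]
        refine (le_of_eq (congrArg _ (add_sub_add_comm _ _ _ _))).trans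
          ((abs_add_le _ _).trans ((add_le_add h5 h3).trans ?_))
        calc _ ≤ P.q * (C * Real.exp (κ * P.s₂.phase z.1)) +
                1 / 4 * C * Real.exp (κ * P.s₂.phase z.1) := by gcongr
          _ = (P.q + 1 / 4) * (C * Real.exp (κ * P.s₂.phase z.1)) := by ring
          _ ≤ β / 2 * (C * Real.exp (κ * P.s₂.phase z.1)) := by
            gcongr
            linarith
          _ = _ := by ring
    · intro u f K hu hf
      have hlim : TendstoUniformly u f Filter.atTop := by
        rw [Metric.tendstoUniformly_iff]
        intro ε hε
        have h1 : Filter.Tendsto (fun n : ℕ => |K| * (β * Real.exp (κ * P.s₂.phase 1)) *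
            (1 / 2 : ℝ) ^ n) Filter.atTop (nhds 0) := by
          simpa using (tendsto_pow_atTop_nhds_zero_of_lt_one (by norm_num : (0 : ℝ) ≤ 1 / 2)
            (by norm_num)).const_mul (|K| * (β * Real.exp (κ * P.s₂.phase 1)))
        filter_upwards [h1.eventually_lt_const hε] with n hn w
        rw [Real.dist_eq]
        refine lt_of_le_of_lt ?_ hn
        have h2 := zero_le_one.trans (hρ1 w)
        calc |f w - u n w| ≤ K * (1 / 2) ^ n * ρ w := hf n w
          _ ≤ |K| * (1 / 2) ^ n * ρ w := by
            gcongr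
            exact le_abs_self K
          _ ≤ |K| * (1 / 2) ^ n * (β * Real.exp (κ * P.s₂.phase 1)) := by
            gcongr
            exact hρ2 w
          _ = _ := by ring
      exact hlim.continuous (Filter.Frequently.of_forall hu)
  refine ⟨f, hf, fun z hz => ⟨?_, ?_⟩⟩
  · have := congrFun hfix (false, z)
    simpa only [hΦ, cond_false, toTriangle_of_mem hz] using this.symm
  · have := congrFun hfix (true, z)
    simpa only [hΦ, cond_true, toTriangle_of_mem hz] using this.symm

end Plant

lemma triangle_fst_mem {z : ℝ × ℝ} (hz : z ∈ triangle) : z.1 ∈ Icc (0 : ℝ) 1 :=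
  ⟨hz.1.trans hz.2.1, hz.2.2⟩

lemma triangle_snd_mem {z : ℝ × ℝ} (hz : z ∈ triangle) : z.2 ∈ Icc (0 : ℝ) 1 :=
  ⟨hz.1, hz.2.1.trans hz.2.2⟩

/-- The delay-free backstepping kernel exists. -/
theorem exists_isBacksteppingKernel (P : Plant) : ∃ K21 K22, IsBacksteppingKernel P K21 K22 := by
  obtain ⟨f, hf, hfix⟩ := P.exists_kernel_fixedPoint
  have e1 : ∀ x, P.s₁.e x ≠ 0 := fun x => (P.s₁.pos x).ne'
  have e2 : ∀ x, P.s₂.e x ≠ 0 := fun x => (P.s₂.pos x).ne'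
  refine ⟨fun x y => f (false, x, y) / P.s₁.e y, fun x y => f (true, x, y) / P.s₂.e y,
    ⟨?_, ?_, ⟨?_, ?_⟩, ?_, ?_⟩⟩
  · exact ((hf.comp (by fun_prop)).div (P.continuous_s₁.comp continuous_snd)
      fun _ => e1 _).continuousOn
  · exact ((hf.comp (by fun_prop)).div (P.continuous_s₂.comp continuous_snd)
      fun _ => e2 _).continuousOn
  · rw [solvesAlongCharacteristics_iff P.s₂ P.s₁ (-1) (fun z hz => (P.s₂_e (triangle_fst_mem hz)).symm)
      (fun z hz => by rw [P.s₁_e (triangle_snd_mem hz), neg_one_mul])]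
    intro x y δ hδ hΩ
    have h0 : (x, y) ∈ triangle := by simpa using hΩ 0 ⟨le_rfl, hδ⟩
    have h1 := hΩ δ ⟨hδ, le_rfl⟩
    have hF : ∀ z ∈ triangle, P.ε₁ z.2 * (f (false, z.1, z.2) / P.s₁.e z.2) = P.rhs₁ f z := by
      intro z hz
      rw [← P.s₁_e (triangle_snd_mem hz), mul_div_cancel₀ _ (e1 _)]
      exact (hfix z hz).1
    rw [hF _ h1, hF _ h0]
    have hsum : P.s₂.phase x + δ + (P.s₁.phase y + -1 * δ) = P.s₂.phase x + P.s₁.phase y := by ring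
    simp only [Plant.rhs₁, Speed.phase_flow, hsum, add_sub_add_left_eq_sub]
    have hi : ∀ s t, IntervalIntegrable (fun s =>
        P.h₁ (P.s₁.phase.symm (P.s₂.phase x + P.s₁.phase y - s)) *
        f (true, P.s₂.phase.symm s, P.s₁.phase.symm (P.s₂.phase x + P.s₁.phase y - s)))
        volume s t := fun s t => Continuous.intervalIntegrable (by fun_prop) _ _
    rw [intervalIntegral.integral_interval_sub_left (hi _ _) (hi _ _)]
    have h9 := intervalIntegral.integral_comp_add_left (a := 0) (b := δ)
      (fun s => P.h₁ (P.s₁.phase.symm (P.s₂.phase x + P.s₁.phase y - s)) *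
        f (true, P.s₂.phase.symm s, P.s₁.phase.symm (P.s₂.phase x + P.s₁.phase y - s)))
      (P.s₂.phase x)
    rw [add_zero] at h9
    rw [← h9]
    refine intervalIntegral.integral_congr fun σ hσ => ?_
    rw [uIcc_of_le hδ] at hσ
    have h2 := triangle_snd_mem (hΩ σ hσ)
    have h3 : P.s₂.phase x + P.s₁.phase y - (P.s₂.phase x + σ) = P.s₁.phase y + -1 * σ := by ring
    simp only [h3, Plant.h₁, Speed.flow] at h2 ⊢
    rw [← P.s₁_e h2, ← P.k₂_eq h2]
    ring
  · rw [solvesAlongCharacteristics_iff P.s₂ P.s₂ 1 (fun z hz => (P.s₂_e (triangle_fst_mem hz)).symm)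
      (fun z hz => by rw [P.s₂_e (triangle_snd_mem hz), one_mul])]
    intro x y δ hδ hΩ
    have h0 : (x, y) ∈ triangle := by simpa using hΩ 0 ⟨le_rfl, hδ⟩
    have h1 := hΩ δ ⟨hδ, le_rfl⟩
    have hF : ∀ z ∈ triangle, P.ε₂ z.2 * (f (true, z.1, z.2) / P.s₂.e z.2) = P.rhs₂ f z := by
      intro z hz
      rw [← P.s₂_e (triangle_snd_mem hz), mul_div_cancel₀ _ (e2 _)]
      exact (hfix z hz).2
    rw [hF _ h1, hF _ h0]
    have hsum : P.s₂.phase x + δ - (P.s₂.phase y + 1 * δ) = P.s₂.phase x - P.s₂.phase y := by ring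
    simp only [Plant.rhs₂, Speed.phase_flow, hsum, add_sub_add_left_eq_sub]
    have hi : ∀ s t, IntervalIntegrable (fun s =>
        P.h₂ (P.s₂.phase.symm (s - (P.s₂.phase x - P.s₂.phase y))) *
        f (false, P.s₂.phase.symm s, P.s₂.phase.symm (s - (P.s₂.phase x - P.s₂.phase y))))
        volume s t := fun s t => Continuous.intervalIntegrable (by fun_prop) _ _
    rw [intervalIntegral.integral_interval_sub_left (hi _ _) (hi _ _)]
    have h9 := intervalIntegral.integral_comp_add_left (a := 0) (b := δ)
      (fun s => P.h₂ (P.s₂.phase.symm (s - (P.s₂.phase x - P.s₂.phase y))) *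
        f (false, P.s₂.phase.symm s, P.s₂.phase.symm (s - (P.s₂.phase x - P.s₂.phase y))))
      (P.s₂.phase x)
    rw [add_zero] at h9
    rw [← h9]
    refine intervalIntegral.integral_congr fun σ hσ => ?_
    rw [uIcc_of_le hδ] at hσ
    have h2 := triangle_snd_mem (hΩ σ hσ)
    have h3 : P.s₂.phase x + σ - (P.s₂.phase x - P.s₂.phase y) = P.s₂.phase y + 1 * σ := by ring
    simp only [h3, Plant.h₂, Speed.flow] at h2 ⊢
    rw [← P.s₂_e h2, ← P.k₁_eq h2]
    ring
  · intro x hx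
    have hz : ((x, x) : ℝ × ℝ) ∈ triangle := ⟨hx.1, le_rfl, hx.2⟩
    rw [(hfix (x, x) hz).1]
    simp only [Plant.rhs₁, add_comm (P.s₂.phase x) (P.s₁.phase x), ← P.s₀_phase,
      OrderIso.symm_apply_apply, intervalIntegral.integral_same, add_zero, Plant.diagonal]
    rw [mul_div_cancel_left₀ _ (e1 _), P.k₂_eq hx, P.s₁_e hx, P.s₂_e hx]
  · intro x hx
    have hz : ((x, 0) : ℝ × ℝ) ∈ triangle := ⟨le_rfl, hx.1, hx.2⟩
    have h0 : (0 : ℝ) ∈ Icc (0 : ℝ) 1 := by simp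
    rw [(hfix (x, 0) hz).2]
    simp only [Plant.rhs₂, Speed.phase_zero, sub_zero, OrderIso.symm_apply_apply,
      intervalIntegral.integral_same, add_zero]
    rw [← P.s₁_e h0, ← P.s₂_e h0, mul_div_cancel₀ _ (e2 _), mul_assoc, mul_div_cancel₀ _ (e1 _)]

end DelayedHyperbolic

namespace DelayedHyperbolic

namespace Plant

variable (P : Plant)

lemma phase_clamp_mem (S : Speed) (x : ℝ) : S.phase (clamp x) ∈ Icc 0 (S.phase 1) :=
  ⟨S.phase_nonneg (clamp_mem x).1, S.phase.monotone (clamp_mem x).2⟩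

/-- The equations of the predictor kernels `ε₁ α₁`, `ε₂ α₂` as a pipe without inflow, run through in
the time `τ x`: first `ε₁ α₁`, from `y = 1` to `y = 0`, then `ε₂ α₂ / q`, from `y = 0` to
`y = 1`. -/
noncomputable def kernelPipe : Pipe where
  Λ := P.s₁.phase 1 + P.s₂.phase 1
  m p := if p < P.s₁.phase 1 then P.q * P.h₁ (P.s₁.phase.symm (P.s₁.phase 1 - p))
    else 1 / P.q * P.h₂ (P.s₂.phase.symm (p - P.s₁.phase 1))
  r p := if p < P.s₁.phase 1 then
      P.s₁.phase 1 + P.s₂.phase (clamp (P.s₁.phase.symm (P.s₁.phase 1 - p)))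
    else P.s₁.phase 1 - P.s₁.phase (clamp (P.s₂.phase.symm (p - P.s₁.phase 1)))
  k _ := 0
  M := (P.q + 1 / P.q) * P.exists_bound_h.choose
  N := 0
  Λ_nonneg := add_nonneg (P.s₁.phase_nonneg zero_le_one) (P.s₂.phase_nonneg zero_le_one)
  m_meas := Measurable.ite measurableSet_Iio (by fun_prop) (by fun_prop)
  r_meas := Measurable.ite measurableSet_Iio (by fun_prop) (by fun_prop)
  k_meas := measurable_const
  m_le p := by
    have h := P.exists_bound_h.choose_spec
    have hq := P.q_pos
    have hq' := one_div_pos.2 hq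
    rw [add_mul]
    have h1 := mul_nonneg hq.le h.1
    have h2 := mul_nonneg hq'.le h.1
    split_ifs
    · rw [abs_mul, abs_of_pos hq]
      nlinarith [(h.2 (P.s₁.phase.symm (P.s₁.phase 1 - p))).1]
    · rw [abs_mul, abs_of_pos hq']
      nlinarith [(h.2 (P.s₂.phase.symm (p - P.s₁.phase 1))).2]
  k_le _ := by simp
  r_mem p := by
    have h1 := P.s₁.phase_nonneg zero_le_one
    have h2 := P.s₂.phase_nonneg zero_le_one
    split_ifs
    · have := phase_clamp_mem P.s₂ (P.s₁.phase.symm (P.s₁.phase 1 - p))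
      constructor <;> linarith [this.1, this.2]
    · have := phase_clamp_mem P.s₁ (P.s₂.phase.symm (p - P.s₁.phase 1))
      constructor <;> linarith [this.1, this.2]

end Plant

lemma mem_square {x y : ℝ} : (x, y) ∈ square ↔ x ∈ Icc (0 : ℝ) 1 ∧ y ∈ Icc (0 : ℝ) 1 := Iff.rfl

/-- The kernels of the predictor exist: they are read off from the solution of the kernel pipe
that starts from the delay-free kernels. -/
theorem exists_isPredictorKernel {P : Plant} {K21 K22 : ℝ → ℝ → ℝ}
    (hK : IsBacksteppingKernel P K21 K22) : ∃ α₁ α₂, IsPredictorKernel P K21 K22 α₁ α₂ := by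
  have hq := P.q_pos
  have hτ := P.τ_pos
  have e1 : ∀ x, P.s₁.e x ≠ 0 := fun x => (P.s₁.pos x).ne'
  have e2 : ∀ x, P.s₂.e x ≠ 0 := fun x => (P.s₂.pos x).ne'
  have h0 : (0 : ℝ) ∈ Icc (0 : ℝ) 1 := by simp
  have h1 : (1 : ℝ) ∈ Icc (0 : ℝ) 1 := by simp
  have hrow : ∀ y ∈ Icc (0 : ℝ) 1, ((1, y) : ℝ × ℝ) ∈ triangle := fun y hy => ⟨hy.1, hy.2, le_rfl⟩
  have hc1 : Continuous fun y => K21 1 (clamp y) :=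
    hK.cont₁.comp_continuous (f := fun y => ((1, clamp y) : ℝ × ℝ)) (by fun_prop)
      fun y => hrow _ (clamp_mem y)
  have hc2 : Continuous fun y => K22 1 (clamp y) :=
    hK.cont₂.comp_continuous (f := fun y => ((1, clamp y) : ℝ × ℝ)) (by fun_prop)
      fun y => hrow _ (clamp_mem y)
  obtain ⟨B₁, hB₁, hb1⟩ := exists_bound_comp_clamp (f := fun y => P.s₁.e y * K21 1 (clamp y))
    (P.continuous_s₁.mul hc1).continuousOn
  obtain ⟨B₂, hB₂, hb2⟩ := exists_bound_comp_clamp (f := fun y => P.s₂.e y * K22 1 (clamp y) / P.q)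
    ((P.continuous_s₂.mul hc2).div_const _).continuousOn
  set L := P.s₁.phase 1 with hL
  have hL0 : 0 ≤ L := P.s₁.phase_nonneg zero_le_one
  set w : ℝ → ℝ := fun p => if p ≤ L then
      (fun y => P.s₁.e y * K21 1 (clamp y)) (clamp (P.s₁.phase.symm (L - p)))
    else (fun y => P.s₂.e y * K22 1 (clamp y) / P.q) (clamp (P.s₂.phase.symm (p - L))) with hw
  have hwm : Measurable w :=
    Measurable.ite measurableSet_Iic
      (((P.continuous_s₁.mul hc1).comp continuous_clamp).measurable.comp (by fun_prop))
      ((((P.continuous_s₂.mul hc2).div_const _).comp continuous_clamp).measurable.comp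
        (by fun_prop))
  obtain ⟨W, hW, hW0⟩ := P.kernelPipe.exists_isSolution (B := max B₁ B₂) hwm fun p => by
    simp only [hw]
    split_ifs
    · exact (hb1 _).trans (le_max_left _ _)
    · exact (hb2 _).trans (le_max_right _ _)
  set α₁ : ℝ → ℝ → ℝ := fun x y => W (L - P.s₁.phase (clamp y)) (P.τ * clamp x) / P.s₁.e y
    with hα₁
  set α₂ : ℝ → ℝ → ℝ := fun x y =>
    P.q * W (L + P.s₂.phase (clamp y)) (P.τ * clamp x) / P.s₂.e y with hα₂
  have hA1 : ∀ x ∈ Icc (0 : ℝ) 1, ∀ y ∈ Icc (0 : ℝ) 1,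
      P.ε₁ y * α₁ x y = W (L - P.s₁.phase y) (P.τ * x) := fun x hx y hy => by
    simp only [hα₁, clamp_of_mem hx, clamp_of_mem hy]
    rw [← P.s₁_e hy, mul_div_cancel₀ _ (e1 _)]
  have hA2 : ∀ x ∈ Icc (0 : ℝ) 1, ∀ y ∈ Icc (0 : ℝ) 1,
      P.ε₂ y * α₂ x y = P.q * W (L + P.s₂.phase y) (P.τ * x) := fun x hx y hy => by
    simp only [hα₂, clamp_of_mem hx, clamp_of_mem hy]
    rw [← P.s₂_e hy, mul_div_cancel₀ _ (e2 _)]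
  have hpm : ∀ (S : Speed) (y : ℝ), y ∈ Icc (0 : ℝ) 1 → S.phase y ∈ Icc 0 (S.phase 1) :=
    fun S y hy => ⟨S.phase_nonneg hy.1, S.phase.monotone hy.2⟩
  have hL2 := P.s₂.phase_nonneg zero_le_one
  have hΛ : P.kernelPipe.Λ = L + P.s₂.phase 1 := rfl
  have hmeas1 : Measurable fun z : ℝ × ℝ => α₁ z.1 z.2 :=
    (hW.meas.comp (f := fun z : ℝ × ℝ => (L - P.s₁.phase (clamp z.2), P.τ * clamp z.1))
      (by fun_prop)).div (P.continuous_s₁.comp continuous_snd).measurable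
  have hmeas2 : Measurable fun z : ℝ × ℝ => α₂ z.1 z.2 :=
    ((hW.meas.comp (f := fun z : ℝ × ℝ => (L + P.s₂.phase (clamp z.2), P.τ * clamp z.1))
      (by fun_prop)).const_mul _).div (P.continuous_s₂.comp continuous_snd).measurable
  refine ⟨α₁, α₂, hmeas1, hmeas2, ?_, ⟨?_, ?_⟩, ?_, ?_, ?_, ?_⟩
  · obtain ⟨B, hB⟩ := hW.bdd P.τ
    obtain ⟨E₁, hE₁0, hE₁⟩ := exists_bound_comp_clamp (P.s₁.continuous_inv.continuousOn)
    obtain ⟨E₂, hE₂0, hE₂⟩ := exists_bound_comp_clamp (P.s₂.continuous_inv.continuousOn)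
    have hB0 : 0 ≤ B := (abs_nonneg _).trans
      (hB 0 ⟨le_rfl, P.kernelPipe.Λ_nonneg⟩ 0 ⟨le_rfl, hτ.le⟩)
    refine ⟨max (B * E₁) (P.q * B * E₂), ?_⟩
    rintro ⟨x, y⟩ ⟨hx, hy⟩
    simp only at hx hy
    have ht : P.τ * x ∈ Icc 0 P.τ := ⟨mul_nonneg hτ.le hx.1, mul_le_of_le_one_right hτ.le hx.2⟩
    have h3 := hpm P.s₁ y hy
    have h4 := hpm P.s₂ y hy
    have h5 := hB (L - P.s₁.phase y) ⟨by linarith [h3.2], by rw [hΛ]; linarith [h3.1]⟩ _ ht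
    have h6 := hB (L + P.s₂.phase y) ⟨by linarith [h4.1], by rw [hΛ]; linarith [h4.2]⟩ _ ht
    have h7 := hE₁ y
    have h8 := hE₂ y
    simp only [hα₁, hα₂, clamp_of_mem hx, clamp_of_mem hy] at h7 h8 ⊢
    constructor
    · refine le_max_of_le_left ?_
      rw [div_eq_mul_one_div, abs_mul]
      gcongr
    · refine le_max_of_le_right ?_
      rw [div_eq_mul_one_div, abs_mul, abs_mul, abs_of_pos hq]
      gcongr
  · rw [solvesAlongCharacteristics_iff (Ω := square) (a := fun _ => 1 / P.τ) P.s₃ P.s₁ (-1) (fun z _ => rfl)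
      (fun z hz => by rw [P.s₁_e hz.2, neg_one_mul])]
    intro x y δ hδ hΩ
    have hxy : (x, y) ∈ square := by simpa using hΩ 0 ⟨le_rfl, hδ⟩
    have hxδ := mem_square.1 (hΩ δ ⟨hδ, le_rfl⟩)
    have hp := hpm P.s₁ y hxy.2
    have hδ' := hpm P.s₁ _ hxδ.2
    simp only [Speed.phase_flow] at hδ'
    rw [hA1 _ hxδ.1 _ hxδ.2, hA1 _ hxy.1 _ hxy.2]
    have hτx : ∀ σ, P.τ * P.s₃.flow σ x = P.τ * x + σ := fun σ => by
      rw [P.s₃_flow]; field_simp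
    have hph : ∀ σ, L - P.s₁.phase (P.s₁.flow (-1 * σ) y) = L - P.s₁.phase y + σ := fun σ => by
      rw [Speed.phase_flow]; ring
    rw [hτx, hph, hW.transport _ _ _ hδ (by linarith [hp.2]) (by rw [hΛ]; linarith [hδ'.1])
      (mul_nonneg hτ.le hxy.1.1)]
    refine intervalIntegral.integral_congr_Ioo_of_le hδ fun σ hσ => ?_
    have hσ' := mem_square.1 (hΩ σ ⟨hσ.1.le, hσ.2.le⟩)
    have hlt : L - P.s₁.phase y + σ < P.s₁.phase 1 := by linarith [hσ.2, hδ'.1]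
    have hY : P.s₁.phase.symm (P.s₁.phase 1 - (L - P.s₁.phase y + σ)) = P.s₁.flow (-1 * σ) y := by
      rw [Speed.flow, ← hL]; congr 1; ring
    have h5 := hA2 _ hσ'.1 _ hσ'.2
    rw [hτx] at h5
    simp only [Plant.kernelPipe, if_pos hlt, hY, clamp_of_mem hσ'.2]
    generalize P.s₁.flow (-1 * σ) y = Y at hσ' h5 ⊢
    calc _ = P.h₁ Y * (P.q * W (L + P.s₂.phase Y) (P.τ * x + σ)) := by
            rw [hL]; ring
      _ = _ := by
        rw [← h5, Plant.h₁, P.s₁_e hσ'.2, P.k₂_eq hσ'.2, P.s₂_e hσ'.2]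
        have := (P.ε₂_pos _ hσ'.2).ne'
        field_simp
  · rw [solvesAlongCharacteristics_iff (Ω := square) (a := fun _ => 1 / P.τ) P.s₃ P.s₂ 1 (fun z _ => rfl)
      (fun z hz => by rw [P.s₂_e hz.2, one_mul])]
    intro x y δ hδ hΩ
    have hxy : (x, y) ∈ square := by simpa using hΩ 0 ⟨le_rfl, hδ⟩
    have hxδ := mem_square.1 (hΩ δ ⟨hδ, le_rfl⟩)
    have hp := hpm P.s₂ y hxy.2
    have hδ' := hpm P.s₂ _ hxδ.2
    simp only [Speed.phase_flow] at hδ'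
    rw [hA2 _ hxδ.1 _ hxδ.2, hA2 _ hxy.1 _ hxy.2]
    have hτx : ∀ σ, P.τ * P.s₃.flow σ x = P.τ * x + σ := fun σ => by
      rw [P.s₃_flow]; field_simp
    have hph : ∀ σ, L + P.s₂.phase (P.s₂.flow (1 * σ) y) = L + P.s₂.phase y + σ := fun σ => by
      rw [Speed.phase_flow]; ring
    rw [hτx, hph, ← mul_sub, hW.transport _ _ _ hδ (by linarith [hp.1])
      (by rw [hΛ]; linarith [hδ'.2]) (mul_nonneg hτ.le hxy.1.1),
      ← intervalIntegral.integral_const_mul]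
    refine intervalIntegral.integral_congr fun σ hσ => ?_
    rw [uIcc_of_le hδ] at hσ
    have hσ' := mem_square.1 (hΩ σ hσ)
    have hlt : ¬ L + P.s₂.phase y + σ < P.s₁.phase 1 := by linarith [hσ.1, hp.1]
    have hY : P.s₂.phase.symm (L + P.s₂.phase y + σ - P.s₁.phase 1) = P.s₂.flow (1 * σ) y := by
      rw [Speed.flow, ← hL]; congr 1; ring
    have h5 := hA1 _ hσ'.1 _ hσ'.2
    rw [hτx] at h5
    simp only [Plant.kernelPipe, if_neg hlt, hY, clamp_of_mem hσ'.2]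
    generalize P.s₂.flow (1 * σ) y = Y at hσ' h5 ⊢
    calc _ = P.h₂ Y * W (L - P.s₁.phase Y) (P.τ * x + σ) := by
            rw [hL]; field_simp
      _ = _ := by
        rw [← h5, Plant.h₂, P.s₂_e hσ'.2, P.k₁_eq hσ'.2, P.s₁_e hσ'.2]
        have := (P.ε₁_pos _ hσ'.2).ne'
        field_simp
  · intro x hx
    have hx' : x ∈ Icc (0 : ℝ) 1 := ⟨hx.1.le, hx.2⟩
    have h5 := hA1 x hx' 1 h1
    rw [← hL, sub_self, hW.inflow _ (mul_pos hτ hx.1)] at h5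
    simp only [Plant.kernelPipe, zero_mul, intervalIntegral.integral_zero, mul_eq_zero] at h5
    exact h5.resolve_left (P.ε₁_pos 1 h1).ne'
  · intro x hx
    rw [mul_assoc, hA1 x hx 0 h0, hA2 x hx 0 h0, Speed.phase_zero, Speed.phase_zero, sub_zero,
      add_zero]
  · intro y hy
    have hp := hpm P.s₁ y hy
    have h5 := hA1 0 h0 y hy
    rw [mul_zero, hW0 _ ⟨by linarith [hp.2], by rw [hΛ]; linarith [hp.1]⟩] at h5
    simp only [hw, if_pos (show L - P.s₁.phase y ≤ L by linarith [hp.1]), sub_sub_cancel,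
      OrderIso.symm_apply_apply, clamp_of_mem hy, P.s₁_e hy] at h5
    exact mul_left_cancel₀ (P.ε₁_pos y hy).ne' h5
  · intro y hy
    have hp := hpm P.s₂ y hy
    have h5 := hA2 0 h0 y hy
    rw [mul_zero, hW0 _ ⟨by linarith [hp.1], by rw [hΛ]; linarith [hp.2]⟩] at h5
    refine mul_left_cancel₀ (P.ε₂_pos y hy).ne' (h5.trans ?_)
    rcases hy.1.eq_or_lt with rfl | hy0
    · rw [hK.bottom 1 h1]
      simp [hw, clamp_of_mem h0, P.s₁_e h0, mul_assoc]
    · have h6 := P.s₂.phase_pos hy0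
      simp only [hw, if_neg (show ¬ L + P.s₂.phase y ≤ L by linarith), add_sub_cancel_left,
        OrderIso.symm_apply_apply, clamp_of_mem hy, P.s₂_e hy]
      field_simp

end DelayedHyperbolic

namespace DelayedHyperbolic

/-! ### The closed loop along characteristics -/

/-- A measurable, locally bounded solution of the closed loop along characteristics. It has a value
at every point, so that the traces are plain evaluations. The control is imposed for `t > 0` only:
at the time `0` the initial state need not be compatible with it. -/
structure IsMildSolution (P : Plant) (α₁ α₂ u₁ u₂ v : ℝ → ℝ → ℝ) : Prop where
  meas₁ : Measurable (Function.uncurry u₁)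
  meas₂ : Measurable (Function.uncurry u₂)
  meas₃ : Measurable (Function.uncurry v)
  bdd : ∀ T, ∃ B, ∀ x ∈ Icc (0 : ℝ) 1, ∀ t ∈ Icc 0 T, |u₁ x t| ≤ B ∧ |u₂ x t| ≤ B ∧ |v x t| ≤ B
  eq₁ : Transported P.s₁ 1 (Ici 0) u₁ fun x t => P.k₁ x * u₂ x t
  eq₂ : Transported P.s₂ (-1) (Ici 0) u₂ fun x t => P.k₂ x * u₁ x t
  eq₃ : Transported P.s₃ (-1) (Ici 0) v fun _ _ => 0
  left : ∀ t, 0 ≤ t → u₁ 0 t = P.q * u₂ 0 t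
  right : ∀ t, 0 ≤ t → u₂ 1 t = v 0 t
  inflow : ∀ t, 0 < t → v 1 t =
    (∫ y in (0 : ℝ)..1, P.τ * P.ε₂ 1 * α₂ (1 - y) 1 * v y t) +
      (∫ y in (0 : ℝ)..1, α₁ 1 y * u₁ y t) + ∫ y in (0 : ℝ)..1, α₂ 1 y * u₂ y t

lemma IsMildSolution.v_eq {P : Plant} {α₁ α₂ u₁ u₂ v : ℝ → ℝ → ℝ}
    (h : IsMildSolution P α₁ α₂ u₁ u₂ v) {x t : ℝ} (hx : x ∈ Icc (0 : ℝ) 1) (ht : 0 ≤ t) :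
    v x t = v 0 (t + P.τ * x) := by
  have hτ := P.τ_pos
  have h1 := h.eq₃ x t (P.τ * x) (mul_nonneg hτ.le hx.1) ht
    (add_nonneg ht (mul_nonneg hτ.le hx.1)) fun σ hσ => by
      rw [P.s₃_flow, neg_one_mul, neg_div, ← sub_eq_add_neg]
      have h2 : σ / P.τ ≤ x := by rw [div_le_iff₀ hτ]; linarith [hσ.2]
      have h3 : 0 ≤ σ / P.τ := div_nonneg hσ.1 hτ.le
      exact ⟨by linarith, by linarith [hx.2]⟩
  rw [intervalIntegral.integral_zero, sub_eq_zero, P.s₃_flow] at h1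
  rw [← h1]
  congr 1
  field_simp
  ring

/-- The predictor equations on the square, read backwards in `x = 1 - (t - t₁)/τ`, are transport
equations in the time `t`. -/
lemma transported_of_solves_square {P : Plant} {S : Speed} {κ t₁ : ℝ} {b : ℝ → ℝ}
    {F G : ℝ → ℝ → ℝ} (h : SolvesAlongCharacteristics square (fun _ => 1 / P.τ) b F G)
    (hb : ∀ y ∈ Icc (0 : ℝ) 1, b y = -κ * S.e y) :
    Transported S κ (Icc t₁ (t₁ + P.τ)) (fun y t => F (1 - (t - t₁) / P.τ) y)
      (fun y t => -G (1 - (t - t₁) / P.τ) y) := by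
  have hτ := P.τ_pos
  rw [solvesAlongCharacteristics_iff (Ω := square) (a := fun _ => 1 / P.τ) P.s₃ S (-κ)
    (fun z _ => rfl) fun z hz => hb z.2 hz.2] at h
  intro y t δ hδ ht htδ hy
  have hX : ∀ σ, P.s₃.flow σ (1 - (t + δ - t₁) / P.τ) = 1 - (t + (δ - σ) - t₁) / P.τ := fun σ => by
    rw [P.s₃_flow]; field_simp; ring
  have hY : ∀ σ, S.flow (-κ * σ) (S.flow (κ * δ) y) = S.flow (κ * (δ - σ)) y := fun σ => by
    rw [Speed.flow_flow]; congr 1; ring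
  have h1 := h (1 - (t + δ - t₁) / P.τ) (S.flow (κ * δ) y) δ hδ fun σ hσ => by
    rw [hX, hY]
    refine ⟨⟨?_, ?_⟩, hy _ ⟨by linarith [hσ.2], by linarith [hσ.1]⟩⟩
    · have : (t + (δ - σ) - t₁) / P.τ ≤ 1 := by
        rw [div_le_one hτ]; linarith [htδ.2, hσ.1]
      simpa using this
    · have : 0 ≤ (t + (δ - σ) - t₁) / P.τ := div_nonneg (by linarith [ht.1, hσ.2]) hτ.le
      simpa using this
  simp only [hX, hY, sub_self, mul_zero, Speed.flow_zero, add_zero] at h1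
  have h2 := intervalIntegral.integral_comp_sub_left (a := 0) (b := δ)
    (fun σ => G (1 - (t + σ - t₁) / P.τ) (S.flow (κ * σ) y)) δ
  rw [sub_self, sub_zero] at h2
  rw [intervalIntegral.integral_neg, ← h2, ← h1]
  ring

/-- The control compensates the delay: from the time `τ` on, the value that enters at `x = 1` is
the one prescribed by the delay-free backstepping kernel. -/
lemma IsMildSolution.right_eq {P : Plant} {K21 K22 α₁ α₂ u₁ u₂ v : ℝ → ℝ → ℝ}
    (h : IsMildSolution P α₁ α₂ u₁ u₂ v) (hα : IsPredictorKernel P K21 K22 α₁ α₂)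
    {t₁ : ℝ} (ht₁ : 0 < t₁) :
    u₂ 1 (t₁ + P.τ) = (∫ y in (0 : ℝ)..1, K21 1 y * u₁ y (t₁ + P.τ)) +
      ∫ y in (0 : ℝ)..1, K22 1 y * u₂ y (t₁ + P.τ) := by
  have hτ := P.τ_pos
  have hτ' := hτ.ne'
  have h0 : (0 : ℝ) ∈ Icc (0 : ℝ) 1 := by simp
  have h1 : (1 : ℝ) ∈ Icc (0 : ℝ) 1 := by simp
  have e1 : ∀ x, P.s₁.e x ≠ 0 := fun x => (P.s₁.pos x).ne'
  have e2 : ∀ x, P.s₂.e x ≠ 0 := fun x => (P.s₂.pos x).ne'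
  set I := Icc t₁ (t₁ + P.τ) with hI
  set X : ℝ → ℝ := fun t => 1 - (t - t₁) / P.τ with hX
  have hXmem : ∀ t ∈ I, X t ∈ Icc (0 : ℝ) 1 := fun t ht => by
    have h2 : (t - t₁) / P.τ ≤ 1 := by rw [div_le_one hτ]; linarith [ht.2]
    have h3 : 0 ≤ (t - t₁) / P.τ := div_nonneg (by linarith [ht.1]) hτ.le
    constructor <;> simp only [hX] <;> linarith
  have hsub : I ⊆ Ici 0 := fun t ht => ht₁.le.trans ht.1
  obtain ⟨B, hB⟩ := h.bdd (t₁ + P.τ)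
  have hB' : ∀ x ∈ Icc (0 : ℝ) 1, ∀ t ∈ I, |u₁ x t| ≤ B ∧ |u₂ x t| ≤ B ∧ |v x t| ≤ B :=
    fun x hx t ht => hB x hx t ⟨hsub ht, ht.2⟩
  obtain ⟨N, hN⟩ := hα.bdd
  obtain ⟨E₁, hE₁0, hE₁⟩ := P.exists_bound_s₁
  obtain ⟨E₂, hE₂0, hE₂⟩ := P.exists_bound_s₂
  obtain ⟨C₁, hC₁0, hC₁⟩ := P.exists_bound_k₁
  obtain ⟨C₂, hC₂0, hC₂⟩ := P.exists_bound_k₂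
  have hN0 : 0 ≤ N := (abs_nonneg _).trans (hN (0, 0) ⟨h0, h0⟩).1
  have hB0 : 0 ≤ B := (abs_nonneg _).trans (hB' 0 h0 t₁ ⟨le_rfl, by linarith⟩).1
  set A₁ : ℝ → ℝ → ℝ := fun y t => P.s₁.e y * α₁ (X t) y with hA₁
  set A₂ : ℝ → ℝ → ℝ := fun y t => P.s₂.e y * α₂ (X t) y with hA₂
  set G₁ : ℝ → ℝ → ℝ := fun y t => -(P.s₁.e y * (P.k₂ y * α₂ (X t) y)) with hG₁
  set G₂ : ℝ → ℝ → ℝ := fun y t => -(P.s₂.e y * (P.k₁ y * α₁ (X t) y)) with hG₂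
  have hXm : Measurable fun z : ℝ × ℝ => (X z.2, z.1) := by simp only [hX]; fun_prop
  have hαm1 : Measurable fun z : ℝ × ℝ => α₁ (X z.2) z.1 := hα.meas₁.comp hXm
  have hαm2 : Measurable fun z : ℝ × ℝ => α₂ (X z.2) z.1 := hα.meas₂.comp hXm
  have hs1 : Measurable fun z : ℝ × ℝ => P.s₁.e z.1 := P.continuous_s₁.measurable.comp measurable_fst
  have hs2 : Measurable fun z : ℝ × ℝ => P.s₂.e z.1 := P.continuous_s₂.measurable.comp measurable_fst
  have hk1 : Measurable fun z : ℝ × ℝ => P.k₁ z.1 := P.continuous_k₁.measurable.comp measurable_fst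
  have hk2 : Measurable fun z : ℝ × ℝ => P.k₂ z.1 := P.continuous_k₂.measurable.comp measurable_fst
  have hA₁m : Measurable (Function.uncurry A₁) := hs1.mul hαm1
  have hA₂m : Measurable (Function.uncurry A₂) := hs2.mul hαm2
  have hG₁m : Measurable (Function.uncurry G₁) := (hs1.mul (hk2.mul hαm2)).neg
  have hG₂m : Measurable (Function.uncurry G₂) := (hs2.mul (hk1.mul hαm1)).neg
  have hf₁m : Measurable (Function.uncurry fun x t => P.k₁ x * u₂ x t) := hk1.mul h.meas₂
  have hf₂m : Measurable (Function.uncurry fun x t => P.k₂ x * u₁ x t) := hk2.mul h.meas₁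
  have hmul : ∀ {a b c d : ℝ}, |a| ≤ b → |c| ≤ d → 0 ≤ b → |a * c| ≤ b * d :=
    fun ha hc hb => by rw [abs_mul]; exact mul_le_mul ha hc (abs_nonneg _) hb
  have bA₁ : ∀ y ∈ Icc (0 : ℝ) 1, ∀ t ∈ I, |A₁ y t| ≤ E₁ * N := fun y hy t ht =>
    hmul (hE₁ y) (hN (X t, y) ⟨hXmem t ht, hy⟩).1 hE₁0
  have bA₂ : ∀ y ∈ Icc (0 : ℝ) 1, ∀ t ∈ I, |A₂ y t| ≤ E₂ * N := fun y hy t ht =>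
    hmul (hE₂ y) (hN (X t, y) ⟨hXmem t ht, hy⟩).2 hE₂0
  have bG₁ : ∀ y ∈ Icc (0 : ℝ) 1, ∀ t ∈ I, |G₁ y t| ≤ E₁ * (C₂ * N) := fun y hy t ht => by
    simp only [hG₁, abs_neg]
    exact hmul (hE₁ y) (hmul (hC₂ y) (hN (X t, y) ⟨hXmem t ht, hy⟩).2 hC₂0) hE₁0
  have bG₂ : ∀ y ∈ Icc (0 : ℝ) 1, ∀ t ∈ I, |G₂ y t| ≤ E₂ * (C₁ * N) := fun y hy t ht => by
    simp only [hG₂, abs_neg]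
    exact hmul (hE₂ y) (hmul (hC₁ y) (hN (X t, y) ⟨hXmem t ht, hy⟩).1 hC₁0) hE₂0
  have bf₁ : ∀ y ∈ Icc (0 : ℝ) 1, ∀ t ∈ I, |P.k₁ y * u₂ y t| ≤ C₁ * B := fun y hy t ht =>
    hmul (hC₁ y) (hB' y hy t ht).2.1 hC₁0
  have bf₂ : ∀ y ∈ Icc (0 : ℝ) 1, ∀ t ∈ I, |P.k₂ y * u₁ y t| ≤ C₂ * B := fun y hy t ht =>
    hmul (hC₂ y) (hB' y hy t ht).1 hC₂0
  have T₁ : Transported P.s₁ 1 I A₁ G₁ :=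
    (transported_of_solves_square (S := P.s₁) (κ := 1) (t₁ := t₁) hα.eqs.eq₁ fun y hy => by
      rw [P.s₁_e hy]; ring).congr (fun y hy t _ => by simp only [hA₁, P.s₁_e hy, hX])
      (fun y hy t _ => by simp only [hG₁, P.s₁_e hy, P.k₂_eq hy, hX])
  have T₂ : Transported P.s₂ (-1) I A₂ G₂ :=
    (transported_of_solves_square (S := P.s₂) (κ := -1) (t₁ := t₁) hα.eqs.eq₂ fun y hy => by
      rw [P.s₂_e hy]; ring).congr (fun y hy t _ => by simp only [hA₂, P.s₂_e hy, hX])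
      (fun y hy t _ => by simp only [hG₂, P.s₂_e hy, P.k₁_eq hy, hX])
  have key₁ := (T₁.mul (h.eq₁.mono hsub) (M := max (E₁ * (C₂ * N)) (C₁ * B)) hG₁m hf₁m
    (fun y hy t ht => (bG₁ y hy t ht).trans (le_max_left _ _))
    (fun y hy t ht => (bf₁ y hy t ht).trans (le_max_right _ _))).integral_right
    (M := max (E₁ * N * B) (E₁ * (C₂ * N) * B + E₁ * N * (C₁ * B))) (by linarith)
    (hA₁m.mul h.meas₁) ((hG₁m.mul h.meas₁).add (hA₁m.mul hf₁m))
    (fun y hy t ht => (hmul (bA₁ y hy t ht) (hB' y hy t ht).1 (by positivity)).trans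
      (le_max_left _ _))
    (fun y hy t ht => ((abs_add_le _ _).trans (add_le_add
      (hmul (bG₁ y hy t ht) (hB' y hy t ht).1 (by positivity))
      (hmul (bA₁ y hy t ht) (bf₁ y hy t ht) (by positivity)))).trans (le_max_right _ _))
  have key₂ := (T₂.mul (h.eq₂.mono hsub) (M := max (E₂ * (C₁ * N)) (C₂ * B)) hG₂m hf₂m
    (fun y hy t ht => (bG₂ y hy t ht).trans (le_max_left _ _))
    (fun y hy t ht => (bf₂ y hy t ht).trans (le_max_right _ _))).integral_left
    (M := max (E₂ * N * B) (E₂ * (C₁ * N) * B + E₂ * N * (C₂ * B))) (by linarith)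
    (hA₂m.mul h.meas₂) ((hG₂m.mul h.meas₂).add (hA₂m.mul hf₂m))
    (fun y hy t ht => (hmul (bA₂ y hy t ht) (hB' y hy t ht).2.1 (by positivity)).trans
      (le_max_left _ _))
    (fun y hy t ht => ((abs_add_le _ _).trans (add_le_add
      (hmul (bG₂ y hy t ht) (hB' y hy t ht).2.1 (by positivity))
      (hmul (bA₂ y hy t ht) (bf₂ y hy t ht) (by positivity)))).trans (le_max_right _ _))
  -- The sources cancel: the kernel equations are adjoint to the plant.
  have hcancel : (∫ t in t₁..t₁ + P.τ, ∫ y in (0 : ℝ)..1,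
        (G₂ y t * u₂ y t + A₂ y t * (P.k₂ y * u₁ y t)) / P.s₂.e y) =
      -∫ t in t₁..t₁ + P.τ, ∫ y in (0 : ℝ)..1,
        (G₁ y t * u₁ y t + A₁ y t * (P.k₁ y * u₂ y t)) / P.s₁.e y := by
    rw [← intervalIntegral.integral_neg]
    congr 1
    ext t
    rw [← intervalIntegral.integral_neg]
    congr 1
    ext y
    have := e1 y
    have := e2 y
    simp only [hG₁, hG₂, hA₁, hA₂]
    field_simp
    ring
  rw [hcancel] at key₂
  -- The boundary terms at `y = 0` cancel, and `α₁` vanishes at `y = 1`.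
  have hle : t₁ ≤ t₁ + P.τ := by linarith
  have hbd : ∫ t in t₁..t₁ + P.τ, (A₁ 0 t * u₁ 0 t - A₁ 1 t * u₁ 1 t) =
      ∫ t in t₁..t₁ + P.τ, A₂ 0 t * u₂ 0 t := by
    refine intervalIntegral.integral_congr_Ioo_of_le hle fun t ht => ?_
    have htI : t ∈ I := ⟨ht.1.le, ht.2.le⟩
    have hpos : 0 < X t := by
      have : (t - t₁) / P.τ < 1 := by rw [div_lt_one hτ]; linarith [ht.2]
      simp only [hX]; linarith
    have h5 := hα.right (X t) ⟨hpos, (hXmem t htI).2⟩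
    have h6 := hα.bottom (X t) (hXmem t htI)
    simp only [hA₁, hA₂, h5, h.left t (hsub htI), P.s₁_e h0, P.s₂_e h0, h6]
    ring
  have hi : ∀ y ∈ Icc (0 : ℝ) 1, IntervalIntegrable (fun t => A₂ y t * u₂ y t) volume t₁
      (t₁ + P.τ) := fun y hy => intervalIntegrable_of_bounded (M := E₂ * N * B) hle
    ((hA₂m.mul h.meas₂).comp measurable_prodMk_left)
    fun t ht => hmul (bA₂ y hy t ht) (hB' y hy t ht).2.1 (by positivity)
  rw [hbd] at key₁
  rw [intervalIntegral.integral_sub (hi 1 h1) (hi 0 h0)] at key₂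
  -- What leaves the delay line during `[t₁, t₁ + τ]` is what it contains at the time `t₁`.
  have hv : ∫ t in t₁..t₁ + P.τ, A₂ 1 t * u₂ 1 t =
      ∫ y in (0 : ℝ)..1, P.τ * P.ε₂ 1 * α₂ (1 - y) 1 * v y t₁ := by
    have h5 : ∫ t in t₁..t₁ + P.τ, A₂ 1 t * u₂ 1 t = ∫ t in t₁..t₁ + P.τ,
        (fun y => P.s₂.e 1 * α₂ (1 - y) 1 * v y t₁) ((t - t₁) / P.τ) := by
      refine intervalIntegral.integral_congr fun t ht => ?_
      rw [uIcc_of_le hle] at ht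
      have h6 : (t - t₁) / P.τ ∈ Icc (0 : ℝ) 1 :=
        ⟨div_nonneg (by linarith [ht.1]) hτ.le, by rw [div_le_one hτ]; linarith [ht.2]⟩
      simp only [hA₂, hX]
      rw [h.right t (hsub ht), h.v_eq h6 ht₁.le, mul_div_cancel₀ _ hτ', add_sub_cancel]
    rw [h5, intervalIntegral.integral_comp_sub_right
      (fun t => (fun y => P.s₂.e 1 * α₂ (1 - y) 1 * v y t₁) (t / P.τ)),
      intervalIntegral.integral_comp_div (fun y => P.s₂.e 1 * α₂ (1 - y) 1 * v y t₁) hτ', sub_self, zero_div, add_sub_cancel_left,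
      div_self hτ', smul_eq_mul, ← intervalIntegral.integral_const_mul]
    congr 1
    ext y
    rw [P.s₂_e h1]
    ring
  rw [hv] at key₂
  have hend : X (t₁ + P.τ) = 0 := by simp [hX, hτ']
  have hstart : X t₁ = 1 := by simp [hX]
  have h7 : ∀ {f g : ℝ → ℝ}, (∀ y ∈ Icc (0 : ℝ) 1, f y = g y) →
      ∫ y in (0 : ℝ)..1, f y = ∫ y in (0 : ℝ)..1, g y := fun hfg =>
    intervalIntegral.integral_congr fun y hy => hfg y (by rwa [uIcc_of_le zero_le_one] at hy)
  have r1 : ∫ y in (0 : ℝ)..1, A₁ y (t₁ + P.τ) * u₁ y (t₁ + P.τ) / P.s₁.e y =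
      ∫ y in (0 : ℝ)..1, K21 1 y * u₁ y (t₁ + P.τ) := h7 fun y hy => by
    have := e1 y
    simp only [hA₁, hend, hα.left₁ y hy]
    field_simp
  have r2 : ∫ y in (0 : ℝ)..1, A₂ y (t₁ + P.τ) * u₂ y (t₁ + P.τ) / P.s₂.e y =
      ∫ y in (0 : ℝ)..1, K22 1 y * u₂ y (t₁ + P.τ) := h7 fun y hy => by
    have := e2 y
    simp only [hA₂, hend, hα.left₂ y hy]
    field_simp
  have r3 : ∫ y in (0 : ℝ)..1, A₁ y t₁ * u₁ y t₁ / P.s₁.e y =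
      ∫ y in (0 : ℝ)..1, α₁ 1 y * u₁ y t₁ := h7 fun y hy => by
    have := e1 y
    simp only [hA₁, hstart]
    field_simp
  have r4 : ∫ y in (0 : ℝ)..1, A₂ y t₁ * u₂ y t₁ / P.s₂.e y =
      ∫ y in (0 : ℝ)..1, α₂ 1 y * u₂ y t₁ := h7 fun y hy => by
    have := e2 y
    simp only [hA₂, hstart]
    field_simp
  rw [r1, r3] at key₁
  rw [r2, r4] at key₂
  have h8 := h.inflow t₁ ht₁
  rw [h.v_eq h1 ht₁.le, mul_one, ← h.right _ (by linarith)] at h8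
  linarith

end DelayedHyperbolic

namespace DelayedHyperbolic

/-! ### The backstepping transformation -/

lemma SolvesAlongCharacteristics.congr {Ω : Set (ℝ × ℝ)} {a b : ℝ → ℝ} {F G F' G' : ℝ → ℝ → ℝ}
    (h : SolvesAlongCharacteristics Ω a b F G) (hF : ∀ z ∈ Ω, F z.1 z.2 = F' z.1 z.2)
    (hG : ∀ z ∈ Ω, G z.1 z.2 = G' z.1 z.2) : SolvesAlongCharacteristics Ω a b F' G' := by
  intro X Y r s hrs hXY
  rw [← hF _ (hXY s ⟨hrs, le_rfl⟩).1, ← hF _ (hXY r ⟨le_rfl, hrs⟩).1, h X Y r s hrs hXY]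
  refine intervalIntegral.integral_congr fun θ hθ => ?_
  rw [uIcc_of_le hrs] at hθ
  exact hG _ (hXY θ hθ).1

/-- Product rule for a solution of the plant and a backstepping kernel whose first argument
`ε₂`-phase is `C - t`: the characteristics of the kernel, read backwards, are those of the plant. -/
lemma kernel_mul_sub_mul {P : Plant} {S : Speed} {κ C M : ℝ} {b : ℝ → ℝ} {F G u f : ℝ → ℝ → ℝ}
    (hker : SolvesAlongCharacteristics triangle P.ε₂ b F G)
    (hb : ∀ y ∈ Icc (0 : ℝ) 1, b y = -κ * S.e y) (hG : Continuous (Function.uncurry G))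
    (hu : Transported S κ (Ici 0) u f) (hf : Measurable (Function.uncurry f)) {y t δ : ℝ}
    (hδ : 0 ≤ δ) (ht : 0 ≤ t)
    (hmem : ∀ σ ∈ Icc 0 δ, (P.s₂.phase.symm (C - (t + σ)), S.flow (κ * σ) y) ∈ triangle)
    (hfM : ∀ σ ∈ Icc 0 δ, |f (S.flow (κ * σ) y) (t + σ)| ≤ M) :
    F (P.s₂.phase.symm (C - (t + δ))) (S.flow (κ * δ) y) * u (S.flow (κ * δ) y) (t + δ) -
      F (P.s₂.phase.symm (C - t)) y * u y t =
      ∫ σ in (0 : ℝ)..δ,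
        (-G (P.s₂.phase.symm (C - (t + σ))) (S.flow (κ * σ) y) * u (S.flow (κ * σ) y) (t + σ) +
          F (P.s₂.phase.symm (C - (t + σ))) (S.flow (κ * σ) y) *
            f (S.flow (κ * σ) y) (t + σ)) := by
  have hflow : Continuous fun σ => S.flow (κ * σ) y :=
    (S.continuous_flow_left y).comp (continuous_const.mul continuous_id)
  have hm : Measurable fun σ => (S.flow (κ * σ) y, t + σ) := hflow.measurable.prodMk (by fun_prop)
  have hGc : Continuous fun σ => G (P.s₂.phase.symm (C - (t + σ))) (S.flow (κ * σ) y) :=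
    hG.comp ((by fun_prop : Continuous fun σ => P.s₂.phase.symm (C - (t + σ))).prodMk hflow)
  rw [solvesAlongCharacteristics_iff P.s₂ S (-κ)
    (fun z hz => (P.s₂_e (triangle_fst_mem hz)).symm) fun z hz => hb _ (triangle_snd_mem hz)] at hker
  have hX : ∀ ρ σ, P.s₂.flow σ (P.s₂.phase.symm (C - (t + ρ))) =
      P.s₂.phase.symm (C - (t + (ρ - σ))) := fun ρ σ => by
    rw [Speed.flow, OrderIso.apply_symm_apply]; congr 1; ring
  have hY : ∀ ρ σ, S.flow (-κ * σ) (S.flow (κ * ρ) y) = S.flow (κ * (ρ - σ)) y := fun ρ σ => by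
    rw [Speed.flow_flow]; congr 1; ring
  have key := mul_sub_mul_eq_integral (a := 0) (b := δ) hδ
    (A := fun σ => F (P.s₂.phase.symm (C - (t + σ))) (S.flow (κ * σ) y))
    (A' := fun σ => -G (P.s₂.phase.symm (C - (t + σ))) (S.flow (κ * σ) y))
    (B := fun σ => u (S.flow (κ * σ) y) (t + σ)) (B' := fun σ => f (S.flow (κ * σ) y) (t + σ))
    (hGc.neg.intervalIntegrable _ _) (intervalIntegrable_of_bounded hδ (hf.comp hm) hfM)
    (fun ρ hρ => by
      have h1 := hker (P.s₂.phase.symm (C - (t + ρ))) (S.flow (κ * ρ) y) ρ hρ.1 fun σ hσ => by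
        rw [hX, hY]
        exact hmem _ ⟨by linarith [hσ.2], by linarith [hσ.1, hρ.2]⟩
      simp only [hX, hY, sub_self, mul_zero, Speed.flow_zero, add_zero] at h1
      have h2 := intervalIntegral.integral_comp_sub_left (a := 0) (b := ρ)
        (fun σ => G (P.s₂.phase.symm (C - (t + σ))) (S.flow (κ * σ) y)) ρ
      rw [sub_self, sub_zero] at h2
      simp only [mul_zero, Speed.flow_zero, add_zero]
      rw [intervalIntegral.integral_neg, ← h2, ← h1]
      ring)
    (fun ρ hρ => by
      simpa using hu y t ρ hρ.1 ht (add_nonneg ht hρ.1) fun σ hσ =>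
        triangle_snd_mem (hmem σ ⟨hσ.1, hσ.2.trans hρ.2⟩))
  simpa using key

set_option maxHeartbeats 1000000 in
/-- Balance of `F u` on the region `0 ≤ y ≤ X(t)`, `t₀ ≤ t ≤ C`, swept by the characteristics of
`u₁`, where `X(t)` is the characteristic of `u₂` through `(x₀, t₀)`, which reaches `0` at the
time `C`. -/
lemma triangle_balance₁ {P : Plant} {C x₀ t₀ M : ℝ} {b : ℝ → ℝ} {F G u f : ℝ → ℝ → ℝ}
    (hx₀ : x₀ ∈ Icc (0 : ℝ) 1) (ht₀ : 0 ≤ t₀) (hC : C = t₀ + P.s₂.phase x₀)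
    (hker : SolvesAlongCharacteristics triangle P.ε₂ b F G)
    (hb : ∀ y ∈ Icc (0 : ℝ) 1, b y = -1 * P.s₁.e y) (hF : Continuous (Function.uncurry F))
    (hG : Continuous (Function.uncurry G)) (hFM : ∀ x y, |F x y| ≤ M) (hGM : ∀ x y, |G x y| ≤ M)
    (hu : Transported P.s₁ 1 (Ici 0) u f) (hum : Measurable (Function.uncurry u))
    (hf : Measurable (Function.uncurry f))
    (huM : ∀ x ∈ Icc (0 : ℝ) 1, ∀ t ∈ Icc t₀ C, |u x t| ≤ M)
    (hfM : ∀ x ∈ Icc (0 : ℝ) 1, ∀ t ∈ Icc t₀ C, |f x t| ≤ M) :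
    (∫ y in (0 : ℝ)..x₀, F y y * u y (C - P.s₂.phase y) / P.s₀.e y) -
        ((∫ t in t₀..C, F (P.s₂.phase.symm (C - t)) 0 * u 0 t) +
          ∫ y in (0 : ℝ)..x₀, F x₀ y * u y t₀ / P.s₁.e y) =
      ∫ t in t₀..C, ∫ y in (0 : ℝ)..P.s₂.phase.symm (C - t),
        (-G (P.s₂.phase.symm (C - t)) y * u y t + F (P.s₂.phase.symm (C - t)) y * f y t) /
          P.s₁.e y := by
  set X : ℝ → ℝ := fun t => P.s₂.phase.symm (C - t) with hX
  have hXc : Continuous X := by simp only [hX]; fun_prop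
  have hM0 : 0 ≤ M := (abs_nonneg _).trans (hFM 0 0)
  have hL := P.s₂.phase_nonneg hx₀.1
  have ht₀C : t₀ ≤ C := by linarith
  have hX₀ : X t₀ = x₀ := by simp [hX, hC]
  have hXmem : ∀ t ∈ Icc t₀ C, 0 ≤ X t ∧ X t ≤ x₀ := fun t ht => by
    simp only [hX, OrderIso.le_symm_apply, OrderIso.symm_apply_le, P.s₂.phase_zero]
    constructor <;> linarith [ht.1, ht.2]
  -- exit position and exit time of the characteristic `φ₁(y) - t = η`
  set z : ℝ → ℝ := fun η => P.s₀.phase.symm (η + C) with hz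
  have hzc : Continuous z := by simp only [hz]; fun_prop
  have hzs : ∀ η, P.s₁.phase (z η) + P.s₂.phase (z η) = η + C := fun η => by
    rw [← P.s₀_phase, hz, OrderIso.apply_symm_apply]
  set A := -C with hA
  set B := P.s₁.phase x₀ - t₀ with hB
  have hAB : A ≤ B := by linarith [P.s₁.phase_nonneg hx₀.1]
  set s : ℝ → ℝ := fun η => max t₀ (-η) with hs
  set e : ℝ → ℝ := fun η => C - P.s₂.phase (z η) with he
  have hsc : Continuous s := by fun_prop
  have hec : Continuous e := by fun_prop
  have hz0 : ∀ η ∈ Icc A B, z η ∈ Icc 0 x₀ := fun η hη => by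
    simp only [hz, mem_Icc, OrderIso.le_symm_apply, OrderIso.symm_apply_le, P.s₀_phase,
      Speed.phase_zero]
    constructor <;> linarith [hη.1, hη.2]
  have hse : ∀ η ∈ Icc A B, t₀ ≤ s η ∧ s η ≤ e η ∧ e η ≤ C := fun η hη => by
    have h1 := P.s₂.phase.monotone (hz0 η hη).2
    have h2 := P.s₂.phase_nonneg (hz0 η hη).1
    have h3 := P.s₁.phase_nonneg (hz0 η hη).1
    have h4 := hzs η
    refine ⟨le_max_left _ _, max_le ?_ ?_, ?_⟩ <;> simp only [he] <;> linarith
  have hte : ∀ η t, t ≤ e η ↔ z η ≤ X t := fun η t => by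
    simp only [hX, OrderIso.le_symm_apply, he]
    constructor <;> intro h <;> linarith
  have hzX : ∀ η t, z η ≤ X t ↔ η ≤ P.s₁.phase (X t) - t := fun η t => by
    simp only [hz, OrderIso.symm_apply_le, P.s₀_phase]
    have : P.s₂.phase (X t) = C - t := by simp [hX]
    constructor <;> intro h <;> linarith
  set Y : ℝ → ℝ → ℝ := fun η t => P.s₁.phase.symm (η + t) with hY
  have hYc : Continuous fun w : ℝ × ℝ => Y w.1 w.2 := by simp only [hY]; fun_prop
  have hYmem : ∀ η ∈ Icc A B, ∀ t ∈ Icc (s η) (e η),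
      t ∈ Icc t₀ C ∧ 0 ≤ Y η t ∧ Y η t ≤ X t := fun η hη t ht => by
    obtain ⟨h1, h2, h3⟩ := hse η hη
    have h4 := (hzX η t).1 ((hte η t).1 ht.2)
    have h5 := (max_le_iff.1 ht.1).2
    refine ⟨⟨h1.trans ht.1, ht.2.trans h3⟩, ?_, ?_⟩
    · simp only [hY, OrderIso.le_symm_apply, Speed.phase_zero]; linarith
    · simp only [hY, OrderIso.symm_apply_le]; linarith
  have htri : ∀ η ∈ Icc A B, ∀ t ∈ Icc (s η) (e η), (X t, Y η t) ∈ triangle := fun η hη t ht => by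
    obtain ⟨h1, h2, h3⟩ := hYmem η hη t ht
    exact ⟨h2, h3, (hXmem t h1).2.trans hx₀.2⟩
  set H : ℝ → ℝ → ℝ := fun η t => F (X t) (Y η t) * u (Y η t) t with hH
  set g : ℝ → ℝ → ℝ := fun η t =>
    -G (X t) (Y η t) * u (Y η t) t + F (X t) (Y η t) * f (Y η t) t with hg
  have hXY : Measurable fun w : ℝ × ℝ => (X w.2, Y w.1 w.2) :=
    ((hXc.comp continuous_snd).prodMk hYc).measurable
  have hYt : Measurable fun w : ℝ × ℝ => (Y w.1 w.2, w.2) :=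
    (hYc.prodMk continuous_snd).measurable
  have hHm : Measurable (Function.uncurry H) :=
    (hF.measurable.comp hXY).mul (hum.comp hYt)
  have hgm : Measurable (Function.uncurry g) :=
    ((hG.measurable.comp hXY).neg.mul (hum.comp hYt)).add
      ((hF.measurable.comp hXY).mul (hf.comp hYt))
  have hmul : ∀ {a c : ℝ}, |a| ≤ M → |c| ≤ M → |a * c| ≤ M * M :=
    fun ha hc => by rw [abs_mul]; exact mul_le_mul ha hc (abs_nonneg _) hM0
  have hHM : ∀ η ∈ Icc A B, ∀ t ∈ Icc (s η) (e η), |H η t| ≤ M * M := fun η hη t ht =>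
    hmul (hFM _ _) (huM _ (triangle_snd_mem (htri η hη t ht)) _ (hYmem η hη t ht).1)
  have hgM : ∀ η ∈ Icc A B, ∀ t ∈ Icc (s η) (e η), |g η t| ≤ M * M + M * M := fun η hη t ht =>
    (abs_add_le _ _).trans (add_le_add
      (hmul (by rw [abs_neg]; exact hGM _ _)
        (huM _ (triangle_snd_mem (htri η hη t ht)) _ (hYmem η hη t ht).1))
      (hmul (hFM _ _) (hfM _ (triangle_snd_mem (htri η hη t ht)) _ (hYmem η hη t ht).1)))
  have hi : ∀ r : ℝ → ℝ, Continuous r → (∀ η ∈ Icc A B, r η ∈ Icc (s η) (e η)) →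
      IntervalIntegrable (fun η => H η (r η)) volume A B := fun r hr hrm =>
    intervalIntegrable_of_bounded hAB (hHm.comp (measurable_id.prodMk hr.measurable))
      fun η hη => hHM η hη _ (hrm η hη)
  have hent := hi s hsc fun η hη => ⟨le_rfl, (hse η hη).2.1⟩
  have hext := hi e hec fun η hη => ⟨(hse η hη).2.1, le_rfl⟩
  have key := integral_exit_sub_entry (A := A) (B := B) (a := t₀) (b := C) (s := s) (e := e)
    (hin := fun η => H η (s η)) (hout := fun η => H η (e η)) (α := fun t => -t)
    (β := fun t => P.s₁.phase (X t) - t) (g := g) hAB ht₀C hsc.measurable hec.measurable hgm hse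
    hgM hent hext ?_ ?_ ?_
  · have h1 : ∫ η in A..B, H η (e η) =
        ∫ y in (0 : ℝ)..x₀, F y y * u y (C - P.s₂.phase y) / P.s₀.e y := by
      have h2 := P.s₀.integral_phase hx₀.1 fun ξ => H (ξ - C) (e (ξ - C))
      have h3 := intervalIntegral.integral_comp_sub_right (a := P.s₀.phase 0)
        (b := P.s₀.phase x₀) (fun η => H η (e η)) C
      have h4 : P.s₀.phase 0 - C = A := by simp [hA]
      have h5 : P.s₀.phase x₀ - C = B := by rw [P.s₀_phase, hB, hC]; ring
      rw [h4, h5] at h3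
      rw [← h3, h2]
      congr 1
      ext y
      have h6 : z (P.s₀.phase y - C) = y := by simp [hz]
      have h7 : X (C - P.s₂.phase y) = y := by simp [hX]
      have h8 : Y (P.s₀.phase y - C) (C - P.s₂.phase y) = y := by
        simp only [hY, P.s₀_phase]
        rw [OrderIso.symm_apply_eq]; ring
      simp only [hH, he, h6, h7, h8]
    have h2 : ∫ η in A..B, H η (s η) = (∫ t in t₀..C, F (X t) 0 * u 0 t) +
        ∫ y in (0 : ℝ)..x₀, F x₀ y * u y t₀ / P.s₁.e y := by
      have hm1 : -t₀ ∈ uIcc A B := by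
        rw [uIcc_of_le hAB]; constructor <;> linarith [P.s₁.phase_nonneg hx₀.1]
      rw [← intervalIntegral.integral_add_adjacent_intervals (b := -t₀)
        (hent.mono_set (uIcc_subset_uIcc left_mem_uIcc hm1))
        (hent.mono_set (uIcc_subset_uIcc hm1 right_mem_uIcc))]
      congr 1
      · have h3 := intervalIntegral.integral_comp_neg (a := A) (b := -t₀)
          (fun t => F (X t) 0 * u 0 t)
        rw [neg_neg, hA, neg_neg] at h3
        rw [← h3]
        refine intervalIntegral.integral_congr fun η hη => ?_
        rw [uIcc_of_le (by linarith)] at hη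
        have h4 : s η = -η := max_eq_right (by linarith [hη.2])
        have h5 : Y η (-η) = 0 := by simp [hY]
        simp only [hH, h4, h5]
      · have h3 := P.s₁.integral_phase hx₀.1 fun ξ => H (ξ - t₀) t₀
        have h4 := intervalIntegral.integral_comp_sub_right (a := P.s₁.phase 0)
          (b := P.s₁.phase x₀) (fun η => H η t₀) t₀
        rw [P.s₁.phase_zero, zero_sub] at h4
        rw [P.s₁.phase_zero, h4] at h3
        have h5 : ∀ y, Y (P.s₁.phase y - t₀) t₀ = y := fun y => by simp [hY]
        simp only [hH, h5, hX₀] at h3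
        rw [← h3]
        refine intervalIntegral.integral_congr fun η hη => ?_
        rw [uIcc_of_le (by linarith [P.s₁.phase_nonneg hx₀.1])] at hη
        have h4 : s η = t₀ := max_eq_left (by linarith [hη.1])
        simp only [hH, h4, hX₀]
    rw [h1, h2] at key
    rw [key]
    refine intervalIntegral.integral_congr fun t ht => ?_
    rw [uIcc_of_le ht₀C] at ht
    have h3 := P.s₁.integral_phase (hXmem t ht).1 fun ξ => g (ξ - t) t
    have h4 := intervalIntegral.integral_comp_sub_right (a := P.s₁.phase 0)
      (b := P.s₁.phase (X t)) (fun η => g η t) t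
    rw [P.s₁.phase_zero, zero_sub] at h4
    rw [P.s₁.phase_zero, h4] at h3
    have h5 : ∀ y, Y (P.s₁.phase y - t) t = y := fun y => by simp [hY]
    simp only [hg, h5] at h3
    exact h3
  · intro η hη
    obtain ⟨h1, h2, h3⟩ := hse η hη
    have hfl : ∀ σ, P.s₁.flow (1 * σ) (Y η (s η)) = Y η (s η + σ) := fun σ => by
      simp only [hY, Speed.flow, OrderIso.apply_symm_apply]; congr 1; ring
    have h4 := kernel_mul_sub_mul (κ := 1) (C := C) (M := M) (y := Y η (s η)) (t := s η)
      (δ := e η - s η) hker hb hG hu hf (by linarith) (ht₀.trans h1) (fun σ hσ => by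
        rw [hfl]; exact htri η hη _ ⟨by linarith [hσ.1], by linarith [hσ.2]⟩) (fun σ hσ => by
        rw [hfl]
        have h5 : s η + σ ∈ Icc (s η) (e η) := ⟨by linarith [hσ.1], by linarith [hσ.2]⟩
        exact hfM _ (triangle_snd_mem (htri η hη _ h5)) _ (hYmem η hη _ h5).1)
    simp only [hfl, add_sub_cancel] at h4
    have h9 := intervalIntegral.integral_comp_sub_right (a := s η) (b := e η)
      (fun σ => g η (s η + σ)) (s η)
    simp only [sub_self, add_sub_cancel] at h9
    simp only [hH, h9]
    exact h4
  · intro t ht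
    have h1 := P.s₁.phase_nonneg (hXmem t ht).1
    have h2 := P.s₁.phase.monotone (hXmem t ht).2
    exact ⟨by linarith [ht.2], by linarith, by linarith [ht.1]⟩
  · intro t ht η hη
    rw [hte, hzX, hs, max_le_iff]
    constructor
    · rintro ⟨⟨h1, h2⟩, h3⟩; exact ⟨by linarith, h3⟩
    · rintro ⟨h1, h2⟩; exact ⟨⟨ht.1, by linarith⟩, h2⟩

end DelayedHyperbolic

namespace DelayedHyperbolic

/-- Balance of `F u` on the region `0 ≤ y ≤ X(t)`, `t₀ ≤ t ≤ C`, swept by the characteristics of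
`u₂`; its upper boundary `X` is itself one of them, so that `F u` may be extended by zero beyond
it. -/
lemma triangle_balance₂ {P : Plant} {C x₀ t₀ M : ℝ} {b : ℝ → ℝ} {F G u f : ℝ → ℝ → ℝ}
    (hx₀ : x₀ ∈ Icc (0 : ℝ) 1) (ht₀ : 0 ≤ t₀) (hC : C = t₀ + P.s₂.phase x₀)
    (hker : SolvesAlongCharacteristics triangle P.ε₂ b F G)
    (hb : ∀ y ∈ Icc (0 : ℝ) 1, b y = -(-1) * P.s₂.e y) (hF : Continuous (Function.uncurry F))
    (hG : Continuous (Function.uncurry G)) (hFM : ∀ x y, |F x y| ≤ M) (hGM : ∀ x y, |G x y| ≤ M)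
    (hu : Transported P.s₂ (-1) (Ici 0) u f) (hum : Measurable (Function.uncurry u))
    (hf : Measurable (Function.uncurry f))
    (huM : ∀ x ∈ Icc (0 : ℝ) 1, ∀ t ∈ Icc t₀ C, |u x t| ≤ M)
    (hfM : ∀ x ∈ Icc (0 : ℝ) 1, ∀ t ∈ Icc t₀ C, |f x t| ≤ M) :
    -(∫ y in (0 : ℝ)..x₀, F x₀ y * u y t₀ / P.s₂.e y) =
      (∫ t in t₀..C, ∫ y in (0 : ℝ)..P.s₂.phase.symm (C - t),
        (-G (P.s₂.phase.symm (C - t)) y * u y t + F (P.s₂.phase.symm (C - t)) y * f y t) /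
          P.s₂.e y) - ∫ t in t₀..C, F (P.s₂.phase.symm (C - t)) 0 * u 0 t := by
  set X : ℝ → ℝ := fun t => P.s₂.phase.symm (C - t) with hX
  have hXc : Continuous X := by simp only [hX]; fun_prop
  have hM0 : 0 ≤ M := (abs_nonneg _).trans (hFM 0 0)
  have hL := P.s₂.phase_nonneg hx₀.1
  have ht₀C : t₀ ≤ C := by linarith
  have hX₀ : X t₀ = x₀ := by simp [hX, hC]
  have hX₁ : X C = 0 := by simp [hX]
  have hXmem : ∀ t ∈ Icc t₀ C, 0 ≤ X t ∧ X t ≤ x₀ := fun t ht => by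
    simp only [hX, OrderIso.le_symm_apply, OrderIso.symm_apply_le, P.s₂.phase_zero]
    constructor <;> linarith [ht.1, ht.2]
  have hle : ∀ y t, y ≤ X t ↔ P.s₂.phase y ≤ C - t := fun y t => by
    simp only [hX, OrderIso.le_symm_apply]
  set R : Set (ℝ × ℝ) := {z | z.1 ≤ X z.2} with hR
  have hRm : MeasurableSet R := measurableSet_le measurable_fst (hXc.measurable.comp measurable_snd)
  have hXm : Measurable fun w : ℝ × ℝ => (X w.2, w.1) :=
    ((hXc.comp continuous_snd).prodMk continuous_fst).measurable
  set H : ℝ → ℝ → ℝ := fun y t => F (X t) y * u y t with hH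
  set g : ℝ → ℝ → ℝ := fun y t => -G (X t) y * u y t + F (X t) y * f y t with hg
  have hHm : Measurable (Function.uncurry H) := (hF.measurable.comp hXm).mul hum
  have hgm : Measurable (Function.uncurry g) :=
    ((hG.measurable.comp hXm).neg.mul hum).add ((hF.measurable.comp hXm).mul hf)
  set H' : ℝ → ℝ → ℝ := fun y t => R.indicator (Function.uncurry H) (y, t) with hH'
  set g' : ℝ → ℝ → ℝ := fun y t => R.indicator (Function.uncurry g) (y, t) with hg'
  have hmul : ∀ {a c : ℝ}, |a| ≤ M → |c| ≤ M → |a * c| ≤ M * M :=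
    fun ha hc => by rw [abs_mul]; exact mul_le_mul ha hc (abs_nonneg _) hM0
  have hind : ∀ (k : ℝ → ℝ → ℝ) y t, |k y t| ≤ M * M + M * M →
      |R.indicator (Function.uncurry k) (y, t)| ≤ M * M + M * M := fun k y t hk => by
    rw [indicator]
    split_ifs
    · exact hk
    · rw [abs_zero]; positivity
  have hHM : ∀ y ∈ Icc (0 : ℝ) 1, ∀ t ∈ Icc t₀ C, |H' y t| ≤ M * M + M * M := fun y hy t ht =>
    hind H y t ((hmul (hFM _ _) (huM y hy t ht)).trans (by nlinarith))
  have hgM : ∀ y ∈ Icc (0 : ℝ) 1, ∀ t ∈ Icc t₀ C, |g' y t| ≤ M * M + M * M := fun y hy t ht =>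
    hind g y t ((abs_add_le _ _).trans (add_le_add
      (hmul (by rw [abs_neg]; exact hGM _ _) (huM y hy t ht)) (hmul (hFM _ _) (hfM y hy t ht))))
  have htr : Transported P.s₂ (-1) (Icc t₀ C) H' g' := by
    intro y t δ hδ ht htδ hy
    have hmemR : ∀ σ, (P.s₂.flow (-1 * σ) y, t + σ) ∈ R ↔ y ≤ X t := fun σ => by
      rw [hR, mem_ofPred_eq, hle, hle, Speed.phase_flow]
      constructor <;> intro h <;> linarith
    have hmemR0 : (y, t) ∈ R ↔ y ≤ X t := Iff.rfl
    by_cases hyX : y ≤ X t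
    · simp only [hH', hg', indicator, hmemR, hmemR0, hyX, if_true, Function.uncurry]
      refine kernel_mul_sub_mul (κ := -1) (C := C) (M := M) hker hb hG hu hf hδ (ht₀.trans ht.1)
        (fun σ hσ => ?_) fun σ hσ => hfM _ (hy σ hσ) _
          ⟨by linarith [ht.1, hσ.1], by linarith [htδ.2, hσ.2]⟩
      have h1 := hXmem (t + σ) ⟨by linarith [ht.1, hσ.1], by linarith [htδ.2, hσ.2]⟩
      exact ⟨(hy σ hσ).1, (hmemR σ).2 hyX, h1.2.trans hx₀.2⟩
    · simp only [hH', hg', indicator, hmemR, hmemR0, hyX, if_false, sub_self,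
        intervalIntegral.integral_zero]
  have key := htr.integral_left ht₀C (hHm.indicator hRm) (hgm.indicator hRm) hHM hgM
  -- integrals of functions that vanish beyond `X t`
  have hcut : ∀ (k : ℝ → ℝ → ℝ), ∀ t ∈ Icc t₀ C,
      ∫ y in (0 : ℝ)..1, R.indicator (Function.uncurry k) (y, t) / P.s₂.e y =
        ∫ y in (0 : ℝ)..X t, k y t / P.s₂.e y := fun k t ht => by
    obtain ⟨h1, h2⟩ := hXmem t ht
    have h3 : (fun y => R.indicator (Function.uncurry k) (y, t) / P.s₂.e y) =
        (Iic (X t)).indicator fun y => k y t / P.s₂.e y := by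
      ext y
      by_cases hy : y ≤ X t
      · simp [indicator, hR, hy]
      · simp [indicator, hR, hy]
    rw [h3, intervalIntegral.integral_of_le zero_le_one, intervalIntegral.integral_of_le h1,
      setIntegral_indicator measurableSet_Iic, Ioc_inter_Iic, min_eq_right (h2.trans hx₀.2)]
  have hb1 : ∫ t in t₀..C, (H' 1 t - H' 0 t) = -∫ t in t₀..C, F (X t) 0 * u 0 t := by
    rw [← intervalIntegral.integral_neg]
    refine intervalIntegral.integral_congr_Ioo_of_le ht₀C fun t ht => ?_
    have h1 : X t < 1 := by
      have : X t < X t₀ := by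
        simp only [hX]
        exact P.s₂.phase.symm.strictMono (by linarith [ht.1])
      exact this.trans_le (hX₀.trans_le hx₀.2)
    have h2 := (hXmem t ⟨ht.1.le, ht.2.le⟩).1
    simp [hH', indicator, hR, h1, h2, hH, Function.uncurry]
  rw [hb1] at key
  simp only [hH', hg'] at key
  rw [hcut H C ⟨ht₀C, le_rfl⟩, hcut H t₀ ⟨le_rfl, ht₀C⟩, hX₀, hX₁, intervalIntegral.integral_same,
    zero_sub] at key
  simp only [hH, hX₀] at key
  rw [key, sub_eq_add_neg]
  congr 1
  refine intervalIntegral.integral_congr fun t ht => ?_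
  rw [uIcc_of_le ht₀C] at ht
  exact hcut g t ht

lemma exists_bound_comp_toTriangle {f : ℝ × ℝ → ℝ} (hf : ContinuousOn f triangle) :
    ∃ M, 0 ≤ M ∧ ∀ z, |f (toTriangle z)| ≤ M := by
  have hc : IsCompact (Icc (0 : ℝ) 1 ×ˢ Icc (0 : ℝ) 1) := isCompact_Icc.prod isCompact_Icc
  obtain ⟨M, hM⟩ := hc.exists_bound_of_continuousOn
    (continuous_comp_toTriangle hf).continuousOn
  have h1 : ∀ z : ℝ × ℝ, toTriangle (clamp z.1, clamp z.2) = toTriangle z := fun z => by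
    simp [toTriangle, Plant.clamp_clamp]
  refine ⟨M, (abs_nonneg _).trans (hM (0, 0) (by simp)), fun z => ?_⟩
  rw [← h1]
  exact hM (clamp z.1, clamp z.2) ⟨clamp_mem _, clamp_mem _⟩

/-- The backstepping transformation `u₂ - ∫₀ˣ (K²¹ u₁ + K²² u₂)` turns the equation for `u₂` into
pure transport: its value at `(x,t)` is the one at `x = 0` at the arrival time. -/
theorem IsMildSolution.backstepping {P : Plant} {K21 K22 α₁ α₂ u₁ u₂ v : ℝ → ℝ → ℝ}
    (h : IsMildSolution P α₁ α₂ u₁ u₂ v) (hK : IsBacksteppingKernel P K21 K22)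
    {x₀ t₀ : ℝ} (hx₀ : x₀ ∈ Icc (0 : ℝ) 1) (ht₀ : 0 ≤ t₀) :
    u₂ x₀ t₀ = u₂ 0 (t₀ + P.s₂.phase x₀) + (∫ y in (0 : ℝ)..x₀, K21 x₀ y * u₁ y t₀) +
      ∫ y in (0 : ℝ)..x₀, K22 x₀ y * u₂ y t₀ := by
  obtain ⟨C, hC⟩ : ∃ C, C = t₀ + P.s₂.phase x₀ := ⟨_, rfl⟩
  have e1 : ∀ x, P.s₁.e x ≠ 0 := fun x => (P.s₁.pos x).ne'
  have e2 : ∀ x, P.s₂.e x ≠ 0 := fun x => (P.s₂.pos x).ne'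
  have h0 : (0 : ℝ) ∈ Icc (0 : ℝ) 1 := by simp
  have hL := P.s₂.phase_nonneg hx₀.1
  have ht₀C : t₀ ≤ C := by linarith
  obtain ⟨N₁, hN₁0, hN₁⟩ := exists_bound_comp_toTriangle hK.cont₁
  obtain ⟨N₂, hN₂0, hN₂⟩ := exists_bound_comp_toTriangle hK.cont₂
  have hc₁ := continuous_comp_toTriangle hK.cont₁
  have hc₂ := continuous_comp_toTriangle hK.cont₂
  set κ₁ : ℝ → ℝ → ℝ := fun x y => K21 (toTriangle (x, y)).1 (toTriangle (x, y)).2 with hκ₁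
  set κ₂ : ℝ → ℝ → ℝ := fun x y => K22 (toTriangle (x, y)).1 (toTriangle (x, y)).2 with hκ₂
  have hκ₁c : Continuous (Function.uncurry κ₁) := hc₁
  have hκ₂c : Continuous (Function.uncurry κ₂) := hc₂
  have hκ₁e : ∀ z ∈ triangle, κ₁ z.1 z.2 = K21 z.1 z.2 := fun z hz => by
    simp only [hκ₁, toTriangle_of_mem (z := (z.1, z.2)) hz]
  have hκ₂e : ∀ z ∈ triangle, κ₂ z.1 z.2 = K22 z.1 z.2 := fun z hz => by
    simp only [hκ₂, toTriangle_of_mem (z := (z.1, z.2)) hz]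
  obtain ⟨E₁, hE₁0, hE₁⟩ := P.exists_bound_s₁
  obtain ⟨E₂, hE₂0, hE₂⟩ := P.exists_bound_s₂
  obtain ⟨C₁, hC₁0, hC₁⟩ := P.exists_bound_k₁
  obtain ⟨C₂, hC₂0, hC₂⟩ := P.exists_bound_k₂
  obtain ⟨B, hB⟩ := h.bdd C
  have hB' : ∀ x ∈ Icc (0 : ℝ) 1, ∀ t ∈ Icc t₀ C, |u₁ x t| ≤ B ∧ |u₂ x t| ≤ B :=
    fun x hx t ht => ⟨(hB x hx t ⟨ht₀.trans ht.1, ht.2⟩).1, (hB x hx t ⟨ht₀.trans ht.1, ht.2⟩).2.1⟩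
  have hB0 : 0 ≤ B := (abs_nonneg _).trans (hB' 0 h0 t₀ ⟨le_rfl, ht₀C⟩).1
  have hmul : ∀ {a b c d : ℝ}, |a| ≤ b → |c| ≤ d → 0 ≤ b → |a * c| ≤ b * d :=
    fun ha hc hb => by rw [abs_mul]; exact mul_le_mul ha hc (abs_nonneg _) hb
  set F₁ : ℝ → ℝ → ℝ := fun x y => P.s₁.e y * κ₁ x y with hF₁
  set F₂ : ℝ → ℝ → ℝ := fun x y => P.s₂.e y * κ₂ x y with hF₂
  set G₁ : ℝ → ℝ → ℝ := fun x y => P.s₁.e y * (P.k₂ y * κ₂ x y) with hG₁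
  set G₂ : ℝ → ℝ → ℝ := fun x y => P.s₂.e y * (P.k₁ y * κ₁ x y) with hG₂
  set M : ℝ := E₁ * N₁ + E₂ * N₂ + E₁ * (C₂ * N₂) + E₂ * (C₁ * N₁) + B + C₁ * B + C₂ * B with hM
  have p1 : 0 ≤ E₁ * N₁ := by positivity
  have p2 : 0 ≤ E₂ * N₂ := by positivity
  have p3 : 0 ≤ E₁ * (C₂ * N₂) := by positivity
  have p4 : 0 ≤ E₂ * (C₁ * N₁) := by positivity
  have p5 : 0 ≤ C₁ * B := by positivity
  have p6 : 0 ≤ C₂ * B := by positivity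
  have k1 : ∀ z ∈ triangle, P.ε₁ z.2 * K21 z.1 z.2 = F₁ z.1 z.2 := fun z hz => by
    simp only [hF₁, hκ₁e z hz, P.s₁_e (triangle_snd_mem hz)]
  have k2 : ∀ z ∈ triangle, P.ε₂ z.2 * K22 z.1 z.2 = F₂ z.1 z.2 := fun z hz => by
    simp only [hF₂, hκ₂e z hz, P.s₂_e (triangle_snd_mem hz)]
  have key₁ := triangle_balance₁ (M := M) hx₀ ht₀ hC (F := F₁) (G := G₁)
    (hK.eqs.eq₁.congr k1 fun z hz => by
      simp only [hG₁, hκ₂e z hz, P.s₁_e (triangle_snd_mem hz), P.k₂_eq (triangle_snd_mem hz)])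
    (fun y hy => by rw [P.s₁_e hy, neg_one_mul])
    ((P.continuous_s₁.comp continuous_snd).mul hκ₁c)
    ((P.continuous_s₁.comp continuous_snd).mul ((P.continuous_k₂.comp continuous_snd).mul hκ₂c))
    (fun x y => (hmul (hE₁ y) (hN₁ (x, y)) hE₁0).trans (by linarith))
    (fun x y => (hmul (hE₁ y) (hmul (hC₂ y) (hN₂ (x, y)) hC₂0) hE₁0).trans (by linarith))
    h.eq₁ h.meas₁ ((P.continuous_k₁.measurable.comp measurable_fst).mul h.meas₂)
    (fun x hx t ht => (hB' x hx t ht).1.trans (by linarith))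
    (fun x hx t ht => (hmul (hC₁ x) (hB' x hx t ht).2 hC₁0).trans (by linarith))
  have key₂ := triangle_balance₂ (M := M) hx₀ ht₀ hC (F := F₂) (G := G₂)
    (hK.eqs.eq₂.congr k2 fun z hz => by
      simp only [hG₂, hκ₁e z hz, P.s₂_e (triangle_snd_mem hz), P.k₁_eq (triangle_snd_mem hz)])
    (fun y hy => by rw [P.s₂_e hy]; ring)
    ((P.continuous_s₂.comp continuous_snd).mul hκ₂c)
    ((P.continuous_s₂.comp continuous_snd).mul ((P.continuous_k₁.comp continuous_snd).mul hκ₁c))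
    (fun x y => (hmul (hE₂ y) (hN₂ (x, y)) hE₂0).trans (by linarith))
    (fun x y => (hmul (hE₂ y) (hmul (hC₁ y) (hN₁ (x, y)) hC₁0) hE₂0).trans (by linarith))
    h.eq₂ h.meas₂ ((P.continuous_k₂.measurable.comp measurable_fst).mul h.meas₁)
    (fun x hx t ht => (hB' x hx t ht).2.trans (by linarith))
    (fun x hx t ht => (hmul (hC₂ x) (hB' x hx t ht).1 hC₂0).trans (by linarith))
  -- the sources cancel
  have hcancel : (∫ t in t₀..C, ∫ y in (0 : ℝ)..P.s₂.phase.symm (C - t),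
        (-G₂ (P.s₂.phase.symm (C - t)) y * u₂ y t +
          F₂ (P.s₂.phase.symm (C - t)) y * (P.k₂ y * u₁ y t)) / P.s₂.e y) =
      -∫ t in t₀..C, ∫ y in (0 : ℝ)..P.s₂.phase.symm (C - t),
        (-G₁ (P.s₂.phase.symm (C - t)) y * u₁ y t +
          F₁ (P.s₂.phase.symm (C - t)) y * (P.k₁ y * u₂ y t)) / P.s₁.e y := by
    rw [← intervalIntegral.integral_neg]
    congr 1
    ext t
    rw [← intervalIntegral.integral_neg]
    congr 1
    ext y
    have := e1 y
    have := e2 y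
    simp only [hG₁, hG₂, hF₁, hF₂]
    field_simp
    ring
  -- the boundary terms at `y = 0` cancel
  have hbd : ∫ t in t₀..C, F₂ (P.s₂.phase.symm (C - t)) 0 * u₂ 0 t =
      ∫ t in t₀..C, F₁ (P.s₂.phase.symm (C - t)) 0 * u₁ 0 t := by
    refine intervalIntegral.integral_congr fun t ht => ?_
    rw [uIcc_of_le ht₀C] at ht
    have hXt : P.s₂.phase.symm (C - t) ∈ Icc (0 : ℝ) 1 := by
      have h2 := P.s₂.phase.monotone hx₀.2
      rw [mem_Icc, OrderIso.le_symm_apply, OrderIso.symm_apply_le, P.s₂.phase_zero]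
      constructor <;> linarith [ht.1, ht.2]
    have hz : (P.s₂.phase.symm (C - t), (0 : ℝ)) ∈ triangle := ⟨le_rfl, hXt.1, hXt.2⟩
    have h3 := hK.bottom _ hXt
    simp only [← k1 _ hz, ← k2 _ hz, h3, h.left t (ht₀.trans ht.1)]
    ring
  -- the exit through the diagonal is the source of `u₂` along its characteristic
  have hdiag : ∫ y in (0 : ℝ)..x₀, F₁ y y * u₁ y (C - P.s₂.phase y) / P.s₀.e y =
      u₂ x₀ t₀ - u₂ 0 C := by
    have h1 := h.eq₂ x₀ t₀ (P.s₂.phase x₀) hL ht₀ (add_nonneg ht₀ hL) fun σ hσ => by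
      have h2 := P.s₂.phase.monotone hx₀.2
      rw [mem_Icc, Speed.le_flow_iff, Speed.flow_le_iff, P.s₂.phase_zero]
      constructor <;> linarith [hσ.1, hσ.2]
    have h2 : P.s₂.flow (-1 * P.s₂.phase x₀) x₀ = 0 := by
      rw [Speed.flow_eq_iff, P.s₂.phase_zero]; ring
    rw [h2, ← hC] at h1
    have h3 := P.s₂.integral_phase hx₀.1 fun ξ =>
      P.k₂ (P.s₂.phase.symm ξ) * u₁ (P.s₂.phase.symm ξ) (C - ξ)
    have h4 := intervalIntegral.integral_comp_sub_left (a := 0) (b := P.s₂.phase x₀)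
      (fun ξ => P.k₂ (P.s₂.phase.symm ξ) * u₁ (P.s₂.phase.symm ξ) (C - ξ)) (P.s₂.phase x₀)
    rw [sub_self, sub_zero] at h4
    rw [P.s₂.phase_zero, ← h4] at h3
    have h5 : ∀ σ, P.s₂.flow (-1 * σ) x₀ = P.s₂.phase.symm (P.s₂.phase x₀ - σ) := fun σ => by
      rw [Speed.flow]; congr 1; ring
    have h6 : ∀ σ, C - (P.s₂.phase x₀ - σ) = t₀ + σ := fun σ => by rw [hC]; ring
    simp only [h6] at h3
    simp only [h5, h3] at h1
    rw [← neg_sub (u₂ 0 C), h1, ← intervalIntegral.integral_neg]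
    refine intervalIntegral.integral_congr fun y hy => ?_
    rw [uIcc_of_le hx₀.1] at hy
    have hy' : y ∈ Icc (0 : ℝ) 1 := ⟨hy.1, hy.2.trans hx₀.2⟩
    have hz : (y, y) ∈ triangle := ⟨hy.1, le_rfl, hy'.2⟩
    have h7 : F₁ y y = P.s₁.e y * (-P.k₂ y / (P.s₁.e y + P.s₂.e y)) := by
      rw [← k1 _ hz, hK.diag y hy', P.k₂_eq hy', P.s₁_e hy', P.s₂_e hy']
    have h8 := P.one_div_s₀ y
    have h9 := e1 y
    have h10 := e2 y
    have h11 : P.s₁.e y + P.s₂.e y ≠ 0 := (add_pos (P.s₁.pos y) (P.s₂.pos y)).ne'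
    simp only [OrderIso.symm_apply_apply, h7]
    rw [div_eq_mul_one_div, h8]
    field_simp
    ring
  have r1 : ∫ y in (0 : ℝ)..x₀, F₁ x₀ y * u₁ y t₀ / P.s₁.e y =
      ∫ y in (0 : ℝ)..x₀, K21 x₀ y * u₁ y t₀ :=
    intervalIntegral.integral_congr fun y hy => by
      rw [uIcc_of_le hx₀.1] at hy
      have := e1 y
      simp only [hF₁, hκ₁e (x₀, y) ⟨hy.1, hy.2, hx₀.2⟩]
      field_simp
  have r2 : ∫ y in (0 : ℝ)..x₀, F₂ x₀ y * u₂ y t₀ / P.s₂.e y =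
      ∫ y in (0 : ℝ)..x₀, K22 x₀ y * u₂ y t₀ :=
    intervalIntegral.integral_congr fun y hy => by
      rw [uIcc_of_le hx₀.1] at hy
      have := e2 y
      simp only [hF₂, hκ₂e (x₀, y) ⟨hy.1, hy.2, hx₀.2⟩]
      field_simp
  rw [hdiag, r1] at key₁
  rw [r2, hcancel, hbd] at key₂
  rw [← hC]
  linarith

end DelayedHyperbolic

namespace DelayedHyperbolic

/-! ### Finite-time stability of bounded solutions -/

lemma abs_integral_mul_le {f g : ℝ → ℝ} {x N B D : ℝ} {n : ℕ} (hx : 0 ≤ x) (hN : 0 ≤ N)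
    (hf : ∀ y ∈ Icc 0 x, |f y| ≤ N) (hg : ∀ y ∈ Icc 0 x, |g y| ≤ B * (D * y) ^ n / n.factorial) :
    |∫ y in (0 : ℝ)..x, f y * g y| ≤ N * (B * D ^ n * x ^ (n + 1) / (n + 1).factorial) := by
  have h1 : Continuous fun y : ℝ => N * (B * (D * y) ^ n / n.factorial) := by fun_prop
  refine (intervalIntegral.norm_integral_le_of_norm_le (f := fun y => f y * g y)
    (μ := volume) hx (Filter.Eventually.of_forall
    fun y hy => ?_) (h1.intervalIntegrable (μ := volume) 0 x)).trans (le_of_eq ?_)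
  · rw [Real.norm_eq_abs, abs_mul]
    exact mul_le_mul (hf y ⟨hy.1.le, hy.2⟩) (hg y ⟨hy.1.le, hy.2⟩) (abs_nonneg _) hN
  · have h2 : (fun y : ℝ => N * (B * (D * y) ^ n / n.factorial)) =
        fun y => (N * (B * D ^ n / n.factorial)) * y ^ n := by
      ext y; rw [mul_pow]; ring
    rw [h2, intervalIntegral.integral_const_mul, integral_pow, Nat.factorial_succ]
    push_cast
    have : (n.factorial : ℝ) ≠ 0 := by positivity
    field_simp
    ring

namespace IsMildSolution

variable {P : Plant} {K21 K22 α₁ α₂ u₁ u₂ v : ℝ → ℝ → ℝ}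

lemma left_eq_zero (h : IsMildSolution P α₁ α₂ u₁ u₂ v) (hK : IsBacksteppingKernel P K21 K22)
    (hα : IsPredictorKernel P K21 K22 α₁ α₂) {t : ℝ} (ht : P.τ + P.s₂.phase 1 < t) :
    u₂ 0 t = 0 := by
  have hτ := P.τ_pos
  have h1 := h.right_eq hα (t₁ := t - P.s₂.phase 1 - P.τ) (by linarith)
  have h2 := h.backstepping hK (x₀ := 1) (t₀ := t - P.s₂.phase 1) (by simp) (by linarith)
  rw [sub_add_cancel] at h1 h2
  linarith

/-- The value of `u₁`, traced back to the boundary `x = 0`. -/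
lemma u₁_eq (h : IsMildSolution P α₁ α₂ u₁ u₂ v) {x t : ℝ} (hx : x ∈ Icc (0 : ℝ) 1)
    (ht : P.s₁.phase x ≤ t) :
    u₁ x t = P.q * u₂ 0 (t - P.s₁.phase x) + ∫ y in (0 : ℝ)..x,
      P.k₁ y / P.s₁.e y * u₂ y (t - P.s₁.phase x + P.s₁.phase y) := by
  have h0 := P.s₁.phase_nonneg hx.1
  have h1 := h.eq₁ 0 (t - P.s₁.phase x) (P.s₁.phase x) h0 (sub_nonneg.2 ht)
    (by rw [sub_add_cancel]; exact h0.trans ht) fun σ hσ => by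
      have h2 := P.s₁.phase.monotone hx.2
      rw [mem_Icc, Speed.le_flow_iff, Speed.flow_le_iff, P.s₁.phase_zero]
      constructor <;> linarith [hσ.1, hσ.2]
  have h2 : P.s₁.flow (1 * P.s₁.phase x) 0 = x := by
    rw [Speed.flow_eq_iff, P.s₁.phase_zero]; ring
  have h3 : ∀ σ, P.s₁.flow (1 * σ) 0 = P.s₁.phase.symm σ := fun σ => by
    rw [Speed.flow, P.s₁.phase_zero, one_mul, zero_add]
  have h4 := P.s₁.integral_phase hx.1 fun σ =>
    P.k₁ (P.s₁.phase.symm σ) * u₂ (P.s₁.phase.symm σ) (t - P.s₁.phase x + σ)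
  rw [P.s₁.phase_zero] at h4
  rw [h2, sub_add_cancel, h.left _ (sub_nonneg.2 ht)] at h1
  simp only [h3, h4, OrderIso.symm_apply_apply] at h1
  rw [← sub_eq_iff_eq_add', h1]
  congr 1
  ext y
  ring

/-- A bounded solution vanishes after the final time: `u₂(0,·)` vanishes by the backstepping
transformation, and the Volterra equations in `x` that `u₁` and `u₂` satisfy from there on are
iterated. -/
theorem eq_zero (h : IsMildSolution P α₁ α₂ u₁ u₂ v) (hK : IsBacksteppingKernel P K21 K22)
    (hα : IsPredictorKernel P K21 K22 α₁ α₂) {x t : ℝ} (hx : x ∈ Icc (0 : ℝ) 1)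
    (ht : finalTime P < t) : u₁ x t = 0 ∧ u₂ x t = 0 ∧ v x t = 0 := by
  have hτ := P.τ_pos
  rw [P.finalTime_eq] at ht
  set t₂ := P.τ + P.s₂.phase 1 with ht₂
  have ht₂0 : 0 < t₂ := add_pos_of_pos_of_nonneg hτ (P.s₂.phase_nonneg zero_le_one)
  obtain ⟨N₁, hN₁0, hN₁⟩ := exists_bound_comp_toTriangle hK.cont₁
  obtain ⟨N₂, hN₂0, hN₂⟩ := exists_bound_comp_toTriangle hK.cont₂
  have hκ₁ : ∀ {x y}, (x, y) ∈ triangle → |K21 x y| ≤ N₁ := fun {x y} hz => by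
    simpa only [toTriangle_of_mem hz] using hN₁ (x, y)
  have hκ₂ : ∀ {x y}, (x, y) ∈ triangle → |K22 x y| ≤ N₂ := fun {x y} hz => by
    simpa only [toTriangle_of_mem hz] using hN₂ (x, y)
  obtain ⟨N₃, hN₃⟩ := (isCompact_Icc (a := (0 : ℝ)) (b := 1)).exists_bound_of_continuousOn
    (f := fun y => P.k₁ y / P.s₁.e y)
    (P.continuous_k₁.div P.continuous_s₁ fun y => (P.s₁.pos y).ne').continuousOn
  have hN₃0 : 0 ≤ N₃ := (norm_nonneg _).trans (hN₃ 0 (by simp))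
  set D := N₁ + N₂ + N₃ with hD
  have main : ∀ T, ∀ x ∈ Icc (0 : ℝ) 1, ∀ t, t₂ + P.s₁.phase x < t → t ≤ T →
      u₁ x t = 0 ∧ u₂ x t = 0 := by
    intro T
    obtain ⟨B, hB⟩ := h.bdd T
    have ind : ∀ n : ℕ, ∀ x ∈ Icc (0 : ℝ) 1, ∀ t, t₂ + P.s₁.phase x < t → t ≤ T →
        |u₁ x t| ≤ B * (D * x) ^ n / n.factorial ∧
          |u₂ x t| ≤ B * (D * x) ^ n / n.factorial := by
      intro n
      induction n with
      | zero =>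
        intro x hx t ht htT
        have := hB x hx t ⟨by linarith [P.s₁.phase_nonneg hx.1], htT⟩
        simpa using ⟨this.1, this.2.1⟩
      | succ n ih =>
        intro x hx t ht htT
        have hB0 : 0 ≤ B := (abs_nonneg _).trans
          (hB x hx t ⟨by linarith [P.s₁.phase_nonneg hx.1], htT⟩).1
        have hyx : ∀ y ∈ Icc 0 x, y ∈ Icc (0 : ℝ) 1 := fun y hy => ⟨hy.1, hy.2.trans hx.2⟩
        have hR : B * (D * x) ^ (n + 1) / (n + 1).factorial =
            D * (B * D ^ n * x ^ (n + 1) / (n + 1).factorial) := by rw [mul_pow]; ring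
        have hR0 : 0 ≤ B * D ^ n * x ^ (n + 1) / (n + 1).factorial := by
          have := hx.1
          positivity
        have hφ := P.s₁.phase_nonneg hx.1
        have hφ2 := P.s₂.phase_nonneg hx.1
        rw [hR]
        constructor
        · rw [h.u₁_eq hx (by linarith), h.left_eq_zero hK hα (by linarith), mul_zero, zero_add]
          refine (abs_integral_mul_le (D := D) (B := B) (n := n) hx.1 hN₃0
            (fun y hy => hN₃ y (hyx y hy)) fun y hy => (ih y (hyx y hy) _ (by linarith) ?_).2).trans
            (mul_le_mul_of_nonneg_right (by linarith) hR0)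
          have := P.s₁.phase.monotone hy.2
          linarith
        · have h3 : ∀ y ∈ Icc 0 x, t₂ + P.s₁.phase y < t := fun y hy => by
            have := P.s₁.phase.monotone hy.2
            linarith
          have h1 := abs_integral_mul_le (D := D) (B := B) (n := n) (f := fun y => K21 x y)
            (g := fun y => u₁ y t) hx.1 hN₁0
            (fun y hy => hκ₁ ⟨hy.1, hy.2, hx.2⟩) fun y hy => (ih y (hyx y hy) t (h3 y hy) htT).1
          have h2 := abs_integral_mul_le (D := D) (B := B) (n := n) (f := fun y => K22 x y)
            (g := fun y => u₂ y t) hx.1 hN₂0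
            (fun y hy => hκ₂ ⟨hy.1, hy.2, hx.2⟩) fun y hy => (ih y (hyx y hy) t (h3 y hy) htT).2
          rw [h.backstepping hK hx (by linarith), h.left_eq_zero hK hα (by linarith), zero_add]
          refine (abs_add_le _ _).trans ((add_le_add h1 h2).trans ?_)
          rw [← add_mul]
          exact mul_le_mul_of_nonneg_right (by linarith) hR0
    intro x hx t ht htT
    have hlim : Filter.Tendsto (fun n : ℕ => B * (D * x) ^ n / n.factorial) Filter.atTop
        (nhds 0) := by
      have := (FloorSemiring.tendsto_pow_div_factorial_atTop (D * x)).const_mul B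
      simpa only [mul_zero, mul_div_assoc] using this
    constructor
    · exact abs_nonpos_iff.1 (ge_of_tendsto' hlim fun n => (ind n x hx t ht htT).1)
    · exact abs_nonpos_iff.1 (ge_of_tendsto' hlim fun n => (ind n x hx t ht htT).2)
  have hfin : ∀ x ∈ Icc (0 : ℝ) 1, ∀ t, t₂ + P.s₁.phase 1 < t → u₁ x t = 0 ∧ u₂ x t = 0 :=
    fun x hx t ht => main t x hx t (by linarith [P.s₁.phase.monotone hx.2]) le_rfl
  have hL := P.s₁.phase_nonneg zero_le_one
  have h1 : 0 ≤ P.τ * x := mul_nonneg hτ.le hx.1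
  refine ⟨(hfin x hx t ht).1, (hfin x hx t ht).2, ?_⟩
  rw [h.v_eq hx (by linarith), ← h.right _ (by linarith)]
  exact (hfin 1 (by simp) _ (by linarith)).2

end IsMildSolution

end DelayedHyperbolic

namespace DelayedHyperbolic

/-! ### The space `L²([0,1])` -/

lemma memLp_of_bound {h : ℝ → ℝ} {M : ℝ} (hm : Measurable h) (hM : ∀ x ∈ Icc (0 : ℝ) 1, |h x| ≤ M)
    {p : ENNReal} : MemLp h p (volume.restrict (Icc (0 : ℝ) 1)) :=
  MemLp.of_bound hm.aestronglyMeasurable M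
    ((ae_restrict_iff' measurableSet_Icc).2 (Filter.Eventually.of_forall hM))

lemma memLp_of_continuous {h : ℝ → ℝ} (hh : Continuous h) {p : ENNReal} :
    MemLp h p (volume.restrict (Icc (0 : ℝ) 1)) := by
  obtain ⟨M, hM⟩ := isCompact_Icc.exists_bound_of_continuousOn hh.continuousOn
  exact memLp_of_bound hh.measurable hM

lemma L2.integrable (w : L2) : Integrable w (volume.restrict (Icc (0 : ℝ) 1)) :=
  (Lp.memLp w).integrable one_le_two

open Classical in
/-- The continuous linear form `w ↦ ∫₀¹ h w` on `L²`; it is set to zero when `h` is not square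
integrable. -/
noncomputable def pairing (h : ℝ → ℝ) : L2 →L[ℝ] ℝ :=
  if hm : MemLp h 2 (volume.restrict (Icc (0 : ℝ) 1)) then innerSL ℝ (hm.toLp h) else 0

lemma pairing_apply {h : ℝ → ℝ} (hm : MemLp h 2 (volume.restrict (Icc (0 : ℝ) 1))) (w : L2) :
    pairing h w = ∫ x in Icc (0 : ℝ) 1, h x * w x := by
  rw [pairing, dif_pos hm, innerSL_apply_apply, L2.inner_def]
  refine integral_congr_ae ?_
  filter_upwards [hm.coeFn_toLp] with x hx
  rw [hx]
  exact mul_comm _ _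

lemma integrable_mul_L2 {h : ℝ → ℝ} (hm : MemLp h 2 (volume.restrict (Icc (0 : ℝ) 1))) (w : L2) :
    Integrable (fun x => h x * w x) (volume.restrict (Icc (0 : ℝ) 1)) :=
  hm.integrable_mul (Lp.memLp w)

lemma abs_pairing_le {h : ℝ → ℝ} {M : ℝ} (hm : Measurable h) (hM : ∀ x ∈ Icc (0 : ℝ) 1, |h x| ≤ M)
    (w : L2) : |pairing h w| ≤ M * ‖w‖ := by
  have hL := memLp_of_bound hm hM (p := 2)
  have hM0 : 0 ≤ M := (abs_nonneg _).trans (hM 0 (by simp))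
  rw [pairing, dif_pos hL, innerSL_apply_apply]
  refine (abs_real_inner_le_norm _ _).trans (mul_le_mul_of_nonneg_right ?_ (norm_nonneg _))
  have h1 := Lp.norm_le_of_ae_bound (f := hL.toLp h) hM0 (by
    filter_upwards [hL.coeFn_toLp, (ae_restrict_iff' measurableSet_Icc).2
      (Filter.Eventually.of_forall hM)] with x hx hx'
    rw [hx]; exact hx')
  refine h1.trans (le_of_eq ?_)
  simp [measureUnivNNReal]

/-- The linear form `w ↦ ∫₀ˣ m w` on `L²`, where `x` is first moved into `[0,1]`. -/
noncomputable def primitive (m : ℝ → ℝ) (x : ℝ) : L2 →L[ℝ] ℝ :=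
  pairing ((Iic (clamp x)).indicator m)

lemma primitive_eq {m : ℝ → ℝ} (hm : Continuous m) {x : ℝ} (hx : x ∈ Icc (0 : ℝ) 1) (w : L2) :
    primitive m x w = ∫ y in (0 : ℝ)..x, m y * w y := by
  have h1 : MemLp ((Iic (clamp x)).indicator m) 2 (volume.restrict (Icc (0 : ℝ) 1)) :=
    (memLp_of_continuous hm).indicator measurableSet_Iic
  rw [primitive, pairing_apply h1, clamp_of_mem hx]
  have h2 : (fun y => (Iic x).indicator m y * w y) = (Iic x).indicator fun y => m y * w y := by
    ext y; by_cases h : y ≤ x <;> simp [indicator, h]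
  rw [h2, setIntegral_indicator measurableSet_Iic, intervalIntegral.integral_of_le hx.1,
    ← integral_Icc_eq_integral_Ioc]
  congr 2
  ext y
  simp only [mem_inter_iff, mem_Icc, mem_Iic]
  constructor
  · rintro ⟨⟨h1, _⟩, h2⟩; exact ⟨h1, h2⟩
  · rintro ⟨h1, h2⟩; exact ⟨⟨h1, h2.trans hx.2⟩, h2⟩

lemma primitive_clamp (m : ℝ → ℝ) (x : ℝ) : primitive m (clamp x) = primitive m x := by
  rw [primitive, primitive, Plant.clamp_clamp]

lemma primitive_zero {m : ℝ → ℝ} (hm : Continuous m) (w : L2) : primitive m 0 w = 0 := by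
  rw [primitive_eq hm (by simp), intervalIntegral.integral_same]

lemma continuous_primitive_apply {m : ℝ → ℝ} (hm : Continuous m) (w : L2) :
    Continuous fun x => primitive m x w := by
  have h1 : ∀ a b, IntervalIntegrable ((Icc (0 : ℝ) 1).indicator fun y => m y * w y) volume a b :=
    fun a b => ((integrable_indicator_iff measurableSet_Icc).2
      (integrable_mul_L2 (memLp_of_continuous hm) w)).intervalIntegrable
  have h2 : (fun x => primitive m x w) = fun x => ∫ y in (0 : ℝ)..clamp x,
      (Icc (0 : ℝ) 1).indicator (fun y => m y * w y) y := by
    ext x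
    rw [← primitive_clamp, primitive_eq hm (clamp_mem x)]
    refine intervalIntegral.integral_congr fun y hy => ?_
    rw [uIcc_of_le (clamp_mem x).1] at hy
    rw [indicator_of_mem (show y ∈ Icc (0 : ℝ) 1 from ⟨hy.1, hy.2.trans (clamp_mem x).2⟩)]
  rw [h2]
  exact (intervalIntegral.continuous_primitive h1 0).comp continuous_clamp

/-- Joint continuity of `∫₀ˣ m w(t)`. -/
lemma continuous_primitive_comp {m : ℝ → ℝ} (hm : Continuous m) {w : ℝ → L2} (hw : Continuous w) :
    Continuous fun z : ℝ × ℝ => primitive m z.1 (w z.2) := by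
  obtain ⟨M, hM⟩ := (isCompact_Icc (a := (0 : ℝ)) (b := 1)).exists_bound_of_continuousOn
    hm.continuousOn
  have hM0 : 0 ≤ M := (norm_nonneg _).trans (hM 0 (by simp))
  have hb : ∀ x w, |primitive m x w| ≤ M * ‖w‖ := fun x w =>
    abs_pairing_le (hm.measurable.indicator measurableSet_Iic) (fun y hy => by
      rw [indicator]
      split_ifs
      · exact hM y hy
      · simpa using hM0) w
  rw [continuous_iff_continuousAt]
  rintro ⟨x₀, t₀⟩
  have h1 : Filter.Tendsto (fun z : ℝ × ℝ => primitive m z.1 (w z.2 - w t₀)) (nhds (x₀, t₀))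
      (nhds 0) := by
    refine squeeze_zero_norm (a := fun z : ℝ × ℝ => M * ‖w z.2 - w t₀‖) (fun z => hb _ _) ?_
    have : Continuous fun z : ℝ × ℝ => M * ‖w z.2 - w t₀‖ := by fun_prop
    simpa using this.tendsto (x₀, t₀)
  have h2 : Filter.Tendsto (fun z : ℝ × ℝ => primitive m z.1 (w t₀)) (nhds (x₀, t₀))
      (nhds (primitive m x₀ (w t₀))) :=
    ((continuous_primitive_apply hm (w t₀)).comp continuous_fst).tendsto (x₀, t₀)
  have h3 := h1.add h2
  simp only [map_sub, sub_add_cancel, zero_add] at h3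
  exact h3

/-- A function whose distributional derivative on `[0,1]` is integrable, boundary values included,
is the primitive of that derivative. -/
lemma eq_primitive_of_forall_integral {Y W : ℝ → ℝ} {A B : ℝ} (hY : IntegrableOn Y (Icc 0 1))
    (hW : IntegrableOn W (Icc 0 1))
    (h : ∀ g : ℝ → ℝ, ContDiff ℝ 1 g → (∫ x in Icc (0 : ℝ) 1, deriv g x * Y x) +
      (∫ x in Icc (0 : ℝ) 1, g x * W x) + (g 0 * A - g 1 * B) = 0) :
    (∀ᵐ x ∂volume.restrict (Icc (0 : ℝ) 1), Y x = A + ∫ y in (0 : ℝ)..x, W y) ∧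
      A + ∫ y in (0 : ℝ)..1, W y = B := by
  set N : ℝ → ℝ := fun x => A + ∫ y in (0 : ℝ)..x, W y with hN
  have hWi : IntervalIntegrable W volume 0 1 :=
    (intervalIntegrable_iff_integrableOn_Icc_of_le zero_le_one).2 hW
  have hNc : ContinuousOn N (Icc 0 1) := by
    have := intervalIntegral.continuousOn_primitive_interval (a := 0) (b := 1) (μ := volume)
      (f := W) (by rwa [uIcc_of_le zero_le_one])
    rw [uIcc_of_le zero_le_one] at this
    exact continuousOn_const.add this
  have hpart : ∀ g : ℝ → ℝ, ContDiff ℝ 1 g →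
      ∫ x in Icc (0 : ℝ) 1, deriv g x * (Y x - N x) = g 1 * (B - N 1) := by
    intro g hg
    have hg' : Continuous (deriv g) := hg.continuous_deriv le_rfl
    have h1 := mul_sub_mul_eq_integral (A := g) (B := N) (A' := deriv g) (B' := W) zero_le_one
      (hg'.intervalIntegrable _ _) hWi
      (fun x hx => (intervalIntegral.integral_deriv_eq_sub
        (fun y _ => (hg.differentiable one_ne_zero) y) (hg'.intervalIntegrable _ _)).symm)
      (fun x _ => by simp [hN])
    have i1 : IntegrableOn (fun x => deriv g x * N x) (Icc (0 : ℝ) 1) :=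
      (hg'.continuousOn.mul hNc).integrableOn_compact isCompact_Icc
    have i2 : IntegrableOn (fun x => g x * W x) (Icc (0 : ℝ) 1) :=
      hW.continuousOn_mul hg.continuous.continuousOn isCompact_Icc
    have i3 : IntegrableOn (fun x => deriv g x * Y x) (Icc (0 : ℝ) 1) :=
      hY.continuousOn_mul hg'.continuousOn isCompact_Icc
    rw [intervalIntegral.integral_of_le zero_le_one, ← integral_Icc_eq_integral_Ioc,
      integral_add i1 i2] at h1
    have h2 := h g hg
    have h3 : N 0 = A := by simp [hN]
    simp only [mul_sub]
    rw [integral_sub i3 i1]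
    rw [h3] at h1
    linarith
  have hN1 : N 1 = B := by
    have := hpart (fun _ => 1) contDiff_const
    simp at this
    linarith
  refine ⟨?_, hN1⟩
  have hint : Integrable ((Icc (0 : ℝ) 1).indicator fun x => Y x - N x) :=
    (integrable_indicator_iff measurableSet_Icc).2
      (hY.sub (hNc.integrableOn_compact isCompact_Icc))
  have h0 := ae_eq_zero_of_integral_contDiff_smul_eq_zero hint.locallyIntegrable fun φ hφ _ => by
    have hd : ∀ x, HasDerivAt (fun x => ∫ y in (0 : ℝ)..x, φ y) (φ x) x := fun x =>
      hφ.continuous.integral_hasStrictDerivAt 0 x |>.hasDerivAt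
    have hd' : deriv (fun x => ∫ y in (0 : ℝ)..x, φ y) = φ := funext fun x => (hd x).deriv
    have h1 := hpart (fun x => ∫ y in (0 : ℝ)..x, φ y)
      (contDiff_one_iff_deriv.2 ⟨fun x => (hd x).differentiableAt, by
        rw [hd']; exact hφ.continuous⟩)
    rw [hd', hN1, sub_self, mul_zero] at h1
    refine Eq.trans ?_ h1
    rw [← integral_indicator measurableSet_Icc]
    congr 1
    ext x
    by_cases hx : x ∈ Icc (0 : ℝ) 1 <;> simp [indicator, hx]
  rw [ae_restrict_iff' measurableSet_Icc]
  filter_upwards [h0] with x hx hxm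
  rw [indicator_of_mem hxm] at hx
  linarith

end DelayedHyperbolic

namespace DelayedHyperbolic

/-! ### Averages in time of weak solutions -/

/-- The integral of `w` over the time interval `[t, t + h]`. -/
noncomputable def average {E : Type*} [NormedAddCommGroup E] [NormedSpace ℝ E] (h : ℝ) (w : ℝ → E)
    (t : ℝ) : E := ∫ s in t..t + h, w s

section average

variable {E : Type*} [NormedAddCommGroup E] [NormedSpace ℝ E] {w : ℝ → E}

lemma average_eq_sub (hw : Continuous w) (h t : ℝ) :
    average h w t = (∫ s in (0 : ℝ)..t + h, w s) - ∫ s in (0 : ℝ)..t, w s := by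
  rw [average, intervalIntegral.integral_interval_sub_left (hw.intervalIntegrable _ _)
    (hw.intervalIntegrable _ _)]

lemma continuous_average (hw : Continuous w) (h : ℝ) : Continuous (average h w) := by
  have h1 : Continuous fun t => ∫ s in (0 : ℝ)..t, w s :=
    intervalIntegral.continuous_primitive (fun _ _ => hw.intervalIntegrable _ _) 0
  have h2 : average h w = fun t => (∫ s in (0 : ℝ)..t + h, w s) - ∫ s in (0 : ℝ)..t, w s :=
    funext fun t => average_eq_sub hw h t
  rw [h2]
  exact (h1.comp (continuous_id.add continuous_const)).sub h1

lemma average_sub (hw : Continuous w) (h k t : ℝ) :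
    average k (fun s => w (s + h) - w s) t = average h w (t + k) - average h w t := by
  have h1 : ∀ a b, IntervalIntegrable w volume a b := fun _ _ => hw.intervalIntegrable _ _
  have h2 : Continuous fun s => w (s + h) := by fun_prop
  rw [average, intervalIntegral.integral_sub (h2.intervalIntegrable _ _) (h1 _ _),
    intervalIntegral.integral_comp_add_right, average_eq_sub hw, average_eq_sub hw,
    ← intervalIntegral.integral_interval_sub_left (h1 0 (t + k + h)) (h1 0 (t + h)),
    ← intervalIntegral.integral_interval_sub_left (h1 0 (t + k)) (h1 0 t)]
  abel

lemma hasDerivAt_average [CompleteSpace E] (hw : Continuous w) (h t : ℝ) :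
    HasDerivAt (average h w) (w (t + h) - w t) t := by
  have h1 : ∀ t, HasDerivAt (fun t => ∫ s in (0 : ℝ)..t, w s) (w t) t := fun t =>
    (hw.integral_hasStrictDerivAt 0 t).hasDerivAt
  have h2 : average h w = fun t => (∫ s in (0 : ℝ)..t + h, w s) - ∫ s in (0 : ℝ)..t, w s :=
    funext fun t => average_eq_sub hw h t
  rw [h2]
  exact ((h1 (t + h)).comp_add_const t h).sub (h1 t)

lemma eq_zero_of_average_eq_zero [CompleteSpace E] (hw : Continuous w) {t : ℝ}
    (h : ∀ k, 0 < k → average k w t = 0) : w t = 0 := by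
  have h1 : HasDerivWithinAt (fun s => ∫ r in t..s, w r) (w t) (Ici t) t :=
    (hw.integral_hasStrictDerivAt t t).hasDerivAt.hasDerivWithinAt
  have h2 : HasDerivWithinAt (fun s => ∫ r in t..s, w r) 0 (Ici t) t := by
    refine (hasDerivWithinAt_const t (Ici t) (0 : E)).congr (fun s hs => ?_) (by simp)
    rcases (mem_Ici.1 hs).eq_or_lt with rfl | hs
    · simp
    · have := h (s - t) (sub_pos.2 hs)
      rwa [average, add_sub_cancel] at this
  exact (uniqueDiffWithinAt_Ici t).eq_deriv _ h1 h2

end average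

/-- The weak form of `∂ₜy + κ e ∂ₓy = c z` with boundary values `a`, `b`, tested with functions of
`x` alone. As `κ = ±1`, the division by the velocity `κ e` is written as `κ / e`. -/
structure IsSpatialWeakSolution (S : Speed) (κ : ℝ) (c a b : ℝ → ℝ) (y z : ℝ → L2) : Prop where
  cont_y : ContinuousOn y (Ici 0)
  cont_z : ContinuousOn z (Ici 0)
  int_a : ∀ T, IntegrableOn a (Icc 0 T)
  int_b : ∀ T, IntegrableOn b (Icc 0 T)
  weak : ∀ g : ℝ → ℝ, ContDiff ℝ 1 g → ∀ T, 0 ≤ T →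
    pairing (fun x => g x * (κ / S.e x)) (y T - y 0) =
      pairing (deriv g) (∫ t in (0 : ℝ)..T, y t) +
      pairing (fun x => g x * (κ * c x / S.e x)) (∫ t in (0 : ℝ)..T, z t) +
      (g 0 * (∫ t in (0 : ℝ)..T, a t) - g 1 * ∫ t in (0 : ℝ)..T, b t)

lemma intervalIntegrable_of_continuousOn_Ici {E : Type*} [NormedAddCommGroup E] {y : ℝ → E}
    (hy : ContinuousOn y (Ici 0)) {s t : ℝ} (hs : 0 ≤ s) (ht : 0 ≤ t) :
    IntervalIntegrable y volume s t :=
  (hy.mono fun _ hr => (le_min hs ht).trans hr.1).intervalIntegrable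

lemma IsWeakTransportSolution.isSpatialWeakSolution {S : Speed} {κ : ℝ} {lam c a b : ℝ → ℝ}
    {f : ℝ → ℝ → ℝ} {y₀ : L2} {y z : ℝ → L2} (hy : IsWeakTransportSolution lam f y₀ a b y)
    (hκ : κ * κ = 1) (hlam : ∀ x ∈ Icc (0 : ℝ) 1, lam x = κ * S.e x) (hc : Continuous c)
    (hf : ∀ x ∈ Icc (0 : ℝ) 1, ∀ t, f x t = c x * z t x) (hz : ContinuousOn z (Ici 0)) :
    IsSpatialWeakSolution S κ c a b y z := by
  have ha : ∀ T, IntegrableOn a (Icc 0 T) := fun T => (hy.left_memLp T).integrable one_le_two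
  have hb : ∀ T, IntegrableOn b (Icc 0 T) := fun T => (hy.right_memLp T).integrable one_le_two
  refine ⟨hy.cont, hz, ha, hb, fun g hg T hT => ?_⟩
  have hκ0 : κ ≠ 0 := fun h => by simp [h] at hκ
  have e0 : ∀ x, S.e x ≠ 0 := fun x => (S.pos x).ne'
  have hg' : Continuous (deriv g) := hg.continuous_deriv le_rfl
  have hgc := hg.continuous
  have c1 : Continuous fun x => g x * (κ / S.e x) := hgc.mul (continuous_const.div S.cont e0)
  have c2 : Continuous fun x => g x * (κ * c x / S.e x) :=
    hgc.mul ((continuous_const.mul hc).div S.cont e0)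
  have hdiv : ∀ x ∈ Icc (0 : ℝ) 1, g x / lam x = g x * (κ / S.e x) := fun x hx => by
    have := e0 x
    rw [hlam x hx]
    field_simp
    rw [sq, hκ, mul_one]
  have h1 := hy.weak (fun x _ => g x) (hg.comp contDiff_fst) T hT
  have q1 : ∀ w : L2, ∫ x in Icc (0 : ℝ) 1, g x / lam x * w x =
      pairing (fun x => g x * (κ / S.e x)) w := fun w => by
    rw [pairing_apply (memLp_of_continuous c1)]
    exact setIntegral_congr_fun measurableSet_Icc fun x hx => by simp only [hdiv x hx]
  have q2 : ∀ t, ∫ x in Icc (0 : ℝ) 1, (deriv (fun _ : ℝ => g x) t / lam x + deriv g x) * y t x =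
      pairing (deriv g) (y t) := fun t => by
    rw [pairing_apply (memLp_of_continuous hg')]
    simp
  have q3 : ∀ t, ∫ x in Icc (0 : ℝ) 1, g x / lam x * f x t =
      pairing (fun x => g x * (κ * c x / S.e x)) (z t) := fun t => by
    rw [pairing_apply (memLp_of_continuous c2)]
    refine setIntegral_congr_fun measurableSet_Icc fun x hx => ?_
    simp only [hdiv x hx, hf x hx]
    ring
  have ia : IntervalIntegrable a volume 0 T :=
    (intervalIntegrable_iff_integrableOn_Icc_of_le hT).2 (ha T)
  have ib : IntervalIntegrable b volume 0 T :=
    (intervalIntegrable_iff_integrableOn_Icc_of_le hT).2 (hb T)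
  simp only [q1, q2, q3] at h1
  rw [intervalIntegral.integral_sub (ia.const_mul _) (ib.const_mul _),
    intervalIntegral.integral_const_mul, intervalIntegral.integral_const_mul,
    ContinuousLinearMap.intervalIntegral_comp_comm _
      (intervalIntegrable_of_continuousOn_Ici hy.cont le_rfl hT),
    ContinuousLinearMap.intervalIntegral_comp_comm _
      (intervalIntegrable_of_continuousOn_Ici hz le_rfl hT)] at h1
  rw [map_sub, hy.init, h1]

/-- The continuous representative of the average of `y` over `[t, t + h]`, when `y` solves
`∂ₜy + κ e ∂ₓy = c z` with boundary value `a` at `x = 0`. -/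
noncomputable def profile (S : Speed) (κ : ℝ) (c : ℝ → ℝ) (h : ℝ) (a : ℝ → ℝ) (y z : ℝ → L2)
    (x t : ℝ) : ℝ :=
  (∫ s in max t 0..max (t + h) 0, a s) +
    primitive (fun x => κ * c x / S.e x) x (average h (fun s => z (max s 0)) t) -
    primitive (fun x => κ / S.e x) x (y (max (t + h) 0) - y (max t 0))

lemma continuous_comp_max {E : Type*} [TopologicalSpace E] {y : ℝ → E}
    (hy : ContinuousOn y (Ici 0)) : Continuous fun s => y (max s 0) :=
  hy.comp_continuous (by fun_prop) fun s => le_max_right s 0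

lemma intervalIntegrable_of_integrableOn {a : ℝ → ℝ} (ha : ∀ T, IntegrableOn a (Icc 0 T))
    {s t : ℝ} (hs : 0 ≤ s) (ht : 0 ≤ t) : IntervalIntegrable a volume s t := by
  refine ((ha (max s t)).mono_set ?_).intervalIntegrable
  exact Icc_subset_Icc (le_min hs ht) le_rfl

lemma continuous_integral_max {a : ℝ → ℝ} (ha : ∀ T, IntegrableOn a (Icc 0 T)) :
    Continuous fun t => ∫ s in (0 : ℝ)..max t 0, a s := by
  have h1 : ∀ s t, IntervalIntegrable ((Ici 0).indicator a) volume s t := fun s t => by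
    rw [intervalIntegrable_iff, integrableOn_indicator_iff measurableSet_Ici]
    refine (ha (max s t)).mono_set fun x hx => ⟨hx.1, ?_⟩
    exact hx.2.2
  have h2 : (fun t => ∫ s in (0 : ℝ)..max t 0, a s) =
      fun t => ∫ s in (0 : ℝ)..max t 0, (Ici 0).indicator a s := by
    ext t
    refine intervalIntegral.integral_congr fun s hs => ?_
    rw [uIcc_of_le (le_max_right _ _)] at hs
    rw [indicator_of_mem (mem_Ici.2 hs.1)]
  rw [h2]
  exact (intervalIntegral.continuous_primitive h1 0).comp (by fun_prop)

namespace IsSpatialWeakSolution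

variable {S : Speed} {κ : ℝ} {c a b : ℝ → ℝ} {y z : ℝ → L2}

lemma continuous_profile (h : IsSpatialWeakSolution S κ c a b y z) (hc : Continuous c) (k : ℝ) :
    Continuous (Function.uncurry (profile S κ c k a y z)) := by
  have e0 : ∀ x, S.e x ≠ 0 := fun x => (S.pos x).ne'
  have h1 : Continuous fun t => ∫ s in max t 0..max (t + k) 0, a s := by
    have h2 : (fun t => ∫ s in max t 0..max (t + k) 0, a s) =
        fun t => (∫ s in (0 : ℝ)..max (t + k) 0, a s) - ∫ s in (0 : ℝ)..max t 0, a s := by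
      ext t
      rw [intervalIntegral.integral_interval_sub_left] <;>
        exact intervalIntegrable_of_integrableOn h.int_a le_rfl (le_max_right _ _)
    rw [h2]
    have h3 := continuous_integral_max h.int_a
    exact (h3.comp (by fun_prop : Continuous fun t => t + k)).sub h3
  have h4 := continuous_primitive_comp (m := fun x => κ * c x / S.e x)
    ((continuous_const.mul hc).div S.cont e0)
    (continuous_average (continuous_comp_max h.cont_z) k)
  have h5 := continuous_primitive_comp (m := fun x => κ / S.e x)
    (continuous_const.div S.cont e0)
    (w := fun t => y (max (t + k) 0) - y (max t 0))
    (((continuous_comp_max h.cont_y).comp (by fun_prop : Continuous fun t => t + k)).sub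
      (continuous_comp_max h.cont_y))
  exact ((h1.comp continuous_snd).add h4).sub h5

/-- The average of `y` has a continuous representative whose boundary values are the averages of
`a` and `b`. -/
lemma average_ae_eq (h : IsSpatialWeakSolution S κ c a b y z) (hc : Continuous c)
    {t k : ℝ} (ht : 0 ≤ t) (hk : 0 ≤ k) :
    (∀ᵐ x ∂volume.restrict (Icc (0 : ℝ) 1),
      average k (fun s => y (max s 0)) t x = profile S κ c k a y z x t) ∧
    profile S κ c k a y z 0 t = average k a t ∧ profile S κ c k a y z 1 t = average k b t := by
  have e0 : ∀ x, S.e x ≠ 0 := fun x => (S.pos x).ne'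
  have c1 : Continuous fun x => κ / S.e x := continuous_const.div S.cont e0
  have c2 : Continuous fun x => κ * c x / S.e x := (continuous_const.mul hc).div S.cont e0
  have htk : 0 ≤ t + k := add_nonneg ht hk
  set Y := average k (fun s => y (max s 0)) t with hY
  set Z := average k (fun s => z (max s 0)) t with hZ
  set V := y (t + k) - y t with hV
  have hav : ∀ w : ℝ → L2, ContinuousOn w (Ici 0) →
      (∫ s in (0 : ℝ)..t + k, w s) - ∫ s in (0 : ℝ)..t, w s = average k (fun s => w (max s 0)) t := by
    intro w hw
    rw [average, intervalIntegral.integral_interval_sub_left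
      (intervalIntegrable_of_continuousOn_Ici hw le_rfl htk)
      (intervalIntegrable_of_continuousOn_Ici hw le_rfl ht)]
    refine intervalIntegral.integral_congr fun s hs => ?_
    rw [uIcc_of_le (by linarith)] at hs
    simp only [max_eq_left (ht.trans hs.1)]
  have hab : ∀ w : ℝ → ℝ, (∀ T, IntegrableOn w (Icc 0 T)) →
      (∫ s in (0 : ℝ)..t + k, w s) - ∫ s in (0 : ℝ)..t, w s = average k w t := by
    intro w hw
    rw [average, intervalIntegral.integral_interval_sub_left
      (intervalIntegrable_of_integrableOn hw le_rfl htk)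
      (intervalIntegrable_of_integrableOn hw le_rfl ht)]
  set W : ℝ → ℝ := fun x => κ * c x / S.e x * Z x - κ / S.e x * V x with hW
  have i1 : ∀ {m : ℝ → ℝ}, Continuous m → ∀ w : L2,
      Integrable (fun x => m x * w x) (volume.restrict (Icc (0 : ℝ) 1)) := fun hm w =>
    integrable_mul_L2 (memLp_of_continuous hm) w
  have hWi : IntegrableOn W (Icc 0 1) := (i1 c2 Z).sub (i1 c1 V)
  have hprof : ∀ x ∈ Icc (0 : ℝ) 1, profile S κ c k a y z x t =
      average k a t + ∫ y in (0 : ℝ)..x, W y := by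
    intro x hx
    have hs : Icc 0 x ⊆ Icc (0 : ℝ) 1 := Icc_subset_Icc le_rfl hx.2
    have j1 : ∀ {m : ℝ → ℝ}, Continuous m → ∀ w : L2,
        IntervalIntegrable (fun x => m x * w x) volume 0 x := fun hm w =>
      (intervalIntegrable_iff_integrableOn_Icc_of_le hx.1).2
        (IntegrableOn.mono_set (i1 hm w) hs)
    rw [intervalIntegral.integral_sub (j1 c2 Z) (j1 c1 V), profile, max_eq_left ht,
      max_eq_left htk, primitive_eq c2 hx, primitive_eq c1 hx]
    exact add_sub_assoc _ _ _
  have key := eq_primitive_of_forall_integral (Y := Y) (W := W) (A := average k a t)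
    (B := average k b t) (L2.integrable Y) hWi fun g hg => by
      have hg' : Continuous (deriv g) := hg.continuous_deriv le_rfl
      have h1 := h.weak g hg _ htk
      have h2 := h.weak g hg _ ht
      have h3 : pairing (fun x => g x * (κ / S.e x)) V = pairing (deriv g) Y +
          pairing (fun x => g x * (κ * c x / S.e x)) Z +
          (g 0 * average k a t - g 1 * average k b t) := by
        have h5 : V = (y (t + k) - y 0) - (y t - y 0) := by rw [hV]; abel
        rw [h5, map_sub, h1, h2, hY, hZ, ← hav y h.cont_y, ← hav z h.cont_z, ← hab a h.int_a,
          ← hab b h.int_b]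
        simp only [map_sub]
        ring
      have d1 : Continuous fun x => g x * (κ / S.e x) := hg.continuous.mul c1
      have d2 : Continuous fun x => g x * (κ * c x / S.e x) := hg.continuous.mul c2
      rw [pairing_apply (memLp_of_continuous hg'), pairing_apply (memLp_of_continuous d1),
        pairing_apply (memLp_of_continuous d2)] at h3
      have h4 : ∫ x in Icc (0 : ℝ) 1, g x * W x =
          (∫ x in Icc (0 : ℝ) 1, g x * (κ * c x / S.e x) * Z x) -
            ∫ x in Icc (0 : ℝ) 1, g x * (κ / S.e x) * V x := by
        rw [← integral_sub (i1 d2 Z) (i1 d1 V)]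
        congr 1
        ext x
        simp only [hW]
        ring
      rw [h4]
      linarith
  refine ⟨?_, ?_, ?_⟩
  · filter_upwards [key.1, ae_restrict_mem measurableSet_Icc] with x hx hxm
    rw [hx, hprof x hxm]
  · rw [hprof 0 (by simp), intervalIntegral.integral_same, add_zero]
  · rw [hprof 1 (by simp), key.2]

end IsSpatialWeakSolution

end DelayedHyperbolic

namespace DelayedHyperbolic

lemma primitive_eq_of_ae {m f : ℝ → ℝ} (hm : Continuous m) {x : ℝ} (hx : x ∈ Icc (0 : ℝ) 1) {w : L2}
    (hw : ∀ᵐ y ∂volume.restrict (Icc (0 : ℝ) 1), w y = f y) :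
    primitive m x w = ∫ y in (0 : ℝ)..x, m y * f y := by
  rw [primitive_eq hm hx]
  refine intervalIntegral.integral_congr_ae ?_
  filter_upwards [(ae_restrict_iff' measurableSet_Icc).1 hw] with y hy hyx
  rw [uIoc_of_le hx.1] at hyx
  rw [hy ⟨hyx.1.le, hyx.2.trans hx.2⟩]

lemma integral_swap_of_continuous {f : ℝ → ℝ → ℝ} (hf : Continuous (Function.uncurry f))
    (a b c d : ℝ) :
    ∫ x in a..b, ∫ y in c..d, f x y = ∫ y in c..d, ∫ x in a..b, f x y :=
  intervalIntegral_intervalIntegral_swap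
    ((hf.continuousOn.integrableOn_compact (isCompact_uIcc.prod isCompact_uIcc)).mono_set
      (prod_mono uIoc_subset_uIcc uIoc_subset_uIcc))

/-- A classical solution of `∂ₜU + κ e ∂ₓU = G` on `[0,1] × [0,∞)` solves the equation along
characteristics. -/
lemma transported_of_hasDerivAt {S : Speed} {κ : ℝ} {U D G : ℝ → ℝ → ℝ} (hκ : κ * κ = 1)
    (hU : Continuous (Function.uncurry U)) (hD : Continuous (Function.uncurry D))
    (hG : Continuous (Function.uncurry G)) (hUt : ∀ x t, HasDerivAt (U x) (D x t) t)
    (hUx : ∀ x ∈ Icc (0 : ℝ) 1, ∀ t, 0 ≤ t →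
      U x t = U 0 t + ∫ y in (0 : ℝ)..x, κ / S.e y * (G y t - D y t)) :
    Transported S κ (Ici 0) U G := by
  have e0 : ∀ x, S.e x ≠ 0 := fun x => (S.pos x).ne'
  have hκ0 : κ ≠ 0 := fun h => by simp [h] at hκ
  set E : ℝ → ℝ → ℝ := fun x t => κ / S.e x * (G x t - D x t) with hE
  have hEc : Continuous (Function.uncurry E) :=
    ((continuous_const.div S.cont e0).comp continuous_fst).mul (hG.sub hD)
  have hEx : ∀ t, Continuous fun x => E x t := fun t => hEc.comp (Continuous.prodMk_left t)
  have hd : ∀ x ∈ Ioo (0 : ℝ) 1, ∀ t, 0 < t → HasStrictFDerivAt (Function.uncurry U)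
      (((1 : ℝ →L[ℝ] ℝ).smulRight (E x t)).coprod ((1 : ℝ →L[ℝ] ℝ).smulRight (D x t))) (x, t) := by
    intro x hx t ht
    have hnhds : ∀ᶠ v : ℝ × ℝ in nhds (x, t), v ∈ Ioo (0 : ℝ) 1 ×ˢ Ioi (0 : ℝ) :=
      (isOpen_Ioo.prod isOpen_Ioi).mem_nhds ⟨hx, ht⟩
    refine hasStrictFDerivAt_uncurry_coprod (𝕜 := ℝ) (f := U) (u := (x, t))
      (f₁ := fun x t => (1 : ℝ →L[ℝ] ℝ).smulRight (E x t))
      (f₂ := fun x t => (1 : ℝ →L[ℝ] ℝ).smulRight (D x t)) ?_ ?_ ?_ ?_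
    · filter_upwards [hnhds] with v hv
      have h1 : HasDerivAt (fun x => U 0 v.2 + ∫ y in (0 : ℝ)..x, E y v.2) (E v.1 v.2) v.1 :=
        ((hEx v.2).integral_hasStrictDerivAt 0 v.1).hasDerivAt.const_add _
      have h2 : HasDerivAt (fun x => U x v.2) (E v.1 v.2) v.1 := h1.congr_of_eventuallyEq (by
        filter_upwards [isOpen_Ioo.mem_nhds hv.1] with y hy
        exact hUx y ⟨hy.1.le, hy.2.le⟩ v.2 (mem_Ioi.1 hv.2).le)
      exact h2.hasFDerivAt
    · exact Filter.Eventually.of_forall fun v => (hUt v.1 v.2).hasFDerivAt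
    · exact ((ContinuousLinearMap.smulRightL ℝ ℝ ℝ 1).continuous.comp hEc).continuousAt
    · exact ((ContinuousLinearMap.smulRightL ℝ ℝ ℝ 1).continuous.comp hD).continuousAt
  intro x t δ hδ ht htδ hx
  have hfl : Continuous fun σ => (S.flow (κ * σ) x, t + σ) :=
    ((S.continuous_flow_left x).comp (continuous_const.mul continuous_id)).prodMk (by fun_prop)
  have hder : ∀ σ, HasDerivAt (fun σ => S.flow (κ * σ) x) (κ * S.e (S.flow (κ * σ) x)) σ :=
    fun σ => by
      have := (S.hasDerivAt_flow (κ * σ) x).comp σ ((hasDerivAt_id σ).const_mul κ)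
      simpa [Function.comp_def, mul_comm] using this
  -- inside a characteristic the position is an interior point
  have hint : ∀ σ ∈ Ioo 0 δ, S.flow (κ * σ) x ∈ Ioo (0 : ℝ) 1 := by
    intro σ hσ
    have h0 := hx 0 ⟨le_rfl, hδ⟩
    have h1 := hx δ ⟨hδ, le_rfl⟩
    have hlt : ∀ ρ₁ ρ₂ : ℝ, ρ₁ < ρ₂ → S.flow ρ₁ x < S.flow ρ₂ x := fun ρ₁ ρ₂ h =>
      S.phase.symm.strictMono (by linarith)
    have hcase : κ = 1 ∨ κ = -1 := mul_self_eq_one_iff.1 hκ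
    rcases hcase with rfl | rfl
    · exact ⟨h0.1.trans_lt (hlt _ _ (by linarith [hσ.1])),
        (hlt _ _ (by linarith [hσ.2])).trans_le h1.2⟩
    · exact ⟨h1.1.trans_lt (hlt _ _ (by linarith [hσ.2])),
        (hlt _ _ (by linarith [hσ.1])).trans_le h0.2⟩
  have key := intervalIntegral.integral_eq_sub_of_hasDerivAt_of_le (a := 0) (b := δ)
    (f := fun σ => U (S.flow (κ * σ) x) (t + σ))
    (f' := fun σ => G (S.flow (κ * σ) x) (t + σ)) hδ (hU.comp hfl).continuousOn
    (fun σ hσ => by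
      have h1 := (hd _ (hint σ hσ) (t + σ) (by linarith [mem_Ici.1 ht, hσ.1])).hasFDerivAt
      have h2 := h1.comp_hasDerivAt σ ((hder σ).prodMk ((hasDerivAt_id σ).const_add t))
      have e1 := e0 (S.flow (κ * σ) x)
      refine h2.congr_deriv ?_
      simp only [ContinuousLinearMap.coprod_apply, ContinuousLinearMap.smulRight_apply,
        one_apply_eq_self, smul_eq_mul, hE]
      field_simp
      rw [sq, hκ]
      ring)
    ((hG.comp hfl).intervalIntegrable _ _)
  simpa using key.symm

namespace IsSpatialWeakSolution

variable {S : Speed} {κ : ℝ} {c a b : ℝ → ℝ} {y z : ℝ → L2}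

/-- The double averages in time of a weak solution solve the equation along characteristics. -/
lemma transported_average (h : IsSpatialWeakSolution S κ c a b y z) (hκ : κ * κ = 1)
    (hc : Continuous c) {k l : ℝ} (hk : 0 ≤ k) (hl : 0 ≤ l) {Z : ℝ → ℝ → ℝ}
    (hZ : Continuous (Function.uncurry Z))
    (hzZ : ∀ t, 0 ≤ t → ∀ᵐ x ∂volume.restrict (Icc (0 : ℝ) 1),
      average k (fun s => z (max s 0)) t x = Z x t) :
    Transported S κ (Ici 0) (fun x t => average l (profile S κ c k a y z x) t)
      (fun x t => c x * average l (Z x) t) := by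
  have e0 : ∀ x, S.e x ≠ 0 := fun x => (S.pos x).ne'
  have c1 : Continuous fun x => κ / S.e x := continuous_const.div S.cont e0
  have c2 : Continuous fun x => κ * c x / S.e x := (continuous_const.mul hc).div S.cont e0
  have hN := h.continuous_profile hc k
  set N := profile S κ c k a y z with hNdef
  have hNx : ∀ x, Continuous (N x) := fun x => hN.comp (Continuous.prodMk_right x)
  have hZx : ∀ x, Continuous (Z x) := fun x => hZ.comp (Continuous.prodMk_right x)
  have hav : ∀ {F : ℝ → ℝ → ℝ}, Continuous (Function.uncurry F) →
      Continuous (Function.uncurry fun x t => average l (F x) t) := fun {F} hF =>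
    Plant.continuous_variable_intervalIntegral (f := fun z : ℝ × ℝ => F z.1)
      (hF.comp (by fun_prop : Continuous fun w : (ℝ × ℝ) × ℝ => (w.1.1, w.2)))
      continuous_snd (by fun_prop)
  refine transported_of_hasDerivAt (D := fun x t => N x (t + l) - N x t) hκ (hav hN)
    ((hN.comp (by fun_prop : Continuous fun w : ℝ × ℝ => (w.1, w.2 + l))).sub hN)
    ((hc.comp continuous_fst).mul (hav hZ)) (fun x t => hasDerivAt_average (hNx x) l t) ?_
  intro x hx t ht
  have hyc := continuous_comp_max h.cont_y
  have hzc := continuous_comp_max h.cont_z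
  set V : ℝ → L2 := fun s => y (max (s + k) 0) - y (max s 0) with hV
  have hVc : Continuous V := (hyc.comp (by fun_prop : Continuous fun s => s + k)).sub hyc
  have hsplit : ∀ s, N x s = N 0 s + primitive (fun x => κ * c x / S.e x) x
      (average k (fun s => z (max s 0)) s) - primitive (fun x => κ / S.e x) x (V s) := fun s => by
    simp only [hNdef, profile, primitive_zero c1, primitive_zero c2, hV]
    ring
  have j1 : Continuous fun s => primitive (fun x => κ * c x / S.e x) x
      (average k (fun s => z (max s 0)) s) :=
    (primitive _ x).continuous.comp (continuous_average hzc k)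
  have j2 : Continuous fun s => primitive (fun x => κ / S.e x) x (V s) :=
    (primitive _ x).continuous.comp hVc
  have hle : t ≤ t + l := by linarith
  have q1 : ∫ s in t..t + l, primitive (fun x => κ * c x / S.e x) x
      (average k (fun s => z (max s 0)) s) =
      ∫ y in (0 : ℝ)..x, κ * c y / S.e y * average l (Z y) t := by
    have h1 : ∫ s in t..t + l, primitive (fun x => κ * c x / S.e x) x
        (average k (fun s => z (max s 0)) s) =
        ∫ s in t..t + l, ∫ y in (0 : ℝ)..x, κ * c y / S.e y * Z y s :=
      intervalIntegral.integral_congr fun s hs => by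
        rw [uIcc_of_le hle] at hs
        exact primitive_eq_of_ae c2 hx (hzZ s (ht.trans hs.1))
    rw [h1, integral_swap_of_continuous (f := fun s y => κ * c y / S.e y * Z y s)
      ((c2.comp continuous_snd).mul (hZ.comp continuous_swap))]
    simp only [intervalIntegral.integral_const_mul]
    rfl
  have q2 : ∫ s in t..t + l, primitive (fun x => κ / S.e x) x (V s) =
      ∫ y in (0 : ℝ)..x, κ / S.e y * (N y (t + l) - N y t) := by
    rw [ContinuousLinearMap.intervalIntegral_comp_comm _ (hVc.intervalIntegrable _ _)]
    have h1 := average_sub hyc k l t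
    rw [average] at h1
    rw [hV, h1]
    refine primitive_eq_of_ae c1 hx ?_
    filter_upwards [(h.average_ae_eq hc (add_nonneg ht hl) hk).1, (h.average_ae_eq hc ht hk).1,
      Lp.coeFn_sub (average k (fun s => y (max s 0)) (t + l))
        (average k (fun s => y (max s 0)) t)] with y h2 h3 h4
    rw [h4, Pi.sub_apply, h2, h3]
  have i1 : IntervalIntegrable (fun y => κ * c y / S.e y * average l (Z y) t) volume 0 x :=
    (c2.mul ((hav hZ).comp (Continuous.prodMk_left t))).intervalIntegrable _ _
  have i2 : IntervalIntegrable (fun y => κ / S.e y * (N y (t + l) - N y t)) volume 0 x :=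
    (c1.mul ((hN.comp (Continuous.prodMk_left (t + l))).sub
      (hN.comp (Continuous.prodMk_left t)))).intervalIntegrable _ _
  have q3 : average l (N x) t = average l (N 0) t +
      (∫ y in (0 : ℝ)..x, κ * c y / S.e y * average l (Z y) t) -
      ∫ y in (0 : ℝ)..x, κ / S.e y * (N y (t + l) - N y t) := by
    have j3 : Continuous fun s => N 0 s + primitive (fun x => κ * c x / S.e x) x
        (average k (fun s => z (max s 0)) s) := (hNx 0).add j1
    rw [← q1, ← q2, average, average, ← intervalIntegral.integral_add
      ((hNx 0).intervalIntegrable _ _) (j1.intervalIntegrable _ _),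
      ← intervalIntegral.integral_sub (j3.intervalIntegrable _ _)
        (j2.intervalIntegrable _ _)]
    exact intervalIntegral.integral_congr fun s _ => hsplit s
  rw [q3, add_sub_assoc, ← intervalIntegral.integral_sub i1 i2]
  congr 1
  refine intervalIntegral.integral_congr fun y _ => ?_
  have := e0 y
  field_simp

end IsSpatialWeakSolution

end DelayedHyperbolic

namespace DelayedHyperbolic

/-! ### Finite-time stability of weak solutions -/

lemma average_pairing {m : ℝ → ℝ} {M : ℝ} (hm : Measurable m)
    (hM : ∀ x ∈ Icc (0 : ℝ) 1, |m x| ≤ M) {w : ℝ → L2} (hw : ContinuousOn w (Ici 0))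
    {N : ℝ → ℝ → ℝ} (hN : Continuous (Function.uncurry N)) {k l t : ℝ} (hk : 0 ≤ k) (hl : 0 ≤ l)
    (ht : 0 ≤ t) (hwN : ∀ t, 0 ≤ t → ∀ᵐ x ∂volume.restrict (Icc (0 : ℝ) 1),
      average k (fun s => w (max s 0)) t x = N x t) :
    average l (average k fun s => pairing m (w s)) t = ∫ y in (0 : ℝ)..1, m y * average l (N y) t := by
  have hmL := memLp_of_bound hm hM (p := 2)
  have h1 : ∀ s, 0 ≤ s → average k (fun s => pairing m (w s)) s = ∫ y in (0 : ℝ)..1, m y * N y s := by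
    intro s hs
    have h2 : average k (fun s => pairing m (w s)) s =
        ∫ r in s..s + k, pairing m (w (max r 0)) := by
      refine intervalIntegral.integral_congr fun r hr => ?_
      rw [uIcc_of_le (by linarith)] at hr
      simp only [max_eq_left (hs.trans hr.1)]
    rw [h2, ContinuousLinearMap.intervalIntegral_comp_comm _
      ((continuous_comp_max hw).intervalIntegrable _ _), pairing_apply hmL,
      intervalIntegral.integral_of_le zero_le_one, ← integral_Icc_eq_integral_Ioc]
    refine integral_congr_ae ?_
    filter_upwards [hwN s hs] with y hy
    rw [← hy]
    rfl
  have h2 : average l (average k fun s => pairing m (w s)) t =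
      ∫ s in t..t + l, ∫ y in (0 : ℝ)..1, m y * N y s :=
    intervalIntegral.integral_congr fun s hs => by
      rw [uIcc_of_le (by linarith)] at hs
      exact h1 s (ht.trans hs.1)
  obtain ⟨B, hB⟩ := (isCompact_Icc.prod isCompact_Icc).exists_bound_of_continuousOn
    (s := Icc (0 : ℝ) 1 ×ˢ Icc t (t + l)) hN.continuousOn
  rw [h2, intervalIntegral_intervalIntegral_swap]
  · simp only [intervalIntegral.integral_const_mul]
    rfl
  · refine Measure.integrableOn_of_bounded (M := M * B) ?_ ?_ ?_
    · rw [Measure.volume_eq_prod, Measure.prod_prod]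
      exact ENNReal.mul_ne_top (by simp [uIoc]) (by simp [uIoc])
    · exact ((hm.comp measurable_snd).mul
        (hN.measurable.comp measurable_swap)).aestronglyMeasurable
    · refine (ae_restrict_iff' (measurableSet_uIoc.prod measurableSet_uIoc)).2
        (Filter.Eventually.of_forall fun z hz => ?_)
      rw [uIoc_of_le (by linarith), uIoc_of_le zero_le_one] at hz
      have hy : z.2 ∈ Icc (0 : ℝ) 1 := ⟨hz.2.1.le, hz.2.2⟩
      simp only [Function.uncurry, Real.norm_eq_abs, abs_mul]
      exact mul_le_mul (hM _ hy) (hB (z.2, z.1) ⟨hy, hz.1.1.le, hz.1.2⟩) (abs_nonneg _)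
        ((abs_nonneg _).trans (hM _ hy))

lemma exists_bound_of_continuous {U : ℝ → ℝ → ℝ} (hU : Continuous (Function.uncurry U)) (T : ℝ) :
    ∃ B, ∀ x ∈ Icc (0 : ℝ) 1, ∀ t ∈ Icc 0 T, |U x t| ≤ B := by
  obtain ⟨B, hB⟩ := (isCompact_Icc.prod isCompact_Icc).exists_bound_of_continuousOn
    (s := Icc (0 : ℝ) 1 ×ˢ Icc 0 T) hU.continuousOn
  exact ⟨B, fun x hx t ht => hB (x, t) ⟨hx, ht⟩⟩

lemma continuous_average_param {F : ℝ → ℝ → ℝ} (hF : Continuous (Function.uncurry F)) (l : ℝ) :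
    Continuous (Function.uncurry fun x t => average l (F x) t) :=
  Plant.continuous_variable_intervalIntegral (f := fun z : ℝ × ℝ => F z.1)
    (hF.comp (by fun_prop : Continuous fun w : (ℝ × ℝ) × ℝ => (w.1.1, w.2)))
    continuous_snd (by fun_prop)

lemma feedback_eq_pairing {P : Plant} {K21 K22 α₁ α₂ : ℝ → ℝ → ℝ}
    (hα : IsPredictorKernel P K21 K22 α₁ α₂) :
    ∃ M, 0 ≤ M ∧ (Measurable fun y => P.τ * P.ε₂ 1 * α₂ (1 - y) 1) ∧ (Measurable (α₁ 1)) ∧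
      (Measurable (α₂ 1)) ∧ (∀ y ∈ Icc (0 : ℝ) 1, |P.τ * P.ε₂ 1 * α₂ (1 - y) 1| ≤ M) ∧
      (∀ y ∈ Icc (0 : ℝ) 1, |α₁ 1 y| ≤ M) ∧ (∀ y ∈ Icc (0 : ℝ) 1, |α₂ 1 y| ≤ M) ∧
      ∀ u₁ u₂ v : L2, feedback P α₁ α₂ u₁ u₂ v =
        pairing (fun y => P.τ * P.ε₂ 1 * α₂ (1 - y) 1) v + pairing (α₁ 1) u₁ + pairing (α₂ 1) u₂ := by
  obtain ⟨N, hN⟩ := hα.bdd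
  have h1 : (1 : ℝ) ∈ Icc (0 : ℝ) 1 := by simp
  have hN0 : 0 ≤ N := (abs_nonneg _).trans (hN (1, 1) ⟨h1, h1⟩).1
  have m3 : Measurable fun y => P.τ * P.ε₂ 1 * α₂ (1 - y) 1 :=
    (hα.meas₂.comp (by fun_prop : Measurable fun y : ℝ => (1 - y, (1 : ℝ)))).const_mul _
  have m1 : Measurable (α₁ 1) := hα.meas₁.comp measurable_prodMk_left
  have m2 : Measurable (α₂ 1) := hα.meas₂.comp measurable_prodMk_left
  have b3 : ∀ y ∈ Icc (0 : ℝ) 1, |P.τ * P.ε₂ 1 * α₂ (1 - y) 1| ≤ |P.τ * P.ε₂ 1| * N :=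
    fun y hy => by
      rw [abs_mul]
      exact mul_le_mul_of_nonneg_left
        (hN (1 - y, 1) ⟨⟨by linarith [hy.2], by linarith [hy.1]⟩, h1⟩).2 (abs_nonneg _)
  have b1 : ∀ y ∈ Icc (0 : ℝ) 1, |α₁ 1 y| ≤ N := fun y hy => (hN (1, y) ⟨h1, hy⟩).1
  have b2 : ∀ y ∈ Icc (0 : ℝ) 1, |α₂ 1 y| ≤ N := fun y hy => (hN (1, y) ⟨h1, hy⟩).2
  refine ⟨|P.τ * P.ε₂ 1| * N + N, by positivity, m3, m1, m2,
    fun y hy => (b3 y hy).trans (by linarith), fun y hy => (b1 y hy).trans ?_,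
    fun y hy => (b2 y hy).trans ?_, fun u₁ u₂ v => ?_⟩
  · linarith [mul_nonneg (abs_nonneg (P.τ * P.ε₂ 1)) hN0]
  · linarith [mul_nonneg (abs_nonneg (P.τ * P.ε₂ 1)) hN0]
  · rw [pairing_apply (memLp_of_bound m3 b3), pairing_apply (memLp_of_bound m1 b1),
      pairing_apply (memLp_of_bound m2 b2), feedback]

/-- Every weak solution of the closed loop vanishes from the final time on: its double averages in
time are bounded solutions along characteristics. One average makes the solution continuous in
`(x,t)`, the second one differentiable in `t`. -/
theorem IsClosedLoopSolution.eq_zero {P : Plant} {K21 K22 α₁ α₂ : ℝ → ℝ → ℝ}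
    (hK : IsBacksteppingKernel P K21 K22) (hα : IsPredictorKernel P K21 K22 α₁ α₂)
    {u₁₀ u₂₀ v₀ : L2} {u₁ u₂ v : ℝ → L2}
    (h : IsClosedLoopSolution P α₁ α₂ u₁₀ u₂₀ v₀ u₁ u₂ v) {t : ℝ} (ht : finalTime P ≤ t) :
    u₁ t = 0 ∧ u₂ t = 0 ∧ v t = 0 := by
  obtain ⟨g₁, g₂, g₃, w₁, w₂, w₃⟩ := h
  have one : (1 : ℝ) * 1 = 1 := one_mul 1
  have neg : (-1 : ℝ) * -1 = 1 := by norm_num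
  have h₁ := w₁.isSpatialWeakSolution (S := P.s₁) (κ := 1) (c := P.k₁) one
    (fun x hx => by rw [P.s₁_e hx, one_mul]) P.continuous_k₁ (fun x hx t => by rw [P.k₁_eq hx])
    w₂.cont
  have h₂ := w₂.isSpatialWeakSolution (S := P.s₂) (κ := -1) (c := P.k₂) neg
    (fun x hx => by rw [P.s₂_e hx, neg_one_mul]) P.continuous_k₂ (fun x hx t => by rw [P.k₂_eq hx])
    w₁.cont
  have h₃ := w₃.isSpatialWeakSolution (S := P.s₃) (κ := -1) (c := fun _ => 0) (z := v) neg
    (fun x hx => by rw [P.s₃_e, neg_one_mul]) continuous_const (fun x hx t => by simp) w₃.cont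
  have ht0 : 0 ≤ finalTime P := by
    rw [P.finalTime_eq]
    linarith [P.τ_pos, P.s₁.phase_nonneg zero_le_one, P.s₂.phase_nonneg zero_le_one]
  obtain ⟨M, -, m3, m1, m2, b3, b1, b2, hfb⟩ := feedback_eq_pairing hα
  set N₁ : ℝ → ℝ → ℝ → ℝ := fun k => profile P.s₁ 1 P.k₁ k (fun t => P.q * g₂ t) u₁ u₂ with hN₁
  set N₂ : ℝ → ℝ → ℝ → ℝ := fun k => profile P.s₂ (-1) P.k₂ k g₂ u₂ u₁ with hN₂
  set N₃ : ℝ → ℝ → ℝ → ℝ := fun k => profile P.s₃ (-1) (fun _ => 0) k g₃ v v with hN₃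
  have c₁ : ∀ k, Continuous (Function.uncurry (N₁ k)) := h₁.continuous_profile P.continuous_k₁
  have c₂ : ∀ k, Continuous (Function.uncurry (N₂ k)) := h₂.continuous_profile P.continuous_k₂
  have c₃ : ∀ k, Continuous (Function.uncurry (N₃ k)) := h₃.continuous_profile continuous_const
  have mild : ∀ k l, 0 ≤ k → 0 ≤ l → IsMildSolution P α₁ α₂ (fun x t => average l (N₁ k x) t)
      (fun x t => average l (N₂ k x) t) (fun x t => average l (N₃ k x) t) := by
    intro k l hk hl
    have a₁ := fun t (ht : 0 ≤ t) => h₁.average_ae_eq P.continuous_k₁ ht hk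
    have a₂ := fun t (ht : 0 ≤ t) => h₂.average_ae_eq P.continuous_k₂ ht hk
    have a₃ := fun t (ht : 0 ≤ t) => h₃.average_ae_eq continuous_const ht hk
    have C₁ := continuous_average_param (c₁ k) l
    have C₂ := continuous_average_param (c₂ k) l
    have C₃ := continuous_average_param (c₃ k) l
    have hcongr : ∀ {f g : ℝ → ℝ} {t : ℝ}, 0 ≤ t → (∀ s, 0 ≤ s → f s = g s) →
        average l f t = average l g t := fun ht hfg =>
      intervalIntegral.integral_congr fun s hs => by
        rw [uIcc_of_le (by linarith)] at hs
        exact hfg s (ht.trans hs.1)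
    refine ⟨C₁.measurable, C₂.measurable, C₃.measurable, fun T => ?_, ?_, ?_, ?_, fun t ht => ?_,
      fun t ht => ?_, fun t ht => ?_⟩
    · obtain ⟨B₁, hB₁⟩ := exists_bound_of_continuous C₁ T
      obtain ⟨B₂, hB₂⟩ := exists_bound_of_continuous C₂ T
      obtain ⟨B₃, hB₃⟩ := exists_bound_of_continuous C₃ T
      exact ⟨max B₁ (max B₂ B₃), fun x hx t ht => ⟨(hB₁ x hx t ht).trans (le_max_left _ _),
        (hB₂ x hx t ht).trans ((le_max_left _ _).trans (le_max_right _ _)),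
        (hB₃ x hx t ht).trans ((le_max_right _ _).trans (le_max_right _ _))⟩⟩
    · exact h₁.transported_average one P.continuous_k₁ hk hl (c₂ k) fun t ht => (a₂ t ht).1
    · exact h₂.transported_average neg P.continuous_k₂ hk hl (c₁ k) fun t ht => (a₁ t ht).1
    · have := h₃.transported_average neg continuous_const hk hl (c₃ k) fun t ht => (a₃ t ht).1
      simpa only [zero_mul] using this
    · have e1 : average l (N₁ k 0) t = average l (fun s => P.q * average k g₂ s) t :=
        hcongr ht fun s hs => (a₁ s hs).2.1.trans (intervalIntegral.integral_const_mul _ _)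
      have e2 : average l (N₂ k 0) t = average l (average k g₂) t :=
        hcongr ht fun s hs => (a₂ s hs).2.1
      simp only [e1, e2]
      exact intervalIntegral.integral_const_mul _ _
    · exact hcongr ht fun s hs => (a₂ s hs).2.2.trans (a₃ s hs).2.1.symm
    · have i : ∀ {m : ℝ → ℝ} {w : ℝ → L2}, ContinuousOn w (Ici 0) →
          ContinuousOn (fun s => pairing m (w s)) (Ici 0) := fun hw =>
        (pairing _).continuous.comp_continuousOn hw
      have i' : ∀ {f : ℝ → ℝ}, ContinuousOn f (Ici 0) →
          IntervalIntegrable (average k f) volume t (t + l) := fun {f} hf => by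
        have h5 := (continuous_average (continuous_comp_max hf) k).intervalIntegrable
          (μ := volume) t (t + l)
        refine h5.congr fun s hs => ?_
        rw [uIoc_of_le (by linarith)] at hs
        refine intervalIntegral.integral_congr fun r hr => ?_
        rw [uIcc_of_le (by linarith)] at hr
        simp only [max_eq_left (ht.le.trans (hs.1.le.trans hr.1))]
      have e1 : average l (N₃ k 1) t = average l (fun s =>
          average k (fun s => pairing (fun y => P.τ * P.ε₂ 1 * α₂ (1 - y) 1) (v s)) s +
          average k (fun s => pairing (α₁ 1) (u₁ s)) s +
          average k (fun s => pairing (α₂ 1) (u₂ s)) s) t := hcongr ht.le fun s hs => by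
        refine (a₃ s hs).2.2.trans ?_
        have hsk := add_nonneg hs hk
        have j3 := intervalIntegrable_of_continuousOn_Ici
          (i (m := fun y => P.τ * P.ε₂ 1 * α₂ (1 - y) 1) w₃.cont) hs hsk
        have j1 := intervalIntegrable_of_continuousOn_Ici (i (m := α₁ 1) w₁.cont) hs hsk
        have j2 := intervalIntegrable_of_continuousOn_Ici (i (m := α₂ 1) w₂.cont) hs hsk
        simp only [hfb]
        simp only [average]
        rw [intervalIntegral.integral_add (j3.add j1) j2, intervalIntegral.integral_add j3 j1]
      simp only [e1]
      rw [← average_pairing m3 b3 w₃.cont (c₃ k) hk hl ht.le fun t ht => (a₃ t ht).1,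
        ← average_pairing m1 b1 w₁.cont (c₁ k) hk hl ht.le fun t ht => (a₁ t ht).1,
        ← average_pairing m2 b2 w₂.cont (c₂ k) hk hl ht.le fun t ht => (a₂ t ht).1]
      have j3 := i' (i (m := fun y => P.τ * P.ε₂ 1 * α₂ (1 - y) 1) w₃.cont)
      have j1 := i' (i (m := α₁ 1) w₁.cont)
      have j2 := i' (i (m := α₂ 1) w₂.cont)
      rw [average, intervalIntegral.integral_add (j3.add j1) j2,
        intervalIntegral.integral_add j3 j1]
      rfl
  -- the averages vanish after the final time, hence so do the functions
  have conclude : ∀ (w : ℝ → L2) (N : ℝ → ℝ → ℝ → ℝ), ContinuousOn w (Ici 0) →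
      (∀ k, Continuous (Function.uncurry (N k))) →
      (∀ k t, 0 ≤ k → 0 ≤ t → ∀ᵐ x ∂volume.restrict (Icc (0 : ℝ) 1),
        average k (fun s => w (max s 0)) t x = N k x t) →
      (∀ k l, 0 < k → 0 < l → ∀ x ∈ Icc (0 : ℝ) 1, ∀ t, finalTime P < t →
        average l (N k x) t = 0) → w t = 0 := by
    intro w N hw hN hwN h0
    have hwc := continuous_comp_max hw
    have h1 : ∀ t, finalTime P < t → w (max t 0) = 0 := fun t ht =>
      eq_zero_of_average_eq_zero hwc fun k hk => by
        rw [Lp.eq_zero_iff_ae_eq_zero]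
        filter_upwards [hwN k t hk.le (ht0.trans ht.le), ae_restrict_mem measurableSet_Icc]
          with x hx hxm
        rw [hx]
        exact eq_zero_of_average_eq_zero ((hN k).comp (Continuous.prodMk_right x))
          fun l hl => h0 k l hk hl x hxm t ht
    have h2 : closure (Ioi (finalTime P)) ⊆ {t | w (max t 0) = 0} :=
      closure_minimal h1 (isClosed_eq hwc continuous_const)
    rw [closure_Ioi] at h2
    have h3 : w (max t 0) = 0 := h2 ht
    rwa [max_eq_left (ht0.trans ht)] at h3
  refine ⟨conclude u₁ N₁ w₁.cont c₁ (fun k t hk ht => (h₁.average_ae_eq P.continuous_k₁ ht hk).1)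
    fun k l hk hl x hx t ht => ((mild k l hk.le hl.le).eq_zero hK hα hx ht).1,
    conclude u₂ N₂ w₂.cont c₂ (fun k t hk ht => (h₂.average_ae_eq P.continuous_k₂ ht hk).1)
    fun k l hk hl x hx t ht => ((mild k l hk.le hl.le).eq_zero hK hα hx ht).2.1,
    conclude v N₃ w₃.cont c₃ (fun k t hk ht => (h₃.average_ae_eq continuous_const ht hk).1)
    fun k l hk hl x hx t ht => ((mild k l hk.le hl.le).eq_zero hK hα hx ht).2.2⟩

end DelayedHyperbolic

namespace DelayedHyperbolic

/-! ### Bounded solutions of the closed loop -/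

namespace Plant

variable (P : Plant)

/-- The time at which a signal that enters the delay line reaches `x = 0`. -/
noncomputable def turn : ℝ := P.τ + P.s₂.phase 1

lemma turn_ge : P.τ ≤ P.turn := by
  rw [turn]; linarith [P.s₂.phase_nonneg zero_le_one]

/-- The position of the `u₂`-part of the pipe that is `p` travel time units behind the inflow. -/
noncomputable def pos₂ (p : ℝ) : ℝ := P.s₂.phase.symm (P.turn - p)

/-- The position of the `u₁`-part of the pipe that is `p` travel time units behind the inflow. -/
noncomputable def pos₁ (p : ℝ) : ℝ := P.s₁.phase.symm (p - P.turn)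

@[fun_prop] lemma continuous_pos₂ : Continuous P.pos₂ := by unfold pos₂; fun_prop
@[fun_prop] lemma continuous_pos₁ : Continuous P.pos₁ := by unfold pos₁; fun_prop

/-- The closed loop as a single pipe: the delay line `[0, τ]`, then `u₂` up to `P.turn`, then
`u₁ / q`. All clamps are inactive on the respective part. -/
noncomputable def closedLoopPipe (α₁ α₂ : ℝ → ℝ → ℝ) (N : ℝ)
    (hα₁ : Measurable fun z : ℝ × ℝ => α₁ z.1 z.2) (hα₂ : Measurable fun z : ℝ × ℝ => α₂ z.1 z.2)
    (hN : ∀ z ∈ square, |α₁ z.1 z.2| ≤ N ∧ |α₂ z.1 z.2| ≤ N) : Pipe where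
  Λ := P.turn + P.s₁.phase 1
  m p := if p ≤ P.τ then 0 else if p ≤ P.turn then P.q * P.k₂ (P.pos₂ p)
    else P.k₁ (P.pos₁ p) / P.q
  r p := if p ≤ P.turn then P.turn + P.s₁.phase (clamp (P.pos₂ p))
    else P.turn - P.s₂.phase (clamp (P.pos₁ p))
  k p := if p ≤ P.τ then P.s₂.e 1 * α₂ (clamp (p / P.τ)) 1
    else if p ≤ P.turn then P.s₂.e (P.pos₂ p) * α₂ 1 (clamp (P.pos₂ p))
    else P.q * (P.s₁.e (P.pos₁ p) * α₁ 1 (clamp (P.pos₁ p)))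
  M := P.q * P.exists_bound_k₂.choose + P.exists_bound_k₁.choose / P.q
  N := P.exists_bound_s₂.choose * N + P.q * (P.exists_bound_s₁.choose * N)
  Λ_nonneg := by
    have := P.turn_ge
    linarith [P.τ_pos, P.s₁.phase_nonneg zero_le_one]
  m_meas := by
    refine Measurable.ite measurableSet_Iic measurable_const
      (Measurable.ite measurableSet_Iic ?_ ?_)
    · exact Continuous.measurable (by fun_prop)
    · exact Continuous.measurable (by fun_prop)
  r_meas := Measurable.ite measurableSet_Iic (Continuous.measurable (by fun_prop))
    (Continuous.measurable (by fun_prop))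
  k_meas := by
    refine Measurable.ite measurableSet_Iic ?_ (Measurable.ite measurableSet_Iic ?_ ?_)
    · exact (hα₂.comp (Continuous.measurable
        (by fun_prop : Continuous fun p : ℝ => (clamp (p / P.τ), (1 : ℝ))))).const_mul _
    · exact (P.continuous_s₂.comp P.continuous_pos₂).measurable.mul
        (hα₂.comp (Continuous.measurable
          (by fun_prop : Continuous fun p : ℝ => ((1 : ℝ), clamp (P.pos₂ p)))))
    · exact ((P.continuous_s₁.comp P.continuous_pos₁).measurable.mul
        (hα₁.comp (Continuous.measurable
          (by fun_prop : Continuous fun p : ℝ => ((1 : ℝ), clamp (P.pos₁ p)))))).const_mul _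
  m_le p := by
    obtain ⟨h1, h2⟩ := P.exists_bound_k₁.choose_spec
    obtain ⟨h3, h4⟩ := P.exists_bound_k₂.choose_spec
    have hq := P.q_pos
    have h5 : 0 ≤ P.q * P.exists_bound_k₂.choose := by positivity
    have h6 : 0 ≤ P.exists_bound_k₁.choose / P.q := by positivity
    split_ifs
    · rw [abs_zero]; positivity
    · rw [abs_mul, abs_of_pos hq]
      linarith [mul_le_mul_of_nonneg_left (h4 (P.pos₂ p)) hq.le]
    · rw [abs_div, abs_of_pos hq]
      linarith [div_le_div_of_nonneg_right (h2 (P.pos₁ p)) hq.le]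
  k_le p := by
    obtain ⟨h1, h2⟩ := P.exists_bound_s₁.choose_spec
    obtain ⟨h3, h4⟩ := P.exists_bound_s₂.choose_spec
    have hq := P.q_pos
    have hone : (1 : ℝ) ∈ Icc (0 : ℝ) 1 := by simp
    have hN0 : 0 ≤ N := (abs_nonneg _).trans (hN (1, 1) ⟨hone, hone⟩).1
    have h5 : 0 ≤ P.exists_bound_s₂.choose * N := by positivity
    have h6 : 0 ≤ P.q * (P.exists_bound_s₁.choose * N) := by positivity
    split_ifs
    · rw [abs_mul]
      linarith [mul_le_mul (h4 1) (hN (clamp (p / P.τ), 1) ⟨clamp_mem _, hone⟩).2 (abs_nonneg _) h3]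
    · rw [abs_mul]
      linarith [mul_le_mul (h4 (P.pos₂ p)) (hN (1, clamp (P.pos₂ p)) ⟨hone, clamp_mem _⟩).2
        (abs_nonneg _) h3]
    · rw [abs_mul, abs_mul, abs_of_pos hq]
      linarith [mul_le_mul_of_nonneg_left (mul_le_mul (h2 (P.pos₁ p))
        (hN (1, clamp (P.pos₁ p)) ⟨hone, clamp_mem _⟩).1 (abs_nonneg _) h1) hq.le]
  r_mem p := by
    have h0 := P.turn_ge
    have h1 := P.τ_pos
    have h3 := phase_clamp_mem P.s₁ (P.pos₂ p)
    have h4 := phase_clamp_mem P.s₂ (P.pos₁ p)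
    have h5 : P.turn = P.τ + P.s₂.phase 1 := rfl
    have h6 := P.s₁.phase_nonneg zero_le_one
    split_ifs
    · exact ⟨by linarith [h3.1], by linarith [h3.2]⟩
    · exact ⟨by linarith [h4.2], by linarith [h4.1]⟩

end Plant

/-- Every bounded measurable initial state of the closed loop is the start of a bounded solution.
At the end points of `[0,1]` the initial value is not prescribed, as the coupling conditions hold
from the time `0` on. -/
theorem exists_isMildSolution {P : Plant} {K21 K22 α₁ α₂ : ℝ → ℝ → ℝ}
    (hα : IsPredictorKernel P K21 K22 α₁ α₂) {w₁ w₂ w₃ : ℝ → ℝ} {B : ℝ}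
    (m₁ : Measurable w₁) (m₂ : Measurable w₂) (m₃ : Measurable w₃)
    (b₁ : ∀ x, |w₁ x| ≤ B) (b₂ : ∀ x, |w₂ x| ≤ B) (b₃ : ∀ x, |w₃ x| ≤ B) :
    ∃ u₁ u₂ v, IsMildSolution P α₁ α₂ u₁ u₂ v ∧
      ∀ x ∈ Ioo (0 : ℝ) 1, u₁ x 0 = w₁ x ∧ u₂ x 0 = w₂ x ∧ v x 0 = w₃ x := by
  obtain ⟨N, hN⟩ := hα.bdd
  have hτ := P.τ_pos
  have hτ' := hτ.ne'
  have hq := P.q_pos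
  have hturn := P.turn_ge
  have hturn_eq : P.turn = P.τ + P.s₂.phase 1 := rfl
  have hL := P.s₁.phase_nonneg zero_le_one
  have hB0 : 0 ≤ B := (abs_nonneg _).trans (b₁ 0)
  set Q := P.closedLoopPipe α₁ α₂ N hα.meas₁ hα.meas₂ hN with hQ
  have hΛ : Q.Λ = P.turn + P.s₁.phase 1 := rfl
  obtain ⟨W, hW, hW0⟩ := Q.exists_isSolution (B := max B (B / P.q))
    (w := fun p => if p < P.τ then w₃ (1 - p / P.τ) else if p < P.turn then w₂ (P.pos₂ p)
      else w₁ (P.pos₁ p) / P.q)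
    (Measurable.ite measurableSet_Iio (m₃.comp (by fun_prop)) (Measurable.ite measurableSet_Iio
      (m₂.comp P.continuous_pos₂.measurable)
      ((m₁.comp P.continuous_pos₁.measurable).div_const _)))
    (fun p => by
      split_ifs
      · exact (b₃ _).trans (le_max_left _ _)
      · exact (b₂ _).trans (le_max_left _ _)
      · rw [abs_div, abs_of_pos hq]
        exact (div_le_div_of_nonneg_right (b₁ _) hq.le).trans (le_max_right _ _))
  have hmeas : ∀ {g : ℝ → ℝ}, Continuous g → Measurable (Function.uncurry fun x t => W (g x) t) :=
    fun hg => hW.meas.comp (((hg.comp continuous_fst).prodMk continuous_snd).measurable)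
  -- the pipe coordinates of the point `x` of the parts `u₁`, `u₂`, `v`
  have p₁ : ∀ x ∈ Icc (0 : ℝ) 1, P.turn + P.s₁.phase x ∈ Icc P.turn Q.Λ := fun x hx =>
    ⟨by linarith [P.s₁.phase_nonneg hx.1], by rw [hΛ]; linarith [P.s₁.phase.monotone hx.2]⟩
  have p₂ : ∀ x ∈ Icc (0 : ℝ) 1, P.turn - P.s₂.phase x ∈ Icc P.τ P.turn := fun x hx =>
    ⟨by rw [hturn_eq]; linarith [P.s₂.phase.monotone hx.2], by linarith [P.s₂.phase_nonneg hx.1]⟩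
  have p₃ : ∀ x ∈ Icc (0 : ℝ) 1, P.τ * (1 - x) ∈ Icc 0 P.τ := fun x hx =>
    ⟨mul_nonneg hτ.le (by linarith [hx.2]), by nlinarith [hx.1]⟩
  have i₁ : ∀ x, P.pos₁ (P.turn + P.s₁.phase x) = x := fun x => by simp [Plant.pos₁]
  have i₂ : ∀ x, P.pos₂ (P.turn - P.s₂.phase x) = x := fun x => by simp [Plant.pos₂]
  have hflow : ∀ (S : Speed) (ρ : ℝ → ℝ) (x δ : ℝ), 0 ≤ δ → S.flow (ρ 0) x = x →
      (∀ σ ∈ Icc 0 δ, S.flow (ρ σ) x ∈ Icc (0 : ℝ) 1) → x ∈ Icc (0 : ℝ) 1 :=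
    fun S ρ x δ hδ h0 h => h0 ▸ h 0 ⟨le_rfl, hδ⟩
  refine ⟨fun x t => P.q * W (P.turn + P.s₁.phase x) t, fun x t => W (P.turn - P.s₂.phase x) t,
    fun x t => W (P.τ * (1 - x)) t, ⟨(hmeas (g := fun x => P.turn + P.s₁.phase x)
      (by fun_prop)).const_mul _, hmeas (g := fun x => P.turn - P.s₂.phase x) (by fun_prop),
      hmeas (g := fun x => P.τ * (1 - x)) (by fun_prop), fun T => ?_, ?_, ?_, ?_, fun t _ => ?_, fun t _ => ?_, fun t ht => ?_⟩,
    fun x hx => ⟨?_, ?_, ?_⟩⟩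
  · obtain ⟨C, hC⟩ := hW.bdd T
    have h2 := fun x hx => p₂ x hx
    refine ⟨max (P.q * C) C, fun x hx t ht => ⟨?_, ?_, ?_⟩⟩
    · rw [abs_mul, abs_of_pos hq]
      refine (mul_le_mul_of_nonneg_left (hC _ ⟨?_, (p₁ x hx).2⟩ t ht) hq.le).trans (le_max_left _ _)
      linarith [(p₁ x hx).1]
    · refine (hC _ ⟨by linarith [(p₂ x hx).1], ?_⟩ t ht).trans (le_max_right _ _)
      rw [hΛ]; linarith [(p₂ x hx).2]
    · refine (hC _ ⟨(p₃ x hx).1, ?_⟩ t ht).trans (le_max_right _ _)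
      rw [hΛ]; linarith [(p₃ x hx).2]
  · intro x t δ hδ ht _ hx
    have hx0 := hflow P.s₁ (fun σ => 1 * σ) x δ hδ (by simp) hx
    have h1 := hW.transport (P.turn + P.s₁.phase x) t δ hδ (by linarith [(p₁ x hx0).1])
      (by
        have := (p₁ _ (hx δ ⟨hδ, le_rfl⟩)).2
        rw [Speed.phase_flow] at this
        linarith) ht
    simp only [Speed.phase_flow, one_mul]
    rw [← mul_sub, ← add_assoc, h1, ← intervalIntegral.integral_const_mul]
    refine intervalIntegral.integral_congr_Ioo_of_le hδ fun σ hσ => ?_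
    have hy := hx σ ⟨hσ.1.le, hσ.2.le⟩
    rw [one_mul] at hy
    have h2 : P.turn + P.s₁.phase x + σ = P.turn + P.s₁.phase (P.s₁.flow σ x) := by
      rw [Speed.phase_flow]; ring
    have h3 : ¬ P.turn + P.s₁.phase (P.s₁.flow σ x) ≤ P.turn := by
      rw [← h2]; linarith [hσ.1, (p₁ x hx0).1]
    have h4 : ¬ P.turn + P.s₁.phase (P.s₁.flow σ x) ≤ P.τ := fun h => h3 (h.trans hturn)
    simp only [h2, hQ, Plant.closedLoopPipe, if_neg h3, if_neg h4, i₁, clamp_of_mem hy]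
    field_simp
  · intro x t δ hδ ht _ hx
    have hx0 := hflow P.s₂ (fun σ => -1 * σ) x δ hδ (by simp) hx
    have h1 := hW.transport (P.turn - P.s₂.phase x) t δ hδ (by linarith [(p₂ x hx0).1])
      (by
        have := (p₂ _ (hx δ ⟨hδ, le_rfl⟩)).2
        rw [Speed.phase_flow] at this
        rw [hΛ]
        linarith) ht
    have h2 : ∀ σ, P.turn - P.s₂.phase x + σ = P.turn - P.s₂.phase (P.s₂.flow (-1 * σ) x) :=
      fun σ => by rw [Speed.phase_flow]; ring
    simp only [h2] at h1
    rw [h1]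
    refine intervalIntegral.integral_congr_Ioo_of_le hδ fun σ hσ => ?_
    have hy := hx σ ⟨hσ.1.le, hσ.2.le⟩
    have h3 : ¬ P.turn - P.s₂.phase (P.s₂.flow (-1 * σ) x) ≤ P.τ := by
      rw [← h2]; linarith [hσ.1, (p₂ x hx0).1]
    simp only [hQ, Plant.closedLoopPipe, if_neg h3, if_pos (p₂ _ hy).2, i₂, clamp_of_mem hy]
    ring
  · intro x t δ hδ ht _ hx
    have hx0 := hflow P.s₃ (fun σ => -1 * σ) x δ hδ (by simp) hx
    have h2 : ∀ σ, P.τ * (1 - x) + σ = P.τ * (1 - P.s₃.flow (-1 * σ) x) := fun σ => by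
      rw [P.s₃_flow]; field_simp; ring
    have h1 := hW.transport (P.τ * (1 - x)) t δ hδ (p₃ x hx0).1
      (by
        have := (p₃ _ (hx δ ⟨hδ, le_rfl⟩)).2
        rw [h2, hΛ]
        linarith) ht
    simp only [h2] at h1
    rw [h1]
    refine intervalIntegral.integral_congr fun σ hσ => ?_
    rw [uIcc_of_le hδ] at hσ
    simp only [hQ, Plant.closedLoopPipe, if_pos (p₃ _ (hx σ hσ)).2, zero_mul]
  · simp
  · simp [hturn_eq]
  · obtain ⟨C, hC⟩ := hW.bdd t
    have hi : ∀ a b, 0 ≤ a → a ≤ b → b ≤ Q.Λ →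
        IntervalIntegrable (fun p => Q.k p * W p t) volume a b := fun a b ha hab hb =>
      intervalIntegrable_of_bounded (M := Q.N * C) hab
        (Q.k_meas.mul (hW.meas.comp measurable_prodMk_right)) fun p hp => by
          rw [abs_mul]
          exact mul_le_mul (Q.k_le p) (hC p ⟨ha.trans hp.1, hp.2.trans hb⟩ t ⟨ht.le, le_rfl⟩)
            (abs_nonneg _) Q.N_nonneg
    have h1 := hW.inflow t ht
    rw [← intervalIntegral.integral_add_adjacent_intervals
      (hi 0 P.τ le_rfl hτ.le (by rw [hΛ]; linarith)) (hi P.τ Q.Λ hτ.le (by rw [hΛ]; linarith) le_rfl),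
      ← intervalIntegral.integral_add_adjacent_intervals
      (hi P.τ P.turn hτ.le hturn (by rw [hΛ]; linarith))
      (hi P.turn Q.Λ (by linarith) (by rw [hΛ]; linarith) le_rfl)] at h1
    simp only [sub_self, mul_zero]
    rw [h1]
    have q3 : ∫ p in (0 : ℝ)..P.τ, Q.k p * W p t =
        ∫ y in (0 : ℝ)..1, P.τ * P.ε₂ 1 * α₂ (1 - y) 1 * W (P.τ * (1 - y)) t := by
      have h2 := intervalIntegral.integral_comp_sub_left (a := 0) (b := 1)
        (fun x => Q.k (P.τ * x) * W (P.τ * x) t) 1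
      have h3 := intervalIntegral.mul_integral_comp_mul_left (a := 0) (b := 1)
        (f := fun p => Q.k p * W p t) P.τ
      rw [sub_self, sub_zero] at h2
      rw [mul_zero, mul_one, ← h2] at h3
      rw [← h3, ← intervalIntegral.integral_const_mul]
      refine intervalIntegral.integral_congr fun y hy => ?_
      rw [uIcc_of_le zero_le_one] at hy
      have h4 : 1 - y ∈ Icc (0 : ℝ) 1 := ⟨by linarith [hy.2], by linarith [hy.1]⟩
      simp only [hQ, Plant.closedLoopPipe, if_pos (p₃ y hy).2, mul_div_cancel_left₀ _ hτ',
        clamp_of_mem h4, P.s₂_e (show (1 : ℝ) ∈ Icc (0 : ℝ) 1 by simp)]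
      ring
    have q2 : ∫ p in P.τ..P.turn, Q.k p * W p t =
        ∫ y in (0 : ℝ)..1, α₂ 1 y * W (P.turn - P.s₂.phase y) t := by
      have h2 := intervalIntegral.integral_comp_sub_left (a := 0) (b := P.s₂.phase 1)
        (fun p => Q.k p * W p t) P.turn
      have h3 := P.s₂.integral_phase zero_le_one fun ξ =>
        Q.k (P.turn - ξ) * W (P.turn - ξ) t
      have h5 : P.turn - P.s₂.phase 1 = P.τ := by rw [hturn_eq]; ring
      rw [sub_zero, h5] at h2
      rw [P.s₂.phase_zero, h2] at h3
      rw [h3]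
      refine intervalIntegral.integral_congr_Ioo_of_le zero_le_one fun y hy => ?_
      have hy' : y ∈ Icc (0 : ℝ) 1 := ⟨hy.1.le, hy.2.le⟩
      have h6 : ¬ P.turn - P.s₂.phase y ≤ P.τ := by
        have := P.s₂.phase.strictMono hy.2
        rw [hturn_eq]; linarith
      have := (P.s₂.pos y).ne'
      simp only [hQ, Plant.closedLoopPipe, if_neg h6, if_pos (p₂ y hy').2, i₂, clamp_of_mem hy']
      field_simp
    have q1 : ∫ p in P.turn..Q.Λ, Q.k p * W p t =
        ∫ y in (0 : ℝ)..1, α₁ 1 y * (P.q * W (P.turn + P.s₁.phase y) t) := by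
      have h2 := intervalIntegral.integral_comp_add_left (a := 0) (b := P.s₁.phase 1)
        (fun p => Q.k p * W p t) P.turn
      have h3 := P.s₁.integral_phase zero_le_one fun ξ =>
        Q.k (P.turn + ξ) * W (P.turn + ξ) t
      rw [add_zero, ← hΛ] at h2
      rw [P.s₁.phase_zero, h2] at h3
      rw [h3]
      refine intervalIntegral.integral_congr_Ioo_of_le zero_le_one fun y hy => ?_
      have hy' : y ∈ Icc (0 : ℝ) 1 := ⟨hy.1.le, hy.2.le⟩
      have h6 : ¬ P.turn + P.s₁.phase y ≤ P.turn := by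
        linarith [P.s₁.phase_pos hy.1]
      have h7 : ¬ P.turn + P.s₁.phase y ≤ P.τ := fun h => h6 (h.trans hturn)
      have := (P.s₁.pos y).ne'
      simp only [hQ, Plant.closedLoopPipe, if_neg h6, if_neg h7, i₁, clamp_of_mem hy']
      field_simp
    rw [q1, q2, q3]
    ring
  · have hx' : x ∈ Icc (0 : ℝ) 1 := ⟨hx.1.le, hx.2.le⟩
    have h6 : ¬ P.turn + P.s₁.phase x < P.turn := by linarith [P.s₁.phase_pos hx.1]
    have h7 : ¬ P.turn + P.s₁.phase x < P.τ := fun h => h6 (h.trans_le hturn)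
    simp only [hW0 _ ⟨by linarith [(p₁ x hx').1], (p₁ x hx').2⟩, if_neg h6, if_neg h7, i₁]
    field_simp
  · have hx' : x ∈ Icc (0 : ℝ) 1 := ⟨hx.1.le, hx.2.le⟩
    have h6 : P.turn - P.s₂.phase x < P.turn := by linarith [P.s₂.phase_pos hx.1]
    have h7 : ¬ P.turn - P.s₂.phase x < P.τ := by linarith [(p₂ x hx').1]
    have h8 : P.turn - P.s₂.phase x ≤ Q.Λ := by rw [hΛ]; linarith
    simp only [hW0 _ ⟨by linarith [(p₂ x hx').1], h8⟩, if_pos h6, if_neg h7, i₂]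
  · have hx' : x ∈ Icc (0 : ℝ) 1 := ⟨hx.1.le, hx.2.le⟩
    have h6 : P.τ * (1 - x) < P.τ := by nlinarith [hx.1]
    have h8 : P.τ * (1 - x) ≤ Q.Λ := by rw [hΛ]; linarith
    simp only [hW0 _ ⟨(p₃ x hx').1, h8⟩, if_pos h6, mul_div_cancel_left₀ _ hτ', sub_sub_cancel]

end DelayedHyperbolic

namespace DelayedHyperbolic

/-! ### Energy estimates -/

lemma sq_integral_le {h : ℝ → ℝ} {M : ℝ} (hm : Measurable h) (hM : ∀ x ∈ Icc (0 : ℝ) 1, |h x| ≤ M) :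
    (∫ x in (0 : ℝ)..1, h x) ^ 2 ≤ ∫ x in (0 : ℝ)..1, h x ^ 2 := by
  set c := ∫ x in (0 : ℝ)..1, h x with hc
  have i1 : IntervalIntegrable h volume 0 1 := intervalIntegrable_of_bounded zero_le_one hm hM
  have i2 : IntervalIntegrable (fun x => h x ^ 2) volume 0 1 :=
    intervalIntegrable_of_bounded (M := M ^ 2) zero_le_one (hm.pow_const 2) fun x hx => by
      rw [abs_pow]; exact pow_le_pow_left₀ (abs_nonneg _) (hM x hx) 2
  have h1 : 0 ≤ ∫ x in (0 : ℝ)..1, (h x - c) ^ 2 :=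
    intervalIntegral.integral_nonneg zero_le_one fun x _ => sq_nonneg _
  have h2 : ∫ x in (0 : ℝ)..1, (h x - c) ^ 2 = (∫ x in (0 : ℝ)..1, h x ^ 2) - c ^ 2 := by
    have h3 : ∀ x, (h x - c) ^ 2 = h x ^ 2 - 2 * c * h x + c ^ 2 := fun x => by ring
    simp only [h3]
    rw [intervalIntegral.integral_add (i2.sub (i1.const_mul _)) (by simp),
      intervalIntegral.integral_sub i2 (i1.const_mul _), intervalIntegral.integral_const_mul, ← hc]
    simp
    ring
  linarith

/-- The square of `e^{-κt} F` along the characteristics of `F`. -/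
lemma Transported.damped_sq {S : Speed} {s T B M : ℝ} (κ : ℝ) {F G : ℝ → ℝ → ℝ}
    (h : Transported S s (Icc 0 T) F G) (hF : Measurable (Function.uncurry F))
    (hG : Measurable (Function.uncurry G))
    (hFB : ∀ x ∈ Icc (0 : ℝ) 1, ∀ t ∈ Icc 0 T, |F x t| ≤ B)
    (hGM : ∀ x ∈ Icc (0 : ℝ) 1, ∀ t ∈ Icc 0 T, |G x t| ≤ M) :
    Transported S s (Icc 0 T) (fun x t => Real.exp (-κ * t) ^ 2 * F x t ^ 2)
      (fun x t => Real.exp (-κ * t) ^ 2 * (2 * F x t * (G x t - κ * F x t))) := by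
  have hexp : Continuous fun t => Real.exp (-κ * t) := by fun_prop
  obtain ⟨D, hD⟩ := (isCompact_Icc (a := 0) (b := T)).exists_bound_of_continuousOn hexp.continuousOn
  have hem : Measurable (Function.uncurry fun (_ t : ℝ) => Real.exp (-κ * t)) :=
    (hexp.comp continuous_snd).measurable
  have h1 : Transported S s (Icc 0 T) (fun _ t => Real.exp (-κ * t))
      (fun _ t => -κ * Real.exp (-κ * t)) := by
    intro x t δ _ _ _ _
    have h2 : ∀ σ, HasDerivAt (fun σ => Real.exp (-κ * (t + σ)))
        (-κ * Real.exp (-κ * (t + σ))) σ := fun σ => by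
      have := (((hasDerivAt_id σ).const_add t).const_mul (-κ)).exp
      simpa [mul_comm] using this
    have h3 := intervalIntegral.integral_eq_sub_of_hasDerivAt (a := 0) (b := δ)
      (fun σ _ => h2 σ) (Continuous.intervalIntegrable (by fun_prop) _ _)
    rw [h3, add_zero]
  have h4 : ∀ x ∈ Icc (0 : ℝ) 1, ∀ t ∈ Icc 0 T, |(-κ) * Real.exp (-κ * t)| ≤ max (|κ| * D) M :=
    fun x _ t ht => by
      rw [abs_mul, abs_neg]
      exact (mul_le_mul_of_nonneg_left (hD t ht) (abs_nonneg _)).trans (le_max_left _ _)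
  have h5 := h1.mul h (hem.const_mul _) hG h4
    fun x hx t ht => (hGM x hx t ht).trans (le_max_right _ _)
  have hm : Measurable (Function.uncurry fun x t =>
      -κ * Real.exp (-κ * t) * F x t + Real.exp (-κ * t) * G x t) :=
    ((hem.const_mul _).mul hF).add (hem.mul hG)
  have hb : ∀ x ∈ Icc (0 : ℝ) 1, ∀ t ∈ Icc 0 T,
      |-κ * Real.exp (-κ * t) * F x t + Real.exp (-κ * t) * G x t| ≤ |κ| * D * B + D * M :=
    fun x hx t ht => by
      have hD0 : 0 ≤ D := (norm_nonneg _).trans (hD t ht)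
      refine (abs_add_le _ _).trans (add_le_add ?_ ?_)
      · rw [abs_mul, abs_mul, abs_neg]
        exact mul_le_mul (mul_le_mul_of_nonneg_left (hD t ht) (abs_nonneg _)) (hFB x hx t ht)
          (abs_nonneg _) (by positivity)
      · rw [abs_mul]
        exact mul_le_mul (hD t ht) (hGM x hx t ht) (abs_nonneg _) hD0
  have h6 := h5.mul h5 hm hm hb hb
  refine h6.congr (fun x _ t _ => by ring) fun x _ t _ => by ring

/-- The energy balance of a single transport equation, with the boundary terms `bd` of the
respective direction. -/
def EnergyBalance (S : Speed) (κ T : ℝ) (F G : ℝ → ℝ → ℝ) (bd : ℝ → ℝ) : Prop :=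
  IntervalIntegrable (fun t => (∫ x in (0 : ℝ)..1,
    Real.exp (-κ * t) ^ 2 * (2 * F x t * (G x t - κ * F x t)) / S.e x) +
      Real.exp (-κ * t) ^ 2 * bd t) volume 0 T ∧
  Real.exp (-κ * T) ^ 2 * (∫ x in (0 : ℝ)..1, F x T ^ 2 / S.e x) -
      ∫ x in (0 : ℝ)..1, F x 0 ^ 2 / S.e x =
    ∫ t in (0 : ℝ)..T, ((∫ x in (0 : ℝ)..1,
      Real.exp (-κ * t) ^ 2 * (2 * F x t * (G x t - κ * F x t)) / S.e x) +
        Real.exp (-κ * t) ^ 2 * bd t)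

lemma Transported.energyBalance {S : Speed} {s T B M : ℝ} (κ : ℝ) {F G : ℝ → ℝ → ℝ} {bd : ℝ → ℝ}
    (hs : (s = 1 ∧ ∀ t, bd t = F 0 t ^ 2 - F 1 t ^ 2) ∨ (s = -1 ∧ ∀ t, bd t = F 1 t ^ 2 - F 0 t ^ 2))
    (hT : 0 ≤ T) (h : Transported S s (Icc 0 T) F G) (hF : Measurable (Function.uncurry F))
    (hG : Measurable (Function.uncurry G))
    (hFB : ∀ x ∈ Icc (0 : ℝ) 1, ∀ t ∈ Icc 0 T, |F x t| ≤ B)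
    (hGM : ∀ x ∈ Icc (0 : ℝ) 1, ∀ t ∈ Icc 0 T, |G x t| ≤ M) :
    EnergyBalance S κ T F G bd := by
  have h0 : (0 : ℝ) ∈ Icc (0 : ℝ) 1 := by simp
  have h1 : (1 : ℝ) ∈ Icc (0 : ℝ) 1 := by simp
  have hB0 : 0 ≤ B := (abs_nonneg _).trans (hFB 0 h0 0 ⟨le_rfl, hT⟩)
  have hM0 : 0 ≤ M := (abs_nonneg _).trans (hGM 0 h0 0 ⟨le_rfl, hT⟩)
  have hexp : Continuous fun t => Real.exp (-κ * t) := by fun_prop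
  obtain ⟨D, hD⟩ := (isCompact_Icc (a := 0) (b := T)).exists_bound_of_continuousOn hexp.continuousOn
  have hD0 : 0 ≤ D := (norm_nonneg _).trans (hD 0 ⟨le_rfl, hT⟩)
  have hem : Measurable (Function.uncurry fun (_ t : ℝ) => Real.exp (-κ * t)) :=
    (hexp.comp continuous_snd).measurable
  have hD2 : ∀ t ∈ Icc 0 T, |Real.exp (-κ * t) ^ 2| ≤ D ^ 2 := fun t ht => by
    rw [abs_pow]; exact pow_le_pow_left₀ (abs_nonneg _) (hD t ht) 2
  have hF2 : ∀ x ∈ Icc (0 : ℝ) 1, ∀ t ∈ Icc 0 T, |F x t ^ 2| ≤ B ^ 2 := fun x hx t ht => by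
    rw [abs_pow]; exact pow_le_pow_left₀ (abs_nonneg _) (hFB x hx t ht) 2
  set F' : ℝ → ℝ → ℝ := fun x t => Real.exp (-κ * t) ^ 2 * F x t ^ 2 with hF'
  set G' : ℝ → ℝ → ℝ := fun x t => Real.exp (-κ * t) ^ 2 * (2 * F x t * (G x t - κ * F x t)) with hG'
  have hF'm : Measurable (Function.uncurry F') := (hem.pow_const 2).mul (hF.pow_const 2)
  have hG'm : Measurable (Function.uncurry G') :=
    (hem.pow_const 2).mul ((hF.const_mul 2).mul (hG.sub (hF.const_mul κ)))
  set C := max (D ^ 2 * B ^ 2) (D ^ 2 * (2 * B * (M + |κ| * B))) with hC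
  have hF'C : ∀ x ∈ Icc (0 : ℝ) 1, ∀ t ∈ Icc 0 T, |F' x t| ≤ C := fun x hx t ht => by
    rw [hF', abs_mul]
    exact (mul_le_mul (hD2 t ht) (hF2 x hx t ht) (abs_nonneg _) (by positivity)).trans
      (le_max_left _ _)
  have hG'C : ∀ x ∈ Icc (0 : ℝ) 1, ∀ t ∈ Icc 0 T, |G' x t| ≤ C := fun x hx t ht => by
    have h2 : |G x t - κ * F x t| ≤ M + |κ| * B := by
      refine (abs_sub _ _).trans (add_le_add (hGM x hx t ht) ?_)
      rw [abs_mul]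
      exact mul_le_mul_of_nonneg_left (hFB x hx t ht) (abs_nonneg _)
    rw [hG', abs_mul, abs_mul, abs_mul, abs_two]
    exact (mul_le_mul (hD2 t ht) (mul_le_mul (mul_le_mul_of_nonneg_left (hFB x hx t ht) zero_le_two)
      h2 (abs_nonneg _) (by positivity)) (by positivity) (by positivity)).trans (le_max_right _ _)
  have htr := h.damped_sq κ hF hG hFB hGM
  have key : (∫ x in (0 : ℝ)..1, F' x T / S.e x) - ∫ x in (0 : ℝ)..1, F' x 0 / S.e x =
      (∫ t in (0 : ℝ)..T, ∫ x in (0 : ℝ)..1, G' x t / S.e x) +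
        ∫ t in (0 : ℝ)..T, Real.exp (-κ * t) ^ 2 * bd t := by
    rcases hs with ⟨rfl, hbd⟩ | ⟨rfl, hbd⟩
    · rw [htr.integral_right hT hF'm hG'm hF'C hG'C]
      congr 1
      exact intervalIntegral.integral_congr fun t _ => by simp only [hbd, mul_sub]
    · rw [htr.integral_left hT hF'm hG'm hF'C hG'C]
      congr 1
      exact intervalIntegral.integral_congr fun t _ => by simp only [hbd, mul_sub]
  obtain ⟨e, he⟩ := (isCompact_Icc (a := (0 : ℝ)) (b := 1)).exists_bound_of_continuousOn
    S.continuous_inv.continuousOn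
  have i1 : IntervalIntegrable (fun t => ∫ x in (0 : ℝ)..1, G' x t / S.e x) volume 0 T := by
    refine intervalIntegrable_of_bounded (M := C * e) hT
      (measurable_intervalIntegral (f := fun t x => G' x t / S.e x) ?_ measurable_const
        measurable_const) fun t ht => ?_
    · exact (hG'm.comp measurable_swap).div (S.cont.measurable.comp measurable_snd)
    · have := intervalIntegral.norm_integral_le_of_norm_le_const (a := 0) (b := 1) (C := C * e)
        (f := fun x => G' x t / S.e x) fun x hx => by
          rw [uIoc_of_le zero_le_one] at hx
          have hx' : x ∈ Icc (0 : ℝ) 1 := ⟨hx.1.le, hx.2⟩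
          rw [div_eq_mul_one_div, norm_mul]
          exact mul_le_mul (hG'C x hx' t ht) (he x hx') (norm_nonneg _)
            ((abs_nonneg _).trans (hG'C x hx' t ht))
      simpa using this
  have hFm : ∀ x, Measurable fun t => F x t := fun x => hF.comp measurable_prodMk_left
  have i2 : IntervalIntegrable (fun t => Real.exp (-κ * t) ^ 2 * bd t) volume 0 T := by
    have hbm : Measurable bd ∧ ∀ t ∈ Icc 0 T, |bd t| ≤ B ^ 2 + B ^ 2 := by
      rcases hs with ⟨-, hbd⟩ | ⟨-, hbd⟩
      · rw [show bd = fun t => F 0 t ^ 2 - F 1 t ^ 2 from funext hbd]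
        exact ⟨((hFm 0).pow_const 2).sub ((hFm 1).pow_const 2), fun t ht =>
          (abs_sub _ _).trans (add_le_add (hF2 0 h0 t ht) (hF2 1 h1 t ht))⟩
      · rw [show bd = fun t => F 1 t ^ 2 - F 0 t ^ 2 from funext hbd]
        exact ⟨((hFm 1).pow_const 2).sub ((hFm 0).pow_const 2), fun t ht =>
          (abs_sub _ _).trans (add_le_add (hF2 1 h1 t ht) (hF2 0 h0 t ht))⟩
    refine intervalIntegrable_of_bounded (M := D ^ 2 * (B ^ 2 + B ^ 2)) hT
      ((hexp.measurable.pow_const 2).mul hbm.1) fun t ht => ?_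
    rw [abs_mul]
    exact mul_le_mul (hD2 t ht) (hbm.2 t ht) (abs_nonneg _) (by positivity)
  refine ⟨i1.add i2, ?_⟩
  rw [intervalIntegral.integral_add i1 i2, ← key, ← intervalIntegral.integral_const_mul]
  congr 1
  · congr 1; ext x; simp only [hF']; ring
  · congr 1; ext x; simp [hF']

end DelayedHyperbolic

namespace DelayedHyperbolic

/-- The square of the `L²` norm of the state at the time `t`. -/
noncomputable def energy (u₁ u₂ v : ℝ → ℝ → ℝ) (t : ℝ) : ℝ :=
  ∫ x in (0 : ℝ)..1, (u₁ x t ^ 2 + u₂ x t ^ 2 + v x t ^ 2)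

/-- The lower-order terms of the weighted energy balance, at a point. -/
lemma density_le {q a A₁ A₂ e₁ e₂ e₃ k₁ k₂ κ f₁ f₂ f₃ : ℝ} (hκ : 0 ≤ κ) (hA₂ : 0 ≤ A₂)
    (h1 : |k₁ / e₁| ≤ A₁) (h2 : |k₂ / e₂| ≤ A₂) (ha : 0 ≤ a) (ha₁ : a ≤ 1 / e₁) (ha₂ : a ≤ 1 / e₂)
    (ha₃ : a ≤ 1 / e₃) :
    2 * f₁ * (k₁ * f₂ - κ * f₁) / e₁ + (q ^ 2 + 1) * (2 * f₂ * (k₂ * f₁ - κ * f₂) / e₂) +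
        (q ^ 2 + 2) * (2 * f₃ * (0 - κ * f₃) / e₃) ≤
      (A₁ + (q ^ 2 + 1) * A₂ - 2 * κ * a) * (f₁ ^ 2 + f₂ ^ 2 + f₃ ^ 2) := by
  have hx : |2 * (f₁ * f₂)| ≤ f₁ ^ 2 + f₂ ^ 2 := by
    rw [abs_le]; constructor <;> nlinarith [sq_nonneg (f₁ + f₂), sq_nonneg (f₁ - f₂)]
  have hA₁ : 0 ≤ A₁ := (abs_nonneg _).trans h1
  have t1 : k₁ / e₁ * (2 * (f₁ * f₂)) ≤ A₁ * (f₁ ^ 2 + f₂ ^ 2 + f₃ ^ 2) :=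
    (le_abs_self _).trans (by
      rw [abs_mul]
      exact mul_le_mul h1 (hx.trans (by linarith [sq_nonneg f₃])) (abs_nonneg _) hA₁)
  have t2 : k₂ / e₂ * (2 * (f₁ * f₂)) ≤ A₂ * (f₁ ^ 2 + f₂ ^ 2 + f₃ ^ 2) :=
    (le_abs_self _).trans (by
      rw [abs_mul]
      exact mul_le_mul h2 (hx.trans (by linarith [sq_nonneg f₃])) (abs_nonneg _) hA₂)
  have t2' := mul_le_mul_of_nonneg_left t2 (by positivity : 0 ≤ q ^ 2 + 1)
  have s1 : a * f₁ ^ 2 ≤ 1 / e₁ * f₁ ^ 2 := mul_le_mul_of_nonneg_right ha₁ (sq_nonneg _)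
  have s2 : a * f₂ ^ 2 ≤ (q ^ 2 + 1) * (1 / e₂ * f₂ ^ 2) := by
    have h := mul_le_mul_of_nonneg_right ha₂ (sq_nonneg f₂)
    have : 0 ≤ q ^ 2 * (1 / e₂ * f₂ ^ 2) :=
      mul_nonneg (sq_nonneg _) (mul_nonneg (ha.trans ha₂) (sq_nonneg _))
    linarith
  have s3 : a * f₃ ^ 2 ≤ (q ^ 2 + 2) * (1 / e₃ * f₃ ^ 2) := by
    have h := mul_le_mul_of_nonneg_right ha₃ (sq_nonneg f₃)
    have h' : 0 ≤ 1 / e₃ * f₃ ^ 2 := mul_nonneg (ha.trans ha₃) (sq_nonneg _)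
    have : 0 ≤ q ^ 2 * (1 / e₃ * f₃ ^ 2) := mul_nonneg (sq_nonneg _) h'
    linarith
  have s := mul_le_mul_of_nonneg_left (add_le_add (add_le_add s1 s2) s3)
    (by positivity : 0 ≤ 2 * κ)
  calc _ = k₁ / e₁ * (2 * (f₁ * f₂)) + (q ^ 2 + 1) * (k₂ / e₂ * (2 * (f₁ * f₂))) -
        2 * κ * (1 / e₁ * f₁ ^ 2 + (q ^ 2 + 1) * (1 / e₂ * f₂ ^ 2) +
          (q ^ 2 + 2) * (1 / e₃ * f₃ ^ 2)) := by ring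
    _ ≤ _ := by linarith

/-- A priori estimate: the state, and the values that leave the three parts of the system, are
bounded by the initial state in `L²`. The weights `1`, `q² + 1`, `q² + 2` of `u₁`, `u₂`, `v` absorb
the boundary terms, and the exponential weight the lower-order terms and the feedback. -/
theorem exists_energy_estimate {P : Plant} {K21 K22 α₁ α₂ : ℝ → ℝ → ℝ}
    (hα : IsPredictorKernel P K21 K22 α₁ α₂) : ∃ κ C : ℝ, 0 < C ∧ ∀ u₁ u₂ v : ℝ → ℝ → ℝ,
      IsMildSolution P α₁ α₂ u₁ u₂ v → ∀ T, 0 ≤ T →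
        Real.exp (-κ * T) ^ 2 * energy u₁ u₂ v T ≤ C * energy u₁ u₂ v 0 ∧
        ∫ t in (0 : ℝ)..T, Real.exp (-κ * t) ^ 2 * (u₁ 1 t ^ 2 + u₂ 0 t ^ 2 + v 0 t ^ 2) ≤
          C * energy u₁ u₂ v 0 := by
  obtain ⟨N, hN0, m3, m1, m2, b3, b1, b2, -⟩ := feedback_eq_pairing hα
  have hq := P.q_pos
  have hτ := P.τ_pos
  have hc : ∀ {f : ℝ → ℝ}, Continuous f → ∃ M, ∀ x ∈ Icc (0 : ℝ) 1, |f x| ≤ M := fun hf =>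
    isCompact_Icc.exists_bound_of_continuousOn hf.continuousOn
  have e1 : ∀ x, P.s₁.e x ≠ 0 := fun x => (P.s₁.pos x).ne'
  have e2 : ∀ x, P.s₂.e x ≠ 0 := fun x => (P.s₂.pos x).ne'
  have hone : (0 : ℝ) ∈ Icc (0 : ℝ) 1 := by simp
  obtain ⟨A₁, hA₁⟩ := hc (P.continuous_k₁.div P.continuous_s₁ e1)
  obtain ⟨A₂, hA₂⟩ := hc (P.continuous_k₂.div P.continuous_s₂ e2)
  obtain ⟨M₁, hM₁⟩ := hc P.s₁.continuous_inv
  obtain ⟨M₂, hM₂⟩ := hc P.s₂.continuous_inv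
  obtain ⟨E₁, hE₁⟩ := P.s₁.bdd
  obtain ⟨E₂, hE₂⟩ := P.s₂.bdd
  have hA₁0 : 0 ≤ A₁ := (abs_nonneg _).trans (hA₁ 0 hone)
  have hA₂0 : 0 ≤ A₂ := (abs_nonneg _).trans (hA₂ 0 hone)
  have hE₁0 : 0 < E₁ := (P.s₁.pos 0).trans_le (hE₁ 0)
  have hE₂0 : 0 < E₂ := (P.s₂.pos 0).trans_le (hE₂ 0)
  have hM₁0 : 0 ≤ M₁ := (abs_nonneg _).trans (hM₁ 0 hone)
  have hM₂0 : 0 ≤ M₂ := (abs_nonneg _).trans (hM₂ 0 hone)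
  set a := min (1 / E₁) (min (1 / E₂) P.τ) with ha
  have ha0 : 0 < a := lt_min (by positivity) (lt_min (by positivity) hτ)
  have ha₁ : ∀ x, a ≤ 1 / P.s₁.e x := fun x =>
    (min_le_left _ _).trans (one_div_le_one_div_of_le (P.s₁.pos x) (hE₁ x))
  have ha₂ : ∀ x, a ≤ 1 / P.s₂.e x := fun x => (min_le_right _ _).trans
    ((min_le_left _ _).trans (one_div_le_one_div_of_le (P.s₂.pos x) (hE₂ x)))
  have ha₃ : ∀ x, a ≤ 1 / P.s₃.e x := fun x => by
    rw [P.s₃_e, one_div_one_div]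
    exact (min_le_right _ _).trans (min_le_right _ _)
  set b := M₁ + (P.q ^ 2 + 1) * M₂ + (P.q ^ 2 + 2) * P.τ with hb
  have hb0 : 0 < b := by positivity
  set L := A₁ + (P.q ^ 2 + 1) * A₂ with hL
  set κ := (L + (P.q ^ 2 + 2) * (3 * N ^ 2)) / (2 * a) with hκ
  have hκ0 : 0 ≤ κ := by positivity
  have hκa : 2 * κ * a = L + (P.q ^ 2 + 2) * (3 * N ^ 2) := by
    rw [hκ]; field_simp
  refine ⟨κ, b / a + b, by positivity, fun u₁ u₂ v h T hT => ?_⟩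
  obtain ⟨B, hB⟩ := h.bdd T
  have hI : Icc 0 T ⊆ Ici 0 := fun t ht => ht.1
  have hms : ∀ {w : ℝ → ℝ → ℝ}, Measurable (Function.uncurry w) → ∀ t, Measurable fun x => w x t :=
    fun hw t => hw.comp measurable_prodMk_right
  have hmt : ∀ {w : ℝ → ℝ → ℝ}, Measurable (Function.uncurry w) → ∀ x, Measurable fun t => w x t :=
    fun hw x => hw.comp measurable_prodMk_left
  obtain ⟨C₁, hC₁0, hC₁⟩ := P.exists_bound_k₁
  obtain ⟨C₂, hC₂0, hC₂⟩ := P.exists_bound_k₂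
  have bal₁ := (h.eq₁.mono hI).energyBalance κ (B := B) (M := C₁ * B)
    (bd := fun t => u₁ 0 t ^ 2 - u₁ 1 t ^ 2) (Or.inl ⟨rfl, fun _ => rfl⟩) hT h.meas₁
    ((P.continuous_k₁.measurable.comp measurable_fst).mul h.meas₂) (fun x hx t ht => (hB x hx t ht).1)
    fun x hx t ht => by
      rw [abs_mul]; exact mul_le_mul (hC₁ x) (hB x hx t ht).2.1 (abs_nonneg _) hC₁0
  have bal₂ := (h.eq₂.mono hI).energyBalance κ (B := B) (M := C₂ * B)
    (bd := fun t => u₂ 1 t ^ 2 - u₂ 0 t ^ 2) (Or.inr ⟨rfl, fun _ => rfl⟩) hT h.meas₂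
    ((P.continuous_k₂.measurable.comp measurable_fst).mul h.meas₁)
    (fun x hx t ht => (hB x hx t ht).2.1) fun x hx t ht => by
      rw [abs_mul]; exact mul_le_mul (hC₂ x) (hB x hx t ht).1 (abs_nonneg _) hC₂0
  have bal₃ := (h.eq₃.mono hI).energyBalance κ (B := B) (M := 0)
    (bd := fun t => v 1 t ^ 2 - v 0 t ^ 2) (Or.inr ⟨rfl, fun _ => rfl⟩) hT h.meas₃
    measurable_const (fun x hx t ht => (hB x hx t ht).2.2) fun x hx t ht => by simp
  -- integrability in `x` of bounded expressions
  have hB0 : 0 ≤ B := (abs_nonneg _).trans (hB 0 hone 0 ⟨le_rfl, hT⟩).1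
  have isq : ∀ t ∈ Icc 0 T, IntervalIntegrable (fun x => u₁ x t ^ 2) volume 0 1 ∧
      IntervalIntegrable (fun x => u₂ x t ^ 2) volume 0 1 ∧
      IntervalIntegrable (fun x => v x t ^ 2) volume 0 1 := by
    intro t ht
    have : ∀ {w : ℝ → ℝ}, Measurable w → (∀ x ∈ Icc (0 : ℝ) 1, |w x| ≤ B) →
        IntervalIntegrable (fun x => w x ^ 2) volume 0 1 := fun hw hwB =>
      intervalIntegrable_of_bounded (M := B ^ 2) zero_le_one (hw.pow_const 2) fun x hx => by
        rw [abs_pow]; exact pow_le_pow_left₀ (abs_nonneg _) (hwB x hx) 2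
    exact ⟨this (hms h.meas₁ t) fun x hx => (hB x hx t ht).1,
      this (hms h.meas₂ t) fun x hx => (hB x hx t ht).2.1,
      this (hms h.meas₃ t) fun x hx => (hB x hx t ht).2.2⟩
  have icont : ∀ {w c : ℝ → ℝ}, IntervalIntegrable w volume 0 1 → Continuous c →
      IntervalIntegrable (fun x => w x * c x) volume 0 1 := fun hw hc' =>
    hw.mul_continuousOn hc'.continuousOn
  have idiv : ∀ {w : ℝ → ℝ} (S : Speed), IntervalIntegrable w volume 0 1 →
      IntervalIntegrable (fun x => w x / S.e x) volume 0 1 := fun S hw => by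
    have := icont hw S.continuous_inv
    simpa only [mul_one_div] using this
  -- the weighted energy is equivalent to the energy
  set En : ℝ → ℝ := fun t => (∫ x in (0 : ℝ)..1, u₁ x t ^ 2 / P.s₁.e x) +
    (P.q ^ 2 + 1) * (∫ x in (0 : ℝ)..1, u₂ x t ^ 2 / P.s₂.e x) +
    (P.q ^ 2 + 2) * (∫ x in (0 : ℝ)..1, v x t ^ 2 / P.s₃.e x) with hEn
  have hEn_eq : ∀ t ∈ Icc 0 T, En t = ∫ x in (0 : ℝ)..1, (u₁ x t ^ 2 / P.s₁.e x +
      (P.q ^ 2 + 1) * (u₂ x t ^ 2 / P.s₂.e x) + (P.q ^ 2 + 2) * (v x t ^ 2 / P.s₃.e x)) := by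
    intro t ht
    obtain ⟨i1, i2, i3⟩ := isq t ht
    rw [intervalIntegral.integral_add ((idiv _ i1).add ((idiv _ i2).const_mul _))
      ((idiv _ i3).const_mul _), intervalIntegral.integral_add (idiv _ i1) ((idiv _ i2).const_mul _),
      intervalIntegral.integral_const_mul, intervalIntegral.integral_const_mul]
  have hEn_int : ∀ t ∈ Icc 0 T, IntervalIntegrable (fun x => u₁ x t ^ 2 / P.s₁.e x +
      (P.q ^ 2 + 1) * (u₂ x t ^ 2 / P.s₂.e x) + (P.q ^ 2 + 2) * (v x t ^ 2 / P.s₃.e x))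
      volume 0 1 := fun t ht => by
    obtain ⟨i1, i2, i3⟩ := isq t ht
    exact ((idiv _ i1).add ((idiv _ i2).const_mul _)).add ((idiv _ i3).const_mul _)
  have hen_int : ∀ t ∈ Icc 0 T, IntervalIntegrable (fun x => u₁ x t ^ 2 + u₂ x t ^ 2 + v x t ^ 2)
      volume 0 1 := fun t ht => by
    obtain ⟨i1, i2, i3⟩ := isq t ht
    exact (i1.add i2).add i3
  have hlow : ∀ t ∈ Icc 0 T, a * energy u₁ u₂ v t ≤ En t := by
    intro t ht
    rw [hEn_eq t ht, energy, ← intervalIntegral.integral_const_mul]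
    refine intervalIntegral.integral_mono_on zero_le_one ((hen_int t ht).const_mul _)
      (hEn_int t ht) fun x hx => ?_
    have s1 := mul_le_mul_of_nonneg_right (ha₁ x) (sq_nonneg (u₁ x t))
    have s2 := mul_le_mul_of_nonneg_right (ha₂ x) (sq_nonneg (u₂ x t))
    have s3 := mul_le_mul_of_nonneg_right (ha₃ x) (sq_nonneg (v x t))
    have s2' : 0 ≤ P.q ^ 2 * (1 / P.s₂.e x * u₂ x t ^ 2) :=
      mul_nonneg (sq_nonneg _) (mul_nonneg (ha0.le.trans (ha₂ x)) (sq_nonneg _))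
    have s3' : 0 ≤ (P.q ^ 2 + 1) * (1 / P.s₃.e x * v x t ^ 2) :=
      mul_nonneg (by positivity) (mul_nonneg (ha0.le.trans (ha₃ x)) (sq_nonneg _))
    calc _ ≤ 1 / P.s₁.e x * u₁ x t ^ 2 + (P.q ^ 2 + 1) * (1 / P.s₂.e x * u₂ x t ^ 2) +
          (P.q ^ 2 + 2) * (1 / P.s₃.e x * v x t ^ 2) := by linarith
      _ = _ := by ring
  have hup : En 0 ≤ b * energy u₁ u₂ v 0 := by
    have h0 : (0 : ℝ) ∈ Icc 0 T := ⟨le_rfl, hT⟩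
    rw [hEn_eq 0 h0, energy, ← intervalIntegral.integral_const_mul]
    refine intervalIntegral.integral_mono_on zero_le_one (hEn_int 0 h0)
      ((hen_int 0 h0).const_mul _) fun x hx => ?_
    have r1 := mul_le_mul_of_nonneg_right ((le_abs_self _).trans (hM₁ x hx)) (sq_nonneg (u₁ x 0))
    have r2 := mul_le_mul_of_nonneg_left (mul_le_mul_of_nonneg_right
      ((le_abs_self _).trans (hM₂ x hx)) (sq_nonneg (u₂ x 0))) (by positivity : 0 ≤ P.q ^ 2 + 1)
    have h1 : M₁ ≤ b := by
      have : 0 ≤ (P.q ^ 2 + 1) * M₂ + (P.q ^ 2 + 2) * P.τ := by positivity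
      linarith
    have h2 : (P.q ^ 2 + 1) * M₂ ≤ b := by
      have : 0 ≤ (P.q ^ 2 + 2) * P.τ := by positivity
      linarith
    have h3 : (P.q ^ 2 + 2) * P.τ ≤ b := by
      have : 0 ≤ (P.q ^ 2 + 1) * M₂ := by positivity
      linarith
    have t1 := mul_le_mul_of_nonneg_right h1 (sq_nonneg (u₁ x 0))
    have t2 := mul_le_mul_of_nonneg_right h2 (sq_nonneg (u₂ x 0))
    have t3 := mul_le_mul_of_nonneg_right h3 (sq_nonneg (v x 0))
    calc _ = 1 / P.s₁.e x * u₁ x 0 ^ 2 + (P.q ^ 2 + 1) * (1 / P.s₂.e x * u₂ x 0 ^ 2) +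
          (P.q ^ 2 + 2) * P.τ * v x 0 ^ 2 := by
          rw [P.s₃_e, div_div_eq_mul_div, div_one]; ring
      _ ≤ _ := by linarith
  have hen_nonneg : ∀ t, 0 ≤ energy u₁ u₂ v t := fun t =>
    intervalIntegral.integral_nonneg zero_le_one fun x _ => by positivity
  set J₁ := fun t => (∫ x in (0 : ℝ)..1, Real.exp (-κ * t) ^ 2 *
    (2 * u₁ x t * (P.k₁ x * u₂ x t - κ * u₁ x t)) / P.s₁.e x) +
      Real.exp (-κ * t) ^ 2 * (u₁ 0 t ^ 2 - u₁ 1 t ^ 2) with hJ₁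
  set J₂ := fun t => (∫ x in (0 : ℝ)..1, Real.exp (-κ * t) ^ 2 *
    (2 * u₂ x t * (P.k₂ x * u₁ x t - κ * u₂ x t)) / P.s₂.e x) +
      Real.exp (-κ * t) ^ 2 * (u₂ 1 t ^ 2 - u₂ 0 t ^ 2) with hJ₂
  set J₃ := fun t => (∫ x in (0 : ℝ)..1, Real.exp (-κ * t) ^ 2 *
    (2 * v x t * (0 - κ * v x t)) / P.s₃.e x) +
      Real.exp (-κ * t) ^ 2 * (v 1 t ^ 2 - v 0 t ^ 2) with hJ₃
  have key : Real.exp (-κ * T) ^ 2 * En T - En 0 =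
      ∫ t in (0 : ℝ)..T, (J₁ t + (P.q ^ 2 + 1) * J₂ t + (P.q ^ 2 + 2) * J₃ t) := by
    rw [intervalIntegral.integral_add (bal₁.1.add (bal₂.1.const_mul _)) (bal₃.1.const_mul _),
      intervalIntegral.integral_add bal₁.1 (bal₂.1.const_mul _),
      intervalIntegral.integral_const_mul, intervalIntegral.integral_const_mul, ← bal₁.2, ← bal₂.2,
      ← bal₃.2]
    simp only [hEn]
    ring
  -- the integrand is at most minus the outgoing traces
  have hpt : ∀ t ∈ Ioo 0 T, J₁ t + (P.q ^ 2 + 1) * J₂ t + (P.q ^ 2 + 2) * J₃ t ≤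
      -(Real.exp (-κ * t) ^ 2 * (u₁ 1 t ^ 2 + u₂ 0 t ^ 2 + v 0 t ^ 2)) := by
    intro t ht
    have htI : t ∈ Icc 0 T := ⟨ht.1.le, ht.2.le⟩
    set ρ := Real.exp (-κ * t) ^ 2 with hρ
    have hρ0 : 0 ≤ ρ := by positivity
    obtain ⟨i1, i2, i3⟩ := isq t htI
    have bu : ∀ {w g : ℝ → ℝ}, Measurable w → Measurable g → (∀ x ∈ Icc (0 : ℝ) 1, |w x| ≤ B) →
        (∀ x ∈ Icc (0 : ℝ) 1, |g x| ≤ N) → ∀ x ∈ Icc (0 : ℝ) 1, |g x * w x| ≤ N * B :=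
      fun _ _ hw hg x hx => by
        rw [abs_mul]; exact mul_le_mul (hg x hx) (hw x hx) (abs_nonneg _) hN0
    have hsq : ∀ {w g : ℝ → ℝ}, Measurable w → Measurable g → (∀ x ∈ Icc (0 : ℝ) 1, |w x| ≤ B) →
        (∀ x ∈ Icc (0 : ℝ) 1, |g x| ≤ N) → IntervalIntegrable (fun x => w x ^ 2) volume 0 1 →
        (∫ x in (0 : ℝ)..1, g x * w x) ^ 2 ≤ N ^ 2 * ∫ x in (0 : ℝ)..1, w x ^ 2 := by
      intro w g hw hg hwB hgN hi
      have hb' := bu hw hg hwB hgN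
      refine (sq_integral_le (hg.mul hw) hb').trans ?_
      rw [← intervalIntegral.integral_const_mul]
      refine intervalIntegral.integral_mono_on zero_le_one (intervalIntegrable_of_bounded
        (M := (N * B) ^ 2) zero_le_one ((hg.mul hw).pow_const 2) fun x hx => ?_)
        (hi.const_mul _) fun x hx => ?_
      · rw [abs_pow]; exact pow_le_pow_left₀ (abs_nonneg _) (hb' x hx) 2
      · rw [Pi.mul_apply, mul_pow]
        exact mul_le_mul_of_nonneg_right (by
          rw [← sq_abs]; exact pow_le_pow_left₀ (abs_nonneg _) (hgN x hx) 2) (sq_nonneg _)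
    have f1 := hsq (hms h.meas₁ t) m1 (fun x hx => (hB x hx t htI).1) b1 i1
    have f2 := hsq (hms h.meas₂ t) m2 (fun x hx => (hB x hx t htI).2.1) b2 i2
    have f3 := hsq (hms h.meas₃ t) m3 (fun x hx => (hB x hx t htI).2.2) b3 i3
    have hen : energy u₁ u₂ v t = (∫ x in (0 : ℝ)..1, u₁ x t ^ 2) + (∫ x in (0 : ℝ)..1, u₂ x t ^ 2) +
        ∫ x in (0 : ℝ)..1, v x t ^ 2 := by
      rw [energy, intervalIntegral.integral_add (i1.add i2) i3, intervalIntegral.integral_add i1 i2]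
    have hv : v 1 t ^ 2 ≤ 3 * N ^ 2 * energy u₁ u₂ v t := by
      have h3 : ∀ x y z : ℝ, (x + y + z) ^ 2 ≤ 3 * (x ^ 2 + y ^ 2 + z ^ 2) := fun x y z => by
        nlinarith [sq_nonneg (x - y), sq_nonneg (x - z), sq_nonneg (y - z)]
      rw [h.inflow t ht.1, hen]
      refine (h3 _ _ _).trans ?_
      linarith
    -- the lower-order terms are estimated pointwise in `x`
    have iprod : ∀ {f g : ℝ → ℝ}, Measurable f → Measurable g → (∀ x ∈ Icc (0 : ℝ) 1, |f x| ≤ B) →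
        (∀ x ∈ Icc (0 : ℝ) 1, |g x| ≤ B) → IntervalIntegrable (fun x => f x * g x) volume 0 1 :=
      fun hf hg hfB hgB => intervalIntegrable_of_bounded (M := B * B) zero_le_one (hf.mul hg)
        fun x hx => by rw [abs_mul]; exact mul_le_mul (hfB x hx) (hgB x hx) (abs_nonneg _) hB0
    have i12 := iprod (hms h.meas₁ t) (hms h.meas₂ t) (fun x hx => (hB x hx t htI).1)
      fun x hx => (hB x hx t htI).2.1
    have j1 : IntervalIntegrable (fun x =>
        2 * u₁ x t * (P.k₁ x * u₂ x t - κ * u₁ x t) / P.s₁.e x) volume 0 1 :=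
      (idiv P.s₁ (((icont i12 P.continuous_k₁).const_mul 2).sub (i1.const_mul (2 * κ)))).congr
        fun x _ => by ring
    have j2 : IntervalIntegrable (fun x =>
        2 * u₂ x t * (P.k₂ x * u₁ x t - κ * u₂ x t) / P.s₂.e x) volume 0 1 :=
      (idiv P.s₂ (((icont i12 P.continuous_k₂).const_mul 2).sub (i2.const_mul (2 * κ)))).congr
        fun x _ => by ring
    have j3 : IntervalIntegrable (fun x =>
        2 * v x t * (0 - κ * v x t) / P.s₃.e x) volume 0 1 :=
      (idiv P.s₃ (i3.const_mul (-(2 * κ)))).congr fun x _ => by ring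
    have hvol : (∫ x in (0 : ℝ)..1, 2 * u₁ x t * (P.k₁ x * u₂ x t - κ * u₁ x t) / P.s₁.e x) +
        (P.q ^ 2 + 1) * (∫ x in (0 : ℝ)..1,
          2 * u₂ x t * (P.k₂ x * u₁ x t - κ * u₂ x t) / P.s₂.e x) +
        (P.q ^ 2 + 2) * (∫ x in (0 : ℝ)..1, 2 * v x t * (0 - κ * v x t) / P.s₃.e x) ≤
        (L - 2 * κ * a) * energy u₁ u₂ v t := by
      rw [← intervalIntegral.integral_const_mul, ← intervalIntegral.integral_const_mul,
        ← intervalIntegral.integral_add j1 (j2.const_mul _),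
        ← intervalIntegral.integral_add (j1.add (j2.const_mul _)) (j3.const_mul _), energy,
        ← intervalIntegral.integral_const_mul]
      exact intervalIntegral.integral_mono_on zero_le_one
        ((j1.add (j2.const_mul _)).add (j3.const_mul _)) ((hen_int t htI).const_mul _)
        fun x hx => density_le hκ0 hA₂0 (hA₁ x hx) (hA₂ x hx) ha0.le (ha₁ x) (ha₂ x) (ha₃ x)
    have hfac : ∀ (f e J : ℝ → ℝ), (J = fun x => ρ * f x / e x) → ∫ x in (0 : ℝ)..1, J x =
        ρ * ∫ x in (0 : ℝ)..1, f x / e x := fun f e J hJ => by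
      rw [← intervalIntegral.integral_const_mul, hJ]
      congr 1; ext x; ring
    have hq2 : (P.q * u₂ 0 t) ^ 2 = P.q ^ 2 * u₂ 0 t ^ 2 := by ring
    have hfin : (L - 2 * κ * a) * energy u₁ u₂ v t + (P.q ^ 2 + 2) * v 1 t ^ 2 ≤ 0 := by
      have := mul_le_mul_of_nonneg_left hv (by positivity : 0 ≤ P.q ^ 2 + 2)
      rw [hκa]
      linarith
    have e₁ := hfac (fun x => 2 * u₁ x t * (P.k₁ x * u₂ x t - κ * u₁ x t)) P.s₁.e _ rfl
    have e₂ := hfac (fun x => 2 * u₂ x t * (P.k₂ x * u₁ x t - κ * u₂ x t)) P.s₂.e _ rfl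
    have e₃ := hfac (fun x => 2 * v x t * (0 - κ * v x t)) P.s₃.e _ rfl
    simp only [hJ₁, hJ₂, hJ₃, ← hρ, h.left t ht.1.le, h.right t ht.1.le, hq2]
    rw [e₁, e₂, e₃]
    have := mul_le_mul_of_nonneg_left (add_le_add hvol le_rfl |>.trans hfin) hρ0
    linarith
  have htrace : IntervalIntegrable (fun t => Real.exp (-κ * t) ^ 2 *
      (u₁ 1 t ^ 2 + u₂ 0 t ^ 2 + v 0 t ^ 2)) volume 0 T := by
    have h1 : (1 : ℝ) ∈ Icc (0 : ℝ) 1 := by simp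
    refine IntervalIntegrable.continuousOn_mul (intervalIntegrable_of_bounded
      (M := B ^ 2 + B ^ 2 + B ^ 2) hT ?_ fun t ht => ?_) (Continuous.continuousOn (by fun_prop))
    · exact (((hmt h.meas₁ 1).pow_const 2).add ((hmt h.meas₂ 0).pow_const 2)).add
        ((hmt h.meas₃ 0).pow_const 2)
    · refine (abs_add_le _ _).trans (add_le_add ((abs_add_le _ _).trans (add_le_add ?_ ?_)) ?_) <;>
        rw [abs_pow]
      · exact pow_le_pow_left₀ (abs_nonneg _) (hB 1 h1 t ht).1 2
      · exact pow_le_pow_left₀ (abs_nonneg _) (hB 0 hone t ht).2.1 2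
      · exact pow_le_pow_left₀ (abs_nonneg _) (hB 0 hone t ht).2.2 2
  have hmono := intervalIntegral.integral_mono_on_of_le_Ioo hT
    ((bal₁.1.add (bal₂.1.const_mul (P.q ^ 2 + 1))).add (bal₃.1.const_mul (P.q ^ 2 + 2)))
    htrace.neg hpt
  have hmono' : Real.exp (-κ * T) ^ 2 * En T - En 0 ≤ -∫ t in (0 : ℝ)..T,
      Real.exp (-κ * t) ^ 2 * (u₁ 1 t ^ 2 + u₂ 0 t ^ 2 + v 0 t ^ 2) := by
    rw [key, ← intervalIntegral.integral_neg]
    exact hmono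
  have htr0 : 0 ≤ ∫ t in (0 : ℝ)..T,
      Real.exp (-κ * t) ^ 2 * (u₁ 1 t ^ 2 + u₂ 0 t ^ 2 + v 0 t ^ 2) :=
    intervalIntegral.integral_nonneg hT fun t _ => by positivity
  have hTI : T ∈ Icc 0 T := ⟨hT, le_rfl⟩
  have hET : 0 ≤ En T := (mul_nonneg ha0.le (hen_nonneg T)).trans (hlow T hTI)
  have hE0 := hen_nonneg 0
  constructor
  · have h1 : Real.exp (-κ * T) ^ 2 * (a * energy u₁ u₂ v T) ≤ b * energy u₁ u₂ v 0 :=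
      (mul_le_mul_of_nonneg_left (hlow T hTI) (sq_nonneg _)).trans (by linarith)
    have h2 : Real.exp (-κ * T) ^ 2 * energy u₁ u₂ v T ≤ b / a * energy u₁ u₂ v 0 := by
      rw [div_mul_eq_mul_div, le_div_iff₀ ha0]
      linarith
    have h3 : 0 ≤ b * energy u₁ u₂ v 0 := by positivity
    linarith
  · have h1 : 0 ≤ Real.exp (-κ * T) ^ 2 * En T := mul_nonneg (sq_nonneg _) hET
    have h2 : 0 ≤ b / a * energy u₁ u₂ v 0 := by positivity
    linarith

end DelayedHyperbolic

namespace DelayedHyperbolic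

/-! ### Differences, time shifts and `L²` slices of mild solutions -/

open Classical in
/-- The class in `L²(μ)` of a function; it is zero when the function is not square integrable. -/
noncomputable def toL2 (μ : Measure ℝ) (f : ℝ → ℝ) : Lp ℝ 2 μ :=
  if hf : MemLp f 2 μ then hf.toLp f else 0

lemma coeFn_toL2 {μ : Measure ℝ} {f : ℝ → ℝ} (hf : MemLp f 2 μ) : toL2 μ f =ᵐ[μ] f := by
  rw [toL2, dif_pos hf]
  exact hf.coeFn_toLp

lemma toL2_sub {μ : Measure ℝ} {f g : ℝ → ℝ} (hf : MemLp f 2 μ) (hg : MemLp g 2 μ) :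
    toL2 μ (fun x => f x - g x) = toL2 μ f - toL2 μ g := by
  have h : MemLp (fun x => f x - g x) 2 μ := hf.sub hg
  rw [toL2, toL2, toL2, dif_pos hf, dif_pos hg, dif_pos h, ← MemLp.toLp_sub]
  rfl

lemma toL2_congr {μ : Measure ℝ} {f g : ℝ → ℝ} (hf : MemLp f 2 μ) (hfg : f =ᵐ[μ] g) :
    toL2 μ f = toL2 μ g := by
  have hg : MemLp g 2 μ := hf.ae_eq hfg
  rw [toL2, toL2, dif_pos hf, dif_pos hg]
  exact (MemLp.toLp_eq_toLp_iff _ _).2 hfg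

lemma norm_toL2_sq {μ : Measure ℝ} {f : ℝ → ℝ} (hf : MemLp f 2 μ) :
    ‖toL2 μ f‖ ^ 2 = ∫ x, f x ^ 2 ∂μ := by
  rw [← real_inner_self_eq_norm_sq, L2.inner_def]
  refine integral_congr_ae ?_
  filter_upwards [coeFn_toL2 hf] with x hx
  rw [hx, real_inner_self_eq_norm_sq, Real.norm_eq_abs, sq_abs]

/-- The state `u(·,t)` as an element of `L²([0,1])`. -/
noncomputable def slice (u : ℝ → ℝ → ℝ) (t : ℝ) : L2 :=
  toL2 (volume.restrict (Icc (0 : ℝ) 1)) fun x => u x t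

lemma norm_slice_sq {u : ℝ → ℝ → ℝ} {t : ℝ}
    (hu : MemLp (fun x => u x t) 2 (volume.restrict (Icc (0 : ℝ) 1))) :
    ‖slice u t‖ ^ 2 = ∫ x in (0 : ℝ)..1, u x t ^ 2 := by
  rw [slice, norm_toL2_sq hu, intervalIntegral.integral_of_le zero_le_one,
    integral_Icc_eq_integral_Ioc]

lemma Transported.sub {S : Speed} {κ : ℝ} {F G F' G' : ℝ → ℝ → ℝ}
    (h : Transported S κ (Ici 0) F G) (h' : Transported S κ (Ici 0) F' G')
    (hG : Measurable (Function.uncurry G)) (hG' : Measurable (Function.uncurry G'))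
    (hGM : ∀ T, ∃ M, ∀ x ∈ Icc (0 : ℝ) 1, ∀ t ∈ Icc 0 T, |G x t| ≤ M)
    (hGM' : ∀ T, ∃ M, ∀ x ∈ Icc (0 : ℝ) 1, ∀ t ∈ Icc 0 T, |G' x t| ≤ M) :
    Transported S κ (Ici 0) (fun x t => F x t - F' x t) (fun x t => G x t - G' x t) := by
  intro x t δ hδ ht htδ hx
  have hm : Measurable fun σ => (S.flow (κ * σ) x, t + σ) :=
    ((S.continuous_flow_left x).comp (continuous_const.mul continuous_id)).measurable.prodMk
      (by fun_prop)
  have ht0 : 0 ≤ t := ht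
  have hi : ∀ {G : ℝ → ℝ → ℝ}, Measurable (Function.uncurry G) →
      (∀ T, ∃ M, ∀ x ∈ Icc (0 : ℝ) 1, ∀ t ∈ Icc 0 T, |G x t| ≤ M) →
      IntervalIntegrable (fun σ => G (S.flow (κ * σ) x) (t + σ)) volume 0 δ := fun hG hGM => by
    obtain ⟨M, hM⟩ := hGM (t + δ)
    exact intervalIntegrable_of_bounded hδ (hG.comp hm) fun σ hσ =>
      hM _ (hx σ hσ) _ ⟨add_nonneg ht0 hσ.1, by linarith [hσ.2]⟩
  have h1 := h x t δ hδ ht htδ hx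
  have h2 := h' x t δ hδ ht htδ hx
  rw [intervalIntegral.integral_sub (hi hG hGM) (hi hG' hGM'), ← h1, ← h2]
  ring

lemma Transported.shift {S : Speed} {κ r : ℝ} {F G : ℝ → ℝ → ℝ} (hr : 0 ≤ r)
    (h : Transported S κ (Ici 0) F G) :
    Transported S κ (Ici 0) (fun x t => F x (t + r)) (fun x t => G x (t + r)) := by
  intro x t δ hδ ht htδ hx
  have ht0 : 0 ≤ t := ht
  have h1 := h x (t + r) δ hδ (add_nonneg ht0 hr) (by simp only [mem_Ici]; linarith) hx
  simp only [add_right_comm t δ r, h1]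
  exact intervalIntegral.integral_congr fun σ _ => by simp only [add_right_comm t σ r]

namespace IsMildSolution

variable {P : Plant} {K21 K22 α₁ α₂ u₁ u₂ v u₁' u₂' v' : ℝ → ℝ → ℝ}

lemma shift (h : IsMildSolution P α₁ α₂ u₁ u₂ v) {r : ℝ} (hr : 0 ≤ r) :
    IsMildSolution P α₁ α₂ (fun x t => u₁ x (t + r)) (fun x t => u₂ x (t + r))
      (fun x t => v x (t + r)) where
  meas₁ := h.meas₁.comp (measurable_fst.prodMk (measurable_snd.add_const r))
  meas₂ := h.meas₂.comp (measurable_fst.prodMk (measurable_snd.add_const r))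
  meas₃ := h.meas₃.comp (measurable_fst.prodMk (measurable_snd.add_const r))
  bdd T := by
    obtain ⟨B, hB⟩ := h.bdd (T + r)
    exact ⟨B, fun x hx t ht => hB x hx _ ⟨add_nonneg ht.1 hr, by linarith [ht.2]⟩⟩
  eq₁ := h.eq₁.shift hr
  eq₂ := h.eq₂.shift hr
  eq₃ := h.eq₃.shift hr
  left t ht := h.left _ (add_nonneg ht hr)
  right t ht := h.right _ (add_nonneg ht hr)
  inflow t ht := h.inflow _ (add_pos_of_pos_of_nonneg ht hr)

lemma memLp (h : IsMildSolution P α₁ α₂ u₁ u₂ v) {t : ℝ} (ht : 0 ≤ t) :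
    MemLp (fun x => u₁ x t) 2 (volume.restrict (Icc (0 : ℝ) 1)) ∧
    MemLp (fun x => u₂ x t) 2 (volume.restrict (Icc (0 : ℝ) 1)) ∧
    MemLp (fun x => v x t) 2 (volume.restrict (Icc (0 : ℝ) 1)) := by
  obtain ⟨B, hB⟩ := h.bdd t
  have htt : t ∈ Icc 0 t := ⟨ht, le_rfl⟩
  exact ⟨memLp_of_bound (h.meas₁.comp measurable_prodMk_right) fun x hx => (hB x hx t htt).1,
    memLp_of_bound (h.meas₂.comp measurable_prodMk_right) fun x hx => (hB x hx t htt).2.1,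
    memLp_of_bound (h.meas₃.comp measurable_prodMk_right) fun x hx => (hB x hx t htt).2.2⟩

lemma source_bdd (h : IsMildSolution P α₁ α₂ u₁ u₂ v) (T : ℝ) :
    (∃ M, ∀ x ∈ Icc (0 : ℝ) 1, ∀ t ∈ Icc 0 T, |P.k₁ x * u₂ x t| ≤ M) ∧
    ∃ M, ∀ x ∈ Icc (0 : ℝ) 1, ∀ t ∈ Icc 0 T, |P.k₂ x * u₁ x t| ≤ M := by
  obtain ⟨B, hB⟩ := h.bdd T
  obtain ⟨M₁, hM₁, h₁⟩ := P.exists_bound_k₁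
  obtain ⟨M₂, hM₂, h₂⟩ := P.exists_bound_k₂
  refine ⟨⟨M₁ * B, fun x hx t ht => ?_⟩, M₂ * B, fun x hx t ht => ?_⟩ <;> rw [abs_mul]
  · exact mul_le_mul (h₁ x) (hB x hx t ht).2.1 (abs_nonneg _) hM₁
  · exact mul_le_mul (h₂ x) (hB x hx t ht).1 (abs_nonneg _) hM₂

lemma source_meas (h : IsMildSolution P α₁ α₂ u₁ u₂ v) :
    Measurable (Function.uncurry fun x t => P.k₁ x * u₂ x t) ∧
    Measurable (Function.uncurry fun x t => P.k₂ x * u₁ x t) :=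
  ⟨(P.continuous_k₁.measurable.comp measurable_fst).mul h.meas₂,
    (P.continuous_k₂.measurable.comp measurable_fst).mul h.meas₁⟩

lemma sub (hα : IsPredictorKernel P K21 K22 α₁ α₂) (h : IsMildSolution P α₁ α₂ u₁ u₂ v)
    (h' : IsMildSolution P α₁ α₂ u₁' u₂' v') :
    IsMildSolution P α₁ α₂ (fun x t => u₁ x t - u₁' x t) (fun x t => u₂ x t - u₂' x t)
      (fun x t => v x t - v' x t) where
  meas₁ := h.meas₁.sub h'.meas₁
  meas₂ := h.meas₂.sub h'.meas₂
  meas₃ := h.meas₃.sub h'.meas₃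
  bdd T := by
    obtain ⟨B, hB⟩ := h.bdd T
    obtain ⟨B', hB'⟩ := h'.bdd T
    exact ⟨B + B', fun x hx t ht =>
      ⟨(abs_sub _ _).trans (add_le_add (hB x hx t ht).1 (hB' x hx t ht).1),
      (abs_sub _ _).trans (add_le_add (hB x hx t ht).2.1 (hB' x hx t ht).2.1),
      (abs_sub _ _).trans (add_le_add (hB x hx t ht).2.2 (hB' x hx t ht).2.2)⟩⟩
  eq₁ := by
    simp only [mul_sub]
    exact h.eq₁.sub h'.eq₁ h.source_meas.1 h'.source_meas.1 (fun T => (h.source_bdd T).1)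
      fun T => (h'.source_bdd T).1
  eq₂ := by
    simp only [mul_sub]
    exact h.eq₂.sub h'.eq₂ h.source_meas.2 h'.source_meas.2 (fun T => (h.source_bdd T).2)
      fun T => (h'.source_bdd T).2
  eq₃ := by
    simpa using h.eq₃.sub h'.eq₃ measurable_const measurable_const
      (fun T => ⟨0, by simp⟩) fun T => ⟨0, by simp⟩
  left t ht := by rw [h.left t ht, h'.left t ht]; ring
  right t ht := by rw [h.right t ht, h'.right t ht]
  inflow t ht := by
    obtain ⟨N, -, m3, m1, m2, b3, b1, b2, -⟩ := feedback_eq_pairing hα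
    obtain ⟨l1, l2, l3⟩ := h.memLp ht.le
    obtain ⟨l1', l2', l3'⟩ := h'.memLp ht.le
    have hi : ∀ {m w : ℝ → ℝ}, Measurable m → (∀ x ∈ Icc (0 : ℝ) 1, |m x| ≤ N) →
        MemLp w 2 (volume.restrict (Icc (0 : ℝ) 1)) →
        IntervalIntegrable (fun x => m x * w x) volume 0 1 := fun hm hb hw =>
      (intervalIntegrable_iff_integrableOn_Icc_of_le zero_le_one).2
        ((memLp_of_bound hm hb (p := 2)).integrable_mul hw)
    simp only [mul_sub]
    rw [h.inflow t ht, h'.inflow t ht, intervalIntegral.integral_sub (hi m3 b3 l3) (hi m3 b3 l3'),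
      intervalIntegral.integral_sub (hi m1 b1 l1) (hi m1 b1 l1'),
      intervalIntegral.integral_sub (hi m2 b2 l2) (hi m2 b2 l2')]
    ring

lemma energy_eq (h : IsMildSolution P α₁ α₂ u₁ u₂ v) {t : ℝ} (ht : 0 ≤ t) :
    energy u₁ u₂ v t = ‖slice u₁ t‖ ^ 2 + ‖slice u₂ t‖ ^ 2 + ‖slice v t‖ ^ 2 := by
  obtain ⟨l1, l2, l3⟩ := h.memLp ht
  have hi : ∀ {w : ℝ → ℝ}, MemLp w 2 (volume.restrict (Icc (0 : ℝ) 1)) →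
      IntervalIntegrable (fun x => w x ^ 2) volume 0 1 := fun hw =>
    (intervalIntegrable_iff_integrableOn_Icc_of_le zero_le_one).2 hw.integrable_sq
  rw [norm_slice_sq l1, norm_slice_sq l2, norm_slice_sq l3, energy,
    intervalIntegral.integral_add ((hi l1).add (hi l2)) (hi l3),
    intervalIntegral.integral_add (hi l1) (hi l2)]

lemma trace_bdd (h : IsMildSolution P α₁ α₂ u₁ u₂ v) (T : ℝ) :
    ∃ B, ∀ t ∈ Icc 0 T, |u₁ 1 t| ≤ B ∧ |u₂ 0 t| ≤ B ∧ |v 0 t| ≤ B := by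
  obtain ⟨B, hB⟩ := h.bdd T
  exact ⟨B, fun t ht => ⟨(hB 1 (by simp) t ht).1, (hB 0 (by simp) t ht).2.1,
    (hB 0 (by simp) t ht).2.2⟩⟩

end IsMildSolution

/-- The distance of two mild solutions at the time `t`. -/
noncomputable def stateDist (u₁ u₂ v u₁' u₂' v' : ℝ → ℝ → ℝ) (t : ℝ) : ℝ :=
  ‖slice u₁ t - slice u₁' t‖ + ‖slice u₂ t - slice u₂' t‖ + ‖slice v t - slice v' t‖

lemma stateDist_nonneg (u₁ u₂ v u₁' u₂' v' : ℝ → ℝ → ℝ) (t : ℝ) :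
    0 ≤ stateDist u₁ u₂ v u₁' u₂' v' t := by unfold stateDist; positivity

/-- The trace `g` on `t ≥ 0`, damped by `e^{-κt}`, as an element of `L²`. -/
noncomputable def dampedTrace (κ : ℝ) (g : ℝ → ℝ) : Lp ℝ 2 (volume.restrict (Ici (0 : ℝ))) :=
  toL2 (volume.restrict (Ici (0 : ℝ))) fun t => Real.exp (-κ * t) * g t

lemma memLp_damped {κ C : ℝ} {g f : ℝ → ℝ} (hg : Measurable g)
    (hf : ∀ T, 0 ≤ T → IntervalIntegrable f volume 0 T)
    (hgf : ∀ t, (Real.exp (-κ * t) * g t) ^ 2 ≤ f t)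
    (hC : ∀ T, 0 ≤ T → ∫ t in (0 : ℝ)..T, f t ≤ C) :
    MemLp (fun t => Real.exp (-κ * t) * g t) 2 (volume.restrict (Ici (0 : ℝ))) ∧
      ‖dampedTrace κ g‖ ^ 2 ≤ C := by
  set d := fun t => Real.exp (-κ * t) * g t with hd
  have hdm : Measurable d := Measurable.mul (by fun_prop) hg
  have hi : ∀ T, 0 ≤ T → IntervalIntegrable (fun t => d t ^ 2) volume 0 T := fun T hT =>
    (hf T hT).mono_fun (hdm.pow_const 2).aestronglyMeasurable
      (Filter.Eventually.of_forall fun t => by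
        simp only [Real.norm_eq_abs, abs_of_nonneg (sq_nonneg (d t))]
        exact (hgf t).trans (le_abs_self _))
  have hle : ∀ T, 0 ≤ T → ∫ t in (0 : ℝ)..T, d t ^ 2 ≤ C := fun T hT =>
    (intervalIntegral.integral_mono_on hT (hi T hT) (hf T hT) fun t _ => hgf t).trans (hC T hT)
  have hion : IntegrableOn (fun t => d t ^ 2) (Ioi 0) := by
    refine integrableOn_Ioi_of_intervalIntegral_norm_bounded (b := fun T : ℝ => max T 0) C 0
      (fun T => ?_) (Filter.tendsto_atTop_mono (fun T => le_max_left T 0) Filter.tendsto_id)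
      (Filter.Eventually.of_forall fun T => ?_)
    · exact (intervalIntegrable_iff_integrableOn_Ioc_of_le (le_max_right _ _)).1
        (hi _ (le_max_right _ _))
    · refine le_trans (le_of_eq ?_) (hle (max T 0) (le_max_right _ _))
      exact intervalIntegral.integral_congr fun t _ => by
        simp only [Real.norm_eq_abs, abs_of_nonneg (sq_nonneg (d t))]
  have hmem : MemLp d 2 (volume.restrict (Ici (0 : ℝ))) := by
    rw [memLp_two_iff_integrable_sq hdm.aestronglyMeasurable]
    exact (integrableOn_Ici_iff_integrableOn_Ioi).2 hion
  refine ⟨hmem, ?_⟩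
  rw [dampedTrace, norm_toL2_sq hmem, integral_Ici_eq_integral_Ioi]
  exact le_of_tendsto (intervalIntegral_tendsto_integral_Ioi 0 hion Filter.tendsto_id)
    ((Filter.eventually_ge_atTop 0).mono hle)

/-- The energy estimate for the difference of two mild solutions. -/
theorem exists_stateDist_estimate {P : Plant} {K21 K22 α₁ α₂ : ℝ → ℝ → ℝ}
    (hα : IsPredictorKernel P K21 K22 α₁ α₂) : ∃ κ C : ℝ, 0 ≤ C ∧
      (∀ u₁ u₂ v, IsMildSolution P α₁ α₂ u₁ u₂ v →
        MemLp (fun t => Real.exp (-κ * t) * u₁ 1 t) 2 (volume.restrict (Ici (0 : ℝ))) ∧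
        MemLp (fun t => Real.exp (-κ * t) * u₂ 0 t) 2 (volume.restrict (Ici (0 : ℝ))) ∧
        MemLp (fun t => Real.exp (-κ * t) * v 0 t) 2 (volume.restrict (Ici (0 : ℝ)))) ∧
      ∀ u₁ u₂ v u₁' u₂' v', IsMildSolution P α₁ α₂ u₁ u₂ v → IsMildSolution P α₁ α₂ u₁' u₂' v' →
        (∀ t, 0 ≤ t → stateDist u₁ u₂ v u₁' u₂' v' t ≤
          C * Real.exp (κ * t) * stateDist u₁ u₂ v u₁' u₂' v' 0) ∧
        ‖dampedTrace κ (u₁ 1) - dampedTrace κ (u₁' 1)‖ ≤ C * stateDist u₁ u₂ v u₁' u₂' v' 0 ∧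
        ‖dampedTrace κ (u₂ 0) - dampedTrace κ (u₂' 0)‖ ≤ C * stateDist u₁ u₂ v u₁' u₂' v' 0 ∧
        ‖dampedTrace κ (v 0) - dampedTrace κ (v' 0)‖ ≤ C * stateDist u₁ u₂ v u₁' u₂' v' 0 := by
  obtain ⟨κ, C, hC, hE⟩ := exists_energy_estimate hα
  have hfi : ∀ {u₁ u₂ v}, IsMildSolution P α₁ α₂ u₁ u₂ v → ∀ T, 0 ≤ T →
      IntervalIntegrable (fun t => Real.exp (-κ * t) ^ 2 * (u₁ 1 t ^ 2 + u₂ 0 t ^ 2 + v 0 t ^ 2))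
        volume 0 T := by
    intro u₁ u₂ v h T hT
    obtain ⟨B, hB⟩ := h.trace_bdd T
    refine IntervalIntegrable.continuousOn_mul (intervalIntegrable_of_bounded
      (M := B ^ 2 + B ^ 2 + B ^ 2) hT ?_ fun t ht => ?_) (Continuous.continuousOn (by fun_prop))
    · exact (((h.meas₁.comp measurable_prodMk_left).pow_const 2).add
        ((h.meas₂.comp measurable_prodMk_left).pow_const 2)).add
        ((h.meas₃.comp measurable_prodMk_left).pow_const 2)
    · obtain ⟨a1, a2, a3⟩ := hB t ht
      refine (abs_add_le _ _).trans (add_le_add ((abs_add_le _ _).trans (add_le_add ?_ ?_)) ?_) <;>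
        rw [abs_pow]
      · exact pow_le_pow_left₀ (abs_nonneg _) a1 2
      · exact pow_le_pow_left₀ (abs_nonneg _) a2 2
      · exact pow_le_pow_left₀ (abs_nonneg _) a3 2
  have htr : ∀ {u₁ u₂ v}, IsMildSolution P α₁ α₂ u₁ u₂ v →
      (MemLp (fun t => Real.exp (-κ * t) * u₁ 1 t) 2 (volume.restrict (Ici (0 : ℝ))) ∧
        ‖dampedTrace κ (u₁ 1)‖ ^ 2 ≤ C * energy u₁ u₂ v 0) ∧
      (MemLp (fun t => Real.exp (-κ * t) * u₂ 0 t) 2 (volume.restrict (Ici (0 : ℝ))) ∧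
        ‖dampedTrace κ (u₂ 0)‖ ^ 2 ≤ C * energy u₁ u₂ v 0) ∧
      (MemLp (fun t => Real.exp (-κ * t) * v 0 t) 2 (volume.restrict (Ici (0 : ℝ))) ∧
        ‖dampedTrace κ (v 0)‖ ^ 2 ≤ C * energy u₁ u₂ v 0) := by
    intro u₁ u₂ v h
    have hC' := fun T hT => (hE u₁ u₂ v h T hT).2
    refine ⟨memLp_damped (h.meas₁.comp measurable_prodMk_left) (hfi h) (fun t => ?_) hC',
      memLp_damped (h.meas₂.comp measurable_prodMk_left) (hfi h) (fun t => ?_) hC',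
      memLp_damped (h.meas₃.comp measurable_prodMk_left) (hfi h) (fun t => ?_) hC'⟩ <;>
    · rw [mul_pow]
      refine mul_le_mul_of_nonneg_left ?_ (sq_nonneg _)
      linarith [sq_nonneg (u₁ 1 t), sq_nonneg (u₂ 0 t), sq_nonneg (v 0 t)]
  have hsq : ∀ {a b c d : ℝ}, 0 ≤ a → 0 ≤ b → 0 ≤ c → d ^ 2 ≤ C * (a ^ 2 + b ^ 2 + c ^ 2) →
      d ≤ Real.sqrt C * (a + b + c) := by
    intro a b c d ha hb hc hd
    refine le_of_sq_le_sq ?_ (by positivity)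
    rw [mul_pow, Real.sq_sqrt hC.le]
    refine hd.trans (mul_le_mul_of_nonneg_left ?_ hC.le)
    nlinarith [mul_nonneg ha hb, mul_nonneg ha hc, mul_nonneg hb hc]
  refine ⟨κ, 3 * Real.sqrt C, by positivity,
    fun u₁ u₂ v h => ⟨(htr h).1.1, (htr h).2.1.1, (htr h).2.2.1⟩, ?_⟩
  intro u₁ u₂ v u₁' u₂' v' h h'
  have hd := IsMildSolution.sub hα h h'
  have hsl : ∀ {t}, 0 ≤ t → slice (fun x t => u₁ x t - u₁' x t) t = slice u₁ t - slice u₁' t ∧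
      slice (fun x t => u₂ x t - u₂' x t) t = slice u₂ t - slice u₂' t ∧
      slice (fun x t => v x t - v' x t) t = slice v t - slice v' t := fun ht =>
    ⟨toL2_sub (h.memLp ht).1 (h'.memLp ht).1, toL2_sub (h.memLp ht).2.1 (h'.memLp ht).2.1,
      toL2_sub (h.memLp ht).2.2 (h'.memLp ht).2.2⟩
  have hen : ∀ {t}, 0 ≤ t → energy (fun x t => u₁ x t - u₁' x t) (fun x t => u₂ x t - u₂' x t)
      (fun x t => v x t - v' x t) t = ‖slice u₁ t - slice u₁' t‖ ^ 2 +
        ‖slice u₂ t - slice u₂' t‖ ^ 2 + ‖slice v t - slice v' t‖ ^ 2 := fun ht => by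
    rw [hd.energy_eq ht, (hsl ht).1, (hsl ht).2.1, (hsl ht).2.2]
  have hdt : ∀ {g g' : ℝ → ℝ},
      MemLp (fun t => Real.exp (-κ * t) * g t) 2 (volume.restrict (Ici (0 : ℝ))) →
      MemLp (fun t => Real.exp (-κ * t) * g' t) 2 (volume.restrict (Ici (0 : ℝ))) →
      dampedTrace κ (fun t => g t - g' t) = dampedTrace κ g - dampedTrace κ g' := fun hg hg' => by
    rw [dampedTrace, dampedTrace, dampedTrace, ← toL2_sub hg hg']
    simp only [mul_sub]
  obtain ⟨⟨-, n1⟩, ⟨-, n2⟩, -, n3⟩ := htr hd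
  rw [hdt (htr h).1.1 (htr h').1.1, hen le_rfl] at n1
  rw [hdt (htr h).2.1.1 (htr h').2.1.1, hen le_rfl] at n2
  rw [hdt (htr h).2.2.1 (htr h').2.2.1, hen le_rfl] at n3
  have h0 := stateDist_nonneg u₁ u₂ v u₁' u₂' v' 0
  have hbig : Real.sqrt C * stateDist u₁ u₂ v u₁' u₂' v' 0 ≤
      3 * Real.sqrt C * stateDist u₁ u₂ v u₁' u₂' v' 0 := by
    have := mul_nonneg (Real.sqrt_nonneg C) h0
    linarith
  refine ⟨fun t ht => ?_, ?_, ?_, ?_⟩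
  · have h1 := (hE _ _ _ hd t ht).1
    rw [hen ht, hen le_rfl] at h1
    have hexp : Real.exp (κ * t) * Real.exp (-κ * t) = 1 := by
      rw [← Real.exp_add]; simp
    have key : ∀ {d : ℝ}, d ^ 2 ≤ ‖slice u₁ t - slice u₁' t‖ ^ 2 +
        ‖slice u₂ t - slice u₂' t‖ ^ 2 + ‖slice v t - slice v' t‖ ^ 2 →
        d ≤ Real.sqrt C * Real.exp (κ * t) * stateDist u₁ u₂ v u₁' u₂' v' 0 := by
      intro d hd
      have h2 : (Real.exp (-κ * t) * d) ^ 2 ≤ C * (‖slice u₁ 0 - slice u₁' 0‖ ^ 2 +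
        ‖slice u₂ 0 - slice u₂' 0‖ ^ 2 + ‖slice v 0 - slice v' 0‖ ^ 2) := by
        rw [mul_pow]
        exact (mul_le_mul_of_nonneg_left hd (sq_nonneg _)).trans h1
      have h3 := mul_le_mul_of_nonneg_left
        (hsq (norm_nonneg _) (norm_nonneg _) (norm_nonneg _) h2) (Real.exp_pos (κ * t)).le
      rw [← mul_assoc, hexp, one_mul] at h3
      refine h3.trans (le_of_eq ?_)
      rw [stateDist]
      ring
    have k1 := key (d := ‖slice u₁ t - slice u₁' t‖)
      (by linarith [sq_nonneg ‖slice u₂ t - slice u₂' t‖, sq_nonneg ‖slice v t - slice v' t‖])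
    have k2 := key (d := ‖slice u₂ t - slice u₂' t‖)
      (by linarith [sq_nonneg ‖slice u₁ t - slice u₁' t‖, sq_nonneg ‖slice v t - slice v' t‖])
    have k3 := key (d := ‖slice v t - slice v' t‖)
      (by linarith [sq_nonneg ‖slice u₁ t - slice u₁' t‖, sq_nonneg ‖slice u₂ t - slice u₂' t‖])
    have k4 : stateDist u₁ u₂ v u₁' u₂' v' t = ‖slice u₁ t - slice u₁' t‖ +
      ‖slice u₂ t - slice u₂' t‖ + ‖slice v t - slice v' t‖ := rfl
    linarith
  · exact (hsq (norm_nonneg _) (norm_nonneg _) (norm_nonneg _) n1).trans hbig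
  · exact (hsq (norm_nonneg _) (norm_nonneg _) (norm_nonneg _) n2).trans hbig
  · exact (hsq (norm_nonneg _) (norm_nonneg _) (norm_nonneg _) n3).trans hbig

end DelayedHyperbolic

namespace DelayedHyperbolic

/-! ### Mild solutions are weak solutions -/

/-- Where the initial state is continuous, it is attained pointwise inside the interval: a short
characteristic that ends at `x` starts close to `x`. -/
lemma Transported.tendsto_zero {S : Speed} {s M : ℝ} {F G : ℝ → ℝ → ℝ} {w : ℝ → ℝ}
    (h : Transported S s (Ici 0) F G) (hGM : ∀ x ∈ Icc (0 : ℝ) 1, ∀ t ∈ Icc (0 : ℝ) 1, |G x t| ≤ M)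
    (hw : Continuous w) (h0 : ∀ x ∈ Ioo (0 : ℝ) 1, F x 0 = w x) {x : ℝ} (hx : x ∈ Ioo (0 : ℝ) 1) :
    Filter.Tendsto (F x) (nhdsWithin 0 (Ici 0)) (nhds (F x 0)) := by
  have hc : Continuous fun r => S.flow (s * r) x := (S.continuous_flow_left x).comp (by fun_prop)
  have hnhds : ∀ᶠ r in nhds (0 : ℝ), S.flow (s * r) x ∈ Ioo (0 : ℝ) 1 :=
    hc.tendsto 0 (by simpa using isOpen_Ioo.mem_nhds hx)
  obtain ⟨η, hη, hball⟩ := Metric.eventually_nhds_iff.1 hnhds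
  have hsmall : ∀ᶠ δ in nhdsWithin (0 : ℝ) (Ici 0), 0 ≤ δ ∧ δ < min 1 η :=
    (Filter.eventually_mem_set.2 self_mem_nhdsWithin).and
      (nhdsWithin_le_nhds (Iio_mem_nhds (lt_min one_pos hη)))
  have hest : ∀ᶠ δ in nhdsWithin (0 : ℝ) (Ici 0),
      ‖F x δ - w (S.flow (s * -δ) x)‖ ≤ M * δ := by
    filter_upwards [hsmall] with δ ⟨hδ, hδη⟩
    have hmem : ∀ σ ∈ Icc 0 δ, S.flow (s * (σ - δ)) x ∈ Ioo (0 : ℝ) 1 := fun σ hσ => by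
      refine hball ?_
      rw [Real.dist_eq, sub_zero, abs_lt]
      have := hδη.trans_le (min_le_right _ _)
      exact ⟨by linarith [hσ.1], by linarith [hσ.2]⟩
    have hfl : ∀ σ, S.flow (s * σ) (S.flow (s * -δ) x) = S.flow (s * (σ - δ)) x := fun σ => by
      rw [Speed.flow_flow]; congr 1; ring
    have h1 := h (S.flow (s * -δ) x) 0 δ hδ self_mem_Ici (by simpa using hδ) fun σ hσ => by
      rw [hfl]; exact Ioo_subset_Icc_self (hmem σ hσ)
    rw [hfl, sub_self, mul_zero, Speed.flow_zero, zero_add,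
      h0 _ (by simpa using hmem 0 ⟨le_rfl, hδ⟩)] at h1
    rw [h1]
    have := intervalIntegral.norm_integral_le_of_norm_le_const (a := 0) (b := δ) (C := M)
      (f := fun σ => G (S.flow (s * σ) (S.flow (s * -δ) x)) (0 + σ)) fun σ hσ => by
        rw [uIoc_of_le hδ] at hσ
        rw [hfl, zero_add]
        exact hGM _ (Ioo_subset_Icc_self (hmem σ ⟨hσ.1.le, hσ.2⟩)) _
          ⟨hσ.1.le, hσ.2.trans (hδη.le.trans (min_le_left _ _))⟩
    simpa [abs_of_nonneg hδ] using this
  have hlim : Filter.Tendsto (fun δ : ℝ => M * δ) (nhdsWithin 0 (Ici 0)) (nhds 0) := by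
    have : Continuous fun δ : ℝ => M * δ := by fun_prop
    simpa using (this.tendsto 0).mono_left nhdsWithin_le_nhds
  have hlim' : Filter.Tendsto (fun δ : ℝ => w (S.flow (s * -δ) x)) (nhdsWithin 0 (Ici 0))
      (nhds (F x 0)) := by
    have : Continuous fun δ : ℝ => w (S.flow (s * -δ) x) :=
      hw.comp ((S.continuous_flow_left x).comp (by fun_prop))
    have h2 := (this.tendsto 0).mono_left (nhdsWithin_le_nhds (s := Ici 0))
    rwa [neg_zero, mul_zero, Speed.flow_zero, ← h0 x hx] at h2
  simpa using (squeeze_zero_norm' hest hlim).add hlim'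

lemma tendsto_slice {u : ℝ → ℝ → ℝ} {B : ℝ} (hu : Measurable (Function.uncurry u))
    (hB : ∀ x ∈ Icc (0 : ℝ) 1, ∀ t ∈ Icc (0 : ℝ) 1, |u x t| ≤ B)
    (hlim : ∀ x ∈ Ioo (0 : ℝ) 1, Filter.Tendsto (u x) (nhdsWithin 0 (Ici 0)) (nhds (u x 0))) :
    Filter.Tendsto (fun t => ‖slice u t - slice u 0‖) (nhdsWithin 0 (Ici 0)) (nhds 0) := by
  have h0 : (0 : ℝ) ∈ Icc (0 : ℝ) 1 := by simp
  have hm : ∀ t, Measurable fun x => u x t := fun t => hu.comp measurable_prodMk_right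
  have hmem : ∀ t ∈ Icc (0 : ℝ) 1, MemLp (fun x => u x t) 2 (volume.restrict (Icc (0 : ℝ) 1)) :=
    fun t ht => memLp_of_bound (hm t) fun x hx => hB x hx t ht
  have hsmall : ∀ᶠ t in nhdsWithin (0 : ℝ) (Ici 0), t ∈ Icc (0 : ℝ) 1 :=
    (Filter.eventually_mem_set.2 self_mem_nhdsWithin).and
      (nhdsWithin_le_nhds (Iic_mem_nhds one_pos))
  have hsq : Filter.Tendsto (fun t => ∫ x in (0 : ℝ)..1, (u x t - u x 0) ^ 2)
      (nhdsWithin 0 (Ici 0)) (nhds (∫ x in (0 : ℝ)..1, (0 : ℝ))) := by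
    refine intervalIntegral.tendsto_integral_filter_of_dominated_convergence (fun _ => (B + B) ^ 2)
      (Filter.Eventually.of_forall fun t =>
        (((hm t).sub (hm 0)).pow_const 2).aestronglyMeasurable) ?_ (by simp) ?_
    · filter_upwards [hsmall] with t ht
      refine Filter.Eventually.of_forall fun x hx => ?_
      rw [uIoc_of_le zero_le_one] at hx
      have hx' : x ∈ Icc (0 : ℝ) 1 := ⟨hx.1.le, hx.2⟩
      rw [Real.norm_eq_abs, abs_pow]
      exact pow_le_pow_left₀ (abs_nonneg _)
        ((abs_sub _ _).trans (add_le_add (hB x hx' t ht) (hB x hx' 0 h0))) 2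
    · filter_upwards [compl_mem_ae_iff.2 (measure_singleton (1 : ℝ))] with x hx1 hx
      rw [uIoc_of_le zero_le_one] at hx
      have h1 := hlim x ⟨hx.1, lt_of_le_of_ne hx.2 hx1⟩
      have h2 := (h1.sub_const (u x 0)).pow 2
      simpa using h2
  have hsqrt := (Real.continuous_sqrt.tendsto _).comp hsq
  simp only [intervalIntegral.integral_zero, Real.sqrt_zero] at hsqrt
  refine hsqrt.congr' ?_
  filter_upwards [hsmall] with t ht
  have h1 : slice u t - slice u 0 = slice (fun x _ => u x t - u x 0) 0 :=
    (toL2_sub (hmem t ht) (hmem 0 h0)).symm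
  have h2 := norm_slice_sq (u := fun x _ => u x t - u x 0) (t := 0) ((hmem t ht).sub (hmem 0 h0))
  rw [Function.comp_apply, h1, ← h2, Real.sqrt_sq (norm_nonneg _)]

/-- A mild solution with continuous initial state is continuous in time with values in `L²`: by the
energy estimate, applied to the difference of the solution and its time shift, it is enough to look
at the initial time. -/
lemma IsMildSolution.continuousOn_slice {P : Plant} {K21 K22 α₁ α₂ u₁ u₂ v : ℝ → ℝ → ℝ}
    (hα : IsPredictorKernel P K21 K22 α₁ α₂) (h : IsMildSolution P α₁ α₂ u₁ u₂ v)
    {w₁ w₂ w₃ : ℝ → ℝ} (c₁ : Continuous w₁) (c₂ : Continuous w₂) (c₃ : Continuous w₃)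
    (h0 : ∀ x ∈ Ioo (0 : ℝ) 1, u₁ x 0 = w₁ x ∧ u₂ x 0 = w₂ x ∧ v x 0 = w₃ x) :
    ContinuousOn (slice u₁) (Ici 0) ∧ ContinuousOn (slice u₂) (Ici 0) ∧
      ContinuousOn (slice v) (Ici 0) := by
  obtain ⟨κ, C, hC, -, hest⟩ := exists_stateDist_estimate hα
  obtain ⟨B, hB⟩ := h.bdd 1
  obtain ⟨⟨M₁, hM₁⟩, M₂, hM₂⟩ := h.source_bdd 1
  set D : ℝ → ℝ := fun r =>
    ‖slice u₁ r - slice u₁ 0‖ + ‖slice u₂ r - slice u₂ 0‖ + ‖slice v r - slice v 0‖ with hD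
  have hD0 : Filter.Tendsto D (nhdsWithin 0 (Ici 0)) (nhds 0) := by
    have d1 := tendsto_slice h.meas₁ (fun x hx t ht => (hB x hx t ht).1) fun x hx =>
      h.eq₁.tendsto_zero hM₁ c₁ (fun x hx => (h0 x hx).1) hx
    have d2 := tendsto_slice h.meas₂ (fun x hx t ht => (hB x hx t ht).2.1) fun x hx =>
      h.eq₂.tendsto_zero hM₂ c₂ (fun x hx => (h0 x hx).2.1) hx
    have d3 := tendsto_slice h.meas₃ (fun x hx t ht => (hB x hx t ht).2.2) fun x hx =>
      h.eq₃.tendsto_zero (M := 0) (by simp) c₃ (fun x hx => (h0 x hx).2.2) hx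
    simpa using (d1.add d2).add d3
  have hshift : ∀ r t, 0 ≤ r → 0 ≤ t → ‖slice u₁ (t + r) - slice u₁ t‖ ≤ C * Real.exp (κ * t) * D r ∧
      ‖slice u₂ (t + r) - slice u₂ t‖ ≤ C * Real.exp (κ * t) * D r ∧
      ‖slice v (t + r) - slice v t‖ ≤ C * Real.exp (κ * t) * D r := by
    intro r t hr ht
    have h1 := (hest _ _ _ _ _ _ (h.shift hr) h).1 t ht
    have h2 : stateDist (fun x t => u₁ x (t + r)) (fun x t => u₂ x (t + r)) (fun x t => v x (t + r))
        u₁ u₂ v t = ‖slice u₁ (t + r) - slice u₁ t‖ + ‖slice u₂ (t + r) - slice u₂ t‖ +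
          ‖slice v (t + r) - slice v t‖ := rfl
    have h3 : stateDist (fun x t => u₁ x (t + r)) (fun x t => u₂ x (t + r)) (fun x t => v x (t + r))
        u₁ u₂ v 0 = D r := by
      have : stateDist (fun x t => u₁ x (t + r)) (fun x t => u₂ x (t + r)) (fun x t => v x (t + r))
        u₁ u₂ v 0 = ‖slice u₁ (0 + r) - slice u₁ 0‖ + ‖slice u₂ (0 + r) - slice u₂ 0‖ +
          ‖slice v (0 + r) - slice v 0‖ := rfl
      rw [this, zero_add]
    rw [h2, h3] at h1
    have n1 := norm_nonneg (slice u₁ (t + r) - slice u₁ t)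
    have n2 := norm_nonneg (slice u₂ (t + r) - slice u₂ t)
    have n3 := norm_nonneg (slice v (t + r) - slice v t)
    exact ⟨by linarith, by linarith, by linarith⟩
  have key : ∀ {y : ℝ → L2}, (∀ r t, 0 ≤ r → 0 ≤ t →
      ‖y (t + r) - y t‖ ≤ C * Real.exp (κ * t) * D r) → ContinuousOn y (Ici 0) := by
    intro y hy
    rw [Metric.continuousOn_iff]
    intro t ht ε hε
    have ht0 : 0 ≤ t := ht
    set K := C * Real.exp (|κ| * (t + 1)) with hK
    have hK0 : 0 ≤ K := by positivity
    obtain ⟨δ, hδ, hDδ⟩ := Metric.mem_nhdsWithin_iff.1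
      (hD0 (Metric.ball_mem_nhds 0 (div_pos hε (by linarith : 0 < K + 1))))
    have hstep : ∀ s r, 0 ≤ s → s ≤ t + 1 → 0 ≤ r → r < δ → ‖y (s + r) - y s‖ < ε := by
      intro s r hs hst hr hrδ
      have h1 : D r < ε / (K + 1) := by
        have h2 : r ∈ D ⁻¹' Metric.ball 0 (ε / (K + 1)) := hDδ ⟨by
          rw [Metric.mem_ball, Real.dist_eq, sub_zero, abs_of_nonneg hr]; exact hrδ, hr⟩
        rw [mem_preimage, Metric.mem_ball, Real.dist_eq, sub_zero] at h2
        exact (le_abs_self _).trans_lt h2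
      have h2 : C * Real.exp (κ * s) ≤ K := by
        refine mul_le_mul_of_nonneg_left (Real.exp_le_exp.2 ?_) hC
        exact (mul_le_mul_of_nonneg_right (le_abs_self κ) hs).trans
          (mul_le_mul_of_nonneg_left hst (abs_nonneg κ))
      have hDr : 0 ≤ D r := by positivity
      rw [lt_div_iff₀ (by linarith)] at h1
      have h3 := mul_le_mul_of_nonneg_right h2 hDr
      have h4 := hy r s hr hs
      linarith
    refine ⟨min δ 1, lt_min hδ one_pos, fun s hs hst => ?_⟩
    have hs0 : 0 ≤ s := hs
    rw [Real.dist_eq, lt_min_iff] at hst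
    rw [dist_eq_norm]
    rcases le_total t s with hts | hts
    · rw [abs_of_nonneg (by linarith)] at hst
      have := hstep t (s - t) ht0 (by linarith) (by linarith) hst.1
      rwa [add_sub_cancel] at this
    · rw [abs_of_nonpos (by linarith)] at hst
      have := hstep s (t - s) hs0 (by linarith) (by linarith) (by linarith)
      rw [add_sub_cancel] at this
      rwa [norm_sub_rev]
  exact ⟨key fun r t hr ht => (hshift r t hr ht).1, key fun r t hr ht => (hshift r t hr ht).2.1,
    key fun r t hr ht => (hshift r t hr ht).2.2⟩

lemma deriv_time_eq {ψ : ℝ → ℝ → ℝ} (hψ : ContDiff ℝ 1 fun z : ℝ × ℝ => ψ z.1 z.2)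
    (x t : ℝ) :
    deriv (fun s => ψ x s) t = fderiv ℝ (fun z : ℝ × ℝ => ψ z.1 z.2) (x, t) (0, 1) := by
  have h1 := ((hψ.differentiable one_ne_zero).differentiableAt (x := (x, t))).hasFDerivAt
  have h2 : HasDerivAt (fun s : ℝ => (x, s)) ((0 : ℝ), (1 : ℝ)) t :=
    (hasDerivAt_const t x).prodMk (hasDerivAt_id t)
  exact (h1.comp_hasDerivAt t h2).deriv

lemma deriv_space_eq {ψ : ℝ → ℝ → ℝ} (hψ : ContDiff ℝ 1 fun z : ℝ × ℝ => ψ z.1 z.2)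
    (x t : ℝ) :
    deriv (fun ξ => ψ ξ t) x = fderiv ℝ (fun z : ℝ × ℝ => ψ z.1 z.2) (x, t) (1, 0) := by
  have h1 := ((hψ.differentiable one_ne_zero).differentiableAt (x := (x, t))).hasFDerivAt
  have h2 : HasDerivAt (fun ξ : ℝ => (ξ, t)) ((1 : ℝ), (0 : ℝ)) x :=
    (hasDerivAt_id x).prodMk (hasDerivAt_const x t)
  exact (h1.comp_hasDerivAt x h2).deriv

lemma continuous_deriv_time {ψ : ℝ → ℝ → ℝ} (hψ : ContDiff ℝ 1 fun z : ℝ × ℝ => ψ z.1 z.2) :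
    Continuous (Function.uncurry fun x t => deriv (fun s => ψ x s) t) := by
  simp only [deriv_time_eq hψ]
  exact (hψ.continuous_fderiv one_ne_zero).clm_apply continuous_const

lemma continuous_deriv_space {ψ : ℝ → ℝ → ℝ} (hψ : ContDiff ℝ 1 fun z : ℝ × ℝ => ψ z.1 z.2) :
    Continuous (Function.uncurry fun x t => deriv (fun ξ => ψ ξ t) x) := by
  simp only [deriv_space_eq hψ]
  exact (hψ.continuous_fderiv one_ne_zero).clm_apply continuous_const

lemma transported_of_contDiff {ψ : ℝ → ℝ → ℝ} (hψ : ContDiff ℝ 1 fun z : ℝ × ℝ => ψ z.1 z.2)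
    (S : Speed) (s : ℝ) (I : Set ℝ) :
    Transported S s I ψ fun x t =>
      deriv (fun s => ψ x s) t + s * S.e x * deriv (fun ξ => ψ ξ t) x := by
  intro x t δ _ _ _ _
  have hd : ∀ σ, HasDerivAt (fun σ => ψ (S.flow (s * σ) x) (t + σ))
      (deriv (fun r => ψ (S.flow (s * σ) x) r) (t + σ) + s * S.e (S.flow (s * σ) x) *
        deriv (fun ξ => ψ ξ (t + σ)) (S.flow (s * σ) x)) σ := by
    intro σ
    have h1 := ((hψ.differentiable one_ne_zero).differentiableAt
      (x := (S.flow (s * σ) x, t + σ))).hasFDerivAt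
    have h2 : HasDerivAt (fun σ => S.flow (s * σ) x) (s * S.e (S.flow (s * σ) x)) σ := by
      have := (S.hasDerivAt_flow (s * σ) x).comp σ ((hasDerivAt_id σ).const_mul s)
      simpa [Function.comp_def, mul_comm] using this
    have h3 := h1.comp_hasDerivAt σ (h2.prodMk ((hasDerivAt_id σ).const_add t))
    refine h3.congr_deriv ?_
    rw [deriv_time_eq hψ, deriv_space_eq hψ, ← smul_eq_mul (s * _), ← map_smul, ← map_add]
    simp
  have hfl : Continuous fun σ => S.flow (s * σ) x := (S.continuous_flow_left x).comp (by fun_prop)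
  have hp : Continuous fun σ => (S.flow (s * σ) x, t + σ) := hfl.prodMk (by fun_prop)
  have hc : Continuous fun σ => deriv (fun r => ψ (S.flow (s * σ) x) r) (t + σ) +
      s * S.e (S.flow (s * σ) x) * deriv (fun ξ => ψ ξ (t + σ)) (S.flow (s * σ) x) :=
    ((continuous_deriv_time hψ).comp hp).add
      ((continuous_const.mul (S.cont.comp hfl)).mul ((continuous_deriv_space hψ).comp hp))
  have := intervalIntegral.integral_eq_sub_of_hasDerivAt (a := 0) (b := δ) (fun σ _ => hd σ)
    (hc.intervalIntegrable _ _)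
  rw [this]
  simp

/-- The weak form of a transport equation, for a function that satisfies it along the
characteristics. -/
lemma Transported.weak {S : Speed} {s T B : ℝ} {F G ψ : ℝ → ℝ → ℝ} (hs : s = 1 ∨ s = -1)
    (hT : 0 ≤ T) (h : Transported S s (Icc 0 T) F G) (hF : Measurable (Function.uncurry F))
    (hG : Measurable (Function.uncurry G))
    (hFB : ∀ x ∈ Icc (0 : ℝ) 1, ∀ t ∈ Icc 0 T, |F x t| ≤ B)
    (hGB : ∀ x ∈ Icc (0 : ℝ) 1, ∀ t ∈ Icc 0 T, |G x t| ≤ B)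
    (hψ : ContDiff ℝ 1 fun z : ℝ × ℝ => ψ z.1 z.2) :
    (∫ x in Icc (0 : ℝ) 1, ψ x T / (s * S.e x) * F x T) -
        (∫ x in Icc (0 : ℝ) 1, ψ x 0 / (s * S.e x) * F x 0) =
      (∫ t in (0 : ℝ)..T, ∫ x in Icc (0 : ℝ) 1,
        (deriv (fun s => ψ x s) t / (s * S.e x) + deriv (fun ξ => ψ ξ t) x) * F x t) +
      (∫ t in (0 : ℝ)..T, ∫ x in Icc (0 : ℝ) 1, ψ x t / (s * S.e x) * G x t) +
      ∫ t in (0 : ℝ)..T, (ψ 0 t * F 0 t - ψ 1 t * F 1 t) := by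
  have e0 : ∀ x, S.e x ≠ 0 := fun x => (S.pos x).ne'
  have hss : s * s = 1 := by rcases hs with rfl | rfl <;> norm_num
  have hs0 : s ≠ 0 := fun h => by simp [h] at hss
  have hsinv : s⁻¹ = s := by rw [inv_eq_iff_eq_inv]; exact eq_inv_of_mul_eq_one_left hss
  set D : ℝ → ℝ → ℝ := fun x t =>
    deriv (fun s => ψ x s) t + s * S.e x * deriv (fun ξ => ψ ξ t) x with hD
  have hDc : Continuous (Function.uncurry D) := (continuous_deriv_time hψ).add
    ((continuous_const.mul (S.cont.comp continuous_fst)).mul (continuous_deriv_space hψ))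
  obtain ⟨M, hM⟩ := exists_bound_of_continuous hDc T
  obtain ⟨N, hN⟩ := exists_bound_of_continuous (U := ψ) hψ.continuous T
  obtain ⟨E, hE⟩ := (isCompact_Icc (a := (0 : ℝ)) (b := 1)).exists_bound_of_continuousOn
    S.continuous_inv.continuousOn
  have hB0 : 0 ≤ B := (abs_nonneg _).trans (hFB 0 (by simp) 0 ⟨le_rfl, hT⟩)
  have hN0 : 0 ≤ N := (abs_nonneg _).trans (hN 0 (by simp) 0 ⟨le_rfl, hT⟩)
  have hM0 : 0 ≤ M := (abs_nonneg _).trans (hM 0 (by simp) 0 ⟨le_rfl, hT⟩)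
  have b1 : ∀ x ∈ Icc (0 : ℝ) 1, ∀ t ∈ Icc 0 T, |D x t * F x t| ≤ M * B := fun x hx t ht => by
    rw [abs_mul]; exact mul_le_mul (hM x hx t ht) (hFB x hx t ht) (abs_nonneg _) hM0
  have b2 : ∀ x ∈ Icc (0 : ℝ) 1, ∀ t ∈ Icc 0 T, |ψ x t * G x t| ≤ N * B := fun x hx t ht => by
    rw [abs_mul]; exact mul_le_mul (hN x hx t ht) (hGB x hx t ht) (abs_nonneg _) hN0
  have b3 : ∀ x ∈ Icc (0 : ℝ) 1, ∀ t ∈ Icc 0 T, |ψ x t * F x t| ≤ N * B := fun x hx t ht => by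
    rw [abs_mul]; exact mul_le_mul (hN x hx t ht) (hFB x hx t ht) (abs_nonneg _) hN0
  have hψm : Measurable (Function.uncurry ψ) := hψ.continuous.measurable
  have m1 : Measurable (Function.uncurry fun x t => D x t * F x t) := hDc.measurable.mul hF
  have m2 : Measurable (Function.uncurry fun x t => ψ x t * G x t) := hψm.mul hG
  have m3 : Measurable (Function.uncurry fun x t => ψ x t * F x t) := hψm.mul hF
  have htr := (transported_of_contDiff hψ S s (Icc 0 T)).mul h hDc.measurable hG
    (fun x hx t ht => (hM x hx t ht).trans (le_max_left M B))
    fun x hx t ht => (hGB x hx t ht).trans (le_max_right M B)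
  have bF : ∀ x ∈ Icc (0 : ℝ) 1, ∀ t ∈ Icc 0 T, |ψ x t * F x t| ≤ M * B + N * B :=
    fun x hx t ht => (b3 x hx t ht).trans (by linarith [mul_nonneg hM0 hB0])
  have bG : ∀ x ∈ Icc (0 : ℝ) 1, ∀ t ∈ Icc 0 T, |D x t * F x t + ψ x t * G x t| ≤ M * B + N * B :=
    fun x hx t ht => (abs_add_le _ _).trans (add_le_add (b1 x hx t ht) (b2 x hx t ht))
  have key : (∫ x in (0 : ℝ)..1, ψ x T * F x T / S.e x) - ∫ x in (0 : ℝ)..1, ψ x 0 * F x 0 / S.e x =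
      (∫ t in (0 : ℝ)..T, ∫ x in (0 : ℝ)..1, (D x t * F x t + ψ x t * G x t) / S.e x) +
        s * ∫ t in (0 : ℝ)..T, (ψ 0 t * F 0 t - ψ 1 t * F 1 t) := by
    rcases hs with rfl | rfl
    · rw [htr.integral_right hT m3 (m1.add m2) bF bG, one_mul]
    · rw [htr.integral_left hT m3 (m1.add m2) bF bG, neg_one_mul, ← intervalIntegral.integral_neg]
      simp only [neg_sub]
      rfl
  have hdiv : ∀ {f : ℝ → ℝ → ℝ} {C : ℝ}, Measurable (Function.uncurry f) →
      (∀ x ∈ Icc (0 : ℝ) 1, ∀ t ∈ Icc 0 T, |f x t| ≤ C) →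
      (∀ t ∈ Icc 0 T, IntervalIntegrable (fun x => f x t / S.e x) volume 0 1) ∧
      IntervalIntegrable (fun t => ∫ x in (0 : ℝ)..1, f x t / S.e x) volume 0 T := by
    intro f C hf hfC
    have hb : ∀ x ∈ Icc (0 : ℝ) 1, ∀ t ∈ Icc 0 T, |f x t / S.e x| ≤ C * E := fun x hx t ht => by
      rw [div_eq_mul_one_div, abs_mul]
      exact mul_le_mul (hfC x hx t ht) (hE x hx) (abs_nonneg _)
        ((abs_nonneg _).trans (hfC x hx t ht))
    refine ⟨fun t ht => intervalIntegrable_of_bounded zero_le_one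
      ((hf.comp measurable_prodMk_right).div S.cont.measurable) fun x hx => hb x hx t ht,
      intervalIntegrable_of_bounded (M := C * E) hT (measurable_intervalIntegral
        (f := fun t x => f x t / S.e x) ((hf.comp measurable_swap).div
          (S.cont.measurable.comp measurable_snd)) measurable_const measurable_const)
        fun t ht => ?_⟩
    have := intervalIntegral.norm_integral_le_of_norm_le_const (a := 0) (b := 1) (C := C * E)
      (f := fun x => f x t / S.e x) fun x hx => by
        rw [uIoc_of_le zero_le_one] at hx
        exact hb x ⟨hx.1.le, hx.2⟩ t ht
    simpa using this
  have hsplit : (∫ t in (0 : ℝ)..T, ∫ x in (0 : ℝ)..1, (D x t * F x t + ψ x t * G x t) / S.e x) =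
      (∫ t in (0 : ℝ)..T, ∫ x in (0 : ℝ)..1, D x t * F x t / S.e x) +
        ∫ t in (0 : ℝ)..T, ∫ x in (0 : ℝ)..1, ψ x t * G x t / S.e x := by
    rw [← intervalIntegral.integral_add (hdiv m1 b1).2 (hdiv m2 b2).2]
    refine intervalIntegral.integral_congr fun t ht => ?_
    rw [uIcc_of_le hT] at ht
    simp only [add_div]
    exact intervalIntegral.integral_add ((hdiv m1 b1).1 t ht) ((hdiv m2 b2).1 t ht)
  rw [hsplit] at key
  have hI : ∀ f : ℝ → ℝ, ∫ x in Icc (0 : ℝ) 1, f x = ∫ x in (0 : ℝ)..1, f x := fun f => by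
    rw [intervalIntegral.integral_of_le zero_le_one, integral_Icc_eq_integral_Ioc]
  have p1 : ∀ x t, ψ x t / (s * S.e x) * F x t = s * (ψ x t * F x t / S.e x) := fun x t => by
    rw [div_mul_eq_mul_div, mul_comm s, ← div_div, div_eq_mul_inv _ s, hsinv, mul_comm]
  have p2 : ∀ x t, ψ x t / (s * S.e x) * G x t = s * (ψ x t * G x t / S.e x) := fun x t => by
    rw [div_mul_eq_mul_div, mul_comm s, ← div_div, div_eq_mul_inv _ s, hsinv, mul_comm]
  have p3 : ∀ x t, (deriv (fun s => ψ x s) t / (s * S.e x) + deriv (fun ξ => ψ ξ t) x) * F x t =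
      s * (D x t * F x t / S.e x) := fun x t => by
    have := e0 x
    simp only [hD]
    field_simp
    rw [sq, hss]
    ring
  simp only [hI, p1, p2, p3, intervalIntegral.integral_const_mul]
  rw [← mul_sub, key]
  linear_combination (∫ t in (0 : ℝ)..T, (ψ 0 t * F 0 t - ψ 1 t * F 1 t)) * hss

lemma Transported.isWeakTransportSolution {S : Speed} {s : ℝ} {lam c k a b : ℝ → ℝ}
    {F Z : ℝ → ℝ → ℝ} (hs : s = 1 ∨ s = -1) (hlam : ∀ x ∈ Icc (0 : ℝ) 1, lam x = s * S.e x)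
    (hk : Continuous k) (hkc : ∀ x ∈ Icc (0 : ℝ) 1, k x = c x)
    (h : Transported S s (Ici 0) F fun x t => k x * Z x t)
    (hF : Measurable (Function.uncurry F)) (hZ : Measurable (Function.uncurry Z))
    (hB : ∀ T, ∃ B, ∀ x ∈ Icc (0 : ℝ) 1, ∀ t ∈ Icc 0 T, |F x t| ≤ B ∧ |Z x t| ≤ B)
    (hcont : ContinuousOn (slice F) (Ici 0)) (ha : ∀ t, 0 < t → a t = F 0 t)
    (hb : ∀ t, 0 < t → b t = F 1 t) :
    IsWeakTransportSolution lam (fun x t => c x * slice Z t x) (slice F 0) a b (slice F) := by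
  have hsl : ∀ {W : ℝ → ℝ → ℝ} {T B t : ℝ}, Measurable (Function.uncurry W) → t ∈ Icc 0 T →
      (∀ x ∈ Icc (0 : ℝ) 1, ∀ t ∈ Icc 0 T, |W x t| ≤ B) →
      ∀ᵐ x ∂volume.restrict (Icc (0 : ℝ) 1), slice W t x = W x t := fun hW ht hWB =>
    coeFn_toL2 (memLp_of_bound (hW.comp measurable_prodMk_right) fun x hx => hWB x hx _ ht)
  have htr : ∀ {g : ℝ → ℝ} {x : ℝ}, x ∈ Icc (0 : ℝ) 1 → (∀ t, 0 < t → g t = F x t) → ∀ T,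
      MemLp g 2 (volume.restrict (Icc 0 T)) := by
    intro g x hx hg T
    obtain ⟨B, hB⟩ := hB T
    have h1 : MemLp (F x) 2 (volume.restrict (Icc 0 T)) :=
      MemLp.of_bound (hF.comp measurable_prodMk_left).aestronglyMeasurable B
        ((ae_restrict_iff' measurableSet_Icc).2
          (Filter.Eventually.of_forall fun t ht => (hB x hx t ht).1))
    refine h1.ae_eq ?_
    refine (ae_restrict_iff' measurableSet_Icc).2 ?_
    filter_upwards [compl_mem_ae_iff.2 (measure_singleton (0 : ℝ))] with t ht0 ht
    exact (hg t (lt_of_le_of_ne ht.1 (Ne.symm ht0))).symm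
  refine ⟨hcont, rfl, htr (by simp) ha, htr (by simp) hb, fun ψ hψ T hT => ?_⟩
  obtain ⟨B, hB⟩ := hB T
  obtain ⟨K, hK⟩ := (isCompact_Icc (a := (0 : ℝ)) (b := 1)).exists_bound_of_continuousOn
    hk.continuousOn
  have hB0 : 0 ≤ B := (abs_nonneg _).trans (hB 0 (by simp) 0 ⟨le_rfl, hT⟩).1
  have hK0 : 0 ≤ K := (norm_nonneg _).trans (hK 0 (by simp))
  have hw := (h.mono (I := Icc 0 T) fun t ht => ht.1).weak (B := max B (K * B)) hs hT hF
    ((hk.measurable.comp measurable_fst).mul hZ)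
    (fun x hx t ht => (hB x hx t ht).1.trans (le_max_left _ _)) (fun x hx t ht => by
      rw [abs_mul]
      exact (mul_le_mul (hK x hx) (hB x hx t ht).2 (abs_nonneg _) hK0).trans (le_max_right _ _)) hψ
  have hFae := fun t ht => hsl (T := T) (t := t) hF ht fun x hx t ht => (hB x hx t ht).1
  have hZae := fun t ht => hsl (T := T) (t := t) hZ ht fun x hx t ht => (hB x hx t ht).2
  have hmem : ∀ᵐ x ∂volume.restrict (Icc (0 : ℝ) 1), x ∈ Icc (0 : ℝ) 1 :=
    ae_restrict_mem measurableSet_Icc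
  have c0 : ∀ t ∈ Icc 0 T, ∫ x in Icc (0 : ℝ) 1, ψ x t / lam x * slice F t x =
      ∫ x in Icc (0 : ℝ) 1, ψ x t / (s * S.e x) * F x t := fun t ht => integral_congr_ae (by
    filter_upwards [hFae t ht, hmem] with x hx hxI
    rw [hx, hlam x hxI])
  have c1 : ∀ t ∈ uIcc 0 T, ∫ x in Icc (0 : ℝ) 1,
      (deriv (fun s => ψ x s) t / lam x + deriv (fun ξ => ψ ξ t) x) * slice F t x =
      ∫ x in Icc (0 : ℝ) 1,
        (deriv (fun s => ψ x s) t / (s * S.e x) + deriv (fun ξ => ψ ξ t) x) * F x t := by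
    intro t ht
    rw [uIcc_of_le hT] at ht
    refine integral_congr_ae ?_
    filter_upwards [hFae t ht, hmem] with x hx hxI
    rw [hx, hlam x hxI]
  have c2 : ∀ t ∈ uIcc 0 T, ∫ x in Icc (0 : ℝ) 1, ψ x t / lam x * (c x * slice Z t x) =
      ∫ x in Icc (0 : ℝ) 1, ψ x t / (s * S.e x) * (k x * Z x t) := by
    intro t ht
    rw [uIcc_of_le hT] at ht
    refine integral_congr_ae ?_
    filter_upwards [hZae t ht, hmem] with x hx hxI
    rw [hx, hlam x hxI, hkc x hxI]
  have c3 : ∫ t in (0 : ℝ)..T, (ψ 0 t * a t - ψ 1 t * b t) =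
      ∫ t in (0 : ℝ)..T, (ψ 0 t * F 0 t - ψ 1 t * F 1 t) :=
    intervalIntegral.integral_congr_ae (Filter.Eventually.of_forall fun t ht => by
      rw [uIoc_of_le hT] at ht
      rw [ha t ht.1, hb t ht.1])
  rw [c0 T ⟨hT, le_rfl⟩, c0 0 ⟨le_rfl, hT⟩, intervalIntegral.integral_congr c1,
    intervalIntegral.integral_congr c2, c3]
  exact hw

end DelayedHyperbolic

namespace DelayedHyperbolic

/-! ### Limits of weak solutions -/

lemma tendstoUniformlyOn_of_lipschitz {E : Type*} [NormedAddCommGroup E] {K : Set ℝ} {M : ℝ}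
    {p : ℝ → E → ℝ} {Y : ℕ → ℝ → E} {y : ℝ → E}
    (hp : ∀ t ∈ K, ∀ w w', |p t w - p t w'| ≤ M * ‖w - w'‖)
    (h : TendstoUniformlyOn Y y Filter.atTop K) :
    TendstoUniformlyOn (fun n t => p t (Y n t)) (fun t => p t (y t)) Filter.atTop K := by
  rw [Metric.tendstoUniformlyOn_iff] at h ⊢
  intro ε hε
  filter_upwards [h (ε / (|M| + 1)) (by positivity)] with n hn t ht
  have h1 := hn t ht
  rw [dist_eq_norm, lt_div_iff₀ (by positivity)] at h1
  rw [Real.dist_eq]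
  have h2 := hp t ht (y t) (Y n t)
  have h3 := mul_le_mul_of_nonneg_right (le_abs_self M) (norm_nonneg (y t - Y n t))
  have h4 : ‖y t - Y n t‖ * (|M| + 1) = |M| * ‖y t - Y n t‖ + ‖y t - Y n t‖ := by ring
  linarith [norm_nonneg (y t - Y n t)]

lemma pairing_lipschitz {D : ℝ → ℝ → ℝ} (hD : Continuous (Function.uncurry D)) (T : ℝ) :
    ∃ M, ∀ t ∈ Icc 0 T, ∀ w w' : L2,
      |pairing (fun x => D x t) w - pairing (fun x => D x t) w'| ≤ M * ‖w - w'‖ := by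
  obtain ⟨M, hM⟩ := exists_bound_of_continuous hD T
  refine ⟨M, fun t ht w w' => ?_⟩
  rw [← map_sub]
  exact abs_pairing_le (hD.measurable.comp measurable_prodMk_right) (fun x hx => hM x hx t ht) _

lemma continuousOn_pairing {D : ℝ → ℝ → ℝ} (hD : Continuous (Function.uncurry D)) {y : ℝ → L2}
    (hy : ContinuousOn y (Ici 0)) : ContinuousOn (fun t => pairing (fun x => D x t) (y t)) (Ici 0) := by
  intro t ht
  have ht0 : 0 ≤ t := ht
  have hDt : ∀ t, Continuous fun x => D x t := fun t => hD.comp (continuous_id.prodMk continuous_const)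
  obtain ⟨M, hM⟩ := exists_bound_of_continuous hD (t + 1)
  have hnear : ∀ᶠ s in nhdsWithin t (Ici 0), s ∈ Icc 0 (t + 1) :=
    (Filter.eventually_mem_set.2 self_mem_nhdsWithin).and
      (nhdsWithin_le_nhds (Iic_mem_nhds (by linarith)))
  have h1 : Filter.Tendsto (fun s => pairing (fun x => D x s) (y s - y t)) (nhdsWithin t (Ici 0))
      (nhds 0) := by
    refine squeeze_zero_norm' (a := fun s => M * ‖y s - y t‖) ?_ ?_
    · filter_upwards [hnear] with s hs
      exact abs_pairing_le (hDt s).measurable (fun x hx => hM x hx s hs) _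
    · have h2 : Filter.Tendsto y (nhdsWithin t (Ici 0)) (nhds (y t)) := hy t ht
      have h3 := ((h2.sub_const (y t)).norm).const_mul M
      simpa using h3
  have h2 : Filter.Tendsto (fun s => pairing (fun x => D x s) (y t)) (nhdsWithin t (Ici 0))
      (nhds (pairing (fun x => D x t) (y t))) := by
    simp only [pairing_apply (memLp_of_continuous (hDt _))]
    refine tendsto_integral_filter_of_dominated_convergence (fun x => M * |y t x|)
      (Filter.Eventually.of_forall fun s =>
        (integrable_mul_L2 (memLp_of_continuous (hDt s)) (y t)).aestronglyMeasurable) ?_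
      ((L2.integrable (y t)).abs.const_mul M) (Filter.Eventually.of_forall fun x => ?_)
    · filter_upwards [hnear] with s hs
      filter_upwards [ae_restrict_mem measurableSet_Icc] with x hx
      rw [norm_mul]
      exact mul_le_mul_of_nonneg_right (hM x hx s hs) (norm_nonneg _)
    · have hc : Continuous fun s => D x s * y t x :=
        (hD.comp (continuous_const.prodMk continuous_id)).mul continuous_const
      exact (hc.tendsto t).mono_left nhdsWithin_le_nhds
  have h3 := h1.add h2
  simp only [map_sub, sub_add_cancel, zero_add] at h3
  exact h3

/-- Passage to the limit in the time integral of a linear form with continuous coefficients. -/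
lemma tendsto_integral_pairing {D : ℝ → ℝ → ℝ} (hD : Continuous (Function.uncurry D))
    {Y : ℕ → ℝ → L2} {y : ℝ → L2} {T : ℝ} (hT : 0 ≤ T) (hY : ∀ n, ContinuousOn (Y n) (Ici 0))
    (h : TendstoUniformlyOn Y y Filter.atTop (Icc 0 T)) :
    Filter.Tendsto (fun n => ∫ t in (0 : ℝ)..T, pairing (fun x => D x t) (Y n t)) Filter.atTop
      (nhds (∫ t in (0 : ℝ)..T, pairing (fun x => D x t) (y t))) := by
  obtain ⟨M, hM⟩ := pairing_lipschitz hD T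
  refine TendstoUniformlyOn.tendsto_intervalIntegral_of_continuousOn
    (Filter.Eventually.of_forall fun n => ?_) ?_
  · rw [uIcc_of_le hT]
    exact (continuousOn_pairing hD (hY n)).mono fun t ht => ht.1
  · rw [uIcc_of_le hT]
    exact tendstoUniformlyOn_of_lipschitz (p := fun t w => pairing (fun x => D x t) w) hM h

lemma memLp_intervalIntegrable {g φ : ℝ → ℝ} {T : ℝ} (hT : 0 ≤ T)
    (hg : MemLp g 2 (volume.restrict (Icc 0 T))) (hφ : Continuous φ) :
    IntervalIntegrable (fun t => φ t * g t) volume 0 T := by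
  have h1 : Integrable g (volume.restrict (Icc 0 T)) := hg.integrable one_le_two
  exact ((intervalIntegrable_iff_integrableOn_Icc_of_le hT).2 h1).continuousOn_mul hφ.continuousOn

/-- The weak form is stable under locally uniform convergence in `L²` of the states and weak
convergence of the boundary values. -/
lemma IsWeakTransportSolution.of_tendsto {S : Speed} {s : ℝ} {lam c k a b : ℝ → ℝ}
    {A B : ℕ → ℝ → ℝ} {Y Z : ℕ → ℝ → L2} {y z : ℝ → L2} (hs : s ≠ 0)
    (hlam : ∀ x ∈ Icc (0 : ℝ) 1, lam x = s * S.e x) (hk : Continuous k)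
    (hkc : ∀ x ∈ Icc (0 : ℝ) 1, k x = c x)
    (hn : ∀ n, IsWeakTransportSolution lam (fun x t => c x * Z n t x) (Y n 0) (A n) (B n) (Y n))
    (hZn : ∀ n, ContinuousOn (Z n) (Ici 0))
    (hy : ContinuousOn y (Ici 0))
    (hY : ∀ T, TendstoUniformlyOn Y y Filter.atTop (Icc 0 T))
    (hZ : ∀ T, TendstoUniformlyOn Z z Filter.atTop (Icc 0 T))
    (ha : ∀ T, MemLp a 2 (volume.restrict (Icc 0 T)))
    (hb : ∀ T, MemLp b 2 (volume.restrict (Icc 0 T)))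
    (hA : ∀ T, 0 ≤ T → ∀ φ : ℝ → ℝ, Continuous φ → Filter.Tendsto
      (fun n => ∫ t in (0 : ℝ)..T, φ t * A n t) Filter.atTop (nhds (∫ t in (0 : ℝ)..T, φ t * a t)))
    (hB : ∀ T, 0 ≤ T → ∀ φ : ℝ → ℝ, Continuous φ → Filter.Tendsto
      (fun n => ∫ t in (0 : ℝ)..T, φ t * B n t) Filter.atTop (nhds (∫ t in (0 : ℝ)..T, φ t * b t))) :
    IsWeakTransportSolution lam (fun x t => c x * z t x) (y 0) a b y := by
  refine ⟨hy, rfl, ha, hb, fun ψ hψ T hT => ?_⟩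
  have hse : ∀ x, s * S.e x ≠ 0 := fun x => mul_ne_zero hs (S.pos x).ne'
  have hec : Continuous fun z : ℝ × ℝ => s * S.e z.1 :=
    continuous_const.mul (S.cont.comp continuous_fst)
  set D₀ : ℝ → ℝ → ℝ := fun x t => ψ x t / (s * S.e x) with hD₀
  set D₁ : ℝ → ℝ → ℝ := fun x t =>
    deriv (fun s => ψ x s) t / (s * S.e x) + deriv (fun ξ => ψ ξ t) x with hD₁
  set D₂ : ℝ → ℝ → ℝ := fun x t => ψ x t / (s * S.e x) * k x with hD₂
  have d₀ : Continuous (Function.uncurry D₀) := hψ.continuous.div hec fun z => hse z.1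
  have d₁ : Continuous (Function.uncurry D₁) :=
    ((continuous_deriv_time hψ).div hec fun z => hse z.1).add (continuous_deriv_space hψ)
  have d₂ : Continuous (Function.uncurry D₂) := d₀.mul (hk.comp continuous_fst)
  have hDt : ∀ {D : ℝ → ℝ → ℝ}, Continuous (Function.uncurry D) → ∀ t,
      MemLp (fun x => D x t) 2 (volume.restrict (Icc (0 : ℝ) 1)) := fun hD t =>
    memLp_of_continuous (hD.comp (continuous_id.prodMk continuous_const))
  have e₀ : ∀ (w : L2) t, ∫ x in Icc (0 : ℝ) 1, ψ x t / lam x * w x =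
      pairing (fun x => D₀ x t) w := fun w t => by
    rw [pairing_apply (hDt d₀ t)]
    exact setIntegral_congr_fun measurableSet_Icc fun x hx => by simp only [hD₀, hlam x hx]
  have e₁ : ∀ (w : L2) t, ∫ x in Icc (0 : ℝ) 1,
      (deriv (fun s => ψ x s) t / lam x + deriv (fun ξ => ψ ξ t) x) * w x =
      pairing (fun x => D₁ x t) w := fun w t => by
    rw [pairing_apply (hDt d₁ t)]
    exact setIntegral_congr_fun measurableSet_Icc fun x hx => by simp only [hD₁, hlam x hx]
  have e₂ : ∀ (w : L2) t, ∫ x in Icc (0 : ℝ) 1, ψ x t / lam x * (c x * w x) =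
      pairing (fun x => D₂ x t) w := fun w t => by
    rw [pairing_apply (hDt d₂ t)]
    exact setIntegral_congr_fun measurableSet_Icc fun x hx => by
      simp only [hD₂, hlam x hx, hkc x hx, mul_assoc]
  have c₀ : Continuous (ψ 0) := hψ.continuous.comp (continuous_const.prodMk continuous_id)
  have c₁ : Continuous (ψ 1) := hψ.continuous.comp (continuous_const.prodMk continuous_id)
  have hweak := fun n => (hn n).weak ψ hψ T hT
  simp only [e₀, e₁, e₂] at hweak ⊢
  have hYc := fun n => (hn n).cont
  have l₀ : ∀ t ∈ Icc 0 T, Filter.Tendsto (fun n => pairing (fun x => D₀ x t) (Y n t)) Filter.atTop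
      (nhds (pairing (fun x => D₀ x t) (y t))) := fun t ht =>
    ((pairing fun x => D₀ x t).continuous.tendsto _).comp ((hY T).tendsto_at ht)
  have lhs := (l₀ T ⟨hT, le_rfl⟩).sub (l₀ 0 ⟨le_rfl, hT⟩)
  have rhs := ((tendsto_integral_pairing d₁ hT hYc (hY T)).add
    (tendsto_integral_pairing d₂ hT hZn (hZ T))).add ((hA T hT _ c₀).sub (hB T hT _ c₁))
  rw [intervalIntegral.integral_sub (memLp_intervalIntegrable hT (ha T) c₀)
    (memLp_intervalIntegrable hT (hb T) c₁)]
  refine tendsto_nhds_unique lhs (rhs.congr fun n => ?_)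
  rw [hweak n, intervalIntegral.integral_sub (memLp_intervalIntegrable hT ((hn n).left_memLp T) c₀)
    (memLp_intervalIntegrable hT ((hn n).right_memLp T) c₁)]

lemma exists_uniform_limit {Y : ℕ → ℝ → L2}
    (h : ∀ T, UniformCauchySeqOn Y Filter.atTop (Icc 0 T)) :
    ∃ y, ∀ T, TendstoUniformlyOn Y y Filter.atTop (Icc 0 T) := by
  have h1 : ∀ t, ∃ y, 0 ≤ t → Filter.Tendsto (fun n => Y n t) Filter.atTop (nhds y) := fun t => by
    by_cases ht : 0 ≤ t
    · exact (cauchySeq_tendsto_of_complete ((h t).cauchySeq ⟨ht, le_rfl⟩)).imp fun _ hy _ => hy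
    · exact ⟨0, fun h => absurd h ht⟩
  choose y hy using h1
  exact ⟨y, fun T => (h T).tendstoUniformlyOn_of_tendsto fun t ht => hy t ht.1⟩

lemma continuousOn_of_uniform {Y : ℕ → ℝ → L2} {y : ℝ → L2}
    (h : ∀ T, TendstoUniformlyOn Y y Filter.atTop (Icc 0 T))
    (hY : ∀ n, ContinuousOn (Y n) (Ici 0)) : ContinuousOn y (Ici 0) := by
  intro t ht
  have h1 : ContinuousOn y (Icc 0 (t + 1)) := (h (t + 1)).continuousOn
    (Filter.Eventually.frequently (Filter.Eventually.of_forall fun n =>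
      (hY n).mono fun s hs => hs.1))
  refine (h1 t ⟨ht, by linarith⟩).mono_of_mem_nhdsWithin ?_
  filter_upwards [self_mem_nhdsWithin, nhdsWithin_le_nhds (Iic_mem_nhds (lt_add_one t))] with s h2 h3
  exact ⟨h2, h3⟩

/-- Traces that converge in the damped norm converge to a locally square integrable function. -/
lemma exists_limit_trace {κ : ℝ} {g : ℕ → ℝ → ℝ}
    (hg : ∀ n, MemLp (fun t => Real.exp (-κ * t) * g n t) 2 (volume.restrict (Ici (0 : ℝ))))
    (hc : CauchySeq fun n => dampedTrace κ (g n)) :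
    ∃ g' : ℝ → ℝ, (∀ T, MemLp g' 2 (volume.restrict (Icc 0 T))) ∧
      ∀ T, 0 ≤ T → ∀ φ : ℝ → ℝ, Continuous φ → Filter.Tendsto
        (fun n => ∫ t in (0 : ℝ)..T, φ t * g n t) Filter.atTop
          (nhds (∫ t in (0 : ℝ)..T, φ t * g' t)) := by
  obtain ⟨h, hh⟩ := cauchySeq_tendsto_of_complete hc
  have hexp : ∀ t, Real.exp (κ * t) * Real.exp (-κ * t) = 1 := fun t => by
    rw [← Real.exp_add]; simp
  refine ⟨fun t => Real.exp (κ * t) * h t, fun T => ?_, fun T hT φ hφ => ?_⟩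
  · have h1 : MemLp h 2 (volume.restrict (Icc 0 T)) :=
      (Lp.memLp h).mono_measure (Measure.restrict_mono (fun t ht => ht.1) le_rfl)
    have hec : Continuous fun t => Real.exp (κ * t) := by fun_prop
    obtain ⟨M, hM⟩ := isCompact_Icc.exists_bound_of_continuousOn (s := Icc 0 T) hec.continuousOn
    refine MemLp.of_le_mul (c := M) h1 (hec.aestronglyMeasurable.mul h1.1) ?_
    filter_upwards [ae_restrict_mem measurableSet_Icc] with t ht
    rw [norm_mul]
    exact mul_le_mul_of_nonneg_right (hM t ht) (norm_nonneg _)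
  · -- the integral against `φ` is an inner product in `L²` of the half-line
    set φ' : ℝ → ℝ := (Icc 0 T).indicator fun t => φ t * Real.exp (κ * t) with hφ'
    have hφc : Continuous fun t => φ t * Real.exp (κ * t) := by fun_prop
    obtain ⟨M, hM⟩ := isCompact_Icc.exists_bound_of_continuousOn (s := Icc 0 T) hφc.continuousOn
    have hφm : MemLp φ' 2 (volume.restrict (Ici (0 : ℝ))) := by
      rw [hφ', memLp_indicator_iff_restrict measurableSet_Icc, Measure.restrict_restrict
        measurableSet_Icc, inter_eq_left.2 Icc_subset_Ici_self]
      exact MemLp.of_bound hφc.aestronglyMeasurable M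
        ((ae_restrict_iff' measurableSet_Icc).2 (Filter.Eventually.of_forall hM))
    have hinner : ∀ f : Lp ℝ 2 (volume.restrict (Ici (0 : ℝ))), inner ℝ (toL2 _ φ') f =
        ∫ t in (0 : ℝ)..T, φ t * (Real.exp (κ * t) * f t) := by
      intro f
      rw [L2.inner_def]
      have h1 : ∫ t in Ici (0 : ℝ), inner ℝ (toL2 (volume.restrict (Ici (0 : ℝ))) φ' t) (f t) =
          ∫ t in Ici (0 : ℝ), (Icc 0 T).indicator (fun t => φ t * (Real.exp (κ * t) * f t)) t := by
        refine integral_congr_ae ?_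
        filter_upwards [coeFn_toL2 hφm] with t ht
        rw [ht, hφ']
        by_cases hm : t ∈ Icc 0 T
        · simp only [indicator_of_mem hm, RCLike.inner_apply, conj_trivial]
          ring
        · simp only [indicator_of_notMem hm, RCLike.inner_apply, conj_trivial, mul_zero]
      rw [h1, setIntegral_indicator measurableSet_Icc,
        inter_eq_right.2 Icc_subset_Ici_self, intervalIntegral.integral_of_le hT,
        integral_Icc_eq_integral_Ioc]
    have hlim := Filter.Tendsto.inner (𝕜 := ℝ) (tendsto_const_nhds (x := toL2 _ φ')) hh
    simp only [hinner] at hlim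
    refine hlim.congr fun n => ?_
    refine intervalIntegral.integral_congr_ae ?_
    have h2 := (ae_restrict_iff' measurableSet_Ici).1 (coeFn_toL2 (hg n))
    filter_upwards [h2] with t ht htI
    rw [uIoc_of_le hT] at htI
    rw [dampedTrace, ht htI.1.le, ← mul_assoc (Real.exp _), hexp, one_mul]

end DelayedHyperbolic

namespace DelayedHyperbolic

/-! ### Existence of solutions of the closed loop -/

lemma exists_continuous_approx (W : L2) : ∃ w : ℕ → ℝ → ℝ, (∀ n, Continuous (w n)) ∧
    (∀ n, ∃ B, ∀ x, |w n x| ≤ B) ∧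
    Filter.Tendsto (fun n => toL2 (volume.restrict (Icc (0 : ℝ) 1)) (w n)) Filter.atTop (nhds W) := by
  have h := fun n : ℕ => (Lp.memLp W).exists_boundedContinuous_eLpNorm_sub_le (by norm_num)
    (ε := ENNReal.ofReal (1 / ((n : ℝ) + 1))) (by simp; positivity)
  choose g hg hgm using h
  refine ⟨fun n => g n, fun n => (g n).continuous, fun n => ⟨‖g n‖, (g n).norm_coe_le_norm⟩, ?_⟩
  rw [tendsto_iff_norm_sub_tendsto_zero]
  refine squeeze_zero (fun n => norm_nonneg _) (fun n => ?_) tendsto_one_div_add_atTop_nhds_zero_nat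
  rw [norm_sub_rev, toL2, dif_pos (hgm n)]
  conv_lhs => rw [← Lp.toLp_coeFn W (Lp.memLp W), ← MemLp.toLp_sub, Lp.norm_toLp]
  exact ENNReal.toReal_le_of_le_ofReal (by positivity) (hg n)

variable {P : Plant} {K21 K22 α₁ α₂ : ℝ → ℝ → ℝ}

lemma IsMildSolution.feedback_slice {u₁ u₂ v : ℝ → ℝ → ℝ} (h : IsMildSolution P α₁ α₂ u₁ u₂ v)
    {t : ℝ} (ht : 0 < t) : feedback P α₁ α₂ (slice u₁ t) (slice u₂ t) (slice v t) = v 1 t := by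
  obtain ⟨l1, l2, l3⟩ := h.memLp ht.le
  have hI : ∀ (m w : ℝ → ℝ), MemLp w 2 (volume.restrict (Icc (0 : ℝ) 1)) →
      ∫ y in Icc (0 : ℝ) 1, m y * toL2 (volume.restrict (Icc (0 : ℝ) 1)) w y =
        ∫ y in (0 : ℝ)..1, m y * w y := fun m w hw => by
    rw [intervalIntegral.integral_of_le zero_le_one, ← integral_Icc_eq_integral_Ioc]
    refine integral_congr_ae ?_
    filter_upwards [coeFn_toL2 hw] with y hy
    rw [hy]
  rw [feedback, slice, slice, slice, hI _ _ l1, hI _ _ l2, hI _ _ l3, h.inflow t ht]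

/-- Every mild solution with continuous initial state is a weak solution. -/
lemma IsMildSolution.weak (hα : IsPredictorKernel P K21 K22 α₁ α₂) {u₁ u₂ v : ℝ → ℝ → ℝ}
    (h : IsMildSolution P α₁ α₂ u₁ u₂ v)
    {w₁ w₂ w₃ : ℝ → ℝ} (c₁ : Continuous w₁) (c₂ : Continuous w₂) (c₃ : Continuous w₃)
    (h0 : ∀ x ∈ Ioo (0 : ℝ) 1, u₁ x 0 = w₁ x ∧ u₂ x 0 = w₂ x ∧ v x 0 = w₃ x) :
    IsWeakTransportSolution P.ε₁ (fun x t => P.c₁ x * slice u₂ t x) (slice u₁ 0)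
      (fun t => P.q * u₂ 0 t) (u₁ 1) (slice u₁) ∧
    IsWeakTransportSolution (fun x => -P.ε₂ x) (fun x t => P.c₂ x * slice u₁ t x) (slice u₂ 0)
      (u₂ 0) (v 0) (slice u₂) ∧
    IsWeakTransportSolution (fun _ => -(1 / P.τ)) (fun x t => (0 : ℝ) * slice v t x) (slice v 0)
      (v 0) (fun t => feedback P α₁ α₂ (slice u₁ t) (slice u₂ t) (slice v t)) (slice v) := by
  obtain ⟨s1, s2, s3⟩ := h.continuousOn_slice hα c₁ c₂ c₃ h0
  refine ⟨h.eq₁.isWeakTransportSolution (Or.inl rfl) (fun x hx => by rw [P.s₁_e hx, one_mul])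
      P.continuous_k₁ (fun x hx => P.k₁_eq hx) h.meas₁ h.meas₂ (fun T => ?_) s1
      (fun t ht => (h.left t ht.le).symm) fun _ _ => rfl,
    h.eq₂.isWeakTransportSolution (Or.inr rfl) (fun x hx => by rw [P.s₂_e hx, neg_one_mul])
      P.continuous_k₂ (fun x hx => P.k₂_eq hx) h.meas₂ h.meas₁ (fun T => ?_) s2
      (fun _ _ => rfl) fun t ht => (h.right t ht.le).symm,
    Transported.isWeakTransportSolution (S := P.s₃) (k := fun _ => 0) (F := v) (Z := v)
      (Or.inr rfl) (fun x _ => by rw [P.s₃_e, neg_one_mul])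
      continuous_const (fun _ _ => rfl) (by simpa using h.eq₃) h.meas₃ h.meas₃ (fun T => ?_) s3
      (fun _ _ => rfl) fun t ht => h.feedback_slice ht⟩
  · exact (h.bdd T).imp fun B hB x hx t ht => ⟨(hB x hx t ht).1, (hB x hx t ht).2.1⟩
  · exact (h.bdd T).imp fun B hB x hx t ht => ⟨(hB x hx t ht).2.1, (hB x hx t ht).1⟩
  · exact (h.bdd T).imp fun B hB x hx t ht => ⟨(hB x hx t ht).2.2, (hB x hx t ht).2.2⟩

/-- For every initial state in `L²` the closed loop has a weak solution: it is the limit of mild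
solutions with continuous initial states. -/
theorem exists_isClosedLoopSolution (hα : IsPredictorKernel P K21 K22 α₁ α₂) (u₁₀ u₂₀ v₀ : L2) :
    ∃ u₁ u₂ v : ℝ → L2, IsClosedLoopSolution P α₁ α₂ u₁₀ u₂₀ v₀ u₁ u₂ v := by
  obtain ⟨w₁, c₁, b₁, l₁⟩ := exists_continuous_approx u₁₀
  obtain ⟨w₂, c₂, b₂, l₂⟩ := exists_continuous_approx u₂₀
  obtain ⟨w₃, c₃, b₃, l₃⟩ := exists_continuous_approx v₀
  choose B₁ hB₁ using b₁
  choose B₂ hB₂ using b₂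
  choose B₃ hB₃ using b₃
  have hex := fun n => exists_isMildSolution hα (c₁ n).measurable (c₂ n).measurable
    (c₃ n).measurable (B := max (B₁ n) (max (B₂ n) (B₃ n)))
    (fun x => (hB₁ n x).trans (le_max_left _ _))
    (fun x => (hB₂ n x).trans ((le_max_left _ _).trans (le_max_right _ _)))
    fun x => (hB₃ n x).trans ((le_max_right _ _).trans (le_max_right _ _))
  choose u₁ u₂ v hsol hinit using hex
  obtain ⟨κ, C, hC, hmem, hest⟩ := exists_stateDist_estimate hα
  -- the initial states converge in `L²`
  have hslice0 : ∀ {u : ℝ → ℝ → ℝ} {w : ℝ → ℝ}, MemLp (fun x => u x 0) 2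
      (volume.restrict (Icc (0 : ℝ) 1)) → (∀ x ∈ Ioo (0 : ℝ) 1, u x 0 = w x) →
      slice u 0 = toL2 (volume.restrict (Icc (0 : ℝ) 1)) w := fun hu huw => by
    refine toL2_congr hu ?_
    rw [← Measure.restrict_congr_set (μ := volume) (Ioo_ae_eq_Icc (a := (0 : ℝ)) (b := 1))]
    exact (ae_restrict_iff' measurableSet_Ioo).2 (Filter.Eventually.of_forall huw)
  have i₁ : Filter.Tendsto (fun n => slice (u₁ n) 0) Filter.atTop (nhds u₁₀) :=
    l₁.congr fun n => (hslice0 ((hsol n).memLp le_rfl).1 fun x hx => (hinit n x hx).1).symm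
  have i₂ : Filter.Tendsto (fun n => slice (u₂ n) 0) Filter.atTop (nhds u₂₀) :=
    l₂.congr fun n => (hslice0 ((hsol n).memLp le_rfl).2.1 fun x hx => (hinit n x hx).2.1).symm
  have i₃ : Filter.Tendsto (fun n => slice (v n) 0) Filter.atTop (nhds v₀) :=
    l₃.congr fun n => (hslice0 ((hsol n).memLp le_rfl).2.2 fun x hx => (hinit n x hx).2.2).symm
  have hdist : ∀ ε, 0 < ε → ∃ N, ∀ m ≥ N, ∀ n ≥ N,
      stateDist (u₁ m) (u₂ m) (v m) (u₁ n) (u₂ n) (v n) 0 < ε := by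
    intro ε hε
    obtain ⟨N₁, h₁⟩ := Metric.cauchySeq_iff.1 i₁.cauchySeq (ε / 3) (by positivity)
    obtain ⟨N₂, h₂⟩ := Metric.cauchySeq_iff.1 i₂.cauchySeq (ε / 3) (by positivity)
    obtain ⟨N₃, h₃⟩ := Metric.cauchySeq_iff.1 i₃.cauchySeq (ε / 3) (by positivity)
    refine ⟨max N₁ (max N₂ N₃), fun m hm n hn => ?_⟩
    simp only [ge_iff_le, max_le_iff] at hm hn
    have d₁ := h₁ m hm.1 n hn.1
    have d₂ := h₂ m hm.2.1 n hn.2.1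
    have d₃ := h₃ m hm.2.2 n hn.2.2
    rw [dist_eq_norm] at d₁ d₂ d₃
    rw [stateDist]
    linarith
  -- hence so do the states, locally uniformly in time, and the traces
  have hunif : ∀ {Y : ℕ → ℝ → L2}, (∀ m n t, ‖Y m t - Y n t‖ ≤
      stateDist (u₁ m) (u₂ m) (v m) (u₁ n) (u₂ n) (v n) t) →
      ∀ T, UniformCauchySeqOn Y Filter.atTop (Icc 0 T) := by
    intro Y hY T
    rw [Metric.uniformCauchySeqOn_iff]
    intro ε hε
    set K := C * Real.exp (|κ| * T) with hK
    have hK0 : 0 ≤ K := by positivity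
    obtain ⟨N, hN⟩ := hdist (ε / (K + 1)) (by positivity)
    refine ⟨N, fun m hm n hn t ht => ?_⟩
    have h1 := (hest _ _ _ _ _ _ (hsol m) (hsol n)).1 t ht.1
    have h2 := hN m hm n hn
    have h3 := stateDist_nonneg (u₁ m) (u₂ m) (v m) (u₁ n) (u₂ n) (v n) 0
    have h4 : C * Real.exp (κ * t) ≤ K := by
      refine mul_le_mul_of_nonneg_left (Real.exp_le_exp.2 ?_) hC
      exact (mul_le_mul_of_nonneg_right (le_abs_self κ) ht.1).trans
        (mul_le_mul_of_nonneg_left ht.2 (abs_nonneg κ))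
    have h5 := mul_le_mul_of_nonneg_right h4 h3
    rw [lt_div_iff₀ (by positivity)] at h2
    rw [dist_eq_norm]
    have h6 := hY m n t
    linarith
  have htrace : ∀ {g : ℕ → ℝ → ℝ}, (∀ m n, ‖dampedTrace κ (g m) - dampedTrace κ (g n)‖ ≤
      C * stateDist (u₁ m) (u₂ m) (v m) (u₁ n) (u₂ n) (v n) 0) →
      CauchySeq fun n => dampedTrace κ (g n) := by
    intro g hg
    rw [Metric.cauchySeq_iff]
    intro ε hε
    obtain ⟨N, hN⟩ := hdist (ε / (C + 1)) (by positivity)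
    refine ⟨N, fun m hm n hn => ?_⟩
    have h2 := hN m hm n hn
    have h3 := stateDist_nonneg (u₁ m) (u₂ m) (v m) (u₁ n) (u₂ n) (v n) 0
    rw [lt_div_iff₀ (by positivity)] at h2
    rw [dist_eq_norm]
    have h6 := hg m n
    linarith
  obtain ⟨y₁, hy₁⟩ := exists_uniform_limit (hunif (Y := fun n => slice (u₁ n)) fun m n t => by
    rw [stateDist, add_assoc]; exact le_add_of_nonneg_right (by positivity))
  obtain ⟨y₂, hy₂⟩ := exists_uniform_limit (hunif (Y := fun n => slice (u₂ n)) fun m n t => by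
    rw [stateDist, add_right_comm]; exact le_add_of_nonneg_left (by positivity))
  obtain ⟨y₃, hy₃⟩ := exists_uniform_limit (hunif (Y := fun n => slice (v n)) fun m n t => by
    rw [stateDist]; exact le_add_of_nonneg_left (by positivity))
  obtain ⟨g₁, m₁, t₁⟩ := exists_limit_trace (fun n => (hmem _ _ _ (hsol n)).1)
    (htrace fun m n => (hest _ _ _ _ _ _ (hsol m) (hsol n)).2.1)
  obtain ⟨g₂, m₂, t₂⟩ := exists_limit_trace (fun n => (hmem _ _ _ (hsol n)).2.1)
    (htrace fun m n => (hest _ _ _ _ _ _ (hsol m) (hsol n)).2.2.1)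
  obtain ⟨g₃, m₃, t₃⟩ := exists_limit_trace (fun n => (hmem _ _ _ (hsol n)).2.2)
    (htrace fun m n => (hest _ _ _ _ _ _ (hsol m) (hsol n)).2.2.2)
  have hcont := fun n => (hsol n).continuousOn_slice hα (c₁ n) (c₂ n) (c₃ n) (hinit n)
  have hweak := fun n => (hsol n).weak hα (c₁ n) (c₂ n) (c₃ n) (hinit n)
  have k₁ := continuousOn_of_uniform hy₁ fun n => (hcont n).1
  have k₂ := continuousOn_of_uniform hy₂ fun n => (hcont n).2.1
  have k₃ := continuousOn_of_uniform hy₃ fun n => (hcont n).2.2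
  have z₁ : y₁ 0 = u₁₀ := tendsto_nhds_unique ((hy₁ 0).tendsto_at (by simp)) i₁
  have z₂ : y₂ 0 = u₂₀ := tendsto_nhds_unique ((hy₂ 0).tendsto_at (by simp)) i₂
  have z₃ : y₃ 0 = v₀ := tendsto_nhds_unique ((hy₃ 0).tendsto_at (by simp)) i₃
  -- the control depends continuously on the state
  obtain ⟨N, -, -, -, -, -, -, -, hfb⟩ := feedback_eq_pairing hα
  have hfc : ∀ {a b c : ℝ → L2}, ContinuousOn a (Ici 0) → ContinuousOn b (Ici 0) →
      ContinuousOn c (Ici 0) → ContinuousOn (fun t => feedback P α₁ α₂ (a t) (b t) (c t)) (Ici 0) :=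
    fun ha hb hc => by
      simp only [hfb]
      exact (((pairing _).continuous.comp_continuousOn hc).add
        ((pairing _).continuous.comp_continuousOn ha)).add
          ((pairing _).continuous.comp_continuousOn hb)
  have hfm : ∀ T, MemLp (fun t => feedback P α₁ α₂ (y₁ t) (y₂ t) (y₃ t)) 2
      (volume.restrict (Icc 0 T)) := fun T => by
    have h1 := (hfc k₁ k₂ k₃).mono (Icc_subset_Ici_self : Icc (0 : ℝ) T ⊆ Ici 0)
    obtain ⟨M, hM⟩ := isCompact_Icc.exists_bound_of_continuousOn h1
    exact MemLp.of_bound (h1.aestronglyMeasurable measurableSet_Icc) M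
      ((ae_restrict_iff' measurableSet_Icc).2 (Filter.Eventually.of_forall hM))
  have hft : ∀ T, 0 ≤ T → ∀ φ : ℝ → ℝ, Continuous φ → Filter.Tendsto (fun n => ∫ t in (0 : ℝ)..T,
      φ t * feedback P α₁ α₂ (slice (u₁ n) t) (slice (u₂ n) t) (slice (v n) t)) Filter.atTop
      (nhds (∫ t in (0 : ℝ)..T, φ t * feedback P α₁ α₂ (y₁ t) (y₂ t) (y₃ t))) := by
    intro T hT φ hφ
    obtain ⟨M, hM⟩ := isCompact_Icc.exists_bound_of_continuousOn (s := Icc 0 T) hφ.continuousOn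
    have hpu : ∀ (m : ℝ → ℝ) {Y : ℕ → ℝ → L2} {y : ℝ → L2},
        TendstoUniformlyOn Y y Filter.atTop (Icc 0 T) →
        TendstoUniformlyOn (fun n t => pairing m (Y n t)) (fun t => pairing m (y t))
          Filter.atTop (Icc 0 T) := fun m _ _ h =>
      (pairing m).uniformContinuous.comp_tendstoUniformlyOn h
    have h1 : TendstoUniformlyOn
        (fun n t => feedback P α₁ α₂ (slice (u₁ n) t) (slice (u₂ n) t) (slice (v n) t))
        (fun t => feedback P α₁ α₂ (y₁ t) (y₂ t) (y₃ t)) Filter.atTop (Icc 0 T) := by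
      simp only [hfb]
      exact ((hpu _ (hy₃ T)).add (hpu _ (hy₁ T))).add (hpu _ (hy₂ T))
    have h2 := tendstoUniformlyOn_of_lipschitz (p := fun t r => φ t * r) (M := M)
      (fun t ht w w' => by
        rw [← mul_sub, abs_mul]
        exact mul_le_mul_of_nonneg_right (hM t ht) (abs_nonneg _)) h1
    refine TendstoUniformlyOn.tendsto_intervalIntegral_of_continuousOn
      (Filter.Eventually.of_forall fun n => ?_) ?_ <;> rw [uIcc_of_le hT]
    · exact hφ.continuousOn.mul ((hfc (hcont n).1 (hcont n).2.1 (hcont n).2.2).mono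
        Icc_subset_Ici_self)
    · exact h2
  have ht₂q : ∀ T, 0 ≤ T → ∀ φ : ℝ → ℝ, Continuous φ → Filter.Tendsto
      (fun n => ∫ t in (0 : ℝ)..T, φ t * (P.q * u₂ n 0 t)) Filter.atTop
      (nhds (∫ t in (0 : ℝ)..T, φ t * (P.q * g₂ t))) := fun T hT φ hφ => by
    simpa only [mul_assoc] using t₂ T hT (fun t => φ t * P.q) (hφ.mul continuous_const)
  refine ⟨y₁, y₂, y₃, g₁, g₂, g₃, ?_, ?_, ?_⟩
  · rw [← z₁]
    exact IsWeakTransportSolution.of_tendsto (S := P.s₁) one_ne_zero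
      (fun x hx => by rw [P.s₁_e hx, one_mul]) P.continuous_k₁ (fun x hx => P.k₁_eq hx)
      (fun n => (hweak n).1) (fun n => (hcont n).2.1) k₁ hy₁ hy₂
      (fun T => (m₂ T).const_mul P.q) m₁ ht₂q t₁
  · rw [← z₂]
    exact IsWeakTransportSolution.of_tendsto (S := P.s₂) (neg_ne_zero.2 one_ne_zero)
      (fun x hx => by rw [P.s₂_e hx, neg_one_mul]) P.continuous_k₂ (fun x hx => P.k₂_eq hx)
      (fun n => (hweak n).2.1) (fun n => (hcont n).1) k₂ hy₂ hy₁ m₂ m₃ t₂ t₃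
  · rw [← z₃]
    have h3 := IsWeakTransportSolution.of_tendsto (S := P.s₃) (c := fun _ => 0) (k := fun _ => 0)
      (neg_ne_zero.2 one_ne_zero) (fun x _ => by rw [P.s₃_e, neg_one_mul]) continuous_const
      (fun _ _ => rfl) (fun n => (hweak n).2.2) (fun n => (hcont n).2.2) k₃ hy₃ hy₃ m₃ hfm t₃ hft
    simpa only [zero_mul] using h3

end DelayedHyperbolic

open DelayedHyperbolic in
/-- The kernel equations that define the delay-compensating control law are solvable and, whenever
the gains come from such kernels, for every `L²` initial state the closed loop has a solution, and
every solution is at the zero equilibrium from the time `t_F` on. -/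
theorem theorem2 (P : DelayedHyperbolic.Plant) :
    (∃ K21 K22 α₁ α₂ : ℝ → ℝ → ℝ,
      IsBacksteppingKernel P K21 K22 ∧ IsPredictorKernel P K21 K22 α₁ α₂) ∧
    ∀ K21 K22 α₁ α₂ : ℝ → ℝ → ℝ,
      IsBacksteppingKernel P K21 K22 → IsPredictorKernel P K21 K22 α₁ α₂ →
      ∀ u₁₀ u₂₀ v₀ : L2,
        (∃ u₁ u₂ v : ℝ → L2, IsClosedLoopSolution P α₁ α₂ u₁₀ u₂₀ v₀ u₁ u₂ v) ∧
        ∀ u₁ u₂ v : ℝ → L2, IsClosedLoopSolution P α₁ α₂ u₁₀ u₂₀ v₀ u₁ u₂ v →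
          ∀ t : ℝ, finalTime P ≤ t → u₁ t = 0 ∧ u₂ t = 0 ∧ v t = 0 := by
  refine ⟨?_, fun K21 K22 α₁ α₂ hK hα u₁₀ u₂₀ v₀ => ⟨exists_isClosedLoopSolution hα u₁₀ u₂₀ v₀,
    fun u₁ u₂ v h t ht => h.eq_zero hK hα ht⟩⟩
  obtain ⟨K21, K22, hK⟩ := exists_isBacksteppingKernel P
  obtain ⟨α₁, α₂, hα⟩ := exists_isPredictorKernel hK
  exact ⟨K21, K22, α₁, α₂, hK, hα⟩
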